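/- Let $\mathbb{K}$ be a field of characteristic zero. Chain complexes are $\mathbb{Z}$-graded complexes of $\mathbb{K}$-vector spaces with differentials of degree $-1$, and a dg operad $\mathscr{P}=(\mathcal{P},\gamma,1)$ is a (symmetric, unital) operad in chain complexes with components $\mathscr{P}(n)$, $n\ge 0$; no augmentation is assumed. Write $\mathbb{T}\mathcal{V}$ for the tree module on a graded $\mathbb{S}$-module $\mathcal{V}$, and $\overline{\mathbb{T}}\mathcal{V}$ for the part given by trees with at least one vertex. The bar construction $B_c\mathscr{P}$ is the cofree conilpotent cooperad $\mathbb{T}(s\mathcal{P}\oplus\mathbb{K}\cdot v)$, where $v$ has arity $1$ and degree $2$, with the coderivation $d$ of degree $-1$ induced by $$sx\otimes sy\mapsto(-1)^{|x|}s\gamma(x\otimes y),\qquad sx\otimes v,\ v\otimes sx,\ v\otimes v\mapsto 0,\qquad v\mapsto s1,\qquad sx\mapsto -s\,dx$$ on trees with two vertices and with one vertex, and with the curvature $\theta$ that is the projection onto $\mathbb{K}\cdot v$ followed by $v\mapsto 1$. The cobar construction of $\mathscr{C}=B_c\mathscr{P}$ is the free graded operad $\Omega_u\mathscr{C}=\mathbb{T}(s^{-1}\overline{\mathcal{C}})$,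 where $\overline{\mathcal{C}}=\overline{\mathbb{T}}(s\mathcal{P}\oplus\mathbb{K}\cdot v)$, with the derivation $D$ of degree $-1$ such that $$D(s^{-1}x)=\theta(x)1-s^{-1}dx-\sum(-1)^{|x_1|}s^{-1}x_1\otimes s^{-1}x_2,$$ where $\Delta_2x=\sum x_1\otimes x_2$ is the sum over the inner edges of the tree $x$ of the pairs of trees obtained by cutting this edge ($x_1$ contains the root), with Koszul signs. The counit of the bar–cobar adjunction is the morphism of operads $p:\Omega_uB_c\mathscr{P}\to\mathscr{P}$ with $p(s^{-1}(sx))=x$ for $x\in\mathcal{P}$, $p(s^{-1}v)=0$, and $p(s^{-1}A)=0$ for each tree $A$ with at least two vertices. **Proposition.** For every dg operad $\mathscr{P}$ over $\mathbb{K}$, $D^2=0$, so that $\Omega_uB_c\mathscr{P}$ is a dg operad; $p$ commutes with the differentials; and $p$ is a weak equivalence, that is, it induces isomorphisms $H_k(\Omega_uB_c\mathscr{P}(n))\to H_k(\mathscr{P}(n))$ for all $n\ge0$ and $k\in\mathbb{Z}$. Moreover $p$ is a cofibrant resolution of $\mathscr{P}$: each map $\Omega_uB_c\mathscr{P}(n)_k\to\mathscr{P}(n)_k$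 is surjective, and $\Omega_uB_c\mathscr{P}$ is cofibrant, that is, for every morphism of dg operads $q:\mathscr{X}\to\mathscr{Y}$ that is surjective in each arity and degree and a quasi-isomorphism in each arity, each morphism of dg operads $\Omega_uB_c\mathscr{P}\to\mathscr{Y}$ lifts along $q$ to a morphism of dg operads $\Omega_uB_c\mathscr{P}\to\mathscr{X}$. -/

import Mathlib

universe u v w

open Sum

namespace BarCobar

/-! ### Graded symmetric modules and operads -/

/-- The sign `(-1)^n` as a scalar. -/
def sgn (K : Type u) [Field K] (n : ℤ) : K := ((n.negOnePow : ℤˣ) : ℤ)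

theorem sgn_add (K : Type u) [Field K] (a b : ℤ) : sgn K (a + b) = sgn K a * sgn K b := by
  simp [sgn, Int.negOnePow_add]

theorem sgn_mul_self (K : Type u) [Field K] (a : ℤ) : sgn K a * sgn K a = 1 := by
  rw [← sgn_add, sgn, Int.negOnePow_even _ ⟨a, rfl⟩]; simp

/-- A graded `𝕊`-module over `K`: `obj n p` is the component of arity `n` and degree `p`, and
`act σ x` is the operation `x` with its input `a` renamed `σ a` (a left action, equivalently the
right action of `σ⁻¹`). -/
structure SMod (K : Type u) [Field K] where
  obj : ℕ → ℤ → Type v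
  [acg : ∀ n p, AddCommGroup (obj n p)]
  [mod : ∀ n p, Module K (obj n p)]
  act : ∀ {n : ℕ} {p : ℤ}, Equiv.Perm (Fin n) → obj n p →ₗ[K] obj n p
  act_one : ∀ {n : ℕ} {p : ℤ} (x : obj n p), act 1 x = x
  act_mul : ∀ {n : ℕ} {p : ℤ} (σ τ : Equiv.Perm (Fin n)) (x : obj n p),
    act (σ * τ) x = act σ (act τ x)

attribute [instance] SMod.acg SMod.mod

/-- A labelling by `Fin k` of the inputs of a partial composite `x ∘ᵢ y`, where `x` has inputs
`Fin m` and `y` has inputs `Fin n`: these are the inputs of `x` other than `i` and those of `y`. -/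
abbrev Wire {m : ℕ} (i : Fin m) (n k : ℕ) : Type := {j : Fin m // j ≠ i} ⊕ Fin n ≃ Fin k

/-- The labelling `e'` is obtained from `e` by renaming the inputs of `x`, of `y` and of the
composite along `σ`, `τ` and `ρ`. -/
def Wire.Renames {m n k : ℕ} {i : Fin m} (σ : Equiv.Perm (Fin m)) (τ : Equiv.Perm (Fin n))
    (ρ : Equiv.Perm (Fin k)) (e : Wire i n k) (e' : Wire (σ i) n k) : Prop :=
  (∀ a : {j : Fin m // j ≠ i}, e' (inl ⟨σ a.1, σ.injective.ne a.2⟩) = ρ (e (inl a))) ∧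
    ∀ b, e' (inr (τ b)) = ρ (e (inr b))

/-- The labellings of `(x ∘ᵢ y) ∘ⱼ z` and of `x ∘ᵢ (y ∘ⱼ z)` agree, where `j` is an input
of `y`. -/
def Wire.Seq {m n k l s t : ℕ} {i : Fin m} {j : Fin n} (e : Wire i n k)
    (e₂ : Wire (e (inr j)) l t) (f : Wire j l s) (f₂ : Wire i s t) : Prop :=
  (∀ a : {a : Fin m // a ≠ i}, e₂ (inl ⟨e (inl a), by simp⟩) = f₂ (inl a)) ∧
    (∀ b : {b : Fin n // b ≠ j}, e₂ (inl ⟨e (inr b.1), by simpa using b.2⟩) =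
      f₂ (inr (f (inl b)))) ∧
    ∀ c, e₂ (inr c) = f₂ (inr (f (inr c)))

/-- The labellings of `(x ∘ᵢ y) ∘ⱼ z` and of `(x ∘ⱼ z) ∘ᵢ y` agree, where `i ≠ j` are inputs
of `x`. -/
def Wire.Par {m n k l s t : ℕ} {i j : Fin m} (hij : i ≠ j) (e : Wire i n k)
    (e₂ : Wire (e (inl ⟨j, hij.symm⟩)) l t) (f : Wire j l s)
    (f₂ : Wire (f (inl ⟨i, hij⟩)) n t) : Prop :=
  (∀ a : Fin m, ∀ (hi : a ≠ i) (hj : a ≠ j),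
    e₂ (inl ⟨e (inl ⟨a, hi⟩), by simpa using hj⟩) =
      f₂ (inl ⟨f (inl ⟨a, hj⟩), by simpa using hi⟩)) ∧
    (∀ b, e₂ (inl ⟨e (inr b), by simp⟩) = f₂ (inr b)) ∧
    ∀ c, e₂ (inr c) = f₂ (inl ⟨f (inr c), by simp⟩)

/-- A graded operad, in terms of partial compositions: `comp i e h x y` is `x ∘ᵢ y` with its inputs
labelled by `e`. -/
structure GrOperad (K : Type u) [Field K] extends SMod.{u, v} K where
  one : obj 1 0
  comp : ∀ {m n k : ℕ} (i : Fin m) (_ : Wire i n k) {p q r : ℤ} (_ : p + q = r),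
    obj m p →ₗ[K] obj n q →ₗ[K] obj k r
  equivariance : ∀ {m n k : ℕ} {i : Fin m} (σ : Equiv.Perm (Fin m)) (τ : Equiv.Perm (Fin n))
    (ρ : Equiv.Perm (Fin k)) (e : Wire i n k) (e' : Wire (σ i) n k), e.Renames σ τ ρ e' →
    ∀ {p q r : ℤ} (h : p + q = r) (x : obj m p) (y : obj n q),
      comp (σ i) e' h (act σ x) (act τ y) = act ρ (comp i e h x y)
  one_comp : ∀ {n : ℕ} (e : Wire (0 : Fin 1) n n), (∀ b, e (inr b) = b) →
    ∀ {p : ℤ} (h : 0 + p = p) (y : obj n p), comp 0 e h one y = y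
  comp_one : ∀ {m : ℕ} (i : Fin m) (e : Wire i 1 m), (∀ a, e (inl a) = a.1) → e (inr 0) = i →
    ∀ {p : ℤ} (h : p + 0 = p) (x : obj m p), comp i e h x one = x
  seq : ∀ {m n k l s t : ℕ} {i : Fin m} {j : Fin n} (e : Wire i n k) (e₂ : Wire (e (inr j)) l t)
    (f : Wire j l s) (f₂ : Wire i s t), e.Seq e₂ f f₂ →
    ∀ {p q r pq qr pqr : ℤ} (h : p + q = pq) (h₂ : pq + r = pqr) (g : q + r = qr)
      (g₂ : p + qr = pqr) (x : obj m p) (y : obj n q) (z : obj l r),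
      comp _ e₂ h₂ (comp i e h x y) z = comp i f₂ g₂ x (comp j f g y z)
  par : ∀ {m n k l s t : ℕ} {i j : Fin m} (hij : i ≠ j) (e : Wire i n k)
    (e₂ : Wire (e (inl ⟨j, hij.symm⟩)) l t) (f : Wire j l s)
    (f₂ : Wire (f (inl ⟨i, hij⟩)) n t), e.Par hij e₂ f f₂ →
    ∀ {p q r pq pr pqr : ℤ} (h : p + q = pq) (h₂ : pq + r = pqr) (g : p + r = pr)
      (g₂ : pr + q = pqr) (x : obj m p) (y : obj n q) (z : obj l r),
      comp _ e₂ h₂ (comp i e h x y) z = sgn K (q * r) • comp _ f₂ g₂ (comp j f g x z) y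

/-- A graded operad with a derivation of degree `-1`. -/
structure DerOperad (K : Type u) [Field K] extends GrOperad.{u, v} K where
  d : ∀ {n : ℕ} {p q : ℤ} (_ : q + 1 = p), obj n p →ₗ[K] obj n q
  d_act : ∀ {n : ℕ} {p q : ℤ} (h : q + 1 = p) (σ : Equiv.Perm (Fin n)) (x : obj n p),
    d h (act σ x) = act σ (d h x)
  d_comp : ∀ {m n k : ℕ} (i : Fin m) (e : Wire i n k) {p q r p' q' r' : ℤ} (h : p + q = r)
    (hp : p' + 1 = p) (hq : q' + 1 = q) (hr : r' + 1 = r) (h₁ : p' + q = r') (h₂ : p + q' = r')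
    (x : obj m p) (y : obj n q),
    d hr (comp i e h x y) = comp i e h₁ (d hp x) y + sgn K p • comp i e h₂ x (d hq y)

/-- The derivation of a graded operad squares to zero. -/
def DerOperad.SquareZero {K : Type u} [Field K] (P : DerOperad.{u, v} K) : Prop :=
  ∀ {n : ℕ} {p q r : ℤ} (h : q + 1 = p) (h' : r + 1 = q) (x : P.obj n p), P.d h' (P.d h x) = 0

/-- A dg operad. -/
structure DGOperad (K : Type u) [Field K] extends DerOperad.{u, v} K where
  d_d : toDerOperad.SquareZero

/-- A morphism of graded operads. -/
structure GrOperad.Hom {K : Type u} [Field K] (P : GrOperad.{u, v} K) (Q : GrOperad.{u, w} K) where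
  app : ∀ {n : ℕ} {p : ℤ}, P.obj n p →ₗ[K] Q.obj n p
  app_act : ∀ {n : ℕ} {p : ℤ} (σ : Equiv.Perm (Fin n)) (x : P.obj n p),
    app (P.act σ x) = Q.act σ (app x)
  app_one : app P.one = Q.one
  app_comp : ∀ {m n k : ℕ} (i : Fin m) (e : Wire i n k) {p q r : ℤ} (h : p + q = r)
    (x : P.obj m p) (y : P.obj n q), app (P.comp i e h x y) = Q.comp i e h (app x) (app y)

/-- A morphism of graded operads commutes with given derivations. -/
def GrOperad.Hom.Commutes {K : Type u} [Field K] {P : DerOperad.{u, v} K} {Q : DerOperad.{u, w} K}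
    (f : P.toGrOperad.Hom Q.toGrOperad) : Prop :=
  ∀ {n : ℕ} {p q : ℤ} (h : q + 1 = p) (x : P.obj n p), f.app (P.d h x) = Q.d h (f.app x)

/-- A morphism of dg operads. -/
structure DGOperad.Hom {K : Type u} [Field K] (P : DGOperad.{u, v} K) (Q : DGOperad.{u, w} K)
    extends P.toGrOperad.Hom Q.toGrOperad where
  app_d : toHom.Commutes (P := P.toDerOperad) (Q := Q.toDerOperad)

/-! ### Homology, weak equivalences, cofibrant objects -/

namespace DGOperad

variable {K : Type u} [Field K]

def cycles (P : DGOperad.{u, v} K) (n : ℕ) (p : ℤ) : Submodule K (P.obj n p) :=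
  LinearMap.ker (P.d (n := n) (sub_add_cancel p 1))

def boundaries (P : DGOperad.{u, v} K) (n : ℕ) (p : ℤ) : Submodule K (P.obj n p) :=
  LinearMap.range (P.d (n := n) (rfl : p + 1 = p + 1))

/-- The homology in degree `p` of the chain complex `P(n)`. -/
abbrev homology (P : DGOperad.{u, v} K) (n : ℕ) (p : ℤ) : Type v :=
  P.cycles n p ⧸ (P.boundaries n p).submoduleOf (P.cycles n p)

/-- The map induced by a morphism of dg operads in homology. -/
def Hom.homologyMap {P : DGOperad.{u, v} K} {Q : DGOperad.{u, w} K} (f : P.Hom Q) (n : ℕ) (p : ℤ) :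
    P.homology n p →ₗ[K] Q.homology n p :=
  Submodule.mapQ _ _
    (f.app.restrict (p := P.cycles n p) (q := Q.cycles n p) (by
      intro x hx
      have := f.app_d (sub_add_cancel p 1) x
      simp only [cycles, LinearMap.mem_ker] at hx ⊢
      rw [← this, hx, map_zero]))
    (by
      rintro ⟨x, hx⟩ ⟨z, hz⟩
      refine ⟨f.app z, (f.app_d rfl z).symm.trans ?_⟩
      exact congrArg _ hz)

/-- The weak equivalences: the quasi-isomorphisms in each arity. -/
def Hom.IsWeakEquivalence {P : DGOperad.{u, v} K} {Q : DGOperad.{u, w} K} (f : P.Hom Q) : Prop :=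
  ∀ n p, Function.Bijective (f.homologyMap n p)

/-- The fibrations: the degreewise surjections in each arity. -/
def Hom.IsFibration {P : DGOperad.{u, v} K} {Q : DGOperad.{u, w} K} (f : P.Hom Q) : Prop :=
  ∀ n p, Function.Surjective (f.app (n := n) (p := p))

/-- A dg operad is cofibrant when the morphism to it from the initial dg operad has the left lifting
property against the acyclic fibrations, that is, when each morphism from it to the target of an
acyclic fibration lifts to the source. -/
def IsCofibrant (P : DGOperad.{u, v} K) : Prop :=
  ∀ (X Y : DGOperad.{u, w} K) (q : X.Hom Y), q.IsFibration → q.IsWeakEquivalence →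
    ∀ f : P.Hom Y, ∃ g : P.Hom X, ∀ n p (x : P.obj n p), q.app (g.app x) = f.app x

end DGOperad

/-! ### The free operad on a graded `𝕊`-module -/

section Free

variable {K : Type u} [Field K]

/-- Formal operadic expressions in the elements of `W`. -/
inductive Expr (W : SMod.{u, v} K) : ℕ → ℤ → Type (max u v)
  | one : Expr W 1 0
  | gen {n : ℕ} {p : ℤ} (x : W.obj n p) : Expr W n p
  | act {n : ℕ} {p : ℤ} (σ : Equiv.Perm (Fin n)) (x : Expr W n p) : Expr W n p
  | comp {m n k : ℕ} (i : Fin m) (e : Wire i n k) {p q r : ℤ} (h : p + q = r)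
      (x : Expr W m p) (y : Expr W n q) : Expr W k r
  | zero {n : ℕ} {p : ℤ} : Expr W n p
  | add {n : ℕ} {p : ℤ} (x y : Expr W n p) : Expr W n p
  | smul {n : ℕ} {p : ℤ} (c : K) (x : Expr W n p) : Expr W n p

/-- The relations of the free operad: the axioms of `K`-modules and of graded operads, and those of
`W`. -/
inductive Expr.Rel (W : SMod.{u, v} K) : ∀ {n : ℕ} {p : ℤ}, Expr W n p → Expr W n p → Prop
  -- compatibility with the operations
  | act_congr {n : ℕ} {p : ℤ} (σ : Equiv.Perm (Fin n)) {x x' : Expr W n p} :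
      Rel W x x' → Rel W (act σ x) (act σ x')
  | comp_left {m n k : ℕ} (i : Fin m) (e : Wire i n k) {p q r : ℤ} (h : p + q = r)
      {x x' : Expr W m p} (y : Expr W n q) : Rel W x x' → Rel W (comp i e h x y) (comp i e h x' y)
  | comp_right {m n k : ℕ} (i : Fin m) (e : Wire i n k) {p q r : ℤ} (h : p + q = r)
      (x : Expr W m p) {y y' : Expr W n q} : Rel W y y' → Rel W (comp i e h x y) (comp i e h x y')
  | add_left {n : ℕ} {p : ℤ} {x x' : Expr W n p} (y : Expr W n p) :
      Rel W x x' → Rel W (add x y) (add x' y)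
  | add_right {n : ℕ} {p : ℤ} (x : Expr W n p) {y y' : Expr W n p} :
      Rel W y y' → Rel W (add x y) (add x y')
  | smul_congr {n : ℕ} {p : ℤ} (c : K) {x x' : Expr W n p} :
      Rel W x x' → Rel W (smul c x) (smul c x')
  -- modules
  | add_assoc {n : ℕ} {p : ℤ} (x y z : Expr W n p) :
      Rel W (add (add x y) z) (add x (add y z))
  | add_comm {n : ℕ} {p : ℤ} (x y : Expr W n p) : Rel W (add x y) (add y x)
  | zero_add {n : ℕ} {p : ℤ} (x : Expr W n p) : Rel W (add zero x) x
  | smul_add {n : ℕ} {p : ℤ} (c : K) (x y : Expr W n p) :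
      Rel W (smul c (add x y)) (add (smul c x) (smul c y))
  | add_smul {n : ℕ} {p : ℤ} (c c' : K) (x : Expr W n p) :
      Rel W (smul (c + c') x) (add (smul c x) (smul c' x))
  | mul_smul {n : ℕ} {p : ℤ} (c c' : K) (x : Expr W n p) :
      Rel W (smul (c * c') x) (smul c (smul c' x))
  | one_smul {n : ℕ} {p : ℤ} (x : Expr W n p) : Rel W (smul 1 x) x
  | zero_smul {n : ℕ} {p : ℤ} (x : Expr W n p) : Rel W (smul 0 x) zero
  -- generators
  | gen_add {n : ℕ} {p : ℤ} (x y : W.obj n p) : Rel W (gen (x + y)) (add (gen x) (gen y))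
  | gen_smul {n : ℕ} {p : ℤ} (c : K) (x : W.obj n p) : Rel W (gen (c • x)) (smul c (gen x))
  | gen_act {n : ℕ} {p : ℤ} (σ : Equiv.Perm (Fin n)) (x : W.obj n p) :
      Rel W (gen (W.act σ x)) (act σ (gen x))
  -- linearity of the operations
  | act_add {n : ℕ} {p : ℤ} (σ : Equiv.Perm (Fin n)) (x y : Expr W n p) :
      Rel W (act σ (add x y)) (add (act σ x) (act σ y))
  | act_smul {n : ℕ} {p : ℤ} (σ : Equiv.Perm (Fin n)) (c : K) (x : Expr W n p) :
      Rel W (act σ (smul c x)) (smul c (act σ x))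
  | comp_add_left {m n k : ℕ} (i : Fin m) (e : Wire i n k) {p q r : ℤ} (h : p + q = r)
      (x x' : Expr W m p) (y : Expr W n q) :
      Rel W (comp i e h (add x x') y) (add (comp i e h x y) (comp i e h x' y))
  | comp_smul_left {m n k : ℕ} (i : Fin m) (e : Wire i n k) {p q r : ℤ} (h : p + q = r)
      (c : K) (x : Expr W m p) (y : Expr W n q) :
      Rel W (comp i e h (smul c x) y) (smul c (comp i e h x y))
  | comp_add_right {m n k : ℕ} (i : Fin m) (e : Wire i n k) {p q r : ℤ} (h : p + q = r)
      (x : Expr W m p) (y y' : Expr W n q) :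
      Rel W (comp i e h x (add y y')) (add (comp i e h x y) (comp i e h x y'))
  | comp_smul_right {m n k : ℕ} (i : Fin m) (e : Wire i n k) {p q r : ℤ} (h : p + q = r)
      (c : K) (x : Expr W m p) (y : Expr W n q) :
      Rel W (comp i e h x (smul c y)) (smul c (comp i e h x y))
  -- operad axioms
  | act_one {n : ℕ} {p : ℤ} (x : Expr W n p) : Rel W (act 1 x) x
  | act_mul {n : ℕ} {p : ℤ} (σ τ : Equiv.Perm (Fin n)) (x : Expr W n p) :
      Rel W (act (σ * τ) x) (act σ (act τ x))
  | equivariance {m n k : ℕ} {i : Fin m} (σ : Equiv.Perm (Fin m)) (τ : Equiv.Perm (Fin n))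
      (ρ : Equiv.Perm (Fin k)) (e : Wire i n k) (e' : Wire (σ i) n k) (he : e.Renames σ τ ρ e')
      {p q r : ℤ} (h : p + q = r) (x : Expr W m p) (y : Expr W n q) :
      Rel W (comp (σ i) e' h (act σ x) (act τ y)) (act ρ (comp i e h x y))
  | one_comp {n : ℕ} (e : Wire (0 : Fin 1) n n) (he : ∀ b, e (inr b) = b)
      {p : ℤ} (h : 0 + p = p) (y : Expr W n p) : Rel W (comp 0 e h one y) y
  | comp_one {m : ℕ} (i : Fin m) (e : Wire i 1 m) (he : ∀ a, e (inl a) = a.1) (he' : e (inr 0) = i)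
      {p : ℤ} (h : p + 0 = p) (x : Expr W m p) : Rel W (comp i e h x one) x
  | seq {m n k l s t : ℕ} {i : Fin m} {j : Fin n} (e : Wire i n k) (e₂ : Wire (e (inr j)) l t)
      (f : Wire j l s) (f₂ : Wire i s t) (he : e.Seq e₂ f f₂)
      {p q r pq qr pqr : ℤ} (h : p + q = pq) (h₂ : pq + r = pqr) (g : q + r = qr)
      (g₂ : p + qr = pqr) (x : Expr W m p) (y : Expr W n q) (z : Expr W l r) :
      Rel W (comp _ e₂ h₂ (comp i e h x y) z) (comp i f₂ g₂ x (comp j f g y z))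
  | par {m n k l s t : ℕ} {i j : Fin m} (hij : i ≠ j) (e : Wire i n k)
      (e₂ : Wire (e (inl ⟨j, hij.symm⟩)) l t) (f : Wire j l s)
      (f₂ : Wire (f (inl ⟨i, hij⟩)) n t) (he : e.Par hij e₂ f f₂)
      {p q r pq pr pqr : ℤ} (h : p + q = pq) (h₂ : pq + r = pqr) (g : p + r = pr)
      (g₂ : pr + q = pqr) (x : Expr W m p) (y : Expr W n q) (z : Expr W l r) :
      Rel W (comp _ e₂ h₂ (comp i e h x y) z)
        (smul (sgn K (q * r)) (comp _ f₂ g₂ (comp j f g x z) y))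

/-- The component of arity `n` and degree `p` of the free operad. -/
def FreeObj (W : SMod.{u, v} K) (n : ℕ) (p : ℤ) : Type (max u v) := Quot (Expr.Rel W (n := n) (p := p))

namespace FreeObj

variable {W : SMod.{u, v} K} {n : ℕ} {p : ℤ}

instance : Add (FreeObj W n p) :=
  ⟨Quot.map₂ Expr.add (fun x _ _ h => .add_right x h) (fun _ _ y h => .add_left y h)⟩

instance : Zero (FreeObj W n p) := ⟨Quot.mk _ .zero⟩

instance : SMul K (FreeObj W n p) := ⟨fun c => Quot.map (Expr.smul c) (fun _ _ h => .smul_congr c h)⟩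

instance : AddCommMonoid (FreeObj W n p) where
  add_assoc := by rintro ⟨x⟩ ⟨y⟩ ⟨z⟩; exact Quot.sound (.add_assoc x y z)
  add_comm := by rintro ⟨x⟩ ⟨y⟩; exact Quot.sound (.add_comm x y)
  zero_add := by rintro ⟨x⟩; exact Quot.sound (.zero_add x)
  add_zero := by
    rintro ⟨x⟩; exact (Quot.sound (.add_comm x .zero)).trans (Quot.sound (.zero_add x))
  nsmul := nsmulRec

instance : Module K (FreeObj W n p) where
  smul_add := by rintro c ⟨x⟩ ⟨y⟩; exact Quot.sound (.smul_add c x y)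
  add_smul := by rintro c c' ⟨x⟩; exact Quot.sound (.add_smul c c' x)
  mul_smul := by rintro c c' ⟨x⟩; exact Quot.sound (.mul_smul c c' x)
  one_smul := by rintro ⟨x⟩; exact Quot.sound (.one_smul x)
  zero_smul := by rintro ⟨x⟩; exact Quot.sound (.zero_smul x)
  smul_zero := by
    intro c
    have h0 : (0 : FreeObj W n p) = (0 : K) • (0 : FreeObj W n p) :=
      (Quot.sound (.zero_smul Expr.zero)).symm
    have h1 : c • ((0 : K) • (0 : FreeObj W n p)) = (c * 0) • (0 : FreeObj W n p) :=
      (Quot.sound (.mul_smul c 0 Expr.zero)).symm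
    rw [h0, h1, mul_zero]

instance : AddCommGroup (FreeObj W n p) := Module.addCommMonoidToAddCommGroup K

end FreeObj

/-- The free graded operad on a graded `𝕊`-module, by generators and relations. -/
def FreeOperad (W : SMod.{u, v} K) : GrOperad.{u, max u v} K where
  obj := FreeObj W
  act σ :=
    { toFun := Quot.map (Expr.act σ) (fun _ _ h => .act_congr σ h)
      map_add' := by rintro ⟨x⟩ ⟨y⟩; exact Quot.sound (.act_add σ x y)
      map_smul' := by rintro c ⟨x⟩; exact Quot.sound (.act_smul σ c x) }
  act_one := by rintro n p ⟨x⟩; exact Quot.sound (.act_one x)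
  act_mul := by rintro n p σ τ ⟨x⟩; exact Quot.sound (.act_mul σ τ x)
  one := Quot.mk _ .one
  comp i e _ _ _ h :=
    LinearMap.mk₂ K
      (Quot.map₂ (Expr.comp i e h) (fun x _ _ g => .comp_right i e h x g)
        (fun _ _ y g => .comp_left i e h y g))
      (by rintro ⟨x⟩ ⟨x'⟩ ⟨y⟩; exact Quot.sound (.comp_add_left i e h x x' y))
      (by rintro c ⟨x⟩ ⟨y⟩; exact Quot.sound (.comp_smul_left i e h c x y))
      (by rintro ⟨x⟩ ⟨y⟩ ⟨y'⟩; exact Quot.sound (.comp_add_right i e h x y y'))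
      (by rintro c ⟨x⟩ ⟨y⟩; exact Quot.sound (.comp_smul_right i e h c x y))
  equivariance := by
    rintro m n k i σ τ ρ e e' he p q r h ⟨x⟩ ⟨y⟩
    exact Quot.sound (.equivariance σ τ ρ e e' he h x y)
  one_comp := by rintro n e he p h ⟨y⟩; exact Quot.sound (.one_comp e he h y)
  comp_one := by rintro m i e he he' p h ⟨x⟩; exact Quot.sound (.comp_one i e he he' h x)
  seq := by
    rintro m n k l s t i j e e₂ f f₂ he p q r pq qr pqr h h₂ g g₂ ⟨x⟩ ⟨y⟩ ⟨z⟩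
    exact Quot.sound (.seq e e₂ f f₂ he h h₂ g g₂ x y z)
  par := by
    rintro m n k l s t i j hij e e₂ f f₂ he p q r pq pr pqr h h₂ g g₂ ⟨x⟩ ⟨y⟩ ⟨z⟩
    exact Quot.sound (.par hij e e₂ f f₂ he h h₂ g g₂ x y z)

namespace FreeOperad

variable {W : SMod.{u, v} K}

/-- The element of the free operad given by an expression. -/
def mk {n : ℕ} {p : ℤ} (x : Expr W n p) : (FreeOperad W).obj n p := Quot.mk _ x

theorem mk_sound {n : ℕ} {p : ℤ} {x y : Expr W n p} (h : Expr.Rel W x y) : mk x = mk y :=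
  Quot.sound h

theorem mk_comp {m n k : ℕ} (i : Fin m) (e : Wire i n k) {p q r : ℤ} (h : p + q = r)
    (x : Expr W m p) (y : Expr W n q) :
    mk (.comp i e h x y) = (FreeOperad W).comp i e h (mk x) (mk y) := rfl

theorem mk_act {n : ℕ} {p : ℤ} (σ : Equiv.Perm (Fin n)) (x : Expr W n p) :
    mk (.act σ x) = (FreeOperad W).act σ (mk x) := rfl

theorem mk_add {n : ℕ} {p : ℤ} (x y : Expr W n p) : mk (.add x y) = mk x + mk y := rfl

theorem mk_smul {n : ℕ} {p : ℤ} (c : K) (x : Expr W n p) : mk (.smul c x) = c • mk x := rfl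

variable (W)

/-- The inclusion of the generators. -/
def gen {n : ℕ} {p : ℤ} : W.obj n p →ₗ[K] (FreeOperad W).obj n p where
  toFun x := mk (.gen x)
  map_add' x y := Quot.sound (.gen_add x y)
  map_smul' c x := Quot.sound (.gen_smul c x)

variable {W}

theorem gen_act {n : ℕ} {p : ℤ} (σ : Equiv.Perm (Fin n)) (x : W.obj n p) :
    gen W (W.act σ x) = (FreeOperad W).act σ (gen W x) := Quot.sound (.gen_act σ x)

/-- The value of an expression in an operad `Q`, given the values of the generators. -/
def eval (Q : GrOperad.{u, w} K) (f : ∀ {n : ℕ} {p : ℤ}, W.obj n p →ₗ[K] Q.obj n p) :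
    ∀ {n : ℕ} {p : ℤ}, Expr W n p → Q.obj n p
  | _, _, .one => Q.one
  | _, _, .gen x => f x
  | _, _, .act σ x => Q.act σ (eval Q f x)
  | _, _, .comp i e h x y => Q.comp i e h (eval Q f x) (eval Q f y)
  | _, _, .zero => 0
  | _, _, .add x y => eval Q f x + eval Q f y
  | _, _, .smul c x => c • eval Q f x

theorem eval_rel (Q : GrOperad.{u, w} K) (f : ∀ {n : ℕ} {p : ℤ}, W.obj n p →ₗ[K] Q.obj n p)
    (hf : ∀ {n : ℕ} {p : ℤ} (σ : Equiv.Perm (Fin n)) (x : W.obj n p),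
      f (W.act σ x) = Q.act σ (f x))
    {n : ℕ} {p : ℤ} {x y : Expr W n p} (h : Expr.Rel W x y) : eval Q f x = eval Q f y := by
  induction h with
  | equivariance σ τ ρ e e' he h x y => exact Q.equivariance σ τ ρ e e' he h _ _
  | one_comp e he h y => exact Q.one_comp e he h _
  | comp_one i e he he' h x => exact Q.comp_one i e he he' h _
  | seq e e₂ f f₂ he h h₂ g g₂ x y z => exact Q.seq e e₂ f f₂ he h h₂ g g₂ _ _ _
  | par hij e e₂ f f₂ he h h₂ g g₂ x y z => exact Q.par hij e e₂ f f₂ he h h₂ g g₂ _ _ _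
  | add_comm x y => exact _root_.add_comm _ _
  | add_assoc x y z => exact _root_.add_assoc _ _ _
  | add_smul c c' x => exact _root_.add_smul _ _ _
  | mul_smul c c' x => exact SemigroupAction.mul_smul _ _ _
  | act_mul σ τ x => exact Q.act_mul _ _ _
  | act_one x => exact Q.act_one _
  | gen_act σ x => exact hf σ x
  | _ => simp_all [eval]

/-- The morphism of operads from the free operad that extends a map of `𝕊`-modules. -/
def lift (Q : GrOperad.{u, w} K) (f : ∀ {n : ℕ} {p : ℤ}, W.obj n p →ₗ[K] Q.obj n p)
    (hf : ∀ {n : ℕ} {p : ℤ} (σ : Equiv.Perm (Fin n)) (x : W.obj n p),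
      f (W.act σ x) = Q.act σ (f x)) : (FreeOperad W).Hom Q where
  app {n p} :=
    { toFun := Quot.lift (eval Q f) (fun _ _ h => eval_rel Q f hf h)
      map_add' := by rintro ⟨x⟩ ⟨y⟩; rfl
      map_smul' := by rintro c ⟨x⟩; rfl }
  app_act := by rintro n p σ ⟨x⟩; rfl
  app_one := rfl
  app_comp := by rintro m n k i e p q r h ⟨x⟩ ⟨y⟩; rfl

/-- The value on an expression of the derivation with values `u` on the generators. -/
def derivExpr (u : ∀ {n : ℕ} {p q : ℤ} (_ : q + 1 = p), W.obj n p →ₗ[K] (FreeOperad W).obj n q) :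
    ∀ {n : ℕ} {p q : ℤ} (_ : q + 1 = p), Expr W n p → (FreeOperad W).obj n q
  | _, _, _, _, .one => 0
  | _, _, _, h, .gen x => u h x
  | _, _, _, h, .act σ x => (FreeOperad W).act σ (derivExpr u h x)
  | _, _, r', h, .comp (p := p) (q := q) i e g x y =>
      (FreeOperad W).comp i e (p := p - 1) (q := q) (r := r') (by omega)
        (derivExpr u (sub_add_cancel p 1) x) (mk y) +
      sgn K p • (FreeOperad W).comp i e (p := p) (q := q - 1) (r := r') (by omega)
        (mk x) (derivExpr u (sub_add_cancel q 1) y)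
  | _, _, _, _, .zero => 0
  | _, _, _, h, .add x y => derivExpr u h x + derivExpr u h y
  | _, _, _, h, .smul c x => c • derivExpr u h x

theorem derivExpr_comp
    (u : ∀ {n : ℕ} {p q : ℤ} (_ : q + 1 = p), W.obj n p →ₗ[K] (FreeOperad W).obj n q)
    {m n k : ℕ} (i : Fin m) (e : Wire i n k) {p q r p' q' r' : ℤ} (h : p + q = r)
    (hp : p' + 1 = p) (hq : q' + 1 = q) (hr : r' + 1 = r) (h₁ : p' + q = r') (h₂ : p + q' = r')
    (x : Expr W m p) (y : Expr W n q) :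
    derivExpr u hr (.comp i e h x y) =
      (FreeOperad W).comp i e h₁ (derivExpr u hp x) (mk y) +
        sgn K p • (FreeOperad W).comp i e h₂ (mk x) (derivExpr u hq y) := by
  obtain rfl : p' = p - 1 := by omega
  obtain rfl : q' = q - 1 := by omega
  rfl

theorem derivExpr_rel
    (u : ∀ {n : ℕ} {p q : ℤ} (_ : q + 1 = p), W.obj n p →ₗ[K] (FreeOperad W).obj n q)
    (hu : ∀ {n : ℕ} {p q : ℤ} (h : q + 1 = p) (σ : Equiv.Perm (Fin n)) (x : W.obj n p),
      u h (W.act σ x) = (FreeOperad W).act σ (u h x))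
    {n : ℕ} {p : ℤ} {x y : Expr W n p} (hxy : Expr.Rel W x y) :
    ∀ {q : ℤ} (h : q + 1 = p), derivExpr u h x = derivExpr u h y := by
  induction hxy with
  | act_congr σ _ ih => intro q' hq; simp only [derivExpr, ih]
  | comp_left i e g y hx ih =>
    intro r' h
    have hx' := mk_sound hx
    simp only [derivExpr, ih, hx']
  | comp_right i e g x hy ih =>
    intro r' h
    have hy' := mk_sound hy
    simp only [derivExpr, ih, hy']
  | @equivariance m n k i σ τ ρ e e' he p q r g x y =>
    intro r' h
    rw [derivExpr_comp u _ e' g (sub_add_cancel _ 1) (sub_add_cancel _ 1) h (by omega) (by omega)]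
    simp only [derivExpr, mk_act]
    rw [(FreeOperad W).equivariance σ τ ρ e e' he, (FreeOperad W).equivariance σ τ ρ e e' he,
      map_add, map_smul]
  | @one_comp n e he p g y =>
    intro r' h
    rw [derivExpr_comp u _ e g (sub_add_cancel _ 1) h h (by omega) (by omega)]
    have h1 : derivExpr u (sub_add_cancel 0 1) (Expr.one (W := W)) = 0 := rfl
    have h2 : sgn K 0 = 1 := by simp [sgn]
    rw [h1, h2, map_zero, LinearMap.zero_apply, zero_add, one_smul]
    exact (FreeOperad W).one_comp e he _ _
  | @comp_one m i e he he' p g x =>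
    intro r' h
    rw [derivExpr_comp u _ e g h (sub_add_cancel _ 1) h (by omega) (by omega)]
    have h1 : derivExpr u (sub_add_cancel 0 1) (Expr.one (W := W)) = 0 := rfl
    rw [h1, map_zero, smul_zero, add_zero]
    exact (FreeOperad W).comp_one i e he he' _ _
  | @seq m n k l s t i j e e₂ f f₂ he p q r pq qr pqr h h₂ g g₂ x y z =>
    intro r' h'
    rw [derivExpr_comp u _ e₂ h₂ (sub_add_cancel _ 1) (sub_add_cancel _ 1) h' (by omega) (by omega),
      derivExpr_comp u _ e h (sub_add_cancel _ 1) (sub_add_cancel _ 1) (sub_add_cancel _ 1)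
        (by omega) (by omega),
      derivExpr_comp u _ f₂ g₂ (sub_add_cancel _ 1) (sub_add_cancel _ 1) h' (by omega) (by omega),
      derivExpr_comp u _ f g (sub_add_cancel _ 1) (sub_add_cancel _ 1) (sub_add_cancel _ 1)
        (by omega) (by omega)]
    simp only [mk_comp, map_add, map_smul, LinearMap.add_apply, LinearMap.smul_apply, smul_add,
      smul_smul]
    rw [(FreeOperad W).seq e e₂ f f₂ he _ _ g (by omega : p - 1 + qr = r'),
      (FreeOperad W).seq e e₂ f f₂ he _ _ (by omega : q - 1 + r = qr - 1)
        (by omega : p + (qr - 1) = r'),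
      (FreeOperad W).seq e e₂ f f₂ he _ _ (by omega : q + (r - 1) = qr - 1)
        (by omega : p + (qr - 1) = r'),
      show sgn K pq = sgn K p * sgn K q by rw [← h, sgn_add], add_assoc]
  | @par m n k l s t i j hij e e₂ f f₂ he p q r pq pr pqr h h₂ g g₂ x y z =>
    intro r' h'
    change _ = sgn K (q * r) • derivExpr u h' (.comp _ f₂ g₂ (.comp j f g x z) y)
    rw [derivExpr_comp u _ e₂ h₂ (sub_add_cancel _ 1) (sub_add_cancel _ 1) h' (by omega) (by omega),
      derivExpr_comp u _ e h (sub_add_cancel _ 1) (sub_add_cancel _ 1) (sub_add_cancel _ 1)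
        (by omega) (by omega),
      derivExpr_comp u _ f₂ g₂ (sub_add_cancel _ 1) (sub_add_cancel _ 1) h' (by omega) (by omega),
      derivExpr_comp u _ f g (sub_add_cancel _ 1) (sub_add_cancel _ 1) (sub_add_cancel _ 1)
        (by omega) (by omega)]
    simp only [mk_comp, map_add, map_smul, LinearMap.add_apply, LinearMap.smul_apply, smul_add,
      smul_smul]
    rw [(FreeOperad W).par hij e e₂ f f₂ he _ _ (by omega : p - 1 + r = pr - 1)
        (by omega : pr - 1 + q = r'),
      (FreeOperad W).par hij e e₂ f f₂ he _ _ g (by omega : pr + (q - 1) = r'),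
      (FreeOperad W).par hij e e₂ f f₂ he _ _ (by omega : p + (r - 1) = pr - 1)
        (by omega : pr - 1 + q = r')]
    have e1 : sgn K ((q - 1) * r) = sgn K (q * r) * sgn K r := by
      rw [← sgn_add]; simp only [sgn]
      rw [show (q - 1) * r = (q * r + r) - 2 * r by ring, Int.negOnePow_sub,
        Int.negOnePow_two_mul, mul_one]
    have e2 : sgn K (q * (r - 1)) = sgn K (q * r) * sgn K q := by
      rw [← sgn_add]; simp only [sgn]
      rw [show q * (r - 1) = (q * r + q) - 2 * q by ring, Int.negOnePow_sub,
        Int.negOnePow_two_mul, mul_one]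
    have e3 := sgn_mul_self K r
    have e4 := sgn_mul_self K q
    have e5 : sgn K pq = sgn K p * sgn K q := by rw [← h, sgn_add]
    have e6 : sgn K pr = sgn K p * sgn K r := by rw [← g, sgn_add]
    simp only [smul_smul, e1, e2, e5, e6]
    rw [show sgn K p * (sgn K (q * r) * sgn K r) = sgn K (q * r) * (sgn K p * sgn K r) by ring,
      show sgn K p * sgn K q * (sgn K (q * r) * sgn K q) =
        sgn K (q * r) * sgn K p * (sgn K q * sgn K q) by ring, e4, mul_one]
    abel
  | add_comm x y => intro q h; exact _root_.add_comm _ _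
  | add_assoc x y z => intro q h; exact _root_.add_assoc _ _ _
  | add_smul c c' x => intro q h; exact _root_.add_smul _ _ _
  | mul_smul c c' x => intro q h; exact SemigroupAction.mul_smul _ _ _
  | act_mul σ τ x => intro q h; exact (FreeOperad W).act_mul _ _ _
  | act_one x => intro q h; exact (FreeOperad W).act_one _
  | gen_act σ x => intro q h; exact hu h σ x
  | comp_add_left i e g x x' y =>
    intro r' h
    simp only [derivExpr, mk_add, map_add, LinearMap.add_apply, smul_add]
    abel
  | comp_add_right i e g x y y' =>
    intro r' h
    simp only [derivExpr, mk_add, map_add, smul_add]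
    abel
  | comp_smul_left i e g c x y =>
    intro r' h
    simp only [derivExpr, mk_smul, map_smul, LinearMap.smul_apply, smul_add]
    rw [smul_comm]
  | comp_smul_right i e g c x y =>
    intro r' h
    simp only [derivExpr, mk_smul, map_smul, smul_add]
    rw [smul_comm]
  | add_left => intro q h; simp_all [derivExpr]
  | add_right => intro q h; simp_all [derivExpr]
  | _ => intro q h; simp_all [derivExpr]

/-- The free operad, with the derivation of degree `-1` that extends the map `u`. -/
def withDeriv
    (u : ∀ {n : ℕ} {p q : ℤ} (_ : q + 1 = p), W.obj n p →ₗ[K] (FreeOperad W).obj n q)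
    (hu : ∀ {n : ℕ} {p q : ℤ} (h : q + 1 = p) (σ : Equiv.Perm (Fin n)) (x : W.obj n p),
      u h (W.act σ x) = (FreeOperad W).act σ (u h x)) : DerOperad.{u, max u v} K where
  toGrOperad := FreeOperad W
  d h :=
    { toFun := Quot.lift (derivExpr u h) (fun _ _ hxy => derivExpr_rel u hu hxy h)
      map_add' := by rintro ⟨x⟩ ⟨y⟩; rfl
      map_smul' := by rintro c ⟨x⟩; rfl }
  d_act := by rintro n p q h σ ⟨x⟩; rfl
  d_comp := by
    rintro m n k i e p q r p' q' r' h hp hq hr h₁ h₂ ⟨x⟩ ⟨y⟩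
    exact derivExpr_comp u i e h hp hq hr h₁ h₂ x y

end FreeOperad
end Free


/-! ### The reduced tree module -/

section Trees

variable {K : Type u} [Field K]

/-- A labelled vertex of a tree whose edges are named by natural numbers: `out` is its outgoing edge
(towards the root) and `inp a` its incoming edge at the input `a` of the label. -/
structure Vtx (V : SMod.{u, v} K) where
  out : ℕ
  ar : ℕ
  deg : ℤ
  lab : V.obj ar deg
  inp : Fin ar → ℕ

variable {V : SMod.{u, v} K}

/-- The outgoing edge and the set of incoming edges of a vertex. -/
def Vtx.ends (s : Vtx V) : ℕ × Multiset ℕ := (s.out, Finset.univ.val.map s.inp)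

/-- The degree of a product of labelled vertices. -/
def deg (L : List (Vtx V)) : ℤ := (L.map Vtx.deg).sum

/-- Vertices with the given ends form a tree with at least one vertex, with root edge `r` and with
leaves `l 0, …, l (n - 1)`: each edge starts at exactly one vertex or leaf, each edge ends at exactly
one vertex input or at the root, and there is no directed cycle. -/
def IsTreeShape {n : ℕ} (S : Multiset (ℕ × Multiset ℕ)) (r : ℕ) (l : Fin n → ℕ) : Prop :=
  S ≠ 0 ∧ S.map Prod.fst + Finset.univ.val.map l = r ::ₘ (S.map Prod.snd).sum ∧
    (r ::ₘ (S.map Prod.snd).sum).Nodup ∧ ∃ height : ℕ → ℕ, ∀ s ∈ S, ∀ e ∈ s.2, height s.1 < height e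

def IsTree {n : ℕ} (L : List (Vtx V)) (r : ℕ) (l : Fin n → ℕ) : Prop :=
  IsTreeShape (L.map Vtx.ends : Multiset (ℕ × Multiset ℕ)) r l

/-- Rename the edges at a vertex. -/
def Vtx.rename (π : Equiv.Perm ℕ) (s : Vtx V) : Vtx V := ⟨π s.out, s.ar, s.deg, s.lab, π ∘ s.inp⟩

variable (V) in
/-- An ordered list of vertices, a root and `n` leaves. -/
abbrev Monomial (n : ℕ) : Type v := List (Vtx V) × ℕ × (Fin n → ℕ)

/-- A monomial as an element of the free module on the monomials. -/
noncomputable def monomial {n : ℕ} (L : List (Vtx V)) (r : ℕ) (l : Fin n → ℕ) : Monomial V n →₀ K :=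
  Finsupp.single (L, r, l) 1

/-- The relations of the tree module: only trees of the right degree count; multilinearity in the
labels; the Koszul sign rule for the order of the vertices; equivariance at each vertex; the names of
the edges do not matter. -/
inductive TreeRel (n : ℕ) (p : ℤ) : (Monomial V n →₀ K) → Prop
  | zero (L : List (Vtx V)) (r : ℕ) (l : Fin n → ℕ) (h : ¬ (IsTree L r l ∧ deg L = p)) :
      TreeRel n p (monomial L r l)
  | linear (A B : List (Vtx V)) (r : ℕ) (l : Fin n → ℕ) (o k : ℕ) (q : ℤ) (c c' : K)
      (x x' : V.obj k q) (ι : Fin k → ℕ) :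
      TreeRel n p (monomial (A ++ ⟨o, k, q, c • x + c' • x', ι⟩ :: B) r l
        - (c • monomial (A ++ ⟨o, k, q, x, ι⟩ :: B) r l
          + c' • monomial (A ++ ⟨o, k, q, x', ι⟩ :: B) r l))
  | swap (A B : List (Vtx V)) (s t : Vtx V) (r : ℕ) (l : Fin n → ℕ) :
      TreeRel n p (monomial (A ++ s :: t :: B) r l
        - sgn K (s.deg * t.deg) • monomial (A ++ t :: s :: B) r l)
  | equivariant (A B : List (Vtx V)) (r : ℕ) (l : Fin n → ℕ) (o k : ℕ) (q : ℤ)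
      (σ : Equiv.Perm (Fin k)) (x : V.obj k q) (ι : Fin k → ℕ) :
      TreeRel n p (monomial (A ++ ⟨o, k, q, V.act σ x, ι⟩ :: B) r l
        - monomial (A ++ ⟨o, k, q, x, ι ∘ σ⟩ :: B) r l)
  | rename (π : Equiv.Perm ℕ) (L : List (Vtx V)) (r : ℕ) (l : Fin n → ℕ) :
      TreeRel n p (monomial (L.map (Vtx.rename π)) (π r) (π ∘ l) - monomial L r l)

variable (V) in
/-- The component of arity `n` and degree `p` of the reduced tree module: the coinvariant tensor
products of the labels over the trees with at least one vertex. -/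
abbrev TreeObj (n : ℕ) (p : ℤ) : Type (max u v) :=
  (Monomial V n →₀ K) ⧸ Submodule.span K {z : Monomial V n →₀ K | TreeRel n p z}

/-- The element of the tree module given by a list of vertices; it is `0` unless they form a tree of
degree `p`. -/
noncomputable def tree {n : ℕ} {p : ℤ} (L : List (Vtx V)) (r : ℕ) (l : Fin n → ℕ) : TreeObj V n p :=
  Submodule.Quotient.mk (monomial L r l)

theorem tree_eq_zero {n : ℕ} {p : ℤ} {L : List (Vtx V)} {r : ℕ} {l : Fin n → ℕ}
    (h : ¬ (IsTree L r l ∧ deg L = p)) : (tree L r l : TreeObj V n p) = 0 :=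
  (Submodule.Quotient.mk_eq_zero _).2 (Submodule.subset_span (.zero L r l h))

theorem tree_linear {n : ℕ} {p : ℤ} (A B : List (Vtx V)) (r : ℕ) (l : Fin n → ℕ) (o k : ℕ) (q : ℤ)
    (c c' : K) (x x' : V.obj k q) (ι : Fin k → ℕ) :
    (tree (A ++ ⟨o, k, q, c • x + c' • x', ι⟩ :: B) r l : TreeObj V n p) =
      c • tree (A ++ ⟨o, k, q, x, ι⟩ :: B) r l + c' • tree (A ++ ⟨o, k, q, x', ι⟩ :: B) r l :=
  (Submodule.Quotient.eq _).2 (Submodule.subset_span (.linear A B r l o k q c c' x x' ι))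

theorem tree_swap {n : ℕ} {p : ℤ} (A B : List (Vtx V)) (s t : Vtx V) (r : ℕ) (l : Fin n → ℕ) :
    (tree (A ++ s :: t :: B) r l : TreeObj V n p) =
      sgn K (s.deg * t.deg) • tree (A ++ t :: s :: B) r l :=
  (Submodule.Quotient.eq _).2 (Submodule.subset_span (.swap A B s t r l))

theorem tree_equivariant {n : ℕ} {p : ℤ} (A B : List (Vtx V)) (r : ℕ) (l : Fin n → ℕ) (o k : ℕ)
    (q : ℤ) (σ : Equiv.Perm (Fin k)) (x : V.obj k q) (ι : Fin k → ℕ) :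
    (tree (A ++ ⟨o, k, q, V.act σ x, ι⟩ :: B) r l : TreeObj V n p) =
      tree (A ++ ⟨o, k, q, x, ι ∘ σ⟩ :: B) r l :=
  (Submodule.Quotient.eq _).2 (Submodule.subset_span (.equivariant A B r l o k q σ x ι))

theorem tree_rename {n : ℕ} {p : ℤ} (π : Equiv.Perm ℕ) (L : List (Vtx V)) (r : ℕ) (l : Fin n → ℕ) :
    (tree (L.map (Vtx.rename π)) (π r) (π ∘ l) : TreeObj V n p) = tree L r l :=
  (Submodule.Quotient.eq _).2 (Submodule.subset_span (.rename π L r l))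

theorem isTree_congr {n : ℕ} {L L' : List (Vtx V)} {r : ℕ} {l : Fin n → ℕ}
    (h : (L.map Vtx.ends).Perm (L'.map Vtx.ends)) : IsTree L r l ↔ IsTree L' r l := by
  rw [IsTree, IsTree, Multiset.coe_eq_coe.2 h]

theorem isTree_swap {n : ℕ} (A B : List (Vtx V)) (s t : Vtx V) (r : ℕ) (l : Fin n → ℕ) :
    IsTree (A ++ s :: t :: B) r l ↔ IsTree (A ++ t :: s :: B) r l :=
  isTree_congr ((List.Perm.append_left A (List.Perm.swap t s B)).map _)

theorem isTree_replace {n : ℕ} (A B : List (Vtx V)) {s t : Vtx V} (h : s.ends = t.ends) (r : ℕ)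
    (l : Fin n → ℕ) : IsTree (A ++ s :: B) r l ↔ IsTree (A ++ t :: B) r l :=
  isTree_congr (by simp [h])

theorem ends_comp {o k : ℕ} {q : ℤ} (x y : V.obj k q) (ι : Fin k → ℕ) (σ : Equiv.Perm (Fin k)) :
    (⟨o, k, q, x, ι ∘ σ⟩ : Vtx V).ends = (⟨o, k, q, y, ι⟩ : Vtx V).ends := by
  have : Finset.univ.val.map (⇑σ) = (Finset.univ : Finset (Fin k)).val := by
    simp
  simp only [Vtx.ends, ← Multiset.map_map, this]

theorem isTree_rename {n : ℕ} (π : Equiv.Perm ℕ) {L : List (Vtx V)} {r : ℕ} {l : Fin n → ℕ}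
    (h : IsTree L r l) : IsTree (L.map (Vtx.rename π)) (π r) (π ∘ l) := by
  obtain ⟨h0, h1, h2, height, h3⟩ := h
  have e1 : ((L.map (Vtx.rename π)).map Vtx.ends : Multiset (ℕ × Multiset ℕ)) =
      (L.map Vtx.ends : Multiset (ℕ × Multiset ℕ)).map (fun s => (π s.1, s.2.map π)) := by
    rw [Multiset.map_coe, List.map_map, List.map_map]
    congr 1
    refine List.map_congr_left fun s _ => ?_
    simp only [Function.comp_apply, Vtx.ends, Vtx.rename, Multiset.map_map]
    rfl
  have e2 : ∀ S : Multiset (ℕ × Multiset ℕ),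
      ((S.map (fun s => (π s.1, s.2.map π))).map Prod.snd).sum = ((S.map Prod.snd).sum).map π := by
    intro S
    induction S using Multiset.induction_on <;> simp_all
  rw [IsTree, e1]
  refine ⟨by simpa using h0, ?_, ?_, fun e => height (π.symm e), ?_⟩
  · rw [e2, ← Multiset.map_cons, ← h1]
    simp [Function.comp_def]
  · rw [e2, ← Multiset.map_cons]
    exact h2.map π.injective
  · simp only [Multiset.mem_map]
    rintro _ ⟨s, hs, rfl⟩ e he
    obtain ⟨e', he', rfl⟩ := Multiset.mem_map.1 he
    simpa using h3 s hs e' he'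

theorem isTree_rename_iff {n : ℕ} (π : Equiv.Perm ℕ) (L : List (Vtx V)) (r : ℕ) (l : Fin n → ℕ) :
    IsTree (L.map (Vtx.rename π)) (π r) (π ∘ l) ↔ IsTree L r l := by
  refine ⟨fun h => ?_, isTree_rename π⟩
  have := isTree_rename π.symm h
  simpa [Vtx.rename, Function.comp_def] using this

theorem IsTree.leaf_injective {n : ℕ} {L : List (Vtx V)} {r : ℕ} {l : Fin n → ℕ}
    (h : IsTree L r l) : Function.Injective l := by
  obtain ⟨-, h1, h2, -⟩ := h
  rw [← h1, Multiset.nodup_add] at h2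
  intro a b hab
  exact Multiset.inj_on_of_nodup_map h2.2.1 a (by simp) b (by simp) hab

theorem deg_append (A B : List (Vtx V)) : deg (A ++ B) = deg A + deg B := by simp [deg]

theorem deg_cons (s : Vtx V) (B : List (Vtx V)) : deg (s :: B) = s.deg + deg B := by simp [deg]

theorem deg_rename (π : Equiv.Perm ℕ) (L : List (Vtx V)) : deg (L.map (Vtx.rename π)) = deg L := by
  simp [deg, Vtx.rename, Function.comp_def]

section Lift

variable {M : Type w} [AddCommGroup M] [Module K M] {n : ℕ} {p : ℤ}

open Classical in
/-- The linear map on the tree module with given values on the trees. -/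
noncomputable def treeLift (f : List (Vtx V) → ℕ → (Fin n → ℕ) → M)
    (linear : ∀ (A B : List (Vtx V)) (r : ℕ) (l : Fin n → ℕ) (o k : ℕ) (q : ℤ) (c c' : K)
      (x x' : V.obj k q) (ι : Fin k → ℕ), f (A ++ ⟨o, k, q, c • x + c' • x', ι⟩ :: B) r l =
        c • f (A ++ ⟨o, k, q, x, ι⟩ :: B) r l + c' • f (A ++ ⟨o, k, q, x', ι⟩ :: B) r l)
    (swap : ∀ (A B : List (Vtx V)) (s t : Vtx V) (r : ℕ) (l : Fin n → ℕ),
      f (A ++ s :: t :: B) r l = sgn K (s.deg * t.deg) • f (A ++ t :: s :: B) r l)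
    (equivariant : ∀ (A B : List (Vtx V)) (r : ℕ) (l : Fin n → ℕ) (o k : ℕ) (q : ℤ)
      (σ : Equiv.Perm (Fin k)) (x : V.obj k q) (ι : Fin k → ℕ),
      IsTree (A ++ ⟨o, k, q, x, ι ∘ σ⟩ :: B) r l →
      f (A ++ ⟨o, k, q, V.act σ x, ι⟩ :: B) r l = f (A ++ ⟨o, k, q, x, ι ∘ σ⟩ :: B) r l)
    (rename : ∀ (π : Equiv.Perm ℕ) (L : List (Vtx V)) (r : ℕ) (l : Fin n → ℕ), IsTree L r l →
      f (L.map (Vtx.rename π)) (π r) (π ∘ l) = f L r l) : TreeObj V n p →ₗ[K] M :=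
  Submodule.liftQ _
    (Finsupp.linearCombination K fun m : Monomial V n =>
      if IsTree m.1 m.2.1 m.2.2 ∧ deg m.1 = p then f m.1 m.2.1 m.2.2 else 0)
    (by
      rw [Submodule.span_le]
      rintro z hz
      rw [SetLike.mem_coe, LinearMap.mem_ker]
      induction hz with
      | zero L r l h => simp [monomial, h]
      | linear A B r l o k q c c' x x' ι =>
        have e : ∀ y, IsTree (A ++ ⟨o, k, q, y, ι⟩ :: B) r l ↔
            IsTree (A ++ ⟨o, k, q, x, ι⟩ :: B) r l := fun y =>
          isTree_replace A B (s := ⟨o, k, q, y, ι⟩) (t := ⟨o, k, q, x, ι⟩) rfl r l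
        simp only [monomial, map_sub, map_add, map_smul, Finsupp.linearCombination_single, one_smul,
          e (c • x + c' • x'), e x', deg_append, deg_cons, linear]
        split_ifs <;> simp
      | swap A B s t r l =>
        simp only [monomial, map_sub, map_smul, Finsupp.linearCombination_single, one_smul,
          isTree_swap A B s t, deg_append, deg_cons, swap A B s t, add_left_comm t.deg s.deg]
        split_ifs <;> simp
      | equivariant A B r l o k q σ x ι =>
        have e : IsTree (A ++ ⟨o, k, q, V.act σ x, ι⟩ :: B) r l ↔
            IsTree (A ++ ⟨o, k, q, x, ι ∘ σ⟩ :: B) r l :=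
          isTree_replace A B (ends_comp _ _ ι σ).symm r l
        simp only [monomial, map_sub, Finsupp.linearCombination_single, one_smul, e, deg_append,
          deg_cons]
        split_ifs with h
        · rw [equivariant _ _ _ _ _ _ _ _ _ _ h.1, sub_self]
        · simp
      | rename π L r l =>
        simp only [monomial, map_sub, Finsupp.linearCombination_single, one_smul,
          isTree_rename_iff, deg_rename]
        split_ifs with h
        · rw [rename _ _ _ _ h.1, sub_self]
        · simp)

open Classical in
theorem treeLift_tree (f : List (Vtx V) → ℕ → (Fin n → ℕ) → M) (h₁ h₂ h₃ h₄)
    (L : List (Vtx V)) (r : ℕ) (l : Fin n → ℕ) :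
    treeLift (p := p) f h₁ h₂ h₃ h₄ (tree L r l) =
      if IsTree L r l ∧ deg L = p then f L r l else 0 := by
  simp [treeLift, tree, monomial]

end Lift

theorem treeObj_ext {M : Type w} [AddCommGroup M] [Module K M] {n : ℕ} {p : ℤ}
    {f g : TreeObj V n p →ₗ[K] M} (h : ∀ L r l, f (tree L r l) = g (tree L r l)) : f = g := by
  refine Submodule.linearMap_qext _ (Finsupp.lhom_ext' fun m => LinearMap.ext_ring ?_)
  exact h m.1 m.2.1 m.2.2

theorem isTree_relabel {n : ℕ} (σ : Equiv.Perm (Fin n)) (L : List (Vtx V)) (r : ℕ)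
    (l : Fin n → ℕ) : IsTree L r (l ∘ σ) ↔ IsTree L r l := by
  have : Finset.univ.val.map (⇑σ) = (Finset.univ : Finset (Fin n)).val := by simp
  rw [IsTree, IsTree, IsTreeShape, IsTreeShape, ← Multiset.map_map, this]

/-- Renaming the leaves of trees. -/
noncomputable def treeAct {n : ℕ} {p : ℤ} (σ : Equiv.Perm (Fin n)) :
    TreeObj V n p →ₗ[K] TreeObj V n p :=
  treeLift (fun L r l => tree L r (l ∘ σ.symm))
    (fun _ _ _ _ _ _ _ _ _ _ _ _ => tree_linear _ _ _ _ _ _ _ _ _ _ _ _)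
    (fun _ _ _ _ _ _ => tree_swap _ _ _ _ _ _)
    (fun _ _ _ _ _ _ _ _ _ _ _ => tree_equivariant _ _ _ _ _ _ _ _ _ _)
    (fun π L r l _ => tree_rename π L r (l ∘ σ.symm))

theorem treeAct_tree {n : ℕ} {p : ℤ} (σ : Equiv.Perm (Fin n)) (L : List (Vtx V)) (r : ℕ)
    (l : Fin n → ℕ) : (treeAct σ (tree L r l) : TreeObj V n p) = tree L r (l ∘ σ.symm) := by
  rw [treeAct, treeLift_tree]
  split_ifs with h
  · rfl
  · rw [tree_eq_zero]
    rwa [isTree_relabel]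

variable (V) in
/-- The reduced tree module as a graded `𝕊`-module. -/
noncomputable def treeModule : SMod.{u, max u v} K where
  obj := TreeObj V
  act := treeAct
  act_one x := by
    refine LinearMap.congr_fun (f := treeAct 1) (g := LinearMap.id) ?_ x
    exact treeObj_ext fun L r l => treeAct_tree _ _ _ _
  act_mul σ τ x := by
    refine LinearMap.congr_fun (f := treeAct (σ * τ)) (g := treeAct σ ∘ₗ treeAct τ) ?_ x
    refine treeObj_ext fun L r l => ?_
    rw [LinearMap.comp_apply, treeAct_tree, treeAct_tree, treeAct_tree]
    rfl

/-! ### Signed sums over the vertices and over the two-block partitions of a tree -/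

section Sums

variable {M : Type w} [AddCommGroup M] [Module K M]

/-- The sum of `F s L'` over the vertices `s` of `L`, where `L'` is the list of the other vertices,
with the Koszul sign of moving `s` to the front. -/
def pickSum (F : Vtx V → List (Vtx V) → M) : List (Vtx V) → M
  | [] => 0
  | s :: L => F s L + pickSum (fun t L' => sgn K (s.deg * t.deg) • F t (s :: L')) L

/-- The sum of `F A B` over the partitions of `L` into two sublists, with the Koszul sign of moving
`A` to the front. -/
def splitSum (F : List (Vtx V) → List (Vtx V) → M) : List (Vtx V) → M
  | [] => F [] []
  | s :: L => splitSum (fun A B => F (s :: A) B) L +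
      splitSum (fun A B => sgn K (s.deg * deg A) • F A (s :: B)) L

theorem pickSum_add (F G : Vtx V → List (Vtx V) → M) (L : List (Vtx V)) :
    pickSum (fun s L' => F s L' + G s L') L = pickSum F L + pickSum G L := by
  induction L generalizing F G with
  | nil => simp [pickSum]
  | cons s L ih => simp only [pickSum, smul_add, ih]; abel

theorem pickSum_map {N : Type*} [AddCommGroup N] [Module K N] (g : M →ₗ[K] N)
    (F : Vtx V → List (Vtx V) → M) (L : List (Vtx V)) :
    g (pickSum F L) = pickSum (fun s L' => g (F s L')) L := by
  induction L generalizing F with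
  | nil => simp [pickSum]
  | cons s L ih => simp only [pickSum, map_add, ih, map_smul]

theorem pickSum_smul (c : K) (F : Vtx V → List (Vtx V) → M) (L : List (Vtx V)) :
    pickSum (fun s L' => c • F s L') L = c • pickSum F L :=
  (pickSum_map (LinearMap.lsmul K M c) F L).symm

theorem pickSum_rename (π : Equiv.Perm ℕ) (F : Vtx V → List (Vtx V) → M) (L : List (Vtx V)) :
    pickSum F (L.map (Vtx.rename π)) =
      pickSum (fun s L' => F (s.rename π) (L'.map (Vtx.rename π))) L := by
  induction L generalizing F with
  | nil => rfl
  | cons s L ih => simp only [List.map_cons, pickSum, ih]; rfl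

theorem pickSum_swap (F : Vtx V → List (Vtx V) → M) (s t : Vtx V)
    (hF : ∀ v A B, F v (A ++ s :: t :: B) = sgn K (s.deg * t.deg) • F v (A ++ t :: s :: B))
    (A B : List (Vtx V)) :
    pickSum F (A ++ s :: t :: B) = sgn K (s.deg * t.deg) • pickSum F (A ++ t :: s :: B) := by
  induction A generalizing F with
  | nil =>
    have h := fun v => hF v []
    simp only [List.nil_append] at h ⊢
    have e := sgn_mul_self K (s.deg * t.deg)
    simp only [pickSum, smul_add, smul_smul, ← pickSum_smul, h, mul_comm t.deg s.deg, e, one_smul]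
    have e₂ : ∀ x y : K, x * (y * sgn K (s.deg * t.deg)) = sgn K (s.deg * t.deg) * (y * x) :=
      fun x y => by ring
    simp only [e₂]
    abel
  | cons a A ih =>
    simp only [List.cons_append, pickSum, smul_add, hF]
    congr 1
    refine ih _ fun v A' B' => ?_
    rw [← List.cons_append, hF, smul_comm]
    rfl

theorem pickSum_replace (F : Vtx V → List (Vtx V) → M) (c c' : K) (s s₁ s₂ : Vtx V)
    (h₁ : s₁.deg = s.deg) (h₂ : s₂.deg = s.deg)
    (hF : ∀ v A B, F v (A ++ s :: B) = c • F v (A ++ s₁ :: B) + c' • F v (A ++ s₂ :: B))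
    (hF' : ∀ L, F s L = c • F s₁ L + c' • F s₂ L) (A B : List (Vtx V)) :
    pickSum F (A ++ s :: B) = c • pickSum F (A ++ s₁ :: B) + c' • pickSum F (A ++ s₂ :: B) := by
  induction A generalizing F with
  | nil =>
    have h := fun v => hF v []
    simp only [List.nil_append] at h ⊢
    simp only [pickSum, smul_add, ← pickSum_smul, h, hF', h₁, h₂, pickSum_add, smul_comm _ c,
      smul_comm _ c']
    abel
  | cons a A ih =>
    simp only [List.cons_append, pickSum]
    rw [ih]
    · rw [hF]
      simp only [smul_add]
      abel
    · intro v A' B'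
      rw [← List.cons_append, hF]
      simp only [smul_add, List.cons_append, smul_comm _ c, smul_comm _ c']
    · intro L
      simp only [hF', h₁, h₂, smul_add, smul_comm _ c, smul_comm _ c']

theorem splitSum_add (F G : List (Vtx V) → List (Vtx V) → M) (L : List (Vtx V)) :
    splitSum (fun A B => F A B + G A B) L = splitSum F L + splitSum G L := by
  induction L generalizing F G with
  | nil => simp [splitSum]
  | cons s L ih => simp only [splitSum, smul_add, ih]; abel

theorem splitSum_map {N : Type*} [AddCommGroup N] [Module K N] (g : M →ₗ[K] N)
    (F : List (Vtx V) → List (Vtx V) → M) (L : List (Vtx V)) :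
    g (splitSum F L) = splitSum (fun A B => g (F A B)) L := by
  induction L generalizing F with
  | nil => simp [splitSum]
  | cons s L ih => simp only [splitSum, map_add, ih, map_smul]

theorem splitSum_smul (c : K) (F : List (Vtx V) → List (Vtx V) → M) (L : List (Vtx V)) :
    splitSum (fun A B => c • F A B) L = c • splitSum F L :=
  (splitSum_map (LinearMap.lsmul K M c) F L).symm

theorem splitSum_rename (π : Equiv.Perm ℕ) (F : List (Vtx V) → List (Vtx V) → M)
    (L : List (Vtx V)) : splitSum F (L.map (Vtx.rename π)) =
      splitSum (fun A B => F (A.map (Vtx.rename π)) (B.map (Vtx.rename π))) L := by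
  induction L generalizing F with
  | nil => rfl
  | cons s L ih => simp only [List.map_cons, splitSum, ih, deg_rename]; rfl

theorem splitSum_swap (F : List (Vtx V) → List (Vtx V) → M) (s t : Vtx V)
    (hF : ∀ A B C, F (A ++ s :: t :: B) C = sgn K (s.deg * t.deg) • F (A ++ t :: s :: B) C)
    (hF' : ∀ A B C, F C (A ++ s :: t :: B) = sgn K (s.deg * t.deg) • F C (A ++ t :: s :: B))
    (A B : List (Vtx V)) :
    splitSum F (A ++ s :: t :: B) = sgn K (s.deg * t.deg) • splitSum F (A ++ t :: s :: B) := by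
  induction A generalizing F with
  | nil =>
    have h := hF []
    have h' := hF' []
    simp only [List.nil_append] at h h' ⊢
    have e := sgn_mul_self K (s.deg * t.deg)
    simp only [splitSum, smul_add, smul_smul, ← splitSum_smul, h, h', deg_cons, mul_add, sgn_add,
      mul_comm t.deg s.deg]
    have e₁ : ∀ x : K, sgn K (s.deg * t.deg) * (sgn K (s.deg * t.deg) * x) = x := fun x => by
      rw [← mul_assoc, e, one_mul]
    have e₂ : ∀ x y : K, x * (y * sgn K (s.deg * t.deg)) = sgn K (s.deg * t.deg) * (y * x) :=
      fun x y => by ring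
    simp only [e₂, e₁]
    abel
  | cons a A ih =>
    simp only [List.cons_append, splitSum, smul_add]
    congr 1
    · exact ih _ (fun A' B' C => hF (a :: A') B' C) (fun A' B' C => hF' A' B' (a :: C))
    · refine ih _ (fun A' B' C => ?_) (fun A' B' C => ?_)
      · simp only [hF, deg_append, deg_cons, add_left_comm t.deg s.deg]
        rw [smul_comm]
      · rw [← List.cons_append, hF', smul_comm]
        rfl

theorem splitSum_replace (F : List (Vtx V) → List (Vtx V) → M) (c c' : K) (s s₁ s₂ : Vtx V)
    (h₁ : s₁.deg = s.deg) (h₂ : s₂.deg = s.deg)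
    (hF : ∀ A B C, F (A ++ s :: B) C = c • F (A ++ s₁ :: B) C + c' • F (A ++ s₂ :: B) C)
    (hF' : ∀ A B C, F C (A ++ s :: B) = c • F C (A ++ s₁ :: B) + c' • F C (A ++ s₂ :: B))
    (A B : List (Vtx V)) :
    splitSum F (A ++ s :: B) = c • splitSum F (A ++ s₁ :: B) + c' • splitSum F (A ++ s₂ :: B) := by
  induction A generalizing F with
  | nil =>
    have h := hF []
    have h' := hF' []
    simp only [List.nil_append] at h h' ⊢
    simp only [splitSum, smul_add, ← splitSum_smul, h, h', h₁, h₂, splitSum_add, smul_comm _ c,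
      smul_comm _ c']
    abel
  | cons a A ih =>
    simp only [List.cons_append, splitSum]
    rw [ih _ (fun A' B' C => hF (a :: A') B' C) (fun A' B' C => hF' A' B' (a :: C)), ih]
    · simp only [smul_add]
      abel
    · intro A' B' C
      simp only [hF, deg_append, deg_cons, h₁, h₂, smul_add, smul_comm _ c, smul_comm _ c']
    · intro A' B' C
      rw [← List.cons_append, hF']
      simp only [smul_add, List.cons_append, smul_comm _ c, smul_comm _ c']

end Sums

end Trees

/-! ### Auxiliary constructions on `𝕊`-modules -/

section Aux

variable {K : Type u} [Field K]

/-- Renaming the inputs along a bijection `Fin k ≃ Fin n` (so that `k = n`) and rewriting the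
degree. -/
def SMod.transport (V : SMod.{u, v} K) {k n : ℕ} {q p : ℤ} (σ : Fin k ≃ Fin n) (h : q = p) :
    V.obj k q →ₗ[K] V.obj n p := by
  have hk : k = n := Fin.equiv_iff_eq.1 ⟨σ⟩
  subst hk
  subst h
  exact V.act σ

theorem SMod.transport_act (V : SMod.{u, v} K) {k n : ℕ} {q p : ℤ} (σ : Equiv.Perm (Fin k))
    (τ : Fin k ≃ Fin n) (h : q = p) (x : V.obj k q) :
    V.transport τ h (V.act σ x) = V.transport (σ.trans τ) h x := by
  have hk : k = n := Fin.equiv_iff_eq.1 ⟨τ⟩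
  subst hk
  subst h
  exact (V.act_mul τ σ x).symm

theorem SMod.act_transport (V : SMod.{u, v} K) {k n : ℕ} {q p : ℤ} (σ : Equiv.Perm (Fin n))
    (τ : Fin k ≃ Fin n) (h : q = p) (x : V.obj k q) :
    V.act σ (V.transport τ h x) = V.transport (τ.trans σ) h x := by
  have hk : k = n := Fin.equiv_iff_eq.1 ⟨τ⟩
  subst hk
  subst h
  exact (V.act_mul σ τ x).symm

/-- The desuspension `s⁻¹C` of a graded `𝕊`-module. -/
def desusp (C : SMod.{u, v} K) : SMod.{u, v} K where
  obj n p := C.obj n (p + 1)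
  act := C.act
  act_one := C.act_one
  act_mul := C.act_mul

open Classical in
/-- The map `c ↦ c • 1` into the component of arity `n` and degree `p`; it is zero unless `n = 1` and
`p = 0`. -/
noncomputable def GrOperad.unitAt (Q : GrOperad.{u, v} K) (n : ℕ) (p : ℤ) : K →ₗ[K] Q.obj n p :=
  if h : 1 = n ∧ 0 = p then
    Q.transport (finCongr h.1) h.2 ∘ₗ LinearMap.toSpanSingleton K (Q.obj 1 0) Q.one
  else 0

theorem GrOperad.act_unitAt (Q : GrOperad.{u, v} K) {n : ℕ} {p : ℤ} (σ : Equiv.Perm (Fin n))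
    (c : K) : Q.act σ (Q.unitAt n p c) = Q.unitAt n p c := by
  rw [unitAt]
  split_ifs with h
  · obtain ⟨rfl, rfl⟩ := h
    rw [Subsingleton.elim σ 1]
    exact Q.act_one _
  · simp

end Aux

/-! ### The projection of the tree module onto the labels -/

section Proj

variable {K : Type u} [Field K] {V : SMod.{u, v} K}

open Classical in
/-- The label of a one-vertex tree, with its inputs in the order of the leaves. -/
noncomputable def projFun {n : ℕ} (p : ℤ) : List (Vtx V) → (Fin n → ℕ) → V.obj n p
  | [s], l =>
      if h : (∃ σ : Fin s.ar ≃ Fin n, ∀ a, l (σ a) = s.inp a) ∧ s.deg = p then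
        V.transport h.1.choose h.2 s.lab
      else 0
  | _, _ => 0

theorem projFun_eq {n : ℕ} {p : ℤ} {s : Vtx V} {l : Fin n → ℕ} (hl : Function.Injective l)
    (σ : Fin s.ar ≃ Fin n) (hσ : ∀ a, l (σ a) = s.inp a) (h : s.deg = p) :
    projFun p [s] l = V.transport σ h s.lab := by
  have h' : (∃ σ : Fin s.ar ≃ Fin n, ∀ a, l (σ a) = s.inp a) ∧ s.deg = p := ⟨⟨σ, hσ⟩, h⟩
  rw [projFun, dif_pos h']
  congr 2
  ext a
  have := h'.1.choose_spec a
  rw [← hσ] at this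
  rw [hl this]

theorem projFun_long {n : ℕ} {p : ℤ} (A B : List (Vtx V)) (s t : Vtx V) (l : Fin n → ℕ) :
    projFun p (A ++ s :: t :: B) l = 0 := by
  rcases A with _ | ⟨a, _ | ⟨b, A⟩⟩ <;> rfl

theorem projFun_congr {n : ℕ} {p : ℤ} {s t : Vtx V} {l : Fin n → ℕ}
    (h : (∃ σ : Fin s.ar ≃ Fin n, ∀ a, l (σ a) = s.inp a) ∧ s.deg = p →
      projFun p [s] l = projFun p [t] l)
    (h' : (∃ σ : Fin t.ar ≃ Fin n, ∀ a, l (σ a) = t.inp a) ∧ t.deg = p →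
      (∃ σ : Fin s.ar ≃ Fin n, ∀ a, l (σ a) = s.inp a) ∧ s.deg = p) :
    projFun p [s] l = projFun p [t] l := by
  by_cases hs : (∃ σ : Fin s.ar ≃ Fin n, ∀ a, l (σ a) = s.inp a) ∧ s.deg = p
  · exact h hs
  · rw [projFun, dif_neg hs, projFun, dif_neg fun ht => hs (h' ht)]

variable (V) in
/-- The projection of the reduced tree module onto the one-vertex trees. -/
noncomputable def proj {n : ℕ} {p : ℤ} : TreeObj V n p →ₗ[K] V.obj n p :=
  treeLift (fun L _ l => projFun p L l)
    (by
      intro A B r l o k q c c' x x' ι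
      rcases A with _ | ⟨a, A⟩
      · rcases B with _ | ⟨b, B⟩
        · simp only [List.nil_append, projFun]
          split_ifs <;> simp
        · simp [projFun]
      · rcases A with _ | ⟨b, A⟩ <;> simp [projFun])
    (by
      intro A B s t r l
      simp [projFun_long])
    (by
      intro A B r l o k q σ x ι ht
      rcases A with _ | ⟨a, A⟩
      · rcases B with _ | ⟨b, B⟩
        · have hl := ht.leaf_injective
          refine projFun_congr ?_ ?_
          · rintro ⟨⟨τ, hτ⟩, hd⟩
            refine (projFun_eq hl τ hτ hd).trans ((V.transport_act σ τ hd x).trans ?_)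
            exact (projFun_eq (s := ⟨o, k, q, x, ι ∘ σ⟩) hl (σ.trans τ)
              (fun a => hτ (σ a)) hd).symm
          · rintro ⟨⟨τ, hτ⟩, hd⟩
            exact ⟨⟨σ.symm.trans τ, fun a => by simpa using hτ (σ.symm a)⟩, hd⟩
        · rfl
      · rcases A with _ | ⟨b, A⟩ <;> rfl)
    (by
      intro π L r l ht
      rcases L with _ | ⟨s, _ | ⟨t, L⟩⟩
      · rfl
      · have hl := ht.leaf_injective
        have hl' : Function.Injective (π ∘ l) := π.injective.comp hl
        by_cases hs : (∃ σ : Fin s.ar ≃ Fin n, ∀ a, l (σ a) = s.inp a) ∧ s.deg = p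
        · obtain ⟨⟨τ, hτ⟩, hd⟩ := hs
          rw [projFun_eq hl τ hτ hd]
          exact projFun_eq (s := s.rename π) hl' τ (fun a => congrArg π (hτ a)) hd
        · rw [projFun, dif_neg hs]
          simp only [List.map_cons, List.map_nil, projFun]
          rw [dif_neg]
          rintro ⟨⟨τ, hτ⟩, hd⟩
          exact hs ⟨⟨τ, fun a => π.injective (hτ a)⟩, hd⟩
      · rfl)

theorem proj_treeAct {n : ℕ} {p : ℤ} (σ : Equiv.Perm (Fin n)) (x : TreeObj V n p) :
    proj V (treeAct σ x) = V.act σ (proj V x) := by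
  refine LinearMap.congr_fun (f := proj V ∘ₗ treeAct σ) (g := V.act σ ∘ₗ proj V) ?_ x
  refine treeObj_ext fun L r l => ?_
  simp only [LinearMap.comp_apply, treeAct_tree]
  rw [proj, treeLift_tree, treeLift_tree, isTree_relabel]
  split_ifs with h
  · rcases L with _ | ⟨s, _ | ⟨t, L⟩⟩
    · simp [projFun]
    · have hl := h.1.leaf_injective
      have hl' : Function.Injective (l ∘ σ.symm) := hl.comp σ.symm.injective
      by_cases hs : (∃ σ : Fin s.ar ≃ Fin n, ∀ a, l (σ a) = s.inp a) ∧ s.deg = p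
      · obtain ⟨⟨τ, hτ⟩, hd⟩ := hs
        rw [projFun_eq hl τ hτ hd, V.act_transport]
        exact projFun_eq hl' (τ.trans σ) (fun a => by simpa using hτ a) hd
      · have hs' : ¬ ((∃ τ : Fin s.ar ≃ Fin n, ∀ a, (l ∘ σ.symm) (τ a) = s.inp a) ∧
            s.deg = p) := fun ⟨⟨τ, hτ⟩, hd⟩ => hs ⟨⟨τ.trans σ.symm, hτ⟩, hd⟩
        rw [projFun, dif_neg hs', projFun, dif_neg hs, map_zero]
    · simp [projFun]
  · simp

end Proj

/-! ### The bar construction -/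

section Bar

variable {K : Type u} [Field K]

/-- The graded module `K · v`, with `v` in arity `1` and degree `2`. -/
def vPart (K : Type u) [Field K] (n : ℕ) (p : ℤ) : Submodule K K := if n = 1 ∧ p = 2 then ⊤ else ⊥

/-- The graded `𝕊`-module `sP ⊕ K · v`. -/
def barGen (P : DerOperad.{u, v} K) : SMod.{u, max u v} K where
  obj n p := P.obj n (p - 1) × vPart K n p
  act σ := LinearMap.prodMap (P.act σ) LinearMap.id
  act_one x := Prod.ext (P.act_one x.1) rfl
  act_mul σ τ x := Prod.ext (P.act_mul σ τ x.1) rfl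

variable {P : DerOperad.{u, v} K}

/-- The map `sP ⊕ K · v → P` of degree `-1` that sends `sx` to `x` and `v` to `0`. -/
def desuspPart {n : ℕ} {p q : ℤ} (h : q + 1 = p) : (barGen P).obj n p →ₗ[K] P.obj n q :=
  P.transport (Equiv.refl _) (by omega) ∘ₗ LinearMap.fst K (P.obj n (p - 1)) (vPart K n p)

/-- The coefficient of `v`. -/
def vCoeff {n : ℕ} {p : ℤ} : (barGen P).obj n p →ₗ[K] K :=
  (vPart K n p).subtype ∘ₗ LinearMap.snd K (P.obj n (p - 1)) (vPart K n p)

/-- The suspension `x ↦ sx`. -/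
def susp {n : ℕ} {p q : ℤ} (h : q + 1 = p) : P.obj n q →ₗ[K] (barGen P).obj n p :=
  LinearMap.inl K (P.obj n (p - 1)) (vPart K n p) ∘ₗ P.transport (Equiv.refl _) (by omega)

theorem desuspPart_act {n : ℕ} {p q : ℤ} (h : q + 1 = p) (σ : Equiv.Perm (Fin n))
    (x : (barGen P).obj n p) : desuspPart h ((barGen P).act σ x) = P.act σ (desuspPart h x) := by
  obtain rfl : q = p - 1 := by omega
  change P.act 1 (P.act σ x.1) = P.act σ (P.act 1 x.1)
  rw [P.act_one, P.act_one]

theorem vCoeff_act {n : ℕ} {p : ℤ} (σ : Equiv.Perm (Fin n)) (x : (barGen P).obj n p) :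
    vCoeff ((barGen P).act σ x) = vCoeff x := rfl

theorem susp_act {n : ℕ} {p q : ℤ} (h : q + 1 = p) (σ : Equiv.Perm (Fin n)) (x : P.obj n q) :
    susp h (P.act σ x) = (barGen P).act σ (susp h x) := by
  obtain rfl : q = p - 1 := by omega
  refine Prod.ext ?_ rfl
  change P.act 1 (P.act σ x) = P.act σ (P.act 1 x)
  rw [P.act_one, P.act_one]

/-- The part of the bar differential that is defined on `sP ⊕ K · v`: `sx ↦ - s dx` and
`v ↦ s 1`. -/
noncomputable def barLin {n : ℕ} {p : ℤ} : (barGen P).obj n p →ₗ[K] (barGen P).obj n (p - 1) :=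
  susp (q := p - 2) (by omega) ∘ₗ
    (- (P.d (p := p - 1) (by omega) ∘ₗ desuspPart (by omega)) + P.unitAt n (p - 2) ∘ₗ vCoeff)

theorem barLin_act {n : ℕ} {p : ℤ} (σ : Equiv.Perm (Fin n)) (x : (barGen P).obj n p) :
    barLin ((barGen P).act σ x) = (barGen P).act σ (barLin x) := by
  simp only [barLin, LinearMap.comp_apply, LinearMap.add_apply, LinearMap.neg_apply, desuspPart_act,
    vCoeff_act, P.d_act, ← susp_act, map_add, map_neg, P.act_unitAt]

/-- The vertex obtained from `s` by applying `barLin` to its label. -/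
noncomputable def Vtx.barLin (s : Vtx (barGen P)) : Vtx (barGen P) :=
  ⟨s.out, s.ar, s.deg - 1, BarCobar.barLin s.lab, s.inp⟩

/-- The part of the bar differential that is defined on pairs of adjacent labels:
`sx ⊗ sy ↦ (-1)^|x| s (x ∘ᵢ y)`, and `0` if one of the labels is `v`. -/
noncomputable def barMul {m n k : ℕ} (i : Fin m) (e : Wire i n k) {p q : ℤ} :
    (barGen P).obj m p →ₗ[K] (barGen P).obj n q →ₗ[K] (barGen P).obj k (p + q - 1) :=
  sgn K (p - 1) •
    ((P.comp i e (show p - 1 + (q - 1) = p + q - 2 by omega)).compl₁₂ (desuspPart (by omega))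
      (desuspPart (by omega))).compr₂ (susp (by omega))

theorem barMul_act {m n k : ℕ} {i : Fin m} (σ : Equiv.Perm (Fin m)) (τ : Equiv.Perm (Fin n))
    (ρ : Equiv.Perm (Fin k)) (e : Wire i n k) (e' : Wire (σ i) n k) (he : e.Renames σ τ ρ e')
    {p q : ℤ} (x : (barGen P).obj m p) (y : (barGen P).obj n q) :
    barMul (σ i) e' ((barGen P).act σ x) ((barGen P).act τ y) =
      (barGen P).act ρ (barMul i e x y) := by
  simp only [barMul, LinearMap.smul_apply, LinearMap.compr₂_apply, LinearMap.compl₁₂_apply,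
    desuspPart_act, map_smul]
  rw [P.equivariance σ τ ρ e e' he, susp_act]

/-- The vertex obtained by contracting the edge from the vertex `t` to the input `i` of the vertex
`s`; its inputs are numbered by `e`. -/
noncomputable def Vtx.contractVia (s t : Vtx (barGen P)) (i : Fin s.ar) {k : ℕ}
    (e : Wire i t.ar k) : Vtx (barGen P) where
  out := s.out
  ar := k
  deg := s.deg + t.deg - 1
  lab := barMul i e s.lab t.lab
  inp := Sum.elim (fun a => s.inp a.1) t.inp ∘ e.symm

/-- The vertex obtained by contracting the edge from `t` to the input `i` of `s`, for an arbitrary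
numbering of its inputs. -/
noncomputable def Vtx.contract (s t : Vtx (barGen P)) (i : Fin s.ar) : Vtx (barGen P) :=
  s.contractVia t i (Fintype.equivFin _)

theorem tree_contractVia (s t : Vtx (barGen P)) (i : Fin s.ar) {k k' : ℕ} (e : Wire i t.ar k)
    (e' : Wire i t.ar k') (L : List (Vtx (barGen P))) {n : ℕ} {p : ℤ} (r : ℕ) (l : Fin n → ℕ) :
    (tree (s.contractVia t i e :: L) r l : TreeObj (barGen P) n p) =
      tree (s.contractVia t i e' :: L) r l := by
  obtain rfl : k = k' := Fin.equiv_iff_eq.1 ⟨e.symm.trans e'⟩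
  have h := barMul_act 1 1 (e.symm.trans e') e e'
    ⟨fun a => by simp; rfl, fun b => by simp; rfl⟩ s.lab t.lab
  rw [(barGen P).act_one, (barGen P).act_one] at h
  have h' : s.contractVia t i e' = ⟨s.out, k, s.deg + t.deg - 1,
      (barGen P).act (e.symm.trans e') (barMul i e s.lab t.lab),
      Sum.elim (fun a => s.inp a.1) t.inp ∘ e'.symm⟩ := by
    rw [← h]; rfl
  rw [h']
  refine Eq.trans ?_ (tree_equivariant [] L r l _ _ _ _ _ _).symm
  simp only [Vtx.contractVia, List.nil_append]
  congr 3
  ext c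
  simp

/-- The sum over the edges from `t` to `s` of the trees obtained by contracting this edge. -/
noncomputable def contractSum {n : ℕ} {p : ℤ} (s t : Vtx (barGen P)) (L : List (Vtx (barGen P)))
    (r : ℕ) (l : Fin n → ℕ) : TreeObj (barGen P) n p :=
  ∑ i, if s.inp i = t.out then tree (s.contract t i :: L) r l else 0

theorem contractSum_linear_left {n : ℕ} {p : ℤ} (t : Vtx (barGen P)) (L : List (Vtx (barGen P)))
    (r : ℕ) (l : Fin n → ℕ) (o k : ℕ) (q : ℤ) (c c' : K) (x x' : (barGen P).obj k q)
    (ι : Fin k → ℕ) :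
    (contractSum ⟨o, k, q, c • x + c' • x', ι⟩ t L r l : TreeObj (barGen P) n p) =
      c • contractSum ⟨o, k, q, x, ι⟩ t L r l + c' • contractSum ⟨o, k, q, x', ι⟩ t L r l := by
  simp only [contractSum, Finset.smul_sum, ← Finset.sum_add_distrib]
  refine Finset.sum_congr rfl fun i _ => ?_
  split_ifs
  · simp only [Vtx.contract, Vtx.contractVia, map_add, map_smul, LinearMap.add_apply,
      LinearMap.smul_apply]
    exact tree_linear [] _ _ _ _ _ _ _ _ _ _ _
  · simp

theorem contractSum_linear_right {n : ℕ} {p : ℤ} (t : Vtx (barGen P)) (L : List (Vtx (barGen P)))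
    (r : ℕ) (l : Fin n → ℕ) (o k : ℕ) (q : ℤ) (c c' : K) (x x' : (barGen P).obj k q)
    (ι : Fin k → ℕ) :
    (contractSum t ⟨o, k, q, c • x + c' • x', ι⟩ L r l : TreeObj (barGen P) n p) =
      c • contractSum t ⟨o, k, q, x, ι⟩ L r l + c' • contractSum t ⟨o, k, q, x', ι⟩ L r l := by
  simp only [contractSum, Finset.smul_sum, ← Finset.sum_add_distrib]
  refine Finset.sum_congr rfl fun i _ => ?_
  split_ifs
  · simp only [Vtx.contract, Vtx.contractVia, map_add, map_smul]
    exact tree_linear [] _ _ _ _ _ _ _ _ _ _ _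
  · simp

/-- A labelling of the inputs of `x ∘ᵢ y`, after renaming the inputs of `x`. -/
def Wire.renameLeft {m n k : ℕ} {i : Fin m} (σ : Equiv.Perm (Fin m)) (e : Wire i n k) :
    Wire (σ i) n k :=
  (Equiv.sumCongr (σ.subtypeEquiv fun a => by simp : {j : Fin m // j ≠ i} ≃
    {j : Fin m // j ≠ σ i}) (Equiv.refl _)).symm.trans e

/-- A labelling of the inputs of `x ∘ᵢ y`, after renaming the inputs of `y`. -/
def Wire.renameRight {m n k : ℕ} {i : Fin m} (τ : Equiv.Perm (Fin n)) (e : Wire i n k) :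
    Wire i n k :=
  (Equiv.sumCongr (Equiv.refl _) τ).symm.trans e

theorem Wire.renames_left {m n k : ℕ} {i : Fin m} (σ : Equiv.Perm (Fin m)) (e : Wire i n k) :
    e.Renames σ 1 1 (e.renameLeft σ) := by
  refine ⟨fun a => congrArg e ?_, fun b => congrArg e ?_⟩
  · rw [Equiv.symm_apply_eq]
    rfl
  · rw [Equiv.symm_apply_eq]
    rfl

theorem Wire.renames_right {m n k : ℕ} {i : Fin m} (τ : Equiv.Perm (Fin n)) (e : Wire i n k) :
    e.Renames 1 τ 1 (e.renameRight τ) :=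
  ⟨fun _ => rfl, fun b => congrArg (fun c => e (inr c)) (τ.symm_apply_apply b)⟩

theorem contractVia_act_left (t : Vtx (barGen P)) (o k : ℕ) (q : ℤ) (σ : Equiv.Perm (Fin k))
    (x : (barGen P).obj k q) (ι : Fin k → ℕ) (i : Fin k) {k' : ℕ} (e : Wire i t.ar k') :
    Vtx.contractVia ⟨o, k, q, (barGen P).act σ x, ι⟩ t (σ i) (e.renameLeft σ) =
      Vtx.contractVia ⟨o, k, q, x, ι ∘ σ⟩ t i e := by
  have h := barMul_act σ 1 1 e (e.renameLeft σ) (e.renames_left σ) x t.lab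
  rw [(barGen P).act_one, (barGen P).act_one] at h
  simp only [Vtx.contractVia]
  rw [h]
  congr 1
  ext c
  obtain ⟨c, rfl⟩ := e.surjective c
  rcases c with a | b <;> simp [Wire.renameLeft]

theorem contractVia_act_right (t : Vtx (barGen P)) (o k : ℕ) (q : ℤ) (σ : Equiv.Perm (Fin k))
    (x : (barGen P).obj k q) (ι : Fin k → ℕ) (i : Fin t.ar) {k' : ℕ} (e : Wire i k k') :
    Vtx.contractVia t ⟨o, k, q, (barGen P).act σ x, ι⟩ i (e.renameRight σ) =
      Vtx.contractVia t ⟨o, k, q, x, ι ∘ σ⟩ i e := by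
  have h : barMul i (e.renameRight σ) t.lab ((barGen P).act σ x) = barMul i e t.lab x := by
    have h := barMul_act 1 σ 1 e (e.renameRight σ) (e.renames_right σ) t.lab x
    rwa [(barGen P).act_one, (barGen P).act_one] at h
  simp only [Vtx.contractVia]
  rw [h]
  congr 1
  ext c
  obtain ⟨c, rfl⟩ := e.surjective c
  rcases c with a | b <;> simp [Wire.renameRight]

theorem tree_contract_act_left {n : ℕ} {p : ℤ} (t : Vtx (barGen P)) (L : List (Vtx (barGen P)))
    (r : ℕ) (l : Fin n → ℕ) (o k : ℕ) (q : ℤ) (σ : Equiv.Perm (Fin k)) (x : (barGen P).obj k q)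
    (ι : Fin k → ℕ) (i : Fin k) {k' k'' : ℕ} (e : Wire i t.ar k') (e' : Wire (σ i) t.ar k'') :
    (tree (Vtx.contractVia ⟨o, k, q, x, ι ∘ σ⟩ t i e :: L) r l : TreeObj (barGen P) n p) =
      tree (Vtx.contractVia ⟨o, k, q, (barGen P).act σ x, ι⟩ t (σ i) e' :: L) r l := by
  rw [← contractVia_act_left]
  exact tree_contractVia ⟨o, k, q, (barGen P).act σ x, ι⟩ t (σ i) (e.renameLeft σ) e' L r l

theorem contractSum_act_left {n : ℕ} {p : ℤ} (t : Vtx (barGen P)) (L : List (Vtx (barGen P)))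
    (r : ℕ) (l : Fin n → ℕ) (o k : ℕ) (q : ℤ) (σ : Equiv.Perm (Fin k)) (x : (barGen P).obj k q)
    (ι : Fin k → ℕ) :
    (contractSum ⟨o, k, q, (barGen P).act σ x, ι⟩ t L r l : TreeObj (barGen P) n p) =
      contractSum ⟨o, k, q, x, ι ∘ σ⟩ t L r l := by
  unfold contractSum
  refine (Fintype.sum_equiv σ _ _ fun i => ?_).symm
  refine if_congr Iff.rfl ?_ rfl
  unfold Vtx.contract
  exact tree_contract_act_left t L r l o k q σ x ι i _ _

theorem tree_contract_act_right {n : ℕ} {p : ℤ} (t : Vtx (barGen P)) (L : List (Vtx (barGen P)))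
    (r : ℕ) (l : Fin n → ℕ) (o k : ℕ) (q : ℤ) (σ : Equiv.Perm (Fin k)) (x : (barGen P).obj k q)
    (ι : Fin k → ℕ) (i : Fin t.ar) {k' : ℕ} (e e' : Wire i k k') :
    (tree (Vtx.contractVia t ⟨o, k, q, (barGen P).act σ x, ι⟩ i e :: L) r l :
      TreeObj (barGen P) n p) = tree (Vtx.contractVia t ⟨o, k, q, x, ι ∘ σ⟩ i e' :: L) r l := by
  rw [← contractVia_act_right]
  exact tree_contractVia t ⟨o, k, q, (barGen P).act σ x, ι⟩ i e (e'.renameRight σ) L r l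

theorem contractSum_act_right {n : ℕ} {p : ℤ} (t : Vtx (barGen P)) (L : List (Vtx (barGen P)))
    (r : ℕ) (l : Fin n → ℕ) (o k : ℕ) (q : ℤ) (σ : Equiv.Perm (Fin k)) (x : (barGen P).obj k q)
    (ι : Fin k → ℕ) :
    (contractSum t ⟨o, k, q, (barGen P).act σ x, ι⟩ L r l : TreeObj (barGen P) n p) =
      contractSum t ⟨o, k, q, x, ι ∘ σ⟩ L r l := by
  unfold contractSum
  refine Finset.sum_congr rfl fun i _ => ?_
  refine if_congr Iff.rfl ?_ rfl
  unfold Vtx.contract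
  exact tree_contract_act_right t L r l o k q σ x ι i _ _

theorem contractSum_swap {n : ℕ} {p : ℤ} (a b : Vtx (barGen P)) (A B : List (Vtx (barGen P)))
    (s t : Vtx (barGen P)) (r : ℕ) (l : Fin n → ℕ) :
    (contractSum a b (A ++ s :: t :: B) r l : TreeObj (barGen P) n p) =
      sgn K (s.deg * t.deg) • contractSum a b (A ++ t :: s :: B) r l := by
  simp only [contractSum, Finset.smul_sum]
  refine Finset.sum_congr rfl fun i _ => ?_
  split_ifs
  · exact tree_swap (_ :: A) B s t r l
  · simp

theorem contractSum_replace {n : ℕ} {p : ℤ} (a b : Vtx (barGen P)) (c c' : K)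
    (s s₁ s₂ : Vtx (barGen P)) (r : ℕ) (l : Fin n → ℕ)
    (h : ∀ A B, (tree (A ++ s :: B) r l : TreeObj (barGen P) n p) =
      c • tree (A ++ s₁ :: B) r l + c' • tree (A ++ s₂ :: B) r l) (A B : List (Vtx (barGen P))) :
    (contractSum a b (A ++ s :: B) r l : TreeObj (barGen P) n p) =
      c • contractSum a b (A ++ s₁ :: B) r l + c' • contractSum a b (A ++ s₂ :: B) r l := by
  simp only [contractSum, Finset.smul_sum, ← Finset.sum_add_distrib]
  refine Finset.sum_congr rfl fun i _ => ?_
  split_ifs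
  · exact h (_ :: A) B
  · simp

theorem contract_rename (π : Equiv.Perm ℕ) (a b : Vtx (barGen P)) (i : Fin a.ar) :
    (a.rename π).contract (b.rename π) i = (a.contract b i).rename π := by
  simp only [Vtx.contract, Vtx.contractVia, Vtx.rename]
  congr 1
  rw [← Function.comp_assoc, Sum.comp_elim]
  rfl

theorem contractSum_rename {n : ℕ} {p : ℤ} (π : Equiv.Perm ℕ) (a b : Vtx (barGen P))
    (L : List (Vtx (barGen P))) (r : ℕ) (l : Fin n → ℕ) :
    (contractSum (a.rename π) (b.rename π) (L.map (Vtx.rename π)) (π r) (π ∘ l) :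
      TreeObj (barGen P) n p) = contractSum a b L r l := by
  refine (Finset.sum_congr rfl fun i _ => ?_)
  refine if_congr π.apply_eq_iff_eq ?_ rfl
  exact (congrArg (fun s => tree (s :: _) _ _) (contract_rename π a b i)).trans
    (tree_rename π (a.contract b i :: L) r l)

/-- The bar differential on a tree: the sum over its vertices of the trees obtained by applying
`barLin` to the label, and over its inner edges of the trees obtained by contracting the edge. -/
noncomputable def barDiffFun {n : ℕ} {q : ℤ} (L : List (Vtx (barGen P))) (r : ℕ) (l : Fin n → ℕ) :
    TreeObj (barGen P) n q :=
  pickSum (fun s L' => tree (s.barLin :: L') r l) L +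
    pickSum (fun s L' => pickSum (fun t L'' => contractSum s t L'' r l) L') L

theorem barDiffFun_replace {n : ℕ} {q : ℤ} (c c' : K) (s s₁ s₂ : Vtx (barGen P)) (r : ℕ)
    (l : Fin n → ℕ) (h₁ : s₁.deg = s.deg) (h₂ : s₂.deg = s.deg)
    (h : ∀ A B, (tree (A ++ s :: B) r l : TreeObj (barGen P) n q) =
      c • tree (A ++ s₁ :: B) r l + c' • tree (A ++ s₂ :: B) r l)
    (hlin : ∀ L, (tree (s.barLin :: L) r l : TreeObj (barGen P) n q) =
      c • tree (s₁.barLin :: L) r l + c' • tree (s₂.barLin :: L) r l)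
    (hl : ∀ t L, (contractSum s t L r l : TreeObj (barGen P) n q) =
      c • contractSum s₁ t L r l + c' • contractSum s₂ t L r l)
    (hr : ∀ t L, (contractSum t s L r l : TreeObj (barGen P) n q) =
      c • contractSum t s₁ L r l + c' • contractSum t s₂ L r l)
    (A B : List (Vtx (barGen P))) :
    (barDiffFun (A ++ s :: B) r l : TreeObj (barGen P) n q) =
      c • barDiffFun (A ++ s₁ :: B) r l + c' • barDiffFun (A ++ s₂ :: B) r l := by
  rw [barDiffFun, pickSum_replace _ c c' s s₁ s₂ h₁ h₂ (fun v A B => h (_ :: A) B) hlin,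
    pickSum_replace (fun s L' => pickSum (fun t L'' => contractSum s t L'' r l) L') c c' s s₁ s₂
      h₁ h₂
      (fun v A B => pickSum_replace _ c c' s s₁ s₂ h₁ h₂
        (fun w A B => contractSum_replace v w c c' s s₁ s₂ r l h A B) (fun L => hr v L) A B)
      (fun L => by simp only [hl, pickSum_add, pickSum_smul])]
  simp only [barDiffFun, smul_add]
  abel

theorem barDiffFun_linear {n : ℕ} {p : ℤ} (A B : List (Vtx (barGen P))) (r : ℕ) (l : Fin n → ℕ)
    (o k : ℕ) (q : ℤ) (c c' : K) (x x' : (barGen P).obj k q) (ι : Fin k → ℕ) :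
    (barDiffFun (A ++ ⟨o, k, q, c • x + c' • x', ι⟩ :: B) r l : TreeObj (barGen P) n p) =
      c • barDiffFun (A ++ ⟨o, k, q, x, ι⟩ :: B) r l +
        c' • barDiffFun (A ++ ⟨o, k, q, x', ι⟩ :: B) r l := by
  refine barDiffFun_replace c c' ⟨o, k, q, c • x + c' • x', ι⟩ ⟨o, k, q, x, ι⟩ ⟨o, k, q, x', ι⟩ r l
    rfl rfl (fun A B => tree_linear A B r l o k q c c' x x' ι)
    (fun L => ?_) (fun t L => contractSum_linear_left t L r l o k q c c' x x' ι)
    (fun t L => contractSum_linear_right t L r l o k q c c' x x' ι) A B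
  simp only [Vtx.barLin, map_add, map_smul]
  exact tree_linear [] L r l o k (q - 1) c c' (barLin x) (barLin x') ι

theorem barDiffFun_swap {n : ℕ} {p : ℤ} (A B : List (Vtx (barGen P))) (s t : Vtx (barGen P))
    (r : ℕ) (l : Fin n → ℕ) :
    (barDiffFun (A ++ s :: t :: B) r l : TreeObj (barGen P) n p) =
      sgn K (s.deg * t.deg) • barDiffFun (A ++ t :: s :: B) r l := by
  rw [barDiffFun, pickSum_swap _ s t (fun v A B => tree_swap (v.barLin :: A) B s t r l),
    pickSum_swap (fun s L' => pickSum (fun t L'' => contractSum s t L'' r l) L') s t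
      (fun v A B => pickSum_swap _ s t
        (fun w A B => contractSum_swap v w A B s t r l) A B), ← smul_add]
  rfl

theorem barDiffFun_act {n : ℕ} {p : ℤ} (A B : List (Vtx (barGen P))) (r : ℕ) (l : Fin n → ℕ)
    (o k : ℕ) (q : ℤ) (σ : Equiv.Perm (Fin k)) (x : (barGen P).obj k q) (ι : Fin k → ℕ) :
    (barDiffFun (A ++ ⟨o, k, q, (barGen P).act σ x, ι⟩ :: B) r l : TreeObj (barGen P) n p) =
      barDiffFun (A ++ ⟨o, k, q, x, ι ∘ σ⟩ :: B) r l := by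
  have e : ∀ {a b : TreeObj (barGen P) n p}, a = b → a = (1 : K) • b + (0 : K) • b := by
    intro a b h
    rw [one_smul, zero_smul, add_zero, h]
  have := barDiffFun_replace (1 : K) 0 ⟨o, k, q, (barGen P).act σ x, ι⟩
    ⟨o, k, q, x, ι ∘ σ⟩ ⟨o, k, q, x, ι ∘ σ⟩ r l rfl rfl
    (fun A B => e (tree_equivariant A B r l o k q σ x ι))
    (fun L => e (by
      simp only [Vtx.barLin, barLin_act]
      exact tree_equivariant [] L r l o k (q - 1) σ (barLin x) ι))
    (fun t L => e (contractSum_act_left t L r l o k q σ x ι))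
    (fun t L => e (contractSum_act_right t L r l o k q σ x ι)) A B
  rwa [one_smul, zero_smul, add_zero] at this

theorem barDiffFun_rename {n : ℕ} {p : ℤ} (π : Equiv.Perm ℕ) (L : List (Vtx (barGen P))) (r : ℕ)
    (l : Fin n → ℕ) :
    (barDiffFun (L.map (Vtx.rename π)) (π r) (π ∘ l) : TreeObj (barGen P) n p) =
      barDiffFun L r l := by
  simp only [barDiffFun, pickSum_rename, contractSum_rename]
  congr 2
  ext s L'
  exact tree_rename π (s.barLin :: L') r l

variable (P) in
/-- The bar differential `TreeObj (barGen P) n p → TreeObj (barGen P) n q`; it is zero unless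
`q = p - 1`. -/
noncomputable def barDiff {n : ℕ} {p q : ℤ} :
    TreeObj (barGen P) n p →ₗ[K] TreeObj (barGen P) n q :=
  treeLift barDiffFun barDiffFun_linear barDiffFun_swap
    (fun A B r l o k q σ x ι _ => barDiffFun_act A B r l o k q σ x ι)
    (fun π L r l _ => barDiffFun_rename π L r l)

theorem barDiff_treeAct {n : ℕ} {p q : ℤ} (σ : Equiv.Perm (Fin n))
    (x : TreeObj (barGen P) n p) :
    (barDiff P (treeAct σ x) : TreeObj (barGen P) n q) = treeAct σ (barDiff P x) := by
  refine LinearMap.congr_fun (f := barDiff P ∘ₗ treeAct σ) (g := treeAct σ ∘ₗ barDiff P) ?_ x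
  refine treeObj_ext fun L r l => ?_
  simp only [LinearMap.comp_apply, treeAct_tree]
  rw [barDiff, treeLift_tree, treeLift_tree, isTree_relabel]
  split_ifs
  · simp only [barDiffFun, map_add, pickSum_map, treeAct_tree, contractSum, map_sum, apply_ite,
      map_zero]
  · simp

end Bar

/-! ### The cobar construction -/

section Cobar

variable {K : Type u} [Field K] {V : SMod.{u, v} K}

variable (V) in
/-- The underlying graded operad of the cobar construction of the tree module: the free operad on its
desuspension. -/
noncomputable abbrev CobarFree : GrOperad.{u, max u v} K := FreeOperad (desusp (treeModule V))

/-- The generator `s⁻¹x` of the cobar construction. -/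
noncomputable def cobarGen {n : ℕ} {p : ℤ} : TreeObj V n (p + 1) →ₗ[K] (CobarFree V).obj n p :=
  FreeOperad.gen (desusp (treeModule V))

theorem cobarGen_act {n : ℕ} {p : ℤ} (σ : Equiv.Perm (Fin n)) (x : TreeObj V n (p + 1)) :
    (cobarGen (treeAct σ x) : (CobarFree V).obj n p) = (CobarFree V).act σ (cobarGen x) :=
  FreeOperad.gen_act (W := desusp (treeModule V)) σ x

/-- A presentation of the tree with vertices `A` and `B`, root `r` and leaves `l` as a partial
composite of a tree with vertices `A` and a tree with vertices `B`: the root of the latter is the leaf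
`i` of the former. -/
structure Cut {n : ℕ} (A B : List (Vtx V)) (r : ℕ) (l : Fin n → ℕ) (q : ℤ) where
  nA : ℕ
  nB : ℕ
  pA : ℤ
  pB : ℤ
  lA : Fin nA → ℕ
  lB : Fin nB → ℕ
  i : Fin nA
  e : Wire i nB n
  isTreeA : IsTree A r lA
  isTreeB : IsTree B (lA i) lB
  inj : Function.Injective l
  inner : ∀ b, l b ≠ lA i
  labelA : ∀ a : {a : Fin nA // a ≠ i}, l (e (inl a)) = lA a.1
  labelB : ∀ b, l (e (inr b)) = lB b
  degA : deg A = pA + 1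
  degB : deg B = pB + 1
  deg_eq : pA + pB = q

namespace Cut

variable {n : ℕ} {A B : List (Vtx V)} {r : ℕ} {l : Fin n → ℕ} {q : ℤ}

/-- The partial composite, in the cobar construction, of the two generators given by a cut. -/
noncomputable def value (c : Cut A B r l q) : (CobarFree V).obj n q :=
  (CobarFree V).comp c.i c.e c.deg_eq (cobarGen (tree A r c.lA)) (cobarGen (tree B (c.lA c.i) c.lB))

theorem exists_equiv {m k : ℕ} {f : Fin m → ℕ} {g : Fin k → ℕ} (hf : Function.Injective f)
    (hg : Function.Injective g)
    (h : Finset.univ.val.map f = Finset.univ.val.map g) :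
    ∃ σ : Fin m ≃ Fin k, ∀ a, g (σ a) = f a := by
  have hr : Set.range f = Set.range g := by
    ext x
    have := congrArg (x ∈ ·) h
    simpa using this
  refine ⟨(Equiv.ofInjective f hf).trans ((Equiv.setCongr hr).trans (Equiv.ofInjective g hg).symm),
    fun a => ?_⟩
  simpa using Equiv.apply_ofInjective_symm hg (Equiv.setCongr hr (Equiv.ofInjective f hf a))

theorem leaves_eq {m k : ℕ} {f : Fin m → ℕ} {g : Fin k → ℕ} (hf : IsTree A r f)
    (hg : IsTree A r g) : Finset.univ.val.map f = Finset.univ.val.map g :=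
  add_left_cancel (hf.2.1.trans hg.2.1.symm)

theorem value_eq (c c' : Cut A B r l q) : c.value = c'.value := by
  obtain ⟨σ, hσ⟩ := exists_equiv c.isTreeA.leaf_injective c'.isTreeA.leaf_injective
    (leaves_eq c.isTreeA c'.isTreeA)
  have hi : σ c.i = c'.i := by
    by_contra h
    have h1 := c'.labelA ⟨_, h⟩
    rw [hσ] at h1
    exact c.inner _ h1
  obtain ⟨nA, nB, pA, pB, lA, lB, i, e, hA, hB, inj, inner, labA, labB, dA, dB, dq⟩ := c
  obtain ⟨nA', nB', pA', pB', lA', lB', i', e', hA', hB', inj', inner', labA', labB', dA', dB',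
    dq'⟩ := c'
  obtain ⟨σ₁, hσ₁, hi₁⟩ : ∃ σ : Fin nA ≃ Fin nA', (∀ a, lA' (σ a) = lA a) ∧ σ i = i' :=
    ⟨σ, hσ, hi⟩
  clear hi hσ
  clear σ
  rename' σ₁ => σ, hσ₁ => hσ, hi₁ => hi
  obtain rfl : pA = pA' := by omega
  obtain rfl : pB = pB' := by omega
  obtain rfl : nA = nA' := Fin.equiv_iff_eq.1 ⟨σ⟩
  subst hi
  have hr : lA' (σ i) = lA i := hσ i
  obtain ⟨τ, hτ⟩ := exists_equiv hB.leaf_injective hB'.leaf_injective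
    (leaves_eq hB (by rwa [hr] at hB'))
  obtain rfl : nB = nB' := Fin.equiv_iff_eq.1 ⟨τ⟩
  have e1 : lA' = lA ∘ σ.symm := by
    ext a; simp [← hσ]
  have e2 : lB' = lB ∘ τ.symm := by
    ext a; simp [← hτ]
  simp only [value]
  have := (CobarFree V).equivariance σ τ 1 e e'
    ⟨fun a => inj (by
      rw [labA', hσ]
      exact (labA a).symm), fun b => inj (by
      rw [labB', hτ]
      exact (labB b).symm)⟩ dq (cobarGen (tree A r lA)) (cobarGen (tree B (lA i) lB))
  rw [(CobarFree V).act_one, ← cobarGen_act, ← cobarGen_act, treeAct_tree, treeAct_tree] at this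
  rw [← this, ← e1, ← e2, ← hr]

/-- The same cut, for lists of vertices with the same ends and degrees. -/
def congr (c : Cut A B r l q) {A' B' : List (Vtx V)} (hA : (A.map Vtx.ends).Perm (A'.map Vtx.ends))
    (hB : (B.map Vtx.ends).Perm (B'.map Vtx.ends)) (dA : deg A' = deg A) (dB : deg B' = deg B) :
    Cut A' B' r l q where
  __ := c
  isTreeA := (isTree_congr hA).1 c.isTreeA
  isTreeB := (isTree_congr hB).1 c.isTreeB
  degA := dA.trans c.degA
  degB := dB.trans c.degB

/-- The cut obtained by renaming the edges. -/
def rename (c : Cut A B r l q) (π : Equiv.Perm ℕ) :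
    Cut (A.map (Vtx.rename π)) (B.map (Vtx.rename π)) (π r) (π ∘ l) q where
  __ := c
  lA := π ∘ c.lA
  lB := π ∘ c.lB
  isTreeA := isTree_rename π c.isTreeA
  isTreeB := isTree_rename π c.isTreeB
  inj := π.injective.comp c.inj
  inner b h := c.inner b (π.injective h)
  labelA a := congrArg π (c.labelA a)
  labelB b := congrArg π (c.labelB b)
  degA := (deg_rename π A).trans c.degA
  degB := (deg_rename π B).trans c.degB

/-- The cut obtained by renaming the leaves. -/
def relabel (c : Cut A B r l q) (σ : Equiv.Perm (Fin n)) : Cut A B r (l ∘ σ.symm) q where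
  __ := c
  e := c.e.trans σ
  inj := c.inj.comp σ.symm.injective
  inner b := c.inner _
  labelA a := by simpa using c.labelA a
  labelB b := by simpa using c.labelB b

theorem value_rename (c : Cut A B r l q) (π : Equiv.Perm ℕ) : (c.rename π).value = c.value := by
  simp only [value]
  rw [← tree_rename π A r c.lA, ← tree_rename π B (c.lA c.i) c.lB]
  rfl

theorem value_relabel (c : Cut A B r l q) (σ : Equiv.Perm (Fin n)) :
    (c.relabel σ).value = (CobarFree V).act σ c.value := by
  have := (CobarFree V).equivariance 1 1 σ c.e (c.relabel σ).e ⟨fun a => rfl, fun b => rfl⟩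
    c.deg_eq (cobarGen (tree A r c.lA)) (cobarGen (tree B (c.lA c.i) c.lB))
  rw [(CobarFree V).act_one, (CobarFree V).act_one] at this
  exact this

end Cut

open Classical in
/-- The partial composite of the trees with vertices `A` and `B`, as an element of the cobar
construction; it is `0` if the edge between them does not exist. -/
noncomputable def cutTerm {n : ℕ} (q : ℤ) (A B : List (Vtx V)) (r : ℕ) (l : Fin n → ℕ) :
    (CobarFree V).obj n q :=
  if h : Nonempty (Cut A B r l q) then h.some.value else 0

section

variable {n : ℕ} {q : ℤ} {A B : List (Vtx V)} {r : ℕ} {l : Fin n → ℕ}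

theorem cutTerm_eq (c : Cut A B r l q) : cutTerm q A B r l = c.value := by
  rw [cutTerm, dif_pos ⟨c⟩]
  exact Cut.value_eq _ _

theorem cutTerm_eq_zero (h : Cut A B r l q → False) : cutTerm q A B r l = 0 :=
  dif_neg fun ⟨c⟩ => h c

theorem cutTerm_rename (π : Equiv.Perm ℕ) :
    cutTerm q (A.map (Vtx.rename π)) (B.map (Vtx.rename π)) (π r) (π ∘ l) = cutTerm q A B r l := by
  by_cases h : Nonempty (Cut A B r l q)
  · obtain ⟨c⟩ := h
    rw [cutTerm_eq c, cutTerm_eq (c.rename π), Cut.value_rename]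
  · rw [cutTerm_eq_zero fun c => h ⟨c⟩, cutTerm_eq_zero fun c => h ?_]
    have e : ∀ L : List (Vtx V), (L.map (Vtx.rename π)).map (Vtx.rename π.symm) = L := fun L => by
      simp [Vtx.rename, Function.comp_def]
    have c' := c.rename π.symm
    rw [e, e, Equiv.symm_apply_apply] at c'
    have e' : π.symm ∘ π ∘ l = l := by ext; simp
    rw [e'] at c'
    exact ⟨c'⟩

theorem cutTerm_relabel (σ : Equiv.Perm (Fin n)) :
    cutTerm q A B r (l ∘ σ.symm) = (CobarFree V).act σ (cutTerm q A B r l) := by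
  by_cases h : Nonempty (Cut A B r l q)
  · obtain ⟨c⟩ := h
    rw [cutTerm_eq c, cutTerm_eq (c.relabel σ), Cut.value_relabel]
  · rw [cutTerm_eq_zero fun c => h ⟨c⟩, cutTerm_eq_zero fun c => h ?_, map_zero]
    have c' := c.relabel σ.symm
    have e' : (l ∘ σ.symm) ∘ σ.symm.symm = l := by ext; simp
    rw [e'] at c'
    exact ⟨c'⟩

/-- `A` and `A'` have the same ends and the same degree. -/
def SameShape (A A' : List (Vtx V)) : Prop :=
  (A.map Vtx.ends).Perm (A'.map Vtx.ends) ∧ deg A' = deg A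

theorem cutTerm_left (c c' : K) {A₁ A₂ : List (Vtx V)} (h₁ : SameShape A A₁) (h₂ : SameShape A A₂)
    (h : ∀ {m : ℕ} {p : ℤ} (r : ℕ) (l : Fin m → ℕ), (tree A r l : TreeObj V m p) =
      c • tree A₁ r l + c' • tree A₂ r l) :
    cutTerm q A B r l = c • cutTerm q A₁ B r l + c' • cutTerm q A₂ B r l := by
  by_cases hc : Nonempty (Cut A B r l q)
  · obtain ⟨k⟩ := hc
    rw [cutTerm_eq k, cutTerm_eq (k.congr h₁.1 (.refl _) h₁.2 rfl),
      cutTerm_eq (k.congr h₂.1 (.refl _) h₂.2 rfl)]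
    simp only [Cut.value, h, map_add, map_smul, LinearMap.add_apply, LinearMap.smul_apply]
    rfl
  · rw [cutTerm_eq_zero fun k => hc ⟨k⟩,
      cutTerm_eq_zero fun k => hc ⟨k.congr h₁.1.symm (.refl _) h₁.2.symm rfl⟩,
      cutTerm_eq_zero fun k => hc ⟨k.congr h₂.1.symm (.refl _) h₂.2.symm rfl⟩]
    simp

theorem cutTerm_right (c c' : K) {B₁ B₂ : List (Vtx V)} (h₁ : SameShape B B₁) (h₂ : SameShape B B₂)
    (h : ∀ {m : ℕ} {p : ℤ} (r : ℕ) (l : Fin m → ℕ), (tree B r l : TreeObj V m p) =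
      c • tree B₁ r l + c' • tree B₂ r l) :
    cutTerm q A B r l = c • cutTerm q A B₁ r l + c' • cutTerm q A B₂ r l := by
  by_cases hc : Nonempty (Cut A B r l q)
  · obtain ⟨k⟩ := hc
    rw [cutTerm_eq k, cutTerm_eq (k.congr (.refl _) h₁.1 rfl h₁.2),
      cutTerm_eq (k.congr (.refl _) h₂.1 rfl h₂.2)]
    simp only [Cut.value, h, map_add, map_smul]
    rfl
  · rw [cutTerm_eq_zero fun k => hc ⟨k⟩,
      cutTerm_eq_zero fun k => hc ⟨k.congr (.refl _) h₁.1.symm rfl h₁.2.symm⟩,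
      cutTerm_eq_zero fun k => hc ⟨k.congr (.refl _) h₂.1.symm rfl h₂.2.symm⟩]
    simp

end

/-- The sum over the inner edges of a tree of the composites `(-1)^|x₁| s⁻¹x₁ ∘ s⁻¹x₂` of the two
trees obtained by cutting the edge, where `x₁` contains the root. -/
noncomputable def cutFun {n : ℕ} (q : ℤ) (L : List (Vtx V)) (r : ℕ) (l : Fin n → ℕ) :
    (CobarFree V).obj n q :=
  splitSum (fun A B => sgn K (deg A) • cutTerm q A B r l) L

theorem sameShape_replace {s t : Vtx V} (h : s.ends = t.ends) (h' : t.deg = s.deg)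
    (A B : List (Vtx V)) : SameShape (A ++ s :: B) (A ++ t :: B) :=
  ⟨by simp [h], by simp [deg_append, deg_cons, h']⟩

theorem sameShape_swap (s t : Vtx V) (A B : List (Vtx V)) :
    SameShape (A ++ s :: t :: B) (A ++ t :: s :: B) :=
  ⟨(List.Perm.append_left A (List.Perm.swap t s B)).map _, by
    simp only [deg_append, deg_cons]; omega⟩

theorem cutFun_replace {n : ℕ} {q : ℤ} (c c' : K) {s s₁ s₂ : Vtx V} (r : ℕ) (l : Fin n → ℕ)
    (h₁ : s₁.deg = s.deg) (h₂ : s₂.deg = s.deg) (e₁ : s.ends = s₁.ends) (e₂ : s.ends = s₂.ends)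
    (h : ∀ (A B : List (Vtx V)) {m : ℕ} {p : ℤ} (r : ℕ) (l : Fin m → ℕ),
      (tree (A ++ s :: B) r l : TreeObj V m p) =
        c • tree (A ++ s₁ :: B) r l + c' • tree (A ++ s₂ :: B) r l) (A B : List (Vtx V)) :
    cutFun q (A ++ s :: B) r l =
      c • cutFun q (A ++ s₁ :: B) r l + c' • cutFun q (A ++ s₂ :: B) r l := by
  refine splitSum_replace _ c c' s s₁ s₂ h₁ h₂ (fun A B C => ?_) (fun A B C => ?_) A B
  · rw [cutTerm_left c c' (sameShape_replace e₁ h₁ A B) (sameShape_replace e₂ h₂ A B) (h A B)]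
    simp only [deg_append, deg_cons, h₁, h₂, smul_add, smul_comm _ c, smul_comm _ c']
  · rw [cutTerm_right c c' (sameShape_replace e₁ h₁ A B) (sameShape_replace e₂ h₂ A B) (h A B)]
    simp only [smul_add, smul_comm _ c, smul_comm _ c']

theorem cutFun_linear {n : ℕ} {q' : ℤ} (A B : List (Vtx V)) (r : ℕ) (l : Fin n → ℕ) (o k : ℕ)
    (q : ℤ) (c c' : K) (x x' : V.obj k q) (ι : Fin k → ℕ) :
    cutFun q' (A ++ ⟨o, k, q, c • x + c' • x', ι⟩ :: B) r l =
      c • cutFun q' (A ++ ⟨o, k, q, x, ι⟩ :: B) r l +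
        c' • cutFun q' (A ++ ⟨o, k, q, x', ι⟩ :: B) r l :=
  cutFun_replace c c' (s := ⟨o, k, q, c • x + c' • x', ι⟩) (s₁ := ⟨o, k, q, x, ι⟩)
    (s₂ := ⟨o, k, q, x', ι⟩) r l rfl rfl rfl rfl
    (fun A B _ _ r l => tree_linear A B r l o k q c c' x x' ι) A B

theorem cutFun_act {n : ℕ} {q' : ℤ} (A B : List (Vtx V)) (r : ℕ) (l : Fin n → ℕ) (o k : ℕ)
    (q : ℤ) (σ : Equiv.Perm (Fin k)) (x : V.obj k q) (ι : Fin k → ℕ) :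
    cutFun q' (A ++ ⟨o, k, q, V.act σ x, ι⟩ :: B) r l =
      cutFun q' (A ++ ⟨o, k, q, x, ι ∘ σ⟩ :: B) r l := by
  have := cutFun_replace (q := q') (1 : K) 0 (s := ⟨o, k, q, V.act σ x, ι⟩)
    (s₁ := ⟨o, k, q, x, ι ∘ σ⟩) (s₂ := ⟨o, k, q, x, ι ∘ σ⟩) r l rfl rfl
    (ends_comp _ _ ι σ).symm (ends_comp _ _ ι σ).symm
    (fun A B _ _ r l => by
      rw [one_smul, zero_smul, add_zero]
      exact tree_equivariant A B r l o k q σ x ι) A B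
  rwa [one_smul, zero_smul, add_zero] at this

theorem cutFun_swap {n : ℕ} {q : ℤ} (A B : List (Vtx V)) (s t : Vtx V) (r : ℕ) (l : Fin n → ℕ) :
    cutFun q (A ++ s :: t :: B) r l =
      sgn K (s.deg * t.deg) • cutFun q (A ++ t :: s :: B) r l := by
  have e : ∀ {m : ℕ} {p : ℤ} (A B : List (Vtx V)) (r : ℕ) (l : Fin m → ℕ),
      (tree (A ++ s :: t :: B) r l : TreeObj V m p) =
        sgn K (s.deg * t.deg) • tree (A ++ t :: s :: B) r l +
          (0 : K) • tree (A ++ t :: s :: B) r l := fun A B r l => by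
    rw [zero_smul, add_zero]
    exact tree_swap A B s t r l
  refine splitSum_swap _ s t (fun A B C => ?_) (fun A B C => ?_) A B
  · rw [cutTerm_left _ _ (sameShape_swap s t A B) (sameShape_swap s t A B) (e A B), zero_smul,
      add_zero, smul_comm, (sameShape_swap s t A B).2]
  · rw [cutTerm_right _ _ (sameShape_swap s t A B) (sameShape_swap s t A B) (e A B), zero_smul,
      add_zero, smul_comm]

theorem cutFun_rename {n : ℕ} {q : ℤ} (π : Equiv.Perm ℕ) (L : List (Vtx V)) (r : ℕ)
    (l : Fin n → ℕ) : cutFun q (L.map (Vtx.rename π)) (π r) (π ∘ l) = cutFun q L r l := by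
  simp only [cutFun, splitSum_rename, deg_rename, cutTerm_rename]

/-- The map `x ↦ ∑ (-1)^|x₁| s⁻¹x₁ ⊗ s⁻¹x₂`, where `∑ x₁ ⊗ x₂` is the component of the decomposition of
`x` in the trees with two vertices. -/
noncomputable def cutMap {n : ℕ} {p q : ℤ} : TreeObj V n p →ₗ[K] (CobarFree V).obj n q :=
  treeLift (cutFun q) cutFun_linear cutFun_swap
    (fun A B r l o k q σ x ι _ => cutFun_act A B r l o k q σ x ι)
    (fun π L r l _ => cutFun_rename π L r l)

theorem cutMap_act {n : ℕ} {p q : ℤ} (σ : Equiv.Perm (Fin n)) (x : TreeObj V n p) :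
    (cutMap (treeAct σ x) : (CobarFree V).obj n q) = (CobarFree V).act σ (cutMap x) := by
  refine LinearMap.congr_fun (f := cutMap ∘ₗ treeAct σ) (g := (CobarFree V).act σ ∘ₗ cutMap) ?_ x
  refine treeObj_ext fun L r l => ?_
  simp only [LinearMap.comp_apply, treeAct_tree]
  rw [cutMap, treeLift_tree, treeLift_tree, isTree_relabel]
  split_ifs
  · simp only [cutFun, splitSum_map, map_smul, cutTerm_relabel]
  · simp

variable (P : DerOperad.{u, v} K)

/-- The derivation of the cobar construction of the bar construction of `P`, on the generators:
`s⁻¹x ↦ θ(x) 1 - s⁻¹dx - ∑ (-1)^|x₁| s⁻¹x₁ ⊗ s⁻¹x₂`, where the curvature `θ` is the coefficient of `v`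
and `d` is the bar differential. -/
noncomputable def cobarDeriv {n : ℕ} {p q : ℤ} (_ : q + 1 = p) :
    TreeObj (barGen P) n (p + 1) →ₗ[K] (CobarFree (barGen P)).obj n q :=
  (CobarFree (barGen P)).unitAt n q ∘ₗ vCoeff ∘ₗ proj (barGen P)
    - cobarGen ∘ₗ barDiff P - cutMap

theorem cobarDeriv_act {n : ℕ} {p q : ℤ} (h : q + 1 = p) (σ : Equiv.Perm (Fin n))
    (x : TreeObj (barGen P) n (p + 1)) :
    cobarDeriv P h (treeAct σ x) = (CobarFree (barGen P)).act σ (cobarDeriv P h x) := by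
  simp only [cobarDeriv, LinearMap.sub_apply, LinearMap.comp_apply, map_sub]
  rw [proj_treeAct, vCoeff_act, barDiff_treeAct, cobarGen_act, cutMap_act, GrOperad.act_unitAt]

/-- The cobar construction of the bar construction of `P`, as a graded operad with a derivation. -/
noncomputable def cobarBar : DerOperad.{u, max u v} K :=
  FreeOperad.withDeriv (W := desusp (treeModule (barGen P))) (cobarDeriv P) (cobarDeriv_act P)

/-- The counit of the bar-cobar adjunction: the morphism of graded operads that sends `s⁻¹(sx)` to
`x`, and `s⁻¹v` and the `s⁻¹` of a tree with at least two vertices to `0`. -/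
noncomputable def counit : (cobarBar P).toGrOperad.Hom P.toGrOperad :=
  FreeOperad.lift (W := desusp (treeModule (barGen P))) P.toGrOperad (desuspPart rfl ∘ₗ proj (barGen P))
    (fun σ x => (congrArg (desuspPart rfl) (proj_treeAct σ x)).trans (desuspPart_act rfl σ _))

end Cobar

end BarCobar

namespace BarCobar

noncomputable section

open Equiv (Perm apply_symm_apply emptySum natSumNatEquivNat)
open Fin (equiv_iff_eq)
open Finset (range smul_sum sum_add_distrib sum_congr sum_eq_zero univ)
open Fintype (equivFin sum_sum_type)
open Function (Injective comp_assoc comp_def update update_of_ne update_self)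
open LinearMap (comp_apply eqLocus id_apply ker mem_eqLocus mem_ker)
open List (append_assoc append_nil cons_append length_append length_cons map_append map_congr_left
  map_cons mem_append mem_append_left mem_append_right mem_cons_of_mem mem_cons_self mem_filter
  mem_singleton nil_append perm_middle)
open Multiset (add_cons cons_add cons_inj_right cons_swap disjoint_left inj_on_of_nodup_map
  mem_add mem_cons nodup_add nodup_cons singleton_add)
open Submodule (mkQ_apply smul_mem)
open Submodule.Quotient (mk_eq_zero mk_smul mk_surjective)

variable {K : Type u} [Field K] {V : SMod.{u, v} K} {P : DerOperad.{u, v} K} {k m n r : ℕ} {p q : ℤ}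
  {l : Fin n → ℕ} {L : List (Vtx V)}

/-! ### Trees, including the trivial one -/

/-- The edges that start at the vertices of a list. -/
def outs (L : List (Vtx V)) : Multiset ℕ := (L.map Vtx.out : List ℕ)

/-- The edges that end at the vertices of a list. -/
def ins (L : List (Vtx V)) : Multiset ℕ := (L.map fun s => univ.val.map s.inp).sum

/-- The edges that start at the leaves. -/
def lvs (l : Fin n → ℕ) : Multiset ℕ := univ.val.map l

@[simp] lemma outs_nil : outs ([] : List (Vtx V)) = 0 := rfl
@[simp] lemma outs_cons (s : Vtx V) (L : List (Vtx V)) : outs (s :: L) = s.out ::ₘ outs L := rfl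
@[simp] lemma outs_append (A B : List (Vtx V)) : outs (A ++ B) = outs A + outs B := by
  simp [outs]
@[simp] lemma ins_nil : ins ([] : List (Vtx V)) = 0 := rfl
@[simp] lemma ins_cons (s : Vtx V) (L : List (Vtx V)) : ins (s :: L) = lvs s.inp + ins L := by
  simp [ins, lvs]
@[simp] lemma ins_append (A B : List (Vtx V)) : ins (A ++ B) = ins A + ins B := by simp [ins]

lemma mem_outs {x : ℕ} : x ∈ outs L ↔ ∃ s ∈ L, s.out = x := by
  simp [outs]

lemma mem_lvs {x : ℕ} : x ∈ lvs l ↔ ∃ a, l a = x := by simp [lvs]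

lemma mem_ins {x : ℕ} : x ∈ ins L ↔ ∃ s ∈ L, ∃ a, s.inp a = x := by
  induction L with
  | nil => simp
  | cons s L ih => simp [ih, mem_lvs]

lemma outs_perm {L' : List (Vtx V)} (h : L.Perm L') : outs L = outs L' :=
  Multiset.coe_eq_coe.2 (h.map _)

lemma ins_perm {L' : List (Vtx V)} (h : L.Perm L') : ins L = ins L' :=
  (h.map _).sum_eq

lemma deg_perm {L' : List (Vtx V)} (h : L.Perm L') : deg L = deg L' :=
  (h.map _).sum_eq

@[simp] lemma lvs_comp_perm {n m : ℕ} (σ : Fin m ≃ Fin n) (l : Fin n → ℕ) : lvs (l ∘ σ) = lvs l :=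
    by
  have : univ.val.map (⇑σ) = (univ : Finset (Fin n)).val := by
    simp
  rw [lvs, lvs, ← Multiset.map_map, this]

/-- The vertices `L` form a tree with root edge `r` and leaves `l`; the trivial tree, without
vertices and with a single leaf `r`, is allowed. -/
def IsPTree (L : List (Vtx V)) (r : ℕ) (l : Fin n → ℕ) : Prop :=
  outs L + lvs l = r ::ₘ ins L ∧ (r ::ₘ ins L).Nodup ∧
    ∃ height : ℕ → ℕ, ∀ s ∈ L, ∀ a, height s.out < height (s.inp a)

lemma isTree_iff : IsTree L r l ↔ L ≠ [] ∧ IsPTree L r l := by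
  have e1 : ((L.map Vtx.ends : Multiset (ℕ × Multiset ℕ)).map Prod.fst) = outs L := by
    simp [outs, Vtx.ends, comp_def]
  have e2 : ((L.map Vtx.ends : Multiset (ℕ × Multiset ℕ)).map Prod.snd).sum = ins L := by
    simp [ins, Vtx.ends, comp_def]
  rw [IsTree, IsTreeShape, e1, e2]
  refine and_congr (by simp) (and_congr Iff.rfl (and_congr Iff.rfl (exists_congr fun h => ?_)))
  simp [Vtx.ends]

lemma IsTree.ptree (h : IsTree L r l) : IsPTree L r l := (isTree_iff.1 h).2

lemma IsTree.ne_nil (h : IsTree L r l) : L ≠ [] := (isTree_iff.1 h).1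

lemma IsPTree.perm {L' : List (Vtx V)} (h : L.Perm L') : IsPTree L r l ↔ IsPTree L' r l := by
  simp only [IsPTree, outs_perm h, ins_perm h, h.mem_iff]

lemma isPTree_replace (A B : List (Vtx V)) {s t : Vtx V} (h : s.out = t.out) (h' : lvs s.inp = lvs
    t.inp) (r : ℕ) (l : Fin n → ℕ) : IsPTree (A ++ s :: B) r l ↔ IsPTree (A ++ t :: B) r l := by
  have e : ∀ height : ℕ → ℕ, (∀ a, height s.out < height (s.inp a)) ↔
      ∀ a, height t.out < height (t.inp a) := fun height => by
    have e' : ∀ u : Vtx V, (∀ a, height u.out < height (u.inp a)) ↔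
        ∀ x ∈ lvs u.inp, height u.out < height x := fun u => by simp [mem_lvs]
    rw [e', e', h, h']
  rw [h] at e
  simp only [IsPTree, outs_append, ins_append, outs_cons, ins_cons, h, h', mem_append,
    List.mem_cons, or_imp, forall_and, forall_eq, e]

lemma isPTree_relabel (σ : Fin m ≃ Fin n) (L : List (Vtx V)) (r : ℕ) (l : Fin n → ℕ) : IsPTree L r
    (l ∘ σ) ↔ IsPTree L r l := by
  rw [IsPTree, IsPTree, lvs_comp_perm]

/-- Rename the edges at a vertex along a function. -/
def Vtx.ren (f : ℕ → ℕ) (s : Vtx V) : Vtx V := ⟨f s.out, s.ar, s.deg, s.lab, f ∘ s.inp⟩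

lemma Vtx.rename_eq_ren (π : Perm ℕ) : (Vtx.rename π : Vtx V → Vtx V) = Vtx.ren π := rfl

@[simp] lemma outs_ren (f : ℕ → ℕ) (L : List (Vtx V)) : outs (L.map (Vtx.ren f)) = (outs L).map f :=
    by
  simp [outs, comp_def, Vtx.ren]

@[simp] lemma lvs_comp {n : ℕ} (f : ℕ → ℕ) (l : Fin n → ℕ) : lvs (f ∘ l) = (lvs l).map f :=
  (Multiset.map_map _ _ _).symm

@[simp] lemma ins_ren (f : ℕ → ℕ) (L : List (Vtx V)) : ins (L.map (Vtx.ren f)) = (ins L).map f := by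
  induction L with
  | nil => rfl
  | cons s L ih => simp [ih, Vtx.ren]

@[simp] lemma deg_ren (f : ℕ → ℕ) (L : List (Vtx V)) : deg (L.map (Vtx.ren f)) = deg L := by
  simp [deg, Vtx.ren, comp_def]

lemma isPTree_ren (π : Perm ℕ) (h : IsPTree L r l) : IsPTree (L.map (Vtx.ren π)) (π r) (π ∘ l) := by
  obtain ⟨h1, h2, height, h3⟩ := h
  refine ⟨?_, ?_, fun e => height (π.symm e), ?_⟩
  · rw [outs_ren, ins_ren, lvs_comp, ← Multiset.map_add, h1, Multiset.map_cons]
  · rw [ins_ren, ← Multiset.map_cons]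
    exact h2.map π.injective
  · simp only [List.mem_map]
    rintro _ ⟨s, hs, rfl⟩ a
    change height (π.symm (π s.out)) < height (π.symm (π (s.inp a)))
    simpa using h3 s hs a

lemma isPTree_ren_iff (π : Perm ℕ) : IsPTree (L.map (Vtx.ren π)) (π r) (π ∘ l) ↔ IsPTree L r l := by
  refine ⟨fun h => ?_, isPTree_ren π⟩
  have := isPTree_ren π.symm h
  simpa [Vtx.ren, comp_def] using this

/-- The relations of the module of trees: those of the reduced tree module, for trees that may be
trivial. -/
inductive PTreeRel (n : ℕ) (p : ℤ) : (Monomial V n →₀ K) → Prop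
  | zero (L : List (Vtx V)) (r : ℕ) (l : Fin n → ℕ) (h : ¬ (IsPTree L r l ∧ deg L = p)) :
      PTreeRel n p (monomial L r l)
  | linear (A B : List (Vtx V)) (r : ℕ) (l : Fin n → ℕ) (o k : ℕ) (q : ℤ) (c c' : K)
      (x x' : V.obj k q) (ι : Fin k → ℕ) :
      PTreeRel n p (monomial (A ++ ⟨o, k, q, c • x + c' • x', ι⟩ :: B) r l
        - (c • monomial (A ++ ⟨o, k, q, x, ι⟩ :: B) r l
          + c' • monomial (A ++ ⟨o, k, q, x', ι⟩ :: B) r l))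
  | swap (A B : List (Vtx V)) (s t : Vtx V) (r : ℕ) (l : Fin n → ℕ) :
      PTreeRel n p (monomial (A ++ s :: t :: B) r l
        - sgn K (s.deg * t.deg) • monomial (A ++ t :: s :: B) r l)
  | equivariant (A B : List (Vtx V)) (r : ℕ) (l : Fin n → ℕ) (o k : ℕ) (q : ℤ)
      (σ : Perm (Fin k)) (x : V.obj k q) (ι : Fin k → ℕ) :
      PTreeRel n p (monomial (A ++ ⟨o, k, q, V.act σ x, ι⟩ :: B) r l
        - monomial (A ++ ⟨o, k, q, x, ι ∘ σ⟩ :: B) r l)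
  | rename (π : Perm ℕ) (L : List (Vtx V)) (r : ℕ) (l : Fin n → ℕ) :
      PTreeRel n p (monomial (L.map (Vtx.ren π)) (π r) (π ∘ l) - monomial L r l)

variable (V) in
/-- The component of arity `n` and degree `p` of the tree module: the coinvariant tensor products of
the labels over all trees. -/
abbrev PTree (n : ℕ) (p : ℤ) : Type (max u v) :=
  (Monomial V n →₀ K) ⧸ Submodule.span K {z : Monomial V n →₀ K | PTreeRel n p z}

/-- The element of the tree module given by a list of vertices; it is `0` unless they form a tree of
degree `p`. -/
def ptree (L : List (Vtx V)) (r : ℕ) (l : Fin n → ℕ) : PTree V n p :=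
  Submodule.Quotient.mk (monomial L r l)

lemma ptree_eq_zero (h : ¬ (IsPTree L r l ∧ deg L = p)) : (ptree L r l : PTree V n p) = 0 :=
  (mk_eq_zero _).2 (Submodule.subset_span (.zero L r l h))

lemma ptree_linear (A B : List (Vtx V)) (r : ℕ) (l : Fin n → ℕ) (o k : ℕ) (q : ℤ) (c c' : K) (x x' :
    V.obj k q) (ι : Fin k → ℕ) : (ptree (A ++ ⟨o, k, q, c • x + c' • x', ι⟩ :: B) r l : PTree V n p)
    = c • ptree (A ++ ⟨o, k, q, x, ι⟩ :: B) r l + c' • ptree (A ++ ⟨o, k, q, x', ι⟩ :: B) r l :=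
  (Submodule.Quotient.eq _).2 (Submodule.subset_span (.linear A B r l o k q c c' x x' ι))

lemma ptree_swap (A B : List (Vtx V)) (s t : Vtx V) (r : ℕ) (l : Fin n → ℕ) : (ptree (A ++ s :: t ::
    B) r l : PTree V n p) = sgn K (s.deg * t.deg) • ptree (A ++ t :: s :: B) r l :=
  (Submodule.Quotient.eq _).2 (Submodule.subset_span (.swap A B s t r l))

lemma ptree_equivariant (A B : List (Vtx V)) (r : ℕ) (l : Fin n → ℕ) (o k : ℕ) (q : ℤ) (σ : Perm
    (Fin k)) (x : V.obj k q) (ι : Fin k → ℕ) : (ptree (A ++ ⟨o, k, q, V.act σ x, ι⟩ :: B) r l :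
    PTree V n p) = ptree (A ++ ⟨o, k, q, x, ι ∘ σ⟩ :: B) r l :=
  (Submodule.Quotient.eq _).2 (Submodule.subset_span (.equivariant A B r l o k q σ x ι))

lemma ptree_rename (π : Perm ℕ) (L : List (Vtx V)) (r : ℕ) (l : Fin n → ℕ) : (ptree (L.map (Vtx.ren
    π)) (π r) (π ∘ l) : PTree V n p) = ptree L r l :=
  (Submodule.Quotient.eq _).2 (Submodule.subset_span (.rename π L r l))

variable (V) in
/-- A function of lists of vertices, a root and leaves that respects the relations between trees. -/
structure TreeFun (n : ℕ) (M : Type w) [AddCommGroup M] [Module K M] where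
  toFun : List (Vtx V) → ℕ → (Fin n → ℕ) → M
  linear : ∀ (A B : List (Vtx V)) (r : ℕ) (l : Fin n → ℕ) (o k : ℕ) (q : ℤ) (c c' : K)
    (x x' : V.obj k q) (ι : Fin k → ℕ), toFun (A ++ ⟨o, k, q, c • x + c' • x', ι⟩ :: B) r l =
      c • toFun (A ++ ⟨o, k, q, x, ι⟩ :: B) r l + c' • toFun (A ++ ⟨o, k, q, x', ι⟩ :: B) r l
  swap : ∀ (A B : List (Vtx V)) (s t : Vtx V) (r : ℕ) (l : Fin n → ℕ),
    toFun (A ++ s :: t :: B) r l = sgn K (s.deg * t.deg) • toFun (A ++ t :: s :: B) r l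
  equivariant : ∀ (A B : List (Vtx V)) (r : ℕ) (l : Fin n → ℕ) (o k : ℕ) (q : ℤ)
    (σ : Perm (Fin k)) (x : V.obj k q) (ι : Fin k → ℕ),
    toFun (A ++ ⟨o, k, q, V.act σ x, ι⟩ :: B) r l = toFun (A ++ ⟨o, k, q, x, ι ∘ σ⟩ :: B) r l
  rename : ∀ (π : Perm ℕ) (L : List (Vtx V)) (r : ℕ) (l : Fin n → ℕ),
    toFun (L.map (Vtx.ren π)) (π r) (π ∘ l) = toFun L r l

section Lift

variable {M : Type w} [AddCommGroup M] [Module K M]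

open Classical in
/-- The linear map on the tree module with given values on the trees. -/
def TreeFun.lift (p : ℤ) (f : TreeFun V n M) : PTree V n p →ₗ[K] M :=
  Submodule.liftQ _
    (Finsupp.linearCombination K fun m : Monomial V n =>
      if IsPTree m.1 m.2.1 m.2.2 ∧ deg m.1 = p then f.toFun m.1 m.2.1 m.2.2 else 0)
    (by
      rw [Submodule.span_le]
      rintro z hz
      rw [SetLike.mem_coe, mem_ker]
      induction hz with
      | zero L r l h => simp [monomial, h]
      | linear A B r l o k q c c' x x' ι =>
        have e : ∀ y, IsPTree (A ++ ⟨o, k, q, y, ι⟩ :: B) r l ↔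
            IsPTree (A ++ ⟨o, k, q, x, ι⟩ :: B) r l := fun y =>
          isPTree_replace A B (s := ⟨o, k, q, y, ι⟩) (t := ⟨o, k, q, x, ι⟩) rfl rfl r l
        simp only [monomial, map_sub, map_add, map_smul, Finsupp.linearCombination_single, one_smul,
          e (c • x + c' • x'), e x', deg_append, deg_cons, f.linear]
        split_ifs <;> simp
      | swap A B s t r l =>
        simp only [monomial, map_sub, map_smul, Finsupp.linearCombination_single, one_smul,
          IsPTree.perm (List.Perm.append_left A (List.Perm.swap t s B)), deg_append, deg_cons,
          f.swap A B s t, add_left_comm t.deg s.deg]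
        split_ifs <;> simp
      | equivariant A B r l o k q σ x ι =>
        have e : IsPTree (A ++ ⟨o, k, q, V.act σ x, ι⟩ :: B) r l ↔
            IsPTree (A ++ ⟨o, k, q, x, ι ∘ σ⟩ :: B) r l :=
          isPTree_replace A B (s := ⟨o, k, q, V.act σ x, ι⟩) (t := ⟨o, k, q, x, ι ∘ σ⟩) rfl
            (lvs_comp_perm σ ι).symm r l
        simp only [monomial, map_sub, Finsupp.linearCombination_single, one_smul, e, deg_append,
          deg_cons]
        split_ifs with h
        · rw [f.equivariant, sub_self]
        · simp
      | rename π L r l =>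
        simp only [monomial, map_sub, Finsupp.linearCombination_single, one_smul,
          isPTree_ren_iff, deg_ren]
        split_ifs with h
        · rw [f.rename, sub_self]
        · simp)

open Classical in
lemma TreeFun.lift_ptree (f : TreeFun V n M) (L : List (Vtx V)) (r : ℕ) (l : Fin n → ℕ) : f.lift p
    (ptree L r l) = if IsPTree L r l ∧ deg L = p then f.toFun L r l else 0 := by
  simp [TreeFun.lift, ptree, monomial]

lemma TreeFun.lift_eq (f : TreeFun V n M) (h : IsPTree L r l) (hp : deg L = p) : f.lift p (ptree L r
    l) = f.toFun L r l := by
  rw [f.lift_ptree, if_pos ⟨h, hp⟩]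

/-- Linear maps on the tree module agree when they agree on the trees. -/
lemma ptree_ext {f g : PTree V n p →ₗ[K] M} (h : ∀ L r l, IsPTree L r l → deg L = p → f (ptree L r
    l) = g (ptree L r l)) : f = g := by
  refine Submodule.linearMap_qext _ (Finsupp.lhom_ext' fun m => LinearMap.ext_ring ?_)
  change f (ptree m.1 m.2.1 m.2.2) = g (ptree m.1 m.2.1 m.2.2)
  by_cases hm : IsPTree m.1 m.2.1 m.2.2 ∧ deg m.1 = p
  · exact h _ _ _ hm.1 hm.2
  · rw [ptree_eq_zero hm, map_zero, map_zero]

/-- The trees span the tree module. -/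
lemma ptree_induction {C : PTree V n p → Prop} (x : PTree V n p) (tree : ∀ L r l, IsPTree L r l →
    deg L = p → C (ptree L r l)) (zero : C 0) (add : ∀ x y, C x → C y → C (x + y)) (smul : ∀ (c : K)
    x, C x → C (c • x)) : C x := by
  obtain ⟨y, rfl⟩ := mk_surjective _ x
  induction y using Finsupp.induction_linear with
  | zero => exact zero
  | add y z hy hz => exact add _ _ hy hz
  | single m c =>
    have e : (Submodule.Quotient.mk (Finsupp.single m c) : PTree V n p) =
        c • ptree m.1 m.2.1 m.2.2 := by
      rw [ptree, ← mk_smul, monomial, Finsupp.smul_single, smul_eq_mul, mul_one]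
    rw [e]
    refine smul _ _ ?_
    by_cases hm : IsPTree m.1 m.2.1 m.2.2 ∧ deg m.1 = p
    · exact tree _ _ _ hm.1 hm.2
    · rwa [ptree_eq_zero hm]

end Lift

/-- A renaming of finitely many edges extends to a permutation. -/
lemma exists_perm_extending (S : Finset ℕ) (f : ℕ → ℕ) (hf : Set.InjOn f S) : ∃ π : Perm ℕ, ∀ x ∈ S,
    π x = f x := by
  induction S using Finset.induction_on with
  | empty => exact ⟨1, by simp⟩
  | insert a S ha ih =>
    obtain ⟨π, hπ⟩ := ih (hf.mono (by simp))
    refine ⟨Equiv.swap (π a) (f a) * π, ?_⟩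
    intro x hx
    rcases Finset.mem_insert.1 hx with rfl | hx'
    · simp
    · have h1 : π x ≠ π a := fun h => ha (π.injective h ▸ hx')
      have h2 : f x ≠ f a := fun h => ha (hf (by simp [hx']) (by simp) h ▸ hx')
      rw [Perm.mul_apply, hπ x hx']
      rw [hπ x hx'] at h1
      exact Equiv.swap_apply_of_ne_of_ne h1 h2

/-- The edges of a tree, with repetitions. -/
def edges (L : List (Vtx V)) (r : ℕ) (l : Fin n → ℕ) : Multiset ℕ :=
  r ::ₘ (outs L + ins L + lvs l)

lemma map_ren_congr {f g : ℕ → ℕ} (ho : ∀ x ∈ outs L, f x = g x) (hi : ∀ x ∈ ins L, f x = g x) :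
    L.map (Vtx.ren f) = L.map (Vtx.ren g) := by
  refine map_congr_left fun s hs => ?_
  simp only [Vtx.ren, ho s.out (mem_outs.2 ⟨s, hs, rfl⟩)]
  congr 1
  ext a
  exact hi _ (mem_ins.2 ⟨s, hs, a, rfl⟩)

lemma exists_perm_ren {f : ℕ → ℕ} (hf : ∀ x ∈ edges L r l, ∀ y ∈ edges L r l, f x = f y → x = y) : ∃
    π : Perm ℕ, L.map (Vtx.ren f) = L.map (Vtx.ren π) ∧ f r = π r ∧ f ∘ l = π ∘ l ∧ ∀ x ∈ edges L r
    l, π x = f x := by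
  obtain ⟨π, hπ⟩ := exists_perm_extending (edges L r l).toFinset f
    (fun x hx y hy => hf x (by simpa using hx) y (by simpa using hy))
  replace hπ : ∀ x ∈ edges L r l, π x = f x := fun x hx => hπ x (by simpa using hx)
  refine ⟨π, map_ren_congr ?_ ?_, (hπ r ?_).symm, ?_, hπ⟩
  · exact fun x hx => (hπ x (by simp [edges, hx])).symm
  · exact fun x hx => (hπ x (by simp [edges, hx])).symm
  · simp [edges]
  · ext a
    exact (hπ _ (by simp [edges, mem_lvs])).symm

lemma ptree_ren {f : ℕ → ℕ} (hf : ∀ x ∈ edges L r l, ∀ y ∈ edges L r l, f x = f y → x = y) : (ptree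
    (L.map (Vtx.ren f)) (f r) (f ∘ l) : PTree V n p) = ptree L r l := by
  obtain ⟨π, h1, h2, h3, -⟩ := exists_perm_ren hf
  rw [h1, h2, h3, ptree_rename]

lemma IsPTree.leaf_injective (h : IsPTree L r l) : Injective l := by
  obtain ⟨h1, h2, -⟩ := h
  rw [← h1, nodup_add] at h2
  intro a b hab
  exact inj_on_of_nodup_map h2.2.1 a (by simp) b (by simp) hab

/-- Renaming the leaves of trees. -/
def ptreeAct (σ : Perm (Fin n)) : PTree V n p →ₗ[K] PTree V n p :=
  TreeFun.lift p
    { toFun := fun L r l => ptree L r (l ∘ σ.symm)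
      linear := fun _ _ _ _ _ _ _ _ _ _ _ _ => ptree_linear _ _ _ _ _ _ _ _ _ _ _ _
      swap := fun _ _ _ _ _ _ => ptree_swap _ _ _ _ _ _
      equivariant := fun _ _ _ _ _ _ _ _ _ _ => ptree_equivariant _ _ _ _ _ _ _ _ _ _
      rename := fun π L r l => ptree_rename π L r (l ∘ σ.symm) }

lemma ptreeAct_ptree (σ : Perm (Fin n)) (L : List (Vtx V)) (r : ℕ) (l : Fin n → ℕ) : (ptreeAct σ
    (ptree L r l) : PTree V n p) = ptree L r (l ∘ σ.symm) := by
  rw [ptreeAct, TreeFun.lift_ptree]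
  split_ifs with h
  · rfl
  · rw [ptree_eq_zero]
    rwa [isPTree_relabel]

variable (V) in
/-- The tree module as a graded `𝕊`-module. -/
def ptreeModule : SMod.{u, max u v} K where
  obj := PTree V
  act := ptreeAct
  act_one x := by
    refine LinearMap.congr_fun (f := ptreeAct 1) (g := LinearMap.id) ?_ x
    exact ptree_ext fun L r l _ _ => ptreeAct_ptree _ _ _ _
  act_mul σ τ x := by
    refine LinearMap.congr_fun (f := ptreeAct (σ * τ)) (g := ptreeAct σ ∘ₗ ptreeAct τ) ?_ x
    refine ptree_ext fun L r l _ _ => ?_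
    rw [comp_apply, ptreeAct_ptree, ptreeAct_ptree, ptreeAct_ptree]
    rfl

/-! ### Koszul signs -/

section Koszul

variable {M : Type w} [AddCommGroup M] [Module K M]

lemma sgn_congr {a b : ℤ} (h : Even (a - b)) : sgn K a = sgn K b := by
  obtain ⟨c, hc⟩ := h
  obtain rfl : a = b + (c + c) := by omega
  rw [sgn_add, sgn_add, sgn_mul_self, mul_one]

@[simp] lemma sgn_zero : sgn K 0 = 1 := by simp [sgn]

@[simp] lemma sgn_one : sgn K 1 = -1 := by simp [sgn]

lemma sgn_smul_smul (a : ℤ) (x : M) : sgn K a • sgn K a • x = x := by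
  rw [smul_smul, sgn_mul_self, one_smul]

/-- A function of lists of vertices that changes by the Koszul sign when two vertices are
exchanged. -/
def Koszul (G : List (Vtx V) → M) : Prop :=
  ∀ (A B : List (Vtx V)) (s t : Vtx V),
    G (A ++ s :: t :: B) = sgn K (s.deg * t.deg) • G (A ++ t :: s :: B)

lemma Koszul.cons {G : List (Vtx V) → M} (hG : Koszul G) (s : Vtx V) : Koszul fun L => G (s :: L) := fun A B => hG (s :: A) B

lemma Koszul.append_left {G : List (Vtx V) → M} (hG : Koszul G) (L : List (Vtx V)) : Koszul fun L'
    => G (L ++ L') := fun A B s t => by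
  simpa using hG (L ++ A) B s t

lemma Koszul.move {G : List (Vtx V) → M} (hG : Koszul G) (s : Vtx V) (A B : List (Vtx V)) : G (s ::
    A ++ B) = sgn K (s.deg * deg A) • G (A ++ s :: B) := by
  induction A generalizing G with
  | nil => simp [deg]
  | cons a A ih =>
    have h := hG [] (A ++ B) s a
    rw [nil_append, nil_append] at h
    rw [cons_append, cons_append, h]
    have := ih (hG.cons a)
    rw [cons_append] at this
    rw [this, smul_smul, ← sgn_add, deg_cons, mul_add]
    rfl

lemma Koszul.swap_append {G : List (Vtx V) → M} (hG : Koszul G) (A B C : List (Vtx V)) : G (A ++ B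
    ++ C) = sgn K (deg A * deg B) • G (B ++ A ++ C) := by
  induction A generalizing G C with
  | nil => simp [deg]
  | cons a A ih =>
    have h1 := ih (hG.cons a)
    have h2 := hG.move a B (A ++ C)
    simp only [cons_append, append_assoc] at h1 h2 ⊢
    rw [h1 C, h2, smul_smul, ← sgn_add, deg_cons]
    congr 2
    ring

/-- Permuting a list of vertices changes a function with the Koszul rule by a sign that does not
depend on the function. -/
lemma Koszul.exists_perm {L' : List (Vtx V)} (h : L.Perm L') : ∃ ε : ℤ, ∀ {M : Type w} [AddCommGroup
    M] [Module K M] (G : List (Vtx V) → M), Koszul G → G L = sgn K ε • G L' := by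
  induction h with
  | nil => exact ⟨0, fun G _ => by simp⟩
  | cons s _ ih =>
    obtain ⟨ε, h⟩ := ih
    exact ⟨ε, fun G hG => h _ (hG.cons s)⟩
  | swap s t L => exact ⟨_, fun G hG => hG [] L t s⟩
  | trans _ _ ih ih' =>
    obtain ⟨ε, h⟩ := ih
    obtain ⟨ε', h'⟩ := ih'
    exact ⟨ε + ε', fun G hG => by rw [h G hG, h' G hG, smul_smul, sgn_add]⟩

lemma koszul_ptree (r : ℕ) (l : Fin n → ℕ) : Koszul (V := V) fun L => (ptree L r l : PTree V n p) :=
  fun A B s t => ptree_swap A B s t r l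

lemma koszul_tree (r : ℕ) (l : Fin n → ℕ) : Koszul (V := V) fun L => (tree L r l : TreeObj V n p) :=
  fun A B s t => tree_swap A B s t r l

end Koszul

/-! ### Grafting and the operad of trees -/

/-- The labels of the inputs of a partial composite. -/
def wLabel {i : Fin m} (e : Wire i n k) (f : Fin m → ℕ) (g : Fin n → ℕ) : Fin k → ℕ := fun c => Sum.elim (fun a => f a.1) g (e.symm c)

/-- The labelling `e` of the inputs of a partial composite matches the names `f`, `g`, `l` of the
inputs. -/
def Wire.Fits {i : Fin m} (e : Wire i n k) (f : Fin m → ℕ) (g : Fin n → ℕ) (l : Fin k → ℕ) : Prop := (∀ a, l (e (inl a)) = f a.1) ∧ ∀ b, l (e (inr b)) = g b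

lemma Wire.fits_wireLabel {i : Fin m} (e : Wire i n k) (f : Fin m → ℕ) (g : Fin n → ℕ) : e.Fits f g
    (wLabel e f g) := by
  simp [Wire.Fits, wLabel]

lemma Wire.Fits.eq {i : Fin m} {e : Wire i n k} {f : Fin m → ℕ} {g : Fin n → ℕ} {l : Fin k → ℕ} (h :
    e.Fits f g l) : l = wLabel e f g := by
  ext c
  obtain ⟨c, rfl⟩ := e.surjective c
  rcases c with a | b
  · simp [h.1, wLabel]
  · simp [h.2, wLabel]

lemma lvs_eq_sum (l : Fin n → ℕ) : lvs l = ∑ a, {l a} := by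
  rw [lvs, Finset.sum]
  refine (Multiset.sum_map_singleton _).symm.trans ?_
  rw [Multiset.map_map]
  rfl

lemma Wire.Fits.lvs {i : Fin m} {e : Wire i n k} {f : Fin m → ℕ} {g : Fin n → ℕ} {l : Fin k → ℕ} (h
    : e.Fits f g l) : lvs f + lvs g = f i ::ₘ lvs l := by
  rw [lvs_eq_sum, lvs_eq_sum, lvs_eq_sum, Fintype.sum_eq_add_sum_subtype_ne _ i, ← e.sum_comp,
    sum_sum_type, ← singleton_add, add_assoc]
  simp only [h.1, h.2]

/-- The names of the edges of the upper tree in a grafting: the root gets the name `x` of a leaf of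
the lower tree, and the other edges get names that are unused in the lower tree. -/
def upperName (r x : ℕ) (b : ℕ) : ℕ :=
  if b = r then natSumNatEquivNat (inl x) else natSumNatEquivNat (inr b)

/-- The names of the edges of the lower tree in a grafting. -/
def lowerName (a : ℕ) : ℕ := natSumNatEquivNat (inl a)

/-- The tree obtained by grafting a tree onto the leaf `i` of another tree. -/
def graftTree (i : Fin m) (e : Wire i n k) (A : List (Vtx V)) (r : ℕ) (f : Fin m → ℕ) (B : List (Vtx
    V)) (r' : ℕ) (g : Fin n → ℕ) : PTree V k p :=
  ptree (A.map (Vtx.ren lowerName) ++ B.map (Vtx.ren (upperName r' (f i)))) (lowerName r)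
    (wLabel e (lowerName ∘ f) (upperName r' (f i) ∘ g))

/-- The permutation of the names that acts separately on those of the lower and of the upper tree. -/
def sumPerm (π ρ : Perm ℕ) : Perm ℕ :=
  (natSumNatEquivNat.symm.trans (Equiv.sumCongr π ρ)).trans natSumNatEquivNat

lemma sumPerm_lowerName (π ρ : Perm ℕ) (a : ℕ) : sumPerm π ρ (lowerName a) = lowerName (π a) := by
  simp only [sumPerm, lowerName, Equiv.trans_apply, Equiv.symm_apply_apply]; rfl

lemma sumPerm_upperName (π ρ : Perm ℕ) (r x b : ℕ) : sumPerm π ρ (upperName r x b) = upperName (ρ r)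
    (π x) (ρ b) := by
  simp only [sumPerm, upperName, Equiv.trans_apply, ρ.apply_eq_iff_eq]
  split_ifs <;> simp only [Equiv.symm_apply_apply] <;> rfl

lemma comp_wireLabel {i : Fin m} (e : Wire i n k) (f : Fin m → ℕ) (g : Fin n → ℕ) (h : ℕ → ℕ) : h ∘
    wLabel e f g = wLabel e (h ∘ f) (h ∘ g) := by
  ext c
  simp only [Function.comp_apply, wLabel]
  cases e.symm c <;> rfl

lemma graftTree_rename (i : Fin m) (e : Wire i n k) (A : List (Vtx V)) (r : ℕ) (f : Fin m → ℕ) (B :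
    List (Vtx V)) (r' : ℕ) (g : Fin n → ℕ) (π ρ : Perm ℕ) : (graftTree i e (A.map (Vtx.ren π)) (π r)
    (π ∘ f) (B.map (Vtx.ren ρ)) (ρ r') (ρ ∘ g) : PTree V k p) = graftTree i e A r f B r' g := by
  refine Eq.trans ?_ (ptree_rename (sumPerm π ρ) _ _ _)
  have e1 : sumPerm π ρ ∘ lowerName = lowerName ∘ π := funext fun a => sumPerm_lowerName π ρ a
  have e2 : sumPerm π ρ ∘ upperName r' (f i) = upperName (ρ r') (π (f i)) ∘ ρ :=
    funext fun b => sumPerm_upperName π ρ r' (f i) b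
  have e3 : ∀ (g h : ℕ → ℕ) (L : List (Vtx V)),
      (L.map (Vtx.ren g)).map (Vtx.ren h) = L.map (Vtx.ren (h ∘ g)) := fun g h L => by
    rw [List.map_map]
    rfl
  rw [graftTree, sumPerm_lowerName, comp_wireLabel, map_append, e3, e3, e3, e3, e1, e2,
    ← comp_assoc, ← comp_assoc, ← comp_assoc, ← comp_assoc,
    e1, e2]
  rfl

/-- Grafting trees onto a given tree. -/
def graftTreeFun (i : Fin m) (e : Wire i n k) (p : ℤ) (A : List (Vtx V))
    (r : ℕ) (f : Fin m → ℕ) : TreeFun V n (PTree V k p) where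
  toFun := graftTree i e A r f
  linear B C r' g o k q c c' x x' ι := by
    simp only [graftTree, map_append, map_cons, ← append_assoc]
    exact ptree_linear _ _ _ _ _ _ _ _ _ _ _ _
  swap B C s t r' g := by
    simp only [graftTree, map_append, map_cons, ← append_assoc]
    exact ptree_swap _ _ _ _ _ _
  equivariant B C r' g o k q σ x ι := by
    simp only [graftTree, map_append, map_cons, ← append_assoc]
    exact ptree_equivariant _ _ _ _ _ _ _ _ _ _
  rename π L r' g := by
    have := graftTree_rename (p := p) i e A r f L r' g (Equiv.refl ℕ) π
    have e' : A.map (Vtx.ren (Equiv.refl ℕ)) = A := by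
      conv_rhs => rw [← List.map_id A]
      rfl
    rw [e'] at this
    exact this

/-- Grafting of trees: the partial composition of the operad of trees. -/
def graft (i : Fin m) (e : Wire i n k) {r : ℤ} (_ : p + q = r) : PTree V m p →ₗ[K] PTree V n q →ₗ[K]
    PTree V k r :=
  TreeFun.lift p
    { toFun := fun A s f => (graftTreeFun i e r A s f).lift q
      linear := fun A B s f o k q c c' x x' ι => by
        refine ptree_ext fun L r' g hL hq => ?_
        simp only [LinearMap.add_apply, LinearMap.smul_apply, TreeFun.lift_eq _ hL hq,
          graftTreeFun, graftTree, map_append, map_cons, append_assoc,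
          cons_append]
        exact ptree_linear _ _ _ _ _ _ _ _ _ _ _ _
      swap := fun A B s t r' g => by
        refine ptree_ext fun L r' g hL hq => ?_
        simp only [LinearMap.smul_apply, TreeFun.lift_eq _ hL hq,
          graftTreeFun, graftTree, map_append, map_cons, append_assoc,
          cons_append]
        exact ptree_swap _ _ _ _ _ _
      equivariant := fun A B s f o k q σ x ι => by
        refine ptree_ext fun L r' g hL hq => ?_
        simp only [TreeFun.lift_eq _ hL hq,
          graftTreeFun, graftTree, map_append, map_cons, append_assoc,
          cons_append]
        exact ptree_equivariant _ _ _ _ _ _ _ _ _ _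
      rename := fun π A s f => by
        refine ptree_ext fun L r' g hL hq => ?_
        rw [TreeFun.lift_eq _ hL hq, TreeFun.lift_eq _ hL hq]
        have := graftTree_rename (p := r) i e A s f L r' g π (Equiv.refl ℕ)
        have e' : L.map (Vtx.ren (Equiv.refl ℕ)) = L := by
          conv_rhs => rw [← List.map_id L]
          rfl
        rw [e'] at this
        exact this }

/-- The trees `A` and `B` share only the root `b` of `B`. -/
def Apart (A : List (Vtx V)) (r : ℕ) (f : Fin m → ℕ) (B : List (Vtx V)) (b : ℕ) (g : Fin n → ℕ) :
    Prop := ∀ x ∈ edges A r f, x ∈ edges B b g → x = b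

lemma mem_edges (h : IsPTree L r l) {x : ℕ} : x ∈ edges L r l ↔ x = r ∨ x ∈ ins L := by
  have := congrArg (x ∈ ·) h.1
  simp only [mem_add, mem_cons, eq_iff_iff] at this
  simp only [edges, mem_cons, mem_add]
  tauto

section

variable {i : Fin m} {e : Wire i n k} {A B : List (Vtx V)} {b : ℕ} {f : Fin m → ℕ}
  {g : Fin n → ℕ} {l : Fin k → ℕ}

lemma mem_edges_append (hl : e.Fits f g l) {x : ℕ} : x ∈ edges (A ++ B) r l → x ∈ edges A r f ∨ x ∈
    edges B b g := by
  have h : x ∈ lvs l → x ∈ lvs f ∨ x ∈ lvs g := fun hx => by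
    have := congrArg (x ∈ ·) hl.lvs
    simp only [mem_add, mem_cons, eq_iff_iff] at this
    tauto
  simp only [edges, mem_cons, mem_add, outs_append, ins_append]
  tauto

lemma isPTree_append (hA : IsPTree A r f) (hB : IsPTree B b g) (hi : f i = b) (hap : Apart A r f B b
    g) (hl : e.Fits f g l) : IsPTree (A ++ B) r l := by
  have hAe := fun x => mem_edges hA (x := x)
  have hBe := fun x => mem_edges hB (x := x)
  obtain ⟨a1, a2, hgtA, a3⟩ := hA
  obtain ⟨b1, b2, hgtB, b3⟩ := hB
  have hb : b ∉ ins B := (nodup_cons.1 b2).1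
  have hd : ∀ x, x = r ∨ x ∈ ins A → x ∉ ins B := fun x hx hx' => by
    have := hap x ((hAe x).2 hx) ((hBe x).2 (.inr hx'))
    exact hb (this ▸ hx')
  have hleaf : b = r ∨ b ∈ ins A := by
    rw [← hAe, ← hi]
    simp [edges, mem_lvs]
  refine ⟨?_, ?_, fun x => if x ∈ ins B then hgtB x + hgtA b + 1 else hgtA x, ?_⟩
  · have h1 := hl.lvs
    rw [hi] at h1
    have h2 : b ::ₘ (outs (A ++ B) + lvs l) = b ::ₘ (r ::ₘ ins (A ++ B)) := by
      calc b ::ₘ (outs (A ++ B) + lvs l) = outs A + outs B + (lvs f + lvs g) := by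
            rw [h1, outs_append, add_cons]
        _ = (outs A + lvs f) + (outs B + lvs g) := by abel
        _ = _ := by
            rw [a1, b1, ins_append, cons_add, add_cons, cons_swap]
    exact (cons_inj_right b).1 h2
  · rw [ins_append, ← cons_add, nodup_add]
    refine ⟨a2, (nodup_cons.1 b2).2, ?_⟩
    rw [disjoint_left]
    exact fun {x} hx => hd x (by simpa using hx)
  · intro s hs a
    rcases mem_append.1 hs with hs | hs
    · have h1 : s.inp a ∉ ins B := hd _ (.inr (mem_ins.2 ⟨s, hs, a, rfl⟩))
      have h2 : s.out ∉ ins B := by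
        refine hd _ ((hAe _).1 ?_)
        simp only [edges, mem_cons, mem_add]
        exact .inr (.inl (.inl (mem_outs.2 ⟨s, hs, rfl⟩)))
      simp only [if_neg h1, if_neg h2]
      exact a3 s hs a
    · have h1 : s.inp a ∈ ins B := mem_ins.2 ⟨s, hs, a, rfl⟩
      have h2 : s.out = b ∨ s.out ∈ ins B := by
        refine (hBe _).1 ?_
        simp only [edges, mem_cons, mem_add]
        exact .inr (.inl (.inl (mem_outs.2 ⟨s, hs, rfl⟩)))
      have h3 := b3 s hs a
      simp only [if_pos h1]
      rcases h2 with h2 | h2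
      · rw [h2, if_neg hb]
        omega
      · rw [if_pos h2]
        omega

/-- Trees that share only the root of the second one are grafted by joining the lists of their
vertices. -/
lemma graft_ptree (hA : IsPTree A r f) (hB : IsPTree B b g) (hi : f i = b) (hap : Apart A r f B b g)
    (hl : e.Fits f g l) {s : ℤ} (hp : deg A = p) (hq : deg B = q) (h : p + q = s) : graft i e h
    (ptree A r f) (ptree B b g) = (ptree (A ++ B) r l : PTree V k s) := by
  classical
  rw [graft, TreeFun.lift_eq _ hA hp]
  change (graftTreeFun i e s A r f).lift q (ptree B b g) = _
  rw [TreeFun.lift_eq _ hB hq]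
  change ptree (A.map (Vtx.ren lowerName) ++ B.map (Vtx.ren (upperName b (f i)))) (lowerName r)
    (wLabel e (lowerName ∘ f) (upperName b (f i) ∘ g)) = _
  subst hi
  let F : ℕ → ℕ := fun x => if x ∈ edges A r f then lowerName x else upperName (f i) (f i) x
  have hFA : ∀ x ∈ edges A r f, F x = lowerName x := fun x hx => if_pos hx
  have hFB : ∀ x ∈ edges B (f i) g, F x = upperName (f i) (f i) x := fun x hx => by
    by_cases hx' : x ∈ edges A r f
    · rw [hFA x hx', hap x hx' hx]
      simp [lowerName, upperName]
    · exact if_neg hx'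
  have e1 : A.map (Vtx.ren lowerName) = A.map (Vtx.ren F) :=
    map_ren_congr (fun x hx => (hFA x (by simp [edges, hx])).symm)
      (fun x hx => (hFA x (by simp [edges, hx])).symm)
  have e2 : B.map (Vtx.ren (upperName (f i) (f i))) = B.map (Vtx.ren F) :=
    map_ren_congr (fun x hx => (hFB x (by simp [edges, hx])).symm)
      (fun x hx => (hFB x (by simp [edges, hx])).symm)
  have e3 : lowerName ∘ f = F ∘ f := by
    ext a; exact (hFA _ (by simp [edges, mem_lvs])).symm
  have e4 : upperName (f i) (f i) ∘ g = F ∘ g := by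
    ext a; exact (hFB _ (by simp [edges, mem_lvs])).symm
  rw [e1, e2, e3, e4, ← comp_wireLabel, ← hl.eq, ← hFA r (by simp [edges]), ← map_append]
  refine ptree_ren fun x hx y hy hxy => ?_
  have key : ∀ x ∈ edges A r f, ∀ y ∈ edges B (f i) g, F x = F y → x = y := fun x hx y hy h => by
    rw [hFA x hx, hFB y hy, lowerName, upperName] at h
    split_ifs at h with h'
    · rw [h']
      simpa using h
    · simp at h
      omega
  rcases mem_edges_append hl hx with hx | hx <;> rcases mem_edges_append hl hy with hy | hy
  · rw [hFA x hx, hFA y hy] at hxy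
    simpa [lowerName] using hxy
  · exact key x hx y hy hxy
  · exact (key y hy x hx hxy.symm).symm
  · rw [hFB x hx, hFB y hy, upperName, upperName] at hxy
    split_ifs at hxy with h1 h2 h2
    · rw [h1, h2]
    · simp at hxy
      omega
    · simp at hxy
      omega
    · simpa using hxy

end

/-- The edges of a tree can be renamed so that its root gets a given name and the other edges avoid
a given finite set. -/
lemma exists_perm_apart (B : List (Vtx V)) (r : ℕ) (g : Fin n → ℕ) (S : Multiset ℕ) (x : ℕ) : ∃ π :
    Perm ℕ, π r = x ∧ ∀ y ∈ S, y ∈ edges (B.map (Vtx.ren π)) x (π ∘ g) → y = x := by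
  obtain ⟨N, hN⟩ : ∃ N, ∀ y ∈ x ::ₘ S, y < N :=
    ⟨(x ::ₘ S).toFinset.sup id + 1, fun y hy =>
      Nat.lt_succ_of_le (Finset.le_sup (f := id) (Multiset.mem_toFinset.2 hy))⟩
  have hx : x < N := hN x (by simp)
  obtain ⟨π, hπ⟩ := exists_perm_extending (edges B r g).toFinset
    (fun y => if y = r then x else y + N) (by
      intro y _ z _ h
      dsimp only at h
      split_ifs at h <;> omega)
  have hr : π r = x := by rw [hπ r (by simp [edges]), if_pos rfl]
  refine ⟨π, hr, fun y hy hy' => ?_⟩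
  have h1 : edges (B.map (Vtx.ren π)) x (π ∘ g) = (edges B r g).map π := by
    simp [edges, ← hr]
  rw [h1, Multiset.mem_map] at hy'
  obtain ⟨z, hz, rfl⟩ := hy'
  have h2 := hπ z (by simpa using hz)
  split_ifs at h2 with h3
  · exact h2
  · have := hN (π z) (by simp [hy])
    omega

lemma exists_apart {B : List (Vtx V)} {g : Fin n → ℕ} (hB : IsPTree B r g) (S : Multiset ℕ) (x : ℕ)
    : ∃ (B' : List (Vtx V)) (g' : Fin n → ℕ), (ptree B r g : PTree V n p) = ptree B' x g' ∧ IsPTree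
    B' x g' ∧ deg B' = deg B ∧ ∀ y ∈ S, y ∈ edges B' x g' → y = x := by
  obtain ⟨π, rfl, h⟩ := exists_perm_apart B r g S x
  exact ⟨B.map (Vtx.ren π), π ∘ g, (ptree_rename _ _ _ _).symm, isPTree_ren π hB, deg_ren _ _, h⟩

lemma mem_edges_leaf (L : List (Vtx V)) (r : ℕ) (l : Fin n → ℕ) (a : Fin n) : l a ∈ edges L r l :=
    by
  simp [edges, mem_lvs]

lemma graft_equivariance {i : Fin m} (σ : Perm (Fin m)) (τ : Perm (Fin n)) (ρ : Perm (Fin k)) (e :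
    Wire i n k) (e' : Wire (σ i) n k) (he : e.Renames σ τ ρ e') {r : ℤ} (h : p + q = r) (x : PTree V
    m p) (y : PTree V n q) : graft (σ i) e' h (ptreeAct σ x) (ptreeAct τ y) = ptreeAct ρ (graft i e
    h x y) := by
  induction x using ptree_induction with
  | zero => simp
  | add x x' hx hx' => simp [hx, hx']
  | smul c x hx => simp [hx]
  | tree A a f hA hp =>
  induction y using ptree_induction with
  | zero => simp
  | add x x' hx hx' => simp [hx, hx']
  | smul c x hx => simp [hx]
  | tree B b g hB hq =>
  obtain ⟨B', g', hg, hB', hd, hap⟩ := exists_apart (p := q) hB (edges A a f) (f i)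
  have hl := e.fits_wireLabel f g'
  have hA1 := (isPTree_relabel σ.symm _ _ _).2 hA
  have hB1 := (isPTree_relabel τ.symm _ _ _).2 hB'
  rw [hg, ptreeAct_ptree, ptreeAct_ptree, graft_ptree hA hB' rfl hap hl hp (hd.trans hq) h,
    ptreeAct_ptree]
  refine graft_ptree hA1 hB1 (by simp) ?_ ⟨fun a => ?_, fun b => ?_⟩ hp (hd.trans hq) h
  · intro x hx hx'
    refine hap x ?_ ?_
    · simpa [edges] using hx
    · simpa [edges] using hx'
  · have := he.1 ⟨σ.symm a.1, fun h => a.2 (σ.symm_apply_eq.1 h)⟩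
    simp only [apply_symm_apply, Subtype.coe_eta] at this
    rw [this]
    simp [hl.1]
  · have := he.2 (τ.symm b)
    simp only [apply_symm_apply] at this
    rw [this]
    simp [hl.2]

lemma isPTree_nil (x : ℕ) : IsPTree ([] : List (Vtx V)) x (fun _ : Fin 1 => x) := by
  refine ⟨by simp [lvs], by simp, fun _ => 0, by simp⟩

lemma IsPTree.nil_eq {x : ℕ} (h : IsPTree ([] : List (Vtx V)) x l) : n = 1 ∧ ∀ a, l a = x := by
  have h1 := h.1
  simp only [outs_nil, ins_nil, zero_add] at h1
  refine ⟨by simpa [lvs] using congrArg Multiset.card h1, fun a => ?_⟩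
  have : l a ∈ lvs l := mem_lvs.2 ⟨a, rfl⟩
  rw [h1] at this
  simpa using this

lemma ptree_nil_eq (p : ℤ) (x y : ℕ) : (ptree [] x (fun _ : Fin 1 => x) : PTree V 1 p) = ptree [] y
    (fun _ => y) := by
  have := ptree_rename (V := V) (p := p) (Equiv.swap x y) [] x (fun _ : Fin 1 => x)
  rw [← this]
  simp [comp_def]

lemma graft_seq {l s t : ℕ} {i : Fin m} {j : Fin n} (e : Wire i n k) (e₂ : Wire (e (inr j)) l t) (f
    : Wire j l s) (f₂ : Wire i s t) (he : e.Seq e₂ f f₂) {r pq qr pqr : ℤ} (h : p + q = pq) (h₂ : pq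
    + r = pqr) (g : q + r = qr) (g₂ : p + qr = pqr) (x : PTree V m p) (y : PTree V n q) (z : PTree V
    l r) : graft _ e₂ h₂ (graft i e h x y) z = graft i f₂ g₂ x (graft j f g y z) := by
  induction x using ptree_induction with
  | zero => simp
  | add x x' hx hx' => simp [hx, hx']
  | smul c x hx => simp [hx]
  | tree A a lA hA hp =>
  induction y using ptree_induction with
  | zero => simp
  | add x x' hx hx' => simp [hx, hx']
  | smul c x hx => simp [hx]
  | tree B b lB hB hq =>
  induction z using ptree_induction with
  | zero => simp
  | add x x' hx hx' => simp [hx, hx']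
  | smul c x hx => simp [hx]
  | tree C c lC hC hr =>
  obtain ⟨B', lB', hg, hB', hd, hap⟩ := exists_apart (p := q) hB (edges A a lA) (lA i)
  rw [hg]
  clear hg hB
  obtain ⟨C', lC', hg, hC', hd', hap'⟩ := exists_apart (p := r) hC
    (edges A a lA + edges B' (lA i) lB') (lB' j)
  rw [hg]
  clear hg hC
  have hl := e.fits_wireLabel lA lB'
  have hl' := f.fits_wireLabel lB' lC'
  have hl₂ := e₂.fits_wireLabel (wLabel e lA lB') lC'
  have hAB := isPTree_append hA hB' rfl hap hl
  have hapBC : Apart B' (lA i) lB' C' (lB' j) lC' := fun x hx => hap' x (by simp [hx])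
  have hBC := isPTree_append hB' hC' rfl hapBC hl'
  rw [graft_ptree hA hB' rfl hap hl hp (hd.trans hq) h,
    graft_ptree hB' hC' rfl hapBC hl' (hd.trans hq) (hd'.trans hr) g,
    graft_ptree (k := t) hAB hC' (hl.2 j) ?_ hl₂ (by rw [deg_append, hp, hd, hq, h])
      (hd'.trans hr) h₂,
    graft_ptree (k := t) hA hBC rfl ?_ ?_ hp (by rw [deg_append, hd, hd', hq, hr, g]) g₂,
    append_assoc]
  · intro x hx hx'
    rcases mem_edges_append hl' hx' with hx' | hx'
    · exact hap x hx hx'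
    · have := hap' x (by simp [hx]) hx'
      subst this
      exact hap _ hx (mem_edges_leaf _ _ _ _)
  · refine ⟨fun a => ?_, fun d => ?_⟩
    · rw [← he.1, hl₂.1]
      exact hl.1 a
    · obtain ⟨d, rfl⟩ := f.surjective d
      rcases d with d | d
      · rw [← he.2.1, hl₂.1, hl'.1]
        exact hl.2 _
      · rw [← he.2.2, hl₂.2, hl'.2]
  · intro x hx hx'
    refine hap' x ?_ hx'
    simpa using mem_edges_append hl hx

lemma graft_par {l s t : ℕ} {i j : Fin m} (hij : i ≠ j) (e : Wire i n k) (e₂ : Wire (e (inl ⟨j,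
    hij.symm⟩)) l t) (f : Wire j l s) (f₂ : Wire (f (inl ⟨i, hij⟩)) n t) (he : e.Par hij e₂ f f₂) {r
    pq pr pqr : ℤ} (h : p + q = pq) (h₂ : pq + r = pqr) (g : p + r = pr) (g₂ : pr + q = pqr) (x :
    PTree V m p) (y : PTree V n q) (z : PTree V l r) : graft _ e₂ h₂ (graft i e h x y) z = sgn K (q
    * r) • graft _ f₂ g₂ (graft j f g x z) y := by
  induction x using ptree_induction with
  | zero => simp
  | add x x' hx hx' => simp [hx, hx']
  | smul c x hx => simp [hx, smul_comm c]
  | tree A a lA hA hp =>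
  induction y using ptree_induction with
  | zero => simp
  | add x x' hx hx' => simp [hx, hx']
  | smul c x hx => simp [hx, smul_comm c]
  | tree B b lB hB hq =>
  induction z using ptree_induction with
  | zero => simp
  | add x x' hx hx' => simp [hx, hx']
  | smul c x hx => simp [hx, smul_comm c]
  | tree C c lC hC hr =>
  obtain ⟨B', lB', hg, hB', hd, hap⟩ := exists_apart (p := q) hB (edges A a lA) (lA i)
  rw [hg]
  clear hg hB
  obtain ⟨C', lC', hg, hC', hd', hap'⟩ := exists_apart (p := r) hC
    (edges A a lA + edges B' (lA i) lB') (lA j)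
  rw [hg]
  clear hg hC
  have hl := e.fits_wireLabel lA lB'
  have hl' := f.fits_wireLabel lA lC'
  have hl₂ := e₂.fits_wireLabel (wLabel e lA lB') lC'
  have hAB := isPTree_append hA hB' rfl hap hl
  have hapAC : Apart A a lA C' (lA j) lC' := fun x hx => hap' x (by simp [hx])
  have hAC := isPTree_append hA hC' rfl hapAC hl'
  rw [graft_ptree hA hB' rfl hap hl hp (hd.trans hq) h,
    graft_ptree hA hC' rfl hapAC hl' hp (hd'.trans hr) g,
    graft_ptree (k := t) hAB hC' (hl.1 ⟨j, hij.symm⟩) ?_ hl₂ (by rw [deg_append, hp, hd, hq, h])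
      (hd'.trans hr) h₂,
    graft_ptree (k := t) (l := wLabel e₂ (wLabel e lA lB') lC') hAC hB'
      (hl'.1 ⟨i, hij⟩) ?_ ?_ (by rw [deg_append, hp, hd', hr, g]) (hd.trans hq) g₂]
  · have := ((koszul_ptree (p := pqr) a (wLabel e₂ (wLabel e lA lB') lC')).append_left
      A).swap_append B' C' []
    simp only [append_nil, ← append_assoc, hd, hd', hq, hr] at this
    exact this
  · intro x hx hx'
    rcases mem_edges_append hl' hx with hx | hx
    · exact hap x hx hx'
    · have := hap' x (by simp [hx']) hx
      subst this
      exact hap _ (mem_edges_leaf _ _ _ _) hx'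
  · refine ⟨?_, fun d => ?_⟩
    · rintro ⟨d, hdd⟩
      obtain ⟨d, rfl⟩ := f.surjective d
      rcases d with ⟨d, hj⟩ | d
      · have hi : d ≠ i := fun h => hdd (by subst h; rfl)
        have := he.1 d hi hj
        rw [← this, hl₂.1, hl'.1]
        exact hl.1 _
      · have := he.2.2 d
        rw [← this, hl₂.2, hl'.2]
    · rw [← he.2.1, hl₂.1]
      exact hl.2 _
  · intro x hx hx'
    refine hap' x ?_ hx'
    simpa using mem_edges_append hl hx

lemma graft_one_left (e : Wire (0 : Fin 1) n n) (he : ∀ b, e (inr b) = b) (h : 0 + p = p) (y : PTree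
    V n p) : graft 0 e h (ptree [] 0 (fun _ => 0)) y = y := by
  induction y using ptree_induction with
  | zero => simp
  | add x x' hx hx' => simp [hx, hx']
  | smul c x hx => simp [hx]
  | tree B b g hB hq =>
  rw [ptree_nil_eq 0 0 b]
  refine graft_ptree (isPTree_nil b) hB rfl ?_ ⟨?_, ?_⟩ rfl hq h
  · intro x hx _
    simpa [edges, lvs] using hx
  · rintro ⟨a, ha⟩
    exact (ha (Subsingleton.elim _ _)).elim
  · intro b
    rw [he]

lemma graft_one_right (i : Fin m) (e : Wire i 1 m) (he : ∀ a, e (inl a) = a.1) (he' : e (inr 0) = i)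
    (h : p + 0 = p) (x : PTree V m p) : graft i e h x (ptree [] 0 (fun _ => 0)) = x := by
  induction x using ptree_induction with
  | zero => simp
  | add x x' hx hx' => simp [hx, hx']
  | smul c x hx => simp [hx]
  | tree A a f hA hp =>
  rw [ptree_nil_eq 0 0 (f i)]
  refine (graft_ptree (l := f) hA (isPTree_nil (f i)) rfl ?_ ⟨?_, ?_⟩ hp rfl h).trans
    (by rw [append_nil])
  · intro x _ hx
    simpa [edges, lvs] using hx
  · intro a
    rw [he]
  · intro b
    rw [Subsingleton.elim b 0, he']

variable (V) in
/-- The operad of trees: the free operad on `V`, whose partial compositions graft trees. -/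
def planted : GrOperad.{u, max u v} K where
  toSMod := ptreeModule V
  one := ptree [] 0 (fun _ => 0)
  comp i e _ _ _ h := graft i e h
  equivariance σ τ ρ e e' he _ _ _ h x y := graft_equivariance σ τ ρ e e' he h x y
  one_comp e he _ h y := graft_one_left e he h y
  comp_one i e he he' _ h x := graft_one_right i e he he' h x
  seq e e₂ f f₂ he _ _ _ _ _ _ h h₂ g g₂ x y z := graft_seq e e₂ f f₂ he h h₂ g g₂ x y z
  par hij e e₂ f f₂ he _ _ _ _ _ _ h h₂ g g₂ x y z := graft_par hij e e₂ f f₂ he h h₂ g g₂ x y z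

/-! ### Signed sums over vertices -/

section PickSum

variable {M : Type w} [AddCommGroup M] [Module K M]

lemma pick_congr {F G : Vtx V → List (Vtx V) → M} (h : ∀ s L', (s :: L').Perm L → F s L' = G s L') :
    pickSum F L = pickSum G L := by
  induction L generalizing F G with
  | nil => rfl
  | cons a L ih =>
    rw [pickSum, pickSum, h a L (.refl _)]
    congr 1
    exact ih fun s L' hs => by rw [h s (a :: L') ((List.Perm.swap a s L').trans (hs.cons a))]

lemma pick_eq_zero {F : Vtx V → List (Vtx V) → M} (h : ∀ s L', (s :: L').Perm L → F s L' = 0) :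
    pickSum F L = 0 := by
  rw [pick_congr h]
  simpa using pickSum_smul (0 : K) (fun _ _ => (0 : M)) L

lemma pickSum_neg (F : Vtx V → List (Vtx V) → M) (L : List (Vtx V)) : pickSum (fun s L' => - F s L')
    L = - pickSum F L :=
  (pickSum_map (-LinearMap.id : M →ₗ[K] M) F L).symm

lemma pickSum_sum {ι : Type*} (S : Finset ι) (F : ι → Vtx V → List (Vtx V) → M) (L : List (Vtx V)) :
    pickSum (fun s L' => ∑ i ∈ S, F i s L') L = ∑ i ∈ S, pickSum (F i) L := by
  classical
  induction S using Finset.induction_on with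
  | empty => exact pick_eq_zero fun _ _ _ => Finset.sum_empty
  | insert a S ha ih => simp only [Finset.sum_insert ha, pickSum_add, ih]

lemma pickSum_mapVtx {N : Type*} [AddCommGroup N] [Module K N] {U : SMod.{u, w} K} (f : Vtx V → Vtx
    U) (hf : ∀ s, (f s).deg = s.deg) (F : Vtx U → List (Vtx U) → N) (L : List (Vtx V)) : pickSum F
    (L.map f) = pickSum (fun s L' => F (f s) (L'.map f)) L := by
  induction L generalizing F with
  | nil => rfl
  | cons a L ih => simp only [map_cons, pickSum, ih, hf]

/-- Exchanging two signed sums over vertices. -/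
lemma pickSum_comm (F : Vtx V → Vtx V → List (Vtx V) → M) (L : List (Vtx V)) : pickSum (fun s L' =>
    pickSum (fun t L'' => F s t L'') L') L = pickSum (fun s L' => pickSum (fun t L'' => sgn K (s.deg
    * t.deg) • F t s L'') L') L := by
  induction L generalizing F with
  | nil => rfl
  | cons a L ih =>
    have h := ih fun s t L => sgn K (a.deg * s.deg) • sgn K (a.deg * t.deg) • F s t (a :: L)
    have e : ∀ s : Vtx V, sgn K (a.deg * s.deg) * sgn K (s.deg * a.deg) = 1 := fun s => by
      rw [mul_comm s.deg, sgn_mul_self]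
    simp only [pickSum, smul_add, pickSum_add, smul_smul, e, one_smul, ← pickSum_smul] at h ⊢
    rw [h]
    have e1 : ∀ s t : Vtx V, sgn K (a.deg * s.deg) * (sgn K (a.deg * t.deg) *
        sgn K (s.deg * t.deg)) = sgn K (s.deg * t.deg) * (sgn K (a.deg * t.deg) *
        sgn K (a.deg * s.deg)) := fun s t => by ring
    simp only [e1]
    abel

/-- A double sum of terms that change sign when the two vertices are exchanged is zero. -/
lemma pickSum_pickSum_eq_zero [CharZero K] (F : Vtx V → Vtx V → List (Vtx V) → M) (L : List (Vtx V))
    (h : ∀ s t L', (s :: t :: L').Perm L → F s t L' = - (sgn K (s.deg * t.deg) • F t s L')) :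
    pickSum (fun s L' => pickSum (fun t L'' => F s t L'') L') L = 0 := by
  have h1 := pickSum_comm F L
  have h2 : pickSum (fun s L' => pickSum (fun t L'' => F s t L'') L') L =
      - pickSum (fun s L' => pickSum (fun t L'' => sgn K (s.deg * t.deg) • F t s L'') L') L := by
    rw [← pickSum_neg]
    refine pick_congr fun s L' hs => ?_
    rw [← pickSum_neg]
    exact pick_congr fun t L'' ht => h s t L'' ((ht.cons s).trans hs)
  rw [← h1] at h2
  have h3 : (2 : K) • pickSum (fun s L' => pickSum (fun t L'' => F s t L'') L') L = 0 := by
    rw [two_smul]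
    nth_rw 1 [h2]
    exact neg_add_cancel _
  exact (smul_eq_zero.1 h3).resolve_left two_ne_zero

lemma pickSum_append (F : Vtx V → List (Vtx V) → M) (A B : List (Vtx V)) : pickSum F (A ++ B) =
    pickSum (fun s A' => F s (A' ++ B)) A + pickSum (fun s B' => sgn K (deg A * s.deg) • F s (A ++
    B')) B := by
  induction A generalizing F with
  | nil => simp [pickSum, deg]
  | cons a A ih =>
    simp only [cons_append, pickSum, ih, deg_cons, add_mul, sgn_add, smul_smul, add_assoc,
      mul_comm (sgn K (a.deg * _))]

/-- A vertex that is picked from a list can be put back. -/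
lemma pickSum_cons [DecidableEq M] {G : List (Vtx V) → M} (hG : Koszul G) (P : Vtx V → Prop)
    [DecidablePred P] (L : List (Vtx V)) : pickSum (fun s L' => if P s then G (s :: L') else 0) L =
    (L.countP (fun s => P s) : K) • G L := by
  induction L generalizing G with
  | nil => simp [pickSum]
  | cons a L ih =>
    have h := ih (hG.cons a)
    rw [pickSum, List.countP_cons, Nat.cast_add, add_smul, add_comm, ← h]
    congr 1
    · refine pick_congr fun s L' _ => ?_
      split_ifs
      · have := hG [] L' s a
        simp only [nil_append] at this
        rw [this, mul_comm s.deg, sgn_smul_smul]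
      · simp
    · by_cases ha : P a <;> simp [ha]

end PickSum

/-! ### Multilinear functions of labelled vertices -/

section Multi

variable {M : Type w} [AddCommGroup M] [Module K M]

/-- The vertex `s` stands for the linear combination `c s₁ + c' s₂`, by linearity in the label or by
equivariance. -/
inductive Vtx.Comb : K → K → Vtx V → Vtx V → Vtx V → Prop
  | linear (o k : ℕ) (q : ℤ) (c c' : K) (x x' : V.obj k q) (ι : Fin k → ℕ) :
      Vtx.Comb c c' ⟨o, k, q, c • x + c' • x', ι⟩ ⟨o, k, q, x, ι⟩ ⟨o, k, q, x', ι⟩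
  | act (o k : ℕ) (q : ℤ) (σ : Perm (Fin k)) (x : V.obj k q) (ι : Fin k → ℕ) :
      Vtx.Comb 1 0 ⟨o, k, q, V.act σ x, ι⟩ ⟨o, k, q, x, ι ∘ σ⟩ ⟨o, k, q, x, ι ∘ σ⟩

section

variable {c c' : K} {s s₁ s₂ : Vtx V}

lemma Vtx.Comb.deg_left (h : Vtx.Comb c c' s s₁ s₂) : s₁.deg = s.deg := by cases h <;> rfl
lemma Vtx.Comb.deg_right (h : Vtx.Comb c c' s s₁ s₂) : s₂.deg = s.deg := by cases h <;> rfl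
lemma Vtx.Comb.out_left (h : Vtx.Comb c c' s s₁ s₂) : s₁.out = s.out := by cases h <;> rfl
lemma Vtx.Comb.out_right (h : Vtx.Comb c c' s s₁ s₂) : s₂.out = s.out := by cases h <;> rfl

end

/-- A function of lists of vertices that is multilinear and equivariant in the labels and obeys the
Koszul rule. -/
structure Multi (G : List (Vtx V) → M) : Prop where
  koszul : Koszul G
  comb : ∀ (A B : List (Vtx V)) {c c' : K} {s s₁ s₂ : Vtx V}, Vtx.Comb c c' s s₁ s₂ →
    G (A ++ s :: B) = c • G (A ++ s₁ :: B) + c' • G (A ++ s₂ :: B)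

lemma multi_ptree (p : ℤ) (r : ℕ) (l : Fin n → ℕ) :
    Multi (V := V) fun L => (ptree L r l : PTree V n p) where
  koszul := koszul_ptree r l
  comb A B c c' s s₁ s₂ h := by
    cases h with
    | linear o k q c c' x x' ι => exact ptree_linear A B r l o k q c c' x x' ι
    | act o k q σ x ι =>
      rw [one_smul, zero_smul, add_zero]
      exact ptree_equivariant A B r l o k q σ x ι

lemma multi_tree (p : ℤ) (r : ℕ) (l : Fin n → ℕ) :
    Multi (V := V) fun L => (tree L r l : TreeObj V n p) where
  koszul := koszul_tree r l
  comb A B c c' s s₁ s₂ h := by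
    cases h with
    | linear o k q c c' x x' ι => exact tree_linear A B r l o k q c c' x x' ι
    | act o k q σ x ι =>
      rw [one_smul, zero_smul, add_zero]
      exact tree_equivariant A B r l o k q σ x ι

lemma Multi.cons {G : List (Vtx V) → M} (hG : Multi G) (s : Vtx V) : Multi fun L => G (s :: L) :=
  ⟨hG.koszul.cons s, fun A B _ _ _ _ _ h => hG.comb (s :: A) B h⟩

lemma Multi.comb_head {G : List (Vtx V) → M} (hG : Multi G) (L : List (Vtx V)) {c c' : K} {s s₁ s₂ :
    Vtx V} (h : Vtx.Comb c c' s s₁ s₂) : G (s :: L) = c • G (s₁ :: L) + c' • G (s₂ :: L) := hG.comb [] L h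

/-- The dependence of a multilinear function on the label of the first vertex. -/
def Multi.head {G : List (Vtx V) → M} (hG : Multi G) (o k : ℕ) (q : ℤ) (ι : Fin k → ℕ)
    (L : List (Vtx V)) : V.obj k q →ₗ[K] M where
  toFun x := G (⟨o, k, q, x, ι⟩ :: L)
  map_add' x y := by
    have := hG.comb_head L (.linear o k q 1 1 x y ι)
    simpa only [one_smul] using this
  map_smul' a x := by
    have := hG.comb_head L (.linear o k q a 0 x 0 ι)
    simpa only [zero_smul, add_zero, RingHom.id_apply] using this

lemma Multi.smul {G : List (Vtx V) → M} (hG : Multi G) (a : K) : Multi fun L => a • G L :=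
  ⟨fun A B s t => by rw [hG.koszul, smul_comm], fun A B _ _ _ _ _ h => by
    rw [hG.comb A B h, smul_add, smul_comm a, smul_comm a]⟩

lemma multi_zero : Multi (V := V) fun _ => (0 : M) :=
  ⟨fun _ _ _ _ => by simp, fun _ _ _ _ _ _ _ _ => by simp⟩

lemma Multi.map {N : Type*} [AddCommGroup N] [Module K N] {G : List (Vtx V) → M} (hG : Multi G) (f :
    M →ₗ[K] N) : Multi fun L => f (G L) :=
  ⟨fun A B s t => by rw [hG.koszul, map_smul], fun A B _ _ _ _ _ h => by
    rw [hG.comb A B h, map_add, map_smul, map_smul]⟩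

lemma Multi.sum {ι : Type*} (S : Finset ι) {G : ι → List (Vtx V) → M} (hG : ∀ i, Multi (G i)) :
    Multi fun L => ∑ i ∈ S, G i L :=
  ⟨fun A B s t => by simp only [(hG _).koszul A B s t, smul_sum],
    fun A B _ _ _ _ _ h => by
      simp only [(hG _).comb A B h, smul_sum, sum_add_distrib]⟩

lemma Multi.ite {P : Prop} [Decidable P] {G H : List (Vtx V) → M} (hG : Multi G) (hH : Multi H) :
    Multi fun L => if P then G L else H L := by
  split_ifs
  · exact hG
  · exact hH

lemma multi_pickSum {F : Vtx V → List (Vtx V) → M} (hF : ∀ s, Multi (F s))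
    (hF' : ∀ (L : List (Vtx V)) {c c' : K} {s s₁ s₂ : Vtx V}, Vtx.Comb c c' s s₁ s₂ →
      F s L = c • F s₁ L + c' • F s₂ L) : Multi (pickSum F) where
  koszul A B s t := pickSum_swap F s t (fun v A B => (hF v).koszul A B s t) A B
  comb A B c c' s s₁ s₂ h := pickSum_replace F c c' s s₁ s₂ h.deg_left h.deg_right
    (fun v A B => (hF v).comb A B h) (fun L => hF' L h) A B

lemma multi_splitSum {F : List (Vtx V) → List (Vtx V) → M} (hF : ∀ B, Multi fun A => F A B)
    (hF' : ∀ A, Multi (F A)) : Multi (splitSum F) where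
  koszul A B s t := splitSum_swap F s t (fun A B C => (hF C).koszul A B s t)
    (fun A B C => (hF' C).koszul A B s t) A B
  comb A B c c' s s₁ s₂ h := splitSum_replace F c c' s s₁ s₂ h.deg_left h.deg_right
    (fun A B C => (hF C).comb A B h) (fun A B C => (hF' C).comb A B h) A B

/-- Functions of trees from multilinear functions of lists of vertices. -/
def Multi.treeFun (f : List (Vtx V) → ℕ → (Fin n → ℕ) → M)
    (hf : ∀ r l, Multi fun L => f L r l)
    (rename : ∀ (π : Perm ℕ) (L : List (Vtx V)) (r : ℕ) (l : Fin n → ℕ),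
      f (L.map (Vtx.ren π)) (π r) (π ∘ l) = f L r l) : TreeFun V n M where
  toFun := f
  linear A B r l o k q c c' x x' ι := (hf r l).comb A B (.linear o k q c c' x x' ι)
  swap A B s t r l := (hf r l).koszul A B s t
  equivariant A B r l o k q σ x ι := by
    have := (hf r l).comb A B (.act o k q σ x ι)
    rwa [one_smul, zero_smul, add_zero] at this
  rename := rename

end Multi

/-! ### Local operators on trees -/

section Local

variable {U : SMod.{u, w} K}

variable (V U) in
/-- An equivariant linear map of degree `-c` between graded `𝕊`-modules. -/
structure LabMap (c : ℤ) where
  app : ∀ {n : ℕ} {p q : ℤ} (_ : q + c = p), V.obj n p →ₗ[K] U.obj n q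
  app_act : ∀ {n : ℕ} {p q : ℤ} (h : q + c = p) (σ : Perm (Fin n)) (x : V.obj n p),
    app h (V.act σ x) = U.act σ (app h x)

/-- Apply an operator to the label of a vertex. -/
def Vtx.op {c : ℤ} (g : LabMap V U c) (s : Vtx V) : Vtx U :=
  ⟨s.out, s.ar, s.deg - c, g.app (sub_add_cancel _ _) s.lab, s.inp⟩

lemma Vtx.Comb.op {a : ℤ} (g : LabMap V U a) {c c' : K} {s s₁ s₂ : Vtx V} (h : Vtx.Comb c c' s s₁
    s₂) : Vtx.Comb c c' (s.op g) (s₁.op g) (s₂.op g) := by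
  cases h with
  | linear o k q c c' x x' ι =>
    simp only [Vtx.op, map_add, map_smul]
    exact .linear _ _ _ _ _ _ _ _
  | act o k q σ x ι =>
    simp only [Vtx.op, g.app_act]
    exact .act _ _ _ _ _ _

/-- The operator `g₁` at the root edge `r` and the operator `g₀` elsewhere. -/
def Vtx.opAt {c : ℤ} (g₁ g₀ : LabMap V U c) (r : ℕ) (s : Vtx V) : Vtx U :=
  if s.out = r then s.op g₁ else s.op g₀

@[simp] lemma Vtx.opAt_out {c : ℤ} (g₁ g₀ : LabMap V U c) (r : ℕ) (s : Vtx V) : (s.opAt g₁ g₀ r).out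
    = s.out := by
  unfold Vtx.opAt; split_ifs <;> rfl

@[simp] lemma Vtx.opAt_deg {c : ℤ} (g₁ g₀ : LabMap V U c) (r : ℕ) (s : Vtx V) : (s.opAt g₁ g₀ r).deg
    = s.deg - c := by
  unfold Vtx.opAt; split_ifs <;> rfl

lemma Vtx.opAt_ends {c : ℤ} (g₁ g₀ : LabMap V U c) (r : ℕ) (s : Vtx V) : (s.opAt g₁ g₀ r).ends =
    s.ends := by
  unfold Vtx.opAt; split_ifs <;> rfl

lemma Vtx.Comb.opAt {a : ℤ} (g₁ g₀ : LabMap V U a) (r : ℕ) {c c' : K} {s s₁ s₂ : Vtx V} (h :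
    Vtx.Comb c c' s s₁ s₂) : Vtx.Comb c c' (s.opAt g₁ g₀ r) (s₁.opAt g₁ g₀ r) (s₂.opAt g₁ g₀ r) :=
    by
  simp only [Vtx.opAt, h.out_left, h.out_right]
  split_ifs <;> exact h.op _

lemma Vtx.opAt_ren {a : ℤ} (g₁ g₀ : LabMap V U a) (π : Perm ℕ) (r : ℕ) (s : Vtx V) : (s.ren π).opAt
    g₁ g₀ (π r) = (s.opAt g₁ g₀ r).ren π := by
  by_cases h : s.out = r
  · rw [Vtx.opAt, Vtx.opAt, if_pos h]
    exact if_pos (congrArg π h)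
  · rw [Vtx.opAt, Vtx.opAt, if_neg h]
    exact if_neg fun h' => h (π.injective h')

lemma Vtx.op_eq {c : ℤ} (g : LabMap V U c) (s : Vtx V) (h : q + c = s.deg) : s.op g = ⟨s.out, s.ar,
    q, g.app h s.lab, s.inp⟩ := by
  obtain rfl : q = s.deg - c := by omega
  rfl

lemma pickSum_rotate {M : Type*} [AddCommGroup M] [Module K M] (F : Vtx V → Vtx V → Vtx V → List
    (Vtx V) → M) (L : List (Vtx V)) : pickSum (fun u L₁ => pickSum (fun s L₂ => pickSum (fun t L₃ =>
    F u s t L₃) L₂) L₁) L = pickSum (fun s L₁ => pickSum (fun t L₂ => pickSum (fun u L₃ => sgn K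
    (s.deg * u.deg + t.deg * u.deg) • F u s t L₃) L₂) L₁) L := by
  rw [pickSum_comm (fun u s L₂ => pickSum (fun t L₃ => F u s t L₃) L₂)]
  refine pick_congr fun s L' _ => ?_
  simp only [← pickSum_smul]
  rw [pickSum_comm]
  simp only [smul_smul, sgn_add, mul_comm]

end Local

section Con

variable {U : SMod.{u, w} K}

/-- The operator on trees that applies `g₁` to the root vertex and `g₀` to the other vertices. -/
def loc {c : ℤ} (g₁ g₀ : LabMap V V c) : PTree V n p →ₗ[K] PTree V n q :=
  TreeFun.lift p <| Multi.treeFun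
    (fun L r l => pickSum (fun s L' => ptree (s.opAt g₁ g₀ r :: L') r l) L)
    (fun r l => multi_pickSum (fun s => (multi_ptree q r l).cons _)
      fun L _ _ _ _ _ h => (multi_ptree q r l).comb_head L (h.opAt g₁ g₀ r))
    (fun π L r l => by
      refine (pickSum_rename π _ L).trans (pick_congr fun s L' _ => ?_)
      rw [Vtx.rename_eq_ren, Vtx.opAt_ren]
      exact ptree_rename π (s.opAt g₁ g₀ r :: L') r l)

section

variable {r : ℤ} {ρ : ℕ}

lemma loc_ptree {c : ℤ} (g₁ g₀ : LabMap V V c) (h : IsPTree L ρ l) (hp : deg L = p) : (loc g₁ g₀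
    (ptree L ρ l : PTree V n p) : PTree V n q) = pickSum (fun s L' => ptree (s.opAt g₁ g₀ ρ :: L') ρ
    l) L :=
  TreeFun.lift_eq _ h hp

lemma isPTree_opAt {c : ℤ} (g₁ g₀ : LabMap V V c) (s : Vtx V) (L : List (Vtx V)) (r : ℕ) : IsPTree
    (s.opAt g₁ g₀ r :: L) ρ l ↔ IsPTree (s :: L) ρ l := by
  refine isPTree_replace [] L (Vtx.opAt_out _ _ _ _) ?_ ρ l
  exact congrArg Prod.snd (Vtx.opAt_ends g₁ g₀ r s)

/-- The graded commutator of two local operators is the local operator given by the graded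
commutators of the operators on the labels. -/
lemma loc_comm {c c' c'' : ℤ} {g₁ g₀ : LabMap V V c} {g₁' g₀' : LabMap V V c'} {k₁ k₀ : LabMap V V
    c''} (h₁ : ∀ {n : ℕ} {p q q' r : ℤ} (h : q + c = p) (h' : r + c' = q) (g : q' + c' = p) (g' : r
    + c = q') (h'' : r + c'' = p) (x : V.obj n p), g₁'.app h' (g₁.app h x) = sgn K (c * c') • g₁.app
    g' (g₁'.app g x) + k₁.app h'' x) (h₀ : ∀ {n : ℕ} {p q q' r : ℤ} (h : q + c = p) (h' : r + c' =
    q) (g : q' + c' = p) (g' : r + c = q') (h'' : r + c'' = p) (x : V.obj n p), g₀'.app h' (g₀.app h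
    x) = sgn K (c * c') • g₀.app g' (g₀'.app g x) + k₀.app h'' x) (hc : c'' = c + c') {q' : ℤ} (hq :
    q + c = p) (hq' : q' + c' = p) (x : PTree V n p) : (loc g₁' g₀' (loc g₁ g₀ x : PTree V n q) :
    PTree V n r) = sgn K (c * c') • loc g₁ g₀ (loc g₁' g₀' x : PTree V n q') + loc k₁ k₀ x := by
  induction x using ptree_induction with
  | zero => simp
  | add x x' hx hx' => simp only [map_add, hx, hx', smul_add]; abel
  | smul a x hx => simp only [map_smul, hx, smul_add, smul_comm a]
  | tree L ρ l hL hp =>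
  have key : ∀ {c c' : ℤ} (g₁ g₀ : LabMap V V c) (g₁' g₀' : LabMap V V c') {q : ℤ},
      q + c = p → (loc g₁' g₀' (loc g₁ g₀ (ptree L ρ l : PTree V n p) : PTree V n q) :
        PTree V n r) =
      pickSum (fun s L' => ptree ((s.opAt g₁ g₀ ρ).opAt g₁' g₀' ρ :: L') ρ l) L +
      pickSum (fun s L' => pickSum (fun t L'' => sgn K ((s.deg - c) * t.deg) •
        ptree (t.opAt g₁' g₀' ρ :: s.opAt g₁ g₀ ρ :: L'') ρ l) L') L := by
    intro c c' g₁ g₀ g₁' g₀' q hq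
    rw [loc_ptree _ _ hL hp, pickSum_map, ← pickSum_add]
    refine pick_congr fun s L' hs => ?_
    rw [loc_ptree _ _ ((isPTree_opAt _ _ _ _ _).2 ((IsPTree.perm hs).2 hL))
      (by have := deg_perm hs; rw [deg_cons] at this ⊢; rw [Vtx.opAt_deg]; omega)]
    simp only [pickSum, Vtx.opAt_deg]
  rw [key g₁ g₀ g₁' g₀' hq, key g₁' g₀' g₁ g₀ hq', loc_ptree _ _ hL hp, smul_add, add_right_comm]
  refine congrArg₂ (· + ·) ?_ ?_
  · rw [← pickSum_smul, ← pickSum_add]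
    refine pick_congr fun s L' _ => ?_
    have hs : (s.opAt g₁ g₀ ρ).opAt g₁' g₀' ρ = ⟨s.out, s.ar, s.deg - c'',
        (if s.out = ρ then g₁'.app (q := s.deg - c'') (by omega)
            (g₁.app (q := s.deg - c) (by omega) s.lab)
          else g₀'.app (q := s.deg - c'') (by omega)
            (g₀.app (q := s.deg - c) (by omega) s.lab)), s.inp⟩ := by
      rw [Vtx.opAt, Vtx.opAt_out, Vtx.opAt]
      split_ifs
      · exact Vtx.op_eq _ _ (by change _ = s.deg - c; omega)
      · exact Vtx.op_eq _ _ (by change _ = s.deg - c; omega)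
    have hs' : (s.opAt g₁' g₀' ρ).opAt g₁ g₀ ρ = ⟨s.out, s.ar, s.deg - c'',
        (if s.out = ρ then g₁.app (q := s.deg - c'') (by omega)
            (g₁'.app (q := s.deg - c') (by omega) s.lab)
          else g₀.app (q := s.deg - c'') (by omega)
            (g₀'.app (q := s.deg - c') (by omega) s.lab)), s.inp⟩ := by
      rw [Vtx.opAt, Vtx.opAt_out, Vtx.opAt]
      split_ifs
      · exact Vtx.op_eq _ _ (by change _ = s.deg - c'; omega)
      · exact Vtx.op_eq _ _ (by change _ = s.deg - c'; omega)
    have hk : s.opAt k₁ k₀ ρ = ⟨s.out, s.ar, s.deg - c'',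
        (if s.out = ρ then k₁.app (by omega) s.lab else k₀.app (by omega) s.lab), s.inp⟩ := by
      rw [Vtx.opAt]
      split_ifs <;> rfl
    rw [hs, hs', hk]
    have := (multi_ptree r ρ l).comb_head L' (.linear s.out s.ar (s.deg - c'') (sgn K (c * c')) 1
      (if s.out = ρ then g₁.app (q := s.deg - c'') (by omega)
            (g₁'.app (q := s.deg - c') (by omega) s.lab)
          else g₀.app (q := s.deg - c'') (by omega)
            (g₀'.app (q := s.deg - c') (by omega) s.lab))
      (if s.out = ρ then k₁.app (by omega) s.lab else k₀.app (by omega) s.lab) s.inp)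
    refine Eq.trans ?_ (this.trans (by rw [one_smul]))
    congr 3
    split_ifs
    · rw [h₁ (q := s.deg - c) (q' := s.deg - c'), one_smul]
    · rw [h₀ (q := s.deg - c) (q' := s.deg - c'), one_smul]
  · rw [pickSum_comm, ← pickSum_smul]
    refine pick_congr fun s L' _ => ?_
    rw [← pickSum_smul]
    refine pick_congr fun t L'' _ => ?_
    have := koszul_ptree (p := r) ρ l [] L'' (s.opAt g₁' g₀' ρ) (t.opAt g₁ g₀ ρ)
    simp only [nil_append, Vtx.opAt_deg] at this
    rw [this]
    simp only [smul_smul, ← sgn_add]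
    congr 1
    exact sgn_congr ⟨s.deg * t.deg - s.deg * c, by ring⟩

end

end Con

/-! ### Contraction of edges -/

variable (V) in
/-- An equivariant family of partial compositions of degree `-c` on a graded `𝕊`-module. -/
structure LabMul (c : ℤ) where
  app : ∀ {m n k : ℕ} (i : Fin m) (_ : Wire i n k) {p q r : ℤ} (_ : r + c = p + q),
    V.obj m p →ₗ[K] V.obj n q →ₗ[K] V.obj k r
  app_act : ∀ {m n k : ℕ} {i : Fin m} (σ : Perm (Fin m)) (τ : Perm (Fin n))
    (ρ : Perm (Fin k)) (e : Wire i n k) (e' : Wire (σ i) n k), e.Renames σ τ ρ e' →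
    ∀ {p q r : ℤ} (h : r + c = p + q) (x : V.obj m p) (y : V.obj n q),
      app (σ i) e' h (V.act σ x) (V.act τ y) = V.act ρ (app i e h x y)

namespace LabMul

variable {c : ℤ} (μ : LabMul V c)

/-- The vertex obtained by contracting the edge from the vertex `t` to the input `i` of the vertex
`s`; its inputs are numbered by `e`. -/
def vtxVia (s t : Vtx V) (i : Fin s.ar) (e : Wire i t.ar k) : Vtx V :=
  ⟨s.out, k, s.deg + t.deg - c, μ.app i e (by omega) s.lab t.lab, wLabel e s.inp t.inp⟩

/-- The vertex obtained by contracting the edge from `t` to the input `i` of `s`, for an arbitrary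
numbering of its inputs. -/
def vtx (s t : Vtx V) (i : Fin s.ar) : Vtx V := μ.vtxVia s t i (equivFin _)

lemma vtxVia_eq (s t : Vtx V) (i : Fin s.ar) (e : Wire i t.ar k) {r : ℤ} (h : r + c = s.deg + t.deg)
    {ι : Fin k → ℕ} (hι : e.Fits s.inp t.inp ι) : μ.vtxVia s t i e = ⟨s.out, k, r, μ.app i e h s.lab
    t.lab, ι⟩ := by
  obtain rfl : r = s.deg + t.deg - c := by omega
  rw [hι.eq]
  rfl

variable {M : Type*} [AddCommGroup M] [Module K M]

lemma vtxVia_congr {G : List (Vtx V) → M} (hG : Multi G) (s t : Vtx V) (i : Fin s.ar) {k' : ℕ} (e :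
    Wire i t.ar k) (e' : Wire i t.ar k') (L : List (Vtx V)) : G (μ.vtxVia s t i e :: L) = G
    (μ.vtxVia s t i e' :: L) := by
  obtain rfl : k = k' := equiv_iff_eq.1 ⟨e.symm.trans e'⟩
  have hs : s.deg + t.deg - c + c = s.deg + t.deg := by omega
  have h := μ.app_act 1 1 (e.symm.trans e') e e'
    ⟨fun a => by simp; rfl, fun b => by simp; rfl⟩ hs s.lab t.lab
  rw [V.act_one, V.act_one] at h
  have h' : μ.vtxVia s t i e' = ⟨s.out, k, s.deg + t.deg - c,
      V.act (e.symm.trans e') (μ.app i e hs s.lab t.lab), wLabel e' s.inp t.inp⟩ := by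
    rw [← h]; rfl
  rw [h', hG.comb_head L (.act _ _ _ _ _ _), one_smul, zero_smul, add_zero]
  rw [μ.vtxVia_eq s t i e hs (ι := wLabel e' s.inp t.inp ∘ e.symm.trans e')]
  have := e'.fits_wireLabel s.inp t.inp
  exact ⟨fun a => by simpa using this.1 a, fun a => by simpa using this.2 a⟩

/-- The sum, over the edges from `t` to `s`, of the values on the trees obtained by contracting this
edge. -/
def edgeSum (G : List (Vtx V) → M) (s t : Vtx V) (L : List (Vtx V)) : M :=
  ∑ i, if s.inp i = t.out then G (μ.vtx s t i :: L) else 0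

/-- The sum, over the pairs of adjacent vertices, of the values on the trees obtained by contracting
the edge. -/
def conSum (G : List (Vtx V) → M) (L : List (Vtx V)) : M :=
  pickSum (fun s L' => pickSum (fun t L'' => μ.edgeSum G s t L'') L') L

variable {μ} {G : List (Vtx V) → M}

lemma edgeSum_multi (hG : Multi G) (s t : Vtx V) : Multi (μ.edgeSum G s t) :=
  Multi.sum _ fun _ => (hG.cons _).ite multi_zero

lemma edgeSum_left (hG : Multi G) (t : Vtx V) (L : List (Vtx V)) {a a' : K} {s s₁ s₂ : Vtx V} (h :
    Vtx.Comb a a' s s₁ s₂) : μ.edgeSum G s t L = a • μ.edgeSum G s₁ t L + a' • μ.edgeSum G s₂ t L :=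
    by
  cases h with
  | linear o k q a a' x x' ι =>
    simp only [edgeSum, smul_sum, ← sum_add_distrib]
    refine sum_congr rfl fun i _ => ?_
    split_ifs
    · simp only [vtx, vtxVia, map_add, map_smul, LinearMap.add_apply, LinearMap.smul_apply]
      exact hG.comb_head L (.linear _ _ _ _ _ _ _ _)
    · simp
  | act o k q σ x ι =>
    rw [one_smul, zero_smul, add_zero]
    unfold edgeSum
    refine (Fintype.sum_equiv σ _ _ fun i => ?_).symm
    refine if_congr Iff.rfl ?_ rfl
    have key : ∀ {k' : ℕ} (e : Wire i t.ar k'),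
        μ.vtxVia ⟨o, k, q, V.act σ x, ι⟩ t (σ i) (e.renameLeft σ) =
          μ.vtxVia ⟨o, k, q, x, ι ∘ σ⟩ t i e := by
      intro k' e
      have h := μ.app_act σ 1 1 e (e.renameLeft σ) (e.renames_left σ)
        (show q + t.deg - c + c = q + t.deg by omega) x t.lab
      rw [V.act_one, V.act_one] at h
      refine (μ.vtxVia_eq _ _ _ _ (r := q + t.deg - c) (by simp)
        (ι := wLabel e (ι ∘ σ) t.inp) ?_).trans ?_
      · have h1 := e.fits_wireLabel (ι ∘ σ) t.inp
        have h2 := e.renames_left σ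
        refine ⟨fun a => ?_, fun b => (congrArg _ (h2.2 b)).trans (h1.2 b)⟩
        have h3 := h2.1 ⟨σ.symm a.1, fun h => a.2 (σ.symm_apply_eq.1 h)⟩
        simp only [apply_symm_apply, Subtype.coe_eta] at h3
        rw [h3]
        simpa using h1.1 ⟨σ.symm a.1, fun h => a.2 (σ.symm_apply_eq.1 h)⟩
      · exact congrArg (fun y => (⟨o, k', q + t.deg - c, y, wLabel e (ι ∘ σ) t.inp⟩ : Vtx V)) h
    exact (congrArg (fun v => G (v :: L)) (key (equivFin _)).symm).trans
      (μ.vtxVia_congr hG ⟨o, k, q, V.act σ x, ι⟩ t (σ i) _ _ L)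

lemma edgeSum_right (hG : Multi G) (t : Vtx V) (L : List (Vtx V)) {a a' : K} {s s₁ s₂ : Vtx V} (h :
    Vtx.Comb a a' s s₁ s₂) : μ.edgeSum G t s L = a • μ.edgeSum G t s₁ L + a' • μ.edgeSum G t s₂ L :=
    by
  cases h with
  | linear o k q a a' x x' ι =>
    simp only [edgeSum, smul_sum, ← sum_add_distrib]
    refine sum_congr rfl fun i _ => ?_
    split_ifs
    · simp only [vtx, vtxVia, map_add, map_smul]
      exact hG.comb_head L (.linear _ _ _ _ _ _ _ _)
    · simp
  | act o k q σ x ι =>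
    rw [one_smul, zero_smul, add_zero]
    unfold edgeSum
    refine sum_congr rfl fun i _ => ?_
    refine if_congr Iff.rfl ?_ rfl
    have key : ∀ {k' : ℕ} (e : Wire i k k'),
        μ.vtxVia t ⟨o, k, q, V.act σ x, ι⟩ i (e.renameRight σ) =
          μ.vtxVia t ⟨o, k, q, x, ι ∘ σ⟩ i e := by
      intro k' e
      have h := μ.app_act 1 σ 1 e (e.renameRight σ) (e.renames_right σ)
        (show t.deg + q - c + c = t.deg + q by omega) t.lab x
      rw [V.act_one, V.act_one] at h
      refine (μ.vtxVia_eq _ _ _ _ (r := t.deg + q - c) (by simp)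
        (ι := wLabel e t.inp (ι ∘ σ)) ?_).trans ?_
      · have h1 := e.fits_wireLabel t.inp (ι ∘ σ)
        have h2 := e.renames_right σ
        refine ⟨fun a => (congrArg _ (h2.1 a)).trans (h1.1 a), fun b => ?_⟩
        have h3 := h2.2 (σ.symm b)
        simp only [apply_symm_apply] at h3
        refine (congrArg _ h3).trans ?_
        simpa using h1.2 (σ.symm b)
      · exact congrArg (fun y => (⟨t.out, k', t.deg + q - c, y, wLabel e t.inp (ι ∘ σ)⟩ :
          Vtx V)) h
    exact (μ.vtxVia_congr hG t ⟨o, k, q, V.act σ x, ι⟩ i _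
      (Wire.renameRight σ (equivFin _ : Wire i k _)) L).trans
      (congrArg (fun v => G (v :: L)) (key (equivFin _)))

lemma conSum_multi (hG : Multi G) : Multi (μ.conSum G) := by
  refine multi_pickSum (fun s => multi_pickSum (fun t => edgeSum_multi hG s t)
    fun L _ _ _ _ _ h => edgeSum_right hG s L h) fun L _ _ _ _ _ h => ?_
  rw [← pickSum_smul, ← pickSum_smul, ← pickSum_add]
  exact pick_congr fun t L' _ => edgeSum_left hG t L' h

lemma vtx_ren (π : Perm ℕ) (s t : Vtx V) (i : Fin s.ar) : μ.vtx (s.ren π) (t.ren π) i = (μ.vtx s t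
    i).ren π := by
  simp only [vtx, vtxVia, Vtx.ren, comp_wireLabel]
  rfl

variable (μ) in
/-- The sum over the inner edges of a tree of the trees obtained by contracting the edge. -/
def con : PTree V n p →ₗ[K] PTree V n q :=
  TreeFun.lift p <| Multi.treeFun (fun L r l => μ.conSum (fun L => ptree L r l) L)
    (fun r l => conSum_multi (multi_ptree q r l))
    (fun π L r l => by
      refine (pickSum_rename π _ L).trans (pick_congr fun s L' _ => ?_)
      refine (pickSum_rename π _ L').trans (pick_congr fun t L'' _ => ?_)
      refine sum_congr rfl fun i _ => if_congr π.apply_eq_iff_eq ?_ rfl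
      exact (congrArg (fun v => ptree (v :: _) _ _) (vtx_ren π s t i)).trans
        (ptree_rename π (μ.vtx s t i :: L'') r l))

lemma con_ptree (h : IsPTree L r l) (hp : deg L = p) : (μ.con (ptree L r l : PTree V n p) : PTree V
    n q) = μ.conSum (fun L => ptree L r l) L := TreeFun.lift_eq _ h hp

lemma isPTree_vtxVia {s t : Vtx V} {i : Fin s.ar} (e : Wire i t.ar k) (hi : s.inp i = t.out) (h :
    IsPTree (s :: t :: L) r l) : IsPTree (μ.vtxVia s t i e :: L) r l := by
  obtain ⟨h1, h2, height, h3⟩ := h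
  have hl := (e.fits_wireLabel s.inp t.inp).lvs
  simp only [outs_cons, ins_cons, ← add_assoc] at h1 h2
  rw [hl, hi, cons_add] at h1 h2
  refine ⟨?_, ?_, height, ?_⟩
  · refine (cons_inj_right t.out).1 ?_
    simp only [vtxVia, outs_cons, ins_cons]
    simp only [cons_add] at h1 ⊢
    rw [cons_swap, h1, cons_swap]
  · rw [cons_swap] at h2
    simpa [vtxVia] using (nodup_cons.1 h2).2
  · intro u hu
    rcases List.mem_cons.1 hu with rfl | hu
    · intro a
      have hs := h3 s (by simp)
      have ht := h3 t (by simp)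
      obtain ⟨a, rfl⟩ := e.surjective a
      have hf := e.fits_wireLabel s.inp t.inp
      rcases a with a | a
      · change height s.out < height (wLabel e s.inp t.inp _)
        rw [hf.1]
        exact hs _
      · change height s.out < height (wLabel e s.inp t.inp _)
        rw [hf.2]
        refine (hs i).trans ?_
        rw [hi]
        exact ht a
    · exact h3 u (by simp [hu])

lemma isPTree_vtx {s t : Vtx V} {i : Fin s.ar} (hi : s.inp i = t.out) (h : IsPTree (s :: t :: L) r
    l) : IsPTree (μ.vtx s t i :: L) r l :=
  isPTree_vtxVia _ hi h

lemma deg_vtx (s t : Vtx V) (i : Fin s.ar) (L : List (Vtx V)) : deg (μ.vtx s t i :: L) = deg (s :: t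
    :: L) - c := by
  simp only [deg_cons, vtx, vtxVia]
  omega

end LabMul

/-! ### Commutation relations between local operators and contractions -/

section Commutators

namespace LabMul

variable {c : ℤ} {μ : LabMul V c} {M : Type*} [AddCommGroup M] [Module K M]
  {G : List (Vtx V) → M}

lemma edgeSum_cons (hG : Multi G) (s t v : Vtx V) (L : List (Vtx V)) : μ.edgeSum G s t (v :: L) =
    sgn K ((s.deg + t.deg - c) * v.deg) • μ.edgeSum (fun L => G (v :: L)) s t L := by
  simp only [edgeSum, smul_sum]
  refine sum_congr rfl fun i _ => ?_
  split_ifs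
  · exact hG.koszul [] L (μ.vtx s t i) v
  · simp

lemma conSum_cons (G : List (Vtx V) → M) (v : Vtx V) (L : List (Vtx V)) : μ.conSum G (v :: L) =
    pickSum (fun t L' => μ.edgeSum G v t L') L + pickSum (fun s L' => sgn K (v.deg * s.deg) •
    μ.edgeSum G s v L') L + pickSum (fun s L' => pickSum (fun t L'' => sgn K (v.deg * s.deg + v.deg
    * t.deg) • μ.edgeSum G s t (v :: L'')) L') L := by
  simp only [conSum, pickSum, smul_add, ← pickSum_smul, smul_smul, sgn_add, pickSum_add, add_assoc]

lemma edgeSum_eq_zero {s t : Vtx V} (h : ∀ i, s.inp i ≠ t.out) (L : List (Vtx V)) : μ.edgeSum G s t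
    L = 0 :=
  sum_eq_zero fun i _ => if_neg (h i)

lemma edgeSum_map {N : Type*} [AddCommGroup N] [Module K N] (f : M →ₗ[K] N) (G : List (Vtx V) → M)
    (s t : Vtx V) (L : List (Vtx V)) : f (μ.edgeSum G s t L) = μ.edgeSum (fun L => f (G L)) s t L :=
    by
  simp only [edgeSum, map_sum, apply_ite, map_zero]

lemma edgeSum_pickSum (F : Vtx V → List (Vtx V) → List (Vtx V) → M) (s t : Vtx V) (L L₀ : List (Vtx
    V)) : (∑ i, if s.inp i = t.out then pickSum (fun u L' => F u L' (μ.vtx s t i :: L)) L₀ else 0) =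
    pickSum (fun u L' => ∑ i, if s.inp i = t.out then F u L' (μ.vtx s t i :: L) else 0) L₀ := by
  rw [pickSum_sum]
  refine sum_congr rfl fun i _ => ?_
  split_ifs
  · rfl
  · exact (pick_eq_zero fun _ _ _ => rfl).symm

lemma edgeSum_op [AddCommGroup M] [Module K M] {c' c'' : ℤ} {ν : LabMul V c''} {g g₀ : LabMap V V
    c'} (hG : Multi G) (hc : c'' = c + c') (h : ∀ {m n k : ℕ} (i : Fin m) (e : Wire i n k) {p q r p'
    q' s : ℤ} (h : r + c = p + q) (hp : p' + c' = p) (hq : q' + c' = q) (hr : s + c' = r) (h₁ : s +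
    c = p' + q) (h₂ : s + c = p + q') (h₃ : s + c'' = p + q) (x : V.obj m p) (y : V.obj n q), g.app
    hr (μ.app i e h x y) = sgn K (c * c') • (μ.app i e h₁ (g.app hp x) y + sgn K (c' * p) • μ.app i
    e h₂ x (g₀.app hq y)) + ν.app i e h₃ x y) (s t : Vtx V) (L : List (Vtx V)) : (∑ i, if s.inp i =
    t.out then G ((μ.vtx s t i).op g :: L) else 0) = sgn K (c * c') • (μ.edgeSum G (s.op g) t L +
    sgn K (c' * s.deg) • μ.edgeSum G s (t.op g₀) L) + ν.edgeSum G s t L := by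
  unfold edgeSum
  change _ = sgn K (c * c') • ((∑ i, if s.inp i = t.out then G (μ.vtx (s.op g) t i :: L) else 0) +
    sgn K (c' * s.deg) • ∑ i, if s.inp i = t.out then G (μ.vtx s (t.op g₀) i :: L) else 0) +
    ∑ i, if s.inp i = t.out then G (ν.vtx s t i :: L) else 0
  rw [smul_sum, ← sum_add_distrib, smul_sum, ← sum_add_distrib]
  refine sum_congr rfl fun i _ => ?_
  split_ifs
  swap
  · simp
  set w : Wire i t.ar _ := equivFin _ with hw
  have hf := w.fits_wireLabel s.inp t.inp
  have h1 : (μ.vtx s t i).op g = ⟨s.out, _, s.deg + t.deg - c'', g.app (by omega)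
      (μ.app i w (r := s.deg + t.deg - c) (by omega) s.lab t.lab), wLabel w s.inp t.inp⟩ :=
    Vtx.op_eq g _ (by change _ = s.deg + t.deg - c; omega)
  have h2 : μ.vtx (s.op g) t i = ⟨s.out, _, s.deg + t.deg - c'', μ.app i w (by omega)
      (g.app (q := s.deg - c') (by omega) s.lab) t.lab, wLabel w s.inp t.inp⟩ :=
    μ.vtxVia_eq (s.op g) t i w (by change _ = s.deg - c' + t.deg; omega) hf
  have h3 : μ.vtx s (t.op g₀) i = ⟨s.out, _, s.deg + t.deg - c'', μ.app i w (by omega)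
      s.lab (g₀.app (q := t.deg - c') (by omega) t.lab), wLabel w s.inp t.inp⟩ :=
    μ.vtxVia_eq s (t.op g₀) i w (by change _ = s.deg + (t.deg - c'); omega) hf
  have h4 : ν.vtx s t i = ⟨s.out, _, s.deg + t.deg - c'', ν.app i w (by omega)
      s.lab t.lab, wLabel w s.inp t.inp⟩ := rfl
  have h5 := h i w (p := s.deg) (q := t.deg) (r := s.deg + t.deg - c) (p' := s.deg - c')
    (q' := t.deg - c') (s := s.deg + t.deg - c'') (by omega) (by omega) (by omega) (by omega)
    (by omega) (by omega) (by omega) s.lab t.lab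
  rw [h1, h2, h3, h4, h5]
  have h6 : ∀ x, G (⟨s.out, _, s.deg + t.deg - c'', x, wLabel w s.inp t.inp⟩ :: L) =
      hG.head s.out _ (s.deg + t.deg - c'') (wLabel w s.inp t.inp) L x := fun x => rfl
  simp only [h6, map_add, map_smul]

end LabMul

variable {r q' : ℤ}

open LabMul in
/-- The graded commutator of a local operator and a contraction is a contraction. -/
lemma loc_con {c c' c'' : ℤ} {μ : LabMul V c} {ν : LabMul V c''} {g₁ g₀ : LabMap V V c'} (hc : c'' =
    c + c') (h₁ : ∀ {m n k : ℕ} (i : Fin m) (e : Wire i n k) {p q r p' q' s : ℤ} (h : r + c = p + q)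
    (hp : p' + c' = p) (hq : q' + c' = q) (hr : s + c' = r) (h₁ : s + c = p' + q) (h₂ : s + c = p +
    q') (h₃ : s + c'' = p + q) (x : V.obj m p) (y : V.obj n q), g₁.app hr (μ.app i e h x y) = sgn K
    (c * c') • (μ.app i e h₁ (g₁.app hp x) y + sgn K (c' * p) • μ.app i e h₂ x (g₀.app hq y)) +
    ν.app i e h₃ x y) (h₀ : ∀ {m n k : ℕ} (i : Fin m) (e : Wire i n k) {p q r p' q' s : ℤ} (h : r +
    c = p + q) (hp : p' + c' = p) (hq : q' + c' = q) (hr : s + c' = r) (h₁ : s + c = p' + q) (h₂ : s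
    + c = p + q') (h₃ : s + c'' = p + q) (x : V.obj m p) (y : V.obj n q), g₀.app hr (μ.app i e h x
    y) = sgn K (c * c') • (μ.app i e h₁ (g₀.app hp x) y + sgn K (c' * p) • μ.app i e h₂ x (g₀.app hq
    y)) + ν.app i e h₃ x y) (hq : q + c = p) (hq' : q' + c' = p) (x : PTree V n p) : (loc g₁ g₀
    (μ.con x : PTree V n q) : PTree V n r) = sgn K (c * c') • μ.con (loc g₁ g₀ x : PTree V n q') +
    ν.con x := by
  induction x using ptree_induction with
  | zero => simp
  | add x x' hx hx' => simp only [map_add, hx, hx', smul_add]; abel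
  | smul a x hx => simp only [map_smul, hx, smul_add, smul_comm a]
  | tree L ρ l hL hp =>
  set G : List (Vtx V) → PTree V n r := fun L => ptree L ρ l with hG'
  have hG : Multi G := multi_ptree r ρ l
  have hl : (loc g₁ g₀ (μ.con (ptree L ρ l : PTree V n p) : PTree V n q) :
      PTree V n r) = pickSum (fun s L' => pickSum (fun t L'' =>
        (∑ i, if s.inp i = t.out then G ((μ.vtx s t i).opAt g₁ g₀ ρ :: L'') else 0) +
        pickSum (fun u L₃ => sgn K ((s.deg + t.deg - c) * u.deg) •
          sgn K ((s.deg + t.deg - c) * (u.deg - c')) • μ.edgeSum G s t (u.opAt g₁ g₀ ρ :: L₃))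
            L'') L') L := by
    rw [con_ptree hL hp, conSum, pickSum_map]
    refine pick_congr fun s L' hs => ?_
    rw [pickSum_map]
    refine pick_congr fun t L'' ht => ?_
    have hst := (ht.cons s).trans hs
    have e : ∀ u L₃, sgn K ((s.deg + t.deg - c) * (u : Vtx V).deg) •
          sgn K ((s.deg + t.deg - c) * (u.deg - c')) • μ.edgeSum G s t (u.opAt g₁ g₀ ρ :: L₃) =
        ∑ i, if s.inp i = t.out then sgn K ((s.deg + t.deg - c) * u.deg) •
          G (u.opAt g₁ g₀ ρ :: μ.vtx s t i :: L₃) else 0 := by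
      intro u L₃
      rw [edgeSum_cons hG, Vtx.opAt_deg, sgn_smul_smul, edgeSum, smul_sum]
      refine sum_congr rfl fun i _ => ?_
      split_ifs
      · rfl
      · simp
    simp only [e]
    rw [pickSum_sum, ← sum_add_distrib, edgeSum, map_sum]
    refine sum_congr rfl fun i _ => ?_
    split_ifs with hi
    · rw [loc_ptree _ _ (isPTree_vtx hi ((IsPTree.perm hst).2 hL))
        (by rw [deg_vtx, deg_perm hst]; omega), pickSum]
      rfl
    · rw [pick_eq_zero fun _ _ _ => rfl]
      simp
  have hr : (μ.con (loc g₁ g₀ (ptree L ρ l : PTree V n p) : PTree V n q') :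
      PTree V n r) =
      pickSum (fun s L' => pickSum (fun t L'' => μ.edgeSum G (s.opAt g₁ g₀ ρ) t L'') L') L +
      pickSum (fun s L' => pickSum (fun t L'' => sgn K (c' * s.deg) •
        μ.edgeSum G s (t.opAt g₁ g₀ ρ) L'') L') L +
      pickSum (fun s L' => pickSum (fun t L'' => pickSum (fun u L₃ =>
        sgn K (c' * (s.deg + t.deg)) • μ.edgeSum G s t (u.opAt g₁ g₀ ρ :: L₃))
            L'') L') L := by
    have e1 : ∀ s t : Vtx V, sgn K (c' * s.deg) =
        sgn K (s.deg * t.deg) * sgn K ((t.deg - c') * s.deg) := fun s t => by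
      rw [← sgn_add]
      exact sgn_congr ⟨c' * s.deg - s.deg * t.deg, by ring⟩
    have e2 : ∀ s t u : Vtx V, sgn K (c' * (s.deg + t.deg)) =
        sgn K (s.deg * u.deg + t.deg * u.deg) *
          sgn K ((u.deg - c') * s.deg + (u.deg - c') * t.deg) := fun s t u => by
      rw [← sgn_add]
      exact sgn_congr ⟨c' * (s.deg + t.deg) - s.deg * u.deg - t.deg * u.deg, by ring⟩
    rw [loc_ptree _ _ hL hp, pickSum_map]
    rw [pick_congr (G := fun u L' =>
      pickSum (fun t L'' => μ.edgeSum G (u.opAt g₁ g₀ ρ) t L'') L' +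
      pickSum (fun s L'' => sgn K ((u.deg - c') * s.deg) •
        μ.edgeSum G s (u.opAt g₁ g₀ ρ) L'') L' +
      pickSum (fun s L'' => pickSum (fun t L₃ =>
        sgn K ((u.deg - c') * s.deg + (u.deg - c') * t.deg) •
          μ.edgeSum G s t (u.opAt g₁ g₀ ρ :: L₃)) L'') L')]
    · rw [pickSum_add, pickSum_add, pickSum_comm (fun u s L'' => sgn K ((u.deg - c') * s.deg) •
        μ.edgeSum G s (u.opAt g₁ g₀ ρ) L''), pickSum_rotate]
      refine congrArg₂ (· + ·) (congrArg₂ (· + ·) rfl ?_) ?_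
      · refine pick_congr fun s L' _ => pick_congr fun t L'' _ => ?_
        rw [e1 s t, smul_smul]
      · refine pick_congr fun s L' _ => pick_congr fun t L'' _ => pick_congr fun u L₃ _ => ?_
        rw [e2 s t u, smul_smul]
    · intro u L' hu
      rw [con_ptree ((isPTree_opAt _ _ _ _ _).2 ((IsPTree.perm hu).2 hL))
        (by have := deg_perm hu; rw [deg_cons] at this ⊢; rw [Vtx.opAt_deg]; omega), conSum_cons]
      simp only [Vtx.opAt_deg]
      rfl
  rw [hl, hr, con_ptree hL hp, conSum]
  simp only [smul_add, ← pickSum_smul, ← pickSum_add]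
  refine pick_congr fun s L' hs => pick_congr fun t L'' ht => ?_
  rw [add_right_comm]
  refine congrArg₂ (· + ·) ?_ ?_
  · by_cases htr : ∃ i, s.inp i = t.out
    · have ht0 : t.out ≠ ρ := by
        rintro rfl
        obtain ⟨i, hi⟩ := htr
        have h2 := ((IsPTree.perm ((ht.cons s).trans hs)).2 hL).2.1
        exact (nodup_cons.1 h2).1 (mem_ins.2 ⟨s, by simp, i, hi⟩)
      have e1 : t.opAt g₁ g₀ ρ = t.op g₀ := if_neg ht0
      by_cases hsr : s.out = ρ
      · have e2 : s.opAt g₁ g₀ ρ = s.op g₁ := if_pos hsr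
        have e3 : ∀ i, (μ.vtx s t i).opAt g₁ g₀ ρ = (μ.vtx s t i).op g₁ := fun i => if_pos hsr
        simp only [e1, e2, e3]
        rw [edgeSum_op hG hc h₁ s t L'', smul_add]
      · have e2 : s.opAt g₁ g₀ ρ = s.op g₀ := if_neg hsr
        have e3 : ∀ i, (μ.vtx s t i).opAt g₁ g₀ ρ = (μ.vtx s t i).op g₀ := fun i => if_neg hsr
        simp only [e1, e2, e3]
        rw [edgeSum_op hG hc h₀ s t L'', smul_add]
    · push Not at htr
      rw [edgeSum_eq_zero htr, edgeSum_eq_zero (t := t.opAt g₁ g₀ ρ) (by simpa using htr),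
        sum_eq_zero fun i _ => if_neg (htr i)]
      have e2 : s.opAt g₁ g₀ ρ = s.op g₁ ∨ s.opAt g₁ g₀ ρ = s.op g₀ := by
        unfold Vtx.opAt
        split_ifs <;> simp
      rcases e2 with e2 | e2
      · rw [e2, edgeSum_eq_zero (s := s.op g₁) htr]
        simp
      · rw [e2, edgeSum_eq_zero (s := s.op g₀) htr]
        simp
  · refine pick_congr fun u L₃ _ => ?_
    simp only [smul_smul, ← sgn_add]
    congr 1
    exact sgn_congr ⟨(s.deg + t.deg - c) * u.deg - (s.deg + t.deg) * c', by ring⟩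

end Commutators

/-! ### Contracting two edges -/

lemma Wire.exists_seq {l s t : ℕ} {i : Fin m} {j : Fin n} (e : Wire i n k) (e₂ : Wire (e (inr j)) l
    t) (f : Wire j l s) : ∃ f₂ : Wire i s t, e.Seq e₂ f f₂ := by
  let F : {a : Fin m // a ≠ i} ⊕ Fin s → Fin t :=
    Sum.elim (fun a => e₂ (inl ⟨e (inl a), by simp⟩))
      (Sum.elim (fun b => e₂ (inl ⟨e (inr b.1), by simpa using b.2⟩)) (fun c => e₂ (inr c)) ∘ f.symm)
  have hF : Function.Bijective F := by
    constructor
    · rintro (a | d) (a' | d') h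
      · simpa [F] using h
      · obtain ⟨d', rfl⟩ := f.surjective d'
        rcases d' with d' | d' <;> simp [F] at h
      · obtain ⟨d, rfl⟩ := f.surjective d
        rcases d with d | d <;> simp [F] at h
      · obtain ⟨d, rfl⟩ := f.surjective d
        obtain ⟨d', rfl⟩ := f.surjective d'
        rcases d with d | d <;> rcases d' with d' | d' <;> simp [F, Subtype.ext_iff] at h ⊢ <;>
          exact h
    · intro x
      obtain ⟨y, rfl⟩ := e₂.surjective x
      rcases y with ⟨z, hz⟩ | c
      · obtain ⟨z, rfl⟩ := e.surjective z
        rcases z with a | b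
        · exact ⟨inl a, rfl⟩
        · have hb : b ≠ j := fun h => hz (by rw [h])
          exact ⟨inr (f (inl ⟨b, hb⟩)), by simp [F]⟩
      · exact ⟨inr (f (inr c)), by simp [F]⟩
  exact ⟨Equiv.ofBijective F hF, fun a => rfl, fun b => by simp [F], fun c => by simp [F]⟩

lemma lvs_sum_elim {i : Fin m} (f : Fin m → ℕ) (g : Fin n → ℕ) : lvs f + lvs g = f i ::ₘ
    univ.val.map (Sum.elim (fun a : {a : Fin m // a ≠ i} => f a.1) g) := by
  have h : univ.val.map (Sum.elim (fun a : {a : Fin m // a ≠ i} => f a.1) g) =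
      ∑ x, {Sum.elim (fun a : {a : Fin m // a ≠ i} => f a.1) g x} := by
    rw [Finset.sum]
    refine (Multiset.sum_map_singleton _).symm.trans ?_
    rw [Multiset.map_map]
    rfl
  rw [h, lvs_eq_sum, lvs_eq_sum, Fintype.sum_eq_add_sum_subtype_ne _ i,
    sum_sum_type, ← singleton_add, add_assoc]
  rfl

/-- A labelling of the inputs of a partial composite can be found from names of the inputs. -/
lemma Wire.exists_fits {i : Fin m} {f : Fin m → ℕ} {g : Fin n → ℕ} {l : Fin k → ℕ} (hl : Injective
    l) (h : lvs f + lvs g = f i ::ₘ lvs l) : ∃ e : Wire i n k, e.Fits f g l := by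
  rw [lvs_sum_elim (i := i) f g, cons_inj_right] at h
  set F := Sum.elim (fun a : {a : Fin m // a ≠ i} => f a.1) g with hF
  have hFi : Injective F := by
    have h1 : (univ.val.map F).Nodup := by
      rw [h]
      exact univ.nodup.map hl
    exact fun a b hab => inj_on_of_nodup_map h1 a (by simp) b (by simp) hab
  have hr : Set.range F = Set.range l := by
    ext x
    have := congrArg (x ∈ ·) h
    simpa [lvs] using this
  have he : ∀ x, l (((Equiv.ofInjective F hFi).trans
      ((Equiv.setCongr hr).trans (Equiv.ofInjective l hl).symm)) x) = F x := fun x => by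
    simpa using Equiv.apply_ofInjective_symm hl (Equiv.setCongr hr (Equiv.ofInjective F hFi x))
  exact ⟨_, fun a => he (inl a), fun b => he (inr b)⟩

lemma wireLabel_injective {i : Fin m} (e : Wire i n k) {f : Fin m → ℕ} {g : Fin n → ℕ} (hf :
    Injective f) (hg : Injective g) (h : ∀ a b, f a ≠ g b) : Injective (wLabel e f g) := by
  intro x y hxy
  have hl := e.fits_wireLabel f g
  obtain ⟨x, rfl⟩ := e.surjective x
  obtain ⟨y, rfl⟩ := e.surjective y
  congr 1
  rcases x with x | x <;> rcases y with y | y <;> simp only [hl.1, hl.2] at hxy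
  · rw [Subtype.ext (hf hxy)]
  · exact (h _ _ hxy).elim
  · exact (h _ _ hxy.symm).elim
  · rw [hg hxy]

lemma Wire.exists_par {l s t : ℕ} {i j : Fin m} (hij : i ≠ j) (e : Wire i n k)
    (e₂ : Wire (e (inl ⟨j, hij.symm⟩)) l t) (f : Wire j l s) :
    ∃ f₂ : Wire (f (inl ⟨i, hij⟩)) n t, e.Par hij e₂ f f₂ := by
  -- the inputs get distinct names, with residues that tell the three factors apart
  let A : Fin m → ℕ := fun a => 3 * a.1
  let B : Fin n → ℕ := fun a => 3 * a.1 + 1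
  let C : Fin l → ℕ := fun a => 3 * a.1 + 2
  have hA : Injective A := fun a b h => Fin.ext (by simp only [A] at h; omega)
  have hB : Injective B := fun a b h => Fin.ext (by simp only [B] at h; omega)
  have hC : Injective C := fun a b h => Fin.ext (by simp only [C] at h; omega)
  have h1 := e.fits_wireLabel A B
  have h2 := e₂.fits_wireLabel (wLabel e A B) C
  have h3 := f.fits_wireLabel A C
  have hl : Injective (wLabel e₂ (wLabel e A B) C) := by
    refine wireLabel_injective e₂ (wireLabel_injective e hA hB fun a b => ?_) hC fun a c => ?_
    · simp only [A, B]; omega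
    · obtain ⟨a, rfl⟩ := e.surjective a
      rcases a with a | a
      · rw [h1.1]; simp only [A, C]; omega
      · rw [h1.2]; simp only [B, C]; omega
  obtain ⟨f₂, hf₂⟩ : ∃ f₂ : Wire (f (inl ⟨i, hij⟩)) n t, f₂.Fits (wLabel f A C) B
      (wLabel e₂ (wLabel e A B) C) := by
    refine Wire.exists_fits hl ?_
    have e1 := h1.lvs
    have e2 := h2.lvs
    have e3 := h3.lvs
    rw [h1.1] at e2
    rw [h3.1]
    refine (cons_inj_right (A j)).1 ?_
    rw [← cons_add, ← e3, add_right_comm, e1, cons_add, e2, cons_swap]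
  refine ⟨f₂, fun a hi hj => hl ?_, fun b => hl ?_, fun c => hl ?_⟩
  · rw [h2.1, hf₂.1, h3.1]
    exact h1.1 _
  · rw [h2.1, hf₂.2]
    exact h1.2 _
  · rw [h2.2, hf₂.1]
    exact (h3.2 _).symm

section ConCon

variable {M : Type*} [AddCommGroup M] [Module K M]

namespace LabMul

/-- The partial compositions of degree `-1` are associative up to the Koszul sign. -/
structure IsAssoc (μ : LabMul V 1) : Prop where
  seq : ∀ {m n k l s t : ℕ} {i : Fin m} {j : Fin n} (e : Wire i n k) (e₂ : Wire (e (inr j)) l t)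
    (f : Wire j l s) (f₂ : Wire i s t), e.Seq e₂ f f₂ →
    ∀ {p q r pq qr pqr : ℤ} (h : pq + 1 = p + q) (h₂ : pqr + 1 = pq + r) (g : qr + 1 = q + r)
      (g₂ : pqr + 1 = p + qr) (x : V.obj m p) (y : V.obj n q) (z : V.obj l r),
      μ.app _ e₂ h₂ (μ.app i e h x y) z = - (sgn K p • μ.app i f₂ g₂ x (μ.app j f g y z))
  par : ∀ {m n k l s t : ℕ} {i j : Fin m} (hij : i ≠ j) (e : Wire i n k)
    (e₂ : Wire (e (inl ⟨j, hij.symm⟩)) l t) (f : Wire j l s)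
    (f₂ : Wire (f (inl ⟨i, hij⟩)) n t), e.Par hij e₂ f f₂ →
    ∀ {p q r pq pr pqr : ℤ} (h : pq + 1 = p + q) (h₂ : pqr + 1 = pq + r) (g : pr + 1 = p + r)
      (g₂ : pqr + 1 = pr + q) (x : V.obj m p) (y : V.obj n q) (z : V.obj l r),
      μ.app _ e₂ h₂ (μ.app i e h x y) z =
        - (sgn K (q * r) • μ.app _ f₂ g₂ (μ.app j f g x z) y)

variable {μ : LabMul V 1} {G : List (Vtx V) → M}

variable (μ) in
/-- The number of an input of the lower vertex, after a contraction. -/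
def lowerInput (s t : Vtx V) (i : Fin s.ar) (a : {a : Fin s.ar // a ≠ i}) : Fin (μ.vtx s t i).ar :=
  (equivFin ({j : Fin s.ar // j ≠ i} ⊕ Fin t.ar)) (inl a)

variable (μ) in
/-- The number of an input of the upper vertex, after a contraction. -/
def upperInput (s t : Vtx V) (i : Fin s.ar) (b : Fin t.ar) : Fin (μ.vtx s t i).ar :=
  (equivFin ({j : Fin s.ar // j ≠ i} ⊕ Fin t.ar)) (inr b)

lemma vtx_seq (hμ : μ.IsAssoc) (hG : Multi G) (s t u : Vtx V) (i : Fin s.ar) (b : Fin t.ar) (L :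
    List (Vtx V)) : G (μ.vtx (μ.vtx s t i) u (μ.upperInput s t i b) :: L) = - (sgn K s.deg • G
    (μ.vtx s (μ.vtx t u b) i :: L)) := by
  set e : Wire i t.ar _ := equivFin _ with he
  set f : Wire b u.ar _ := equivFin _ with hf
  set e₂ : Wire (e (inr b)) u.ar _ := equivFin _ with he₂
  obtain ⟨f₂, hf₂⟩ := Wire.exists_seq e e₂ f
  have h1 := e.fits_wireLabel s.inp t.inp
  have h2 := e₂.fits_wireLabel (wLabel e s.inp t.inp) u.inp
  have h3 := f.fits_wireLabel t.inp u.inp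
  have e1 : μ.vtx (μ.vtx s t i) u (μ.upperInput s t i b) = ⟨s.out, _, s.deg + t.deg + u.deg - 2,
      μ.app _ e₂ (by omega) (μ.app i e (r := s.deg + t.deg - 1) (by omega) s.lab t.lab) u.lab,
      wLabel e₂ (wLabel e s.inp t.inp) u.inp⟩ :=
    μ.vtxVia_eq (μ.vtx s t i) u (μ.upperInput s t i b) e₂
      (by change _ = s.deg + t.deg - 1 + u.deg; omega) h2
  have e2 : μ.vtxVia s (μ.vtx t u b) i f₂ = ⟨s.out, _, s.deg + t.deg + u.deg - 2,
      μ.app _ f₂ (by omega) s.lab (μ.app b f (r := t.deg + u.deg - 1) (by omega) t.lab u.lab),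
      wLabel e₂ (wLabel e s.inp t.inp) u.inp⟩ := by
    refine μ.vtxVia_eq s (μ.vtx t u b) i f₂
      (by change _ = s.deg + (t.deg + u.deg - 1); omega) ⟨fun a => ?_, fun d => ?_⟩
    · refine Eq.trans (congrArg _ (hf₂.1 a).symm) ?_
      rw [h2.1]
      exact h1.1 a
    · change _ = wLabel f t.inp u.inp d
      obtain ⟨d, rfl⟩ := f.surjective d
      rcases d with d | d
      · refine Eq.trans (congrArg _ (hf₂.2.1 d).symm) ?_
        rw [h2.1, h3.1]
        exact h1.2 _
      · refine Eq.trans (congrArg _ (hf₂.2.2 d).symm) ?_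
        rw [h2.2, h3.2]
  have e3 : G (μ.vtx s (μ.vtx t u b) i :: L) = G (μ.vtxVia s (μ.vtx t u b) i f₂ :: L) :=
    μ.vtxVia_congr hG _ _ _ _ _ _
  rw [e3, e1, e2, hμ.seq e e₂ f f₂ hf₂ _ _ (qr := t.deg + u.deg - 1) (by omega) (by omega)]
  have h6 : ∀ x, G (⟨s.out, _, s.deg + t.deg + u.deg - 2, x,
      wLabel e₂ (wLabel e s.inp t.inp) u.inp⟩ :: L) =
      hG.head s.out _ (s.deg + t.deg + u.deg - 2)
        (wLabel e₂ (wLabel e s.inp t.inp) u.inp) L x := fun x => rfl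
  simp only [h6, map_neg, map_smul]

lemma vtx_par (hμ : μ.IsAssoc) (hG : Multi G) (s t u : Vtx V) {i j : Fin s.ar} (hij : i ≠ j) (L :
    List (Vtx V)) : G (μ.vtx (μ.vtx s t i) u (μ.lowerInput s t i ⟨j, hij.symm⟩) :: L) = - (sgn K
    (t.deg * u.deg) • G (μ.vtx (μ.vtx s u j) t (μ.lowerInput s u j ⟨i, hij⟩) :: L)) := by
  set e : Wire i t.ar _ := equivFin _ with he
  set f : Wire j u.ar _ := equivFin _ with hf
  set e₂ : Wire (e (inl ⟨j, hij.symm⟩)) u.ar _ := equivFin _ with he₂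
  obtain ⟨f₂, hf₂⟩ := Wire.exists_par hij e e₂ f
  have h1 := e.fits_wireLabel s.inp t.inp
  have h2 := e₂.fits_wireLabel (wLabel e s.inp t.inp) u.inp
  have h3 := f.fits_wireLabel s.inp u.inp
  have e1 : μ.vtx (μ.vtx s t i) u (μ.lowerInput s t i ⟨j, hij.symm⟩) =
      ⟨s.out, _, s.deg + t.deg + u.deg - 2,
      μ.app _ e₂ (by omega) (μ.app i e (r := s.deg + t.deg - 1) (by omega) s.lab t.lab) u.lab,
      wLabel e₂ (wLabel e s.inp t.inp) u.inp⟩ :=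
    μ.vtxVia_eq (μ.vtx s t i) u (μ.lowerInput s t i ⟨j, hij.symm⟩) e₂
      (by change _ = s.deg + t.deg - 1 + u.deg; omega) h2
  have e2 : μ.vtxVia (μ.vtx s u j) t (μ.lowerInput s u j ⟨i, hij⟩) f₂ =
      ⟨s.out, _, s.deg + t.deg + u.deg - 2,
      μ.app _ f₂ (by omega) (μ.app j f (r := s.deg + u.deg - 1) (by omega) s.lab u.lab) t.lab,
      wLabel e₂ (wLabel e s.inp t.inp) u.inp⟩ := by
    refine μ.vtxVia_eq (μ.vtx s u j) t (μ.lowerInput s u j ⟨i, hij⟩) f₂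
      (by change _ = s.deg + u.deg - 1 + t.deg; omega) ⟨?_, fun d => ?_⟩
    · rintro ⟨d, hd⟩
      change _ = wLabel f s.inp u.inp d
      obtain ⟨d, rfl⟩ := f.surjective d
      rcases d with ⟨d, hj⟩ | d
      · have hi : d ≠ i := fun h => hd (by subst h; rfl)
        refine Eq.trans (congrArg _ (hf₂.1 d hi hj).symm) ?_
        rw [h2.1, h3.1]
        exact h1.1 _
      · refine Eq.trans (congrArg _ (hf₂.2.2 d).symm) ?_
        rw [h2.2, h3.2]
    · refine Eq.trans (congrArg _ (hf₂.2.1 d).symm) ?_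
      rw [h2.1]
      exact h1.2 _
  have e3 : G (μ.vtx (μ.vtx s u j) t (μ.lowerInput s u j ⟨i, hij⟩) :: L) =
      G (μ.vtxVia (μ.vtx s u j) t (μ.lowerInput s u j ⟨i, hij⟩) f₂ :: L) :=
    μ.vtxVia_congr hG _ _ _ _ _ _
  rw [e3, e1, e2, hμ.par hij e e₂ f f₂ hf₂ _ _ (pr := s.deg + u.deg - 1) (by omega) (by omega)]
  have h6 : ∀ x, G (⟨s.out, _, s.deg + t.deg + u.deg - 2, x,
      wLabel e₂ (wLabel e s.inp t.inp) u.inp⟩ :: L) =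
      hG.head s.out _ (s.deg + t.deg + u.deg - 2)
        (wLabel e₂ (wLabel e s.inp t.inp) u.inp) L x := fun x => rfl
  simp only [h6, map_neg, map_smul]

lemma edgeSum_vtx (G : List (Vtx V) → M) (s t u : Vtx V) (i : Fin s.ar) (L : List (Vtx V)) :
    μ.edgeSum G (μ.vtx s t i) u L = (∑ j : {j : Fin s.ar // j ≠ i}, if s.inp j.1 = u.out then G
    (μ.vtx (μ.vtx s t i) u (μ.lowerInput s t i j) :: L) else 0) + ∑ b, if t.inp b = u.out then G
    (μ.vtx (μ.vtx s t i) u (μ.upperInput s t i b) :: L) else 0 := by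
  set e : Wire i t.ar _ := equivFin _ with he
  have h1 := e.fits_wireLabel s.inp t.inp
  rw [← sum_sum_type (fun x : {j : Fin s.ar // j ≠ i} ⊕ Fin t.ar =>
    if (μ.vtx s t i).inp (e x) = u.out then G (μ.vtx (μ.vtx s t i) u (e x) :: L) else 0) |>.trans
      (congrArg₂ (· + ·) (sum_congr rfl fun j _ => ?_)
        (sum_congr rfl fun b _ => ?_))]
  · exact (Equiv.sum_comp e fun x => if (μ.vtx s t i).inp x = u.out then
      G (μ.vtx (μ.vtx s t i) u x :: L) else 0).symm
  · exact if_congr (by rw [← h1.1 j]; rfl) rfl rfl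
  · exact if_congr (by rw [← h1.2 b]; rfl) rfl rfl

lemma sum_ite_smul {ι : Type*} [Fintype ι] (P : ι → Prop) [DecidablePred P] (a : K) (f : ι → M) : (∑
    i, if P i then a • f i else 0) = a • ∑ i, if P i then f i else 0 := by
  simp only [smul_sum, smul_ite, smul_zero]

lemma sum_ite_sum_comm {ι ι' : Type*} [Fintype ι] [Fintype ι'] (P : ι → Prop) (Q : ι' → Prop)
    [DecidablePred P] [DecidablePred Q] (f : ι → ι' → M) : (∑ i, if P i then ∑ j, if Q j then f i j
    else 0 else 0) = ∑ j, if Q j then ∑ i, if P i then f i j else 0 else 0 := by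
  simp only [← Finset.sum_filter]
  exact Finset.sum_comm

lemma pickSum_pairs_eq_zero [CharZero K] (F : Vtx V → Vtx V → Vtx V → Vtx V → List (Vtx V) → M) (L :
    List (Vtx V)) (h : ∀ s t w z L', F s t w z L' = - (sgn K ((s.deg + t.deg) * (w.deg + z.deg)) • F
    w z s t L')) : pickSum (fun s L₁ => pickSum (fun t L₂ => pickSum (fun w L₃ => pickSum (fun z L₄
    => F s t w z L₄) L₃) L₂) L₁) L = 0 := by
  set S := pickSum (fun s L₁ => pickSum (fun t L₂ => pickSum (fun w L₃ =>
      pickSum (fun z L₄ => F s t w z L₄) L₃) L₂) L₁) L with hS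
  have h1 : S = - S := by
    conv_lhs => rw [hS]
    simp only [pickSum_rotate (fun t w z L₄ => F _ t w z L₄)]
    rw [pickSum_rotate (fun s w z L₃ => pickSum (fun t L₄ =>
      sgn K (w.deg * t.deg + z.deg * t.deg) • F s t w z L₄) L₃), hS, ← pickSum_neg]
    refine pick_congr fun w L₁ _ => ?_
    rw [← pickSum_neg]
    refine pick_congr fun z L₂ _ => ?_
    rw [← pickSum_neg]
    refine pick_congr fun s L₃ _ => ?_
    rw [← pickSum_neg, ← pickSum_smul]
    refine pick_congr fun t L₄ _ => ?_
    rw [h w z s t, neg_neg, smul_smul, ← sgn_add]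
    congr 1
    exact sgn_congr ⟨0, by ring⟩
  have h3 : (2 : K) • S = 0 := by
    rw [two_smul]
    nth_rw 1 [h1]
    exact neg_add_cancel _
  exact (smul_eq_zero.1 h3).resolve_left two_ne_zero

open scoped Classical in
lemma parSum_antisymm (hμ : μ.IsAssoc) (hG : Multi G) (s t u : Vtx V) (L : List (Vtx V)) : (∑ i, if
    s.inp i = t.out then ∑ j : {j : Fin s.ar // j ≠ i}, (if s.inp j.1 = u.out then G (μ.vtx (μ.vtx s
    t i) u (μ.lowerInput s t i j) :: L) else 0) else 0) = - (sgn K (t.deg * u.deg) • ∑ i, if s.inp i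
    = u.out then ∑ j : {j : Fin s.ar // j ≠ i}, (if s.inp j.1 = t.out then G (μ.vtx (μ.vtx s u i) t
    (μ.lowerInput s u i j) :: L) else 0) else 0) := by
  have e : ∀ t u : Vtx V,
      (∑ i, if s.inp i = t.out then ∑ j : {j : Fin s.ar // j ≠ i}, (if s.inp j.1 = u.out then
        G (μ.vtx (μ.vtx s t i) u (μ.lowerInput s t i j) :: L) else 0) else 0) =
      ∑ i, ∑ j, if h : j ≠ i then if s.inp i = t.out ∧ s.inp j = u.out then
        G (μ.vtx (μ.vtx s t i) u (μ.lowerInput s t i ⟨j, h⟩) :: L) else 0 else 0 := by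
    intro t u
    refine sum_congr rfl fun i _ => ?_
    rw [Fintype.sum_eq_add_sum_subtype_ne _ i, dif_neg (by simp), zero_add]
    by_cases h : s.inp i = t.out
    · rw [if_pos h]
      refine sum_congr rfl fun j _ => ?_
      rw [dif_pos j.2]
      exact if_congr (by simp [h]) rfl rfl
    · rw [if_neg h]
      exact (sum_eq_zero fun j _ => by rw [dif_pos j.2, if_neg fun h' => h h'.1]).symm
  rw [e t u, e u t, Finset.sum_comm, smul_sum, ← Finset.sum_neg_distrib]
  refine sum_congr rfl fun j _ => ?_
  rw [smul_sum, ← Finset.sum_neg_distrib]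
  refine sum_congr rfl fun i _ => ?_
  by_cases hij : i = j
  · simp [hij]
  · rw [dif_pos (Ne.symm hij), dif_pos hij]
    by_cases h : s.inp i = t.out ∧ s.inp j = u.out
    · rw [if_pos h, if_pos h.symm]
      exact vtx_par hμ hG s t u hij L
    · rw [if_neg h, if_neg fun h' => h h'.symm]
      simp

/-- The sum of the contractions of two edges is zero, if the partial compositions have degree `-1`
and are associative. -/
lemma con_con [CharZero K] (hμ : μ.IsAssoc) {r : ℤ} (hq : q + 1 = p) (x : PTree V n p) : (μ.con
    (μ.con x : PTree V n q) : PTree V n r) = 0 := by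
  induction x using ptree_induction with
  | zero => simp
  | add x x' hx hx' => simp only [map_add, hx, hx', add_zero]
  | smul a x hx => simp only [map_smul, hx, smul_zero]
  | tree L ρ l hL hp =>
  set G : List (Vtx V) → PTree V n r := fun L => ptree L ρ l with hG'
  have hG : Multi G := multi_ptree r ρ l
  have key : (μ.con (μ.con (ptree L ρ l : PTree V n p) : PTree V n q) : PTree V n r) =
      pickSum (fun s L₁ => pickSum (fun t L₂ => pickSum (fun u L₃ =>
        ∑ i, if s.inp i = t.out then ∑ j : {j : Fin s.ar // j ≠ i}, (if s.inp j.1 = u.out then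
        G (μ.vtx (μ.vtx s t i) u (μ.lowerInput s t i j) :: L₃) else 0) else 0) L₂) L₁) L +
      pickSum (fun s L₁ => pickSum (fun t L₂ => pickSum (fun u L₃ =>
        ∑ i, if s.inp i = t.out then ∑ b, (if t.inp b = u.out then
          G (μ.vtx (μ.vtx s t i) u (μ.upperInput s t i b) :: L₃) else 0) else 0) L₂) L₁) L +
      pickSum (fun s L₁ => pickSum (fun t L₂ => pickSum (fun u L₃ =>
        ∑ i, if s.inp i = t.out then sgn K ((s.deg + t.deg - 1) * u.deg) •
          μ.edgeSum G u (μ.vtx s t i) L₃ else 0) L₂) L₁) L +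
      pickSum (fun s L₁ => pickSum (fun t L₂ => pickSum (fun w L₃ => pickSum (fun z L₄ =>
        ∑ i, if s.inp i = t.out then
          sgn K ((s.deg + t.deg - 1) * w.deg + (s.deg + t.deg - 1) * z.deg) •
          μ.edgeSum G w z (μ.vtx s t i :: L₄) else 0) L₃) L₂) L₁) L := by
    rw [con_ptree hL hp, conSum, pickSum_map]
    rw [← pickSum_add, ← pickSum_add, ← pickSum_add]
    refine pick_congr fun s L₁ hs => ?_
    rw [pickSum_map, ← pickSum_add, ← pickSum_add, ← pickSum_add]
    refine pick_congr fun t L₂ ht => ?_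
    have hst := (ht.cons s).trans hs
    rw [pickSum_sum, pickSum_sum, pickSum_sum]
    have e : pickSum (fun w L₃ => pickSum (fun z L₄ =>
        ∑ i, if s.inp i = t.out then
          sgn K ((s.deg + t.deg - 1) * w.deg + (s.deg + t.deg - 1) * z.deg) •
          μ.edgeSum G w z (μ.vtx s t i :: L₄) else 0) L₃) L₂ =
        ∑ i, pickSum (fun w L₃ => pickSum (fun z L₄ => if s.inp i = t.out then
          sgn K ((s.deg + t.deg - 1) * w.deg + (s.deg + t.deg - 1) * z.deg) •
          μ.edgeSum G w z (μ.vtx s t i :: L₄) else 0) L₃) L₂ := by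
      rw [← pickSum_sum]
      exact pick_congr fun w L₃ _ => pickSum_sum _ _ L₃
    rw [e]
    rw [← sum_add_distrib, ← sum_add_distrib, ← sum_add_distrib, edgeSum,
      map_sum]
    refine sum_congr rfl fun i _ => ?_
    split_ifs with hi
    · rw [con_ptree (isPTree_vtx hi ((IsPTree.perm hst).2 hL))
        (by rw [deg_vtx, deg_perm hst]; omega), conSum_cons]
      simp only [edgeSum_vtx, pickSum_add]
      rfl
    · rw [pick_eq_zero fun _ _ _ => rfl]
      simp [pick_eq_zero]
  rw [key]
  have hpar : pickSum (fun s L₁ => pickSum (fun t L₂ => pickSum (fun u L₃ =>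
        ∑ i, if s.inp i = t.out then ∑ j : {j : Fin s.ar // j ≠ i}, (if s.inp j.1 = u.out then
        G (μ.vtx (μ.vtx s t i) u (μ.lowerInput s t i j) :: L₃) else 0) else 0) L₂) L₁) L = 0 :=
    pick_eq_zero fun s L₁ _ => pickSum_pickSum_eq_zero _ _ fun t u L₃ _ =>
      parSum_antisymm hμ hG s t u L₃
  have hseq : pickSum (fun s L₁ => pickSum (fun t L₂ => pickSum (fun u L₃ =>
        ∑ i, if s.inp i = t.out then ∑ b, (if t.inp b = u.out then
          G (μ.vtx (μ.vtx s t i) u (μ.upperInput s t i b) :: L₃) else 0) else 0) L₂) L₁) L =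
      - pickSum (fun s L₁ => pickSum (fun t L₂ => pickSum (fun u L₃ =>
        ∑ i, if s.inp i = t.out then sgn K ((s.deg + t.deg - 1) * u.deg) •
          μ.edgeSum G u (μ.vtx s t i) L₃ else 0) L₂) L₁) L := by
    rw [pickSum_rotate, ← pickSum_neg]
    refine pick_congr fun s L₁ _ => ?_
    rw [← pickSum_neg]
    refine pick_congr fun t L₂ _ => ?_
    rw [← pickSum_neg]
    refine pick_congr fun u L₃ _ => ?_
    have e : ∀ i b, G (μ.vtx (μ.vtx u s i) t (μ.upperInput u s i b) :: L₃) =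
        (- sgn K u.deg) • G (μ.vtx u (μ.vtx s t b) i :: L₃) := fun i b =>
      (vtx_seq hμ hG _ _ _ _ _ _).trans (neg_smul _ _).symm
    simp only [e, edgeSum, sum_ite_smul, smul_smul]
    rw [sum_ite_sum_comm, ← neg_smul]
    refine congrArg₂ (· • ·) ?_ rfl
    rw [mul_neg, ← sgn_add, neg_inj]
    exact sgn_congr ⟨u.deg, by ring⟩
  have hdis : pickSum (fun s L₁ => pickSum (fun t L₂ => pickSum (fun w L₃ => pickSum (fun z L₄ =>
        ∑ i, if s.inp i = t.out then
          sgn K ((s.deg + t.deg - 1) * w.deg + (s.deg + t.deg - 1) * z.deg) •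
          μ.edgeSum G w z (μ.vtx s t i :: L₄) else 0) L₃) L₂) L₁) L = 0 := by
    refine pickSum_pairs_eq_zero _ _ fun s t w z L₄ => ?_
    have e : ∀ i j, G (μ.vtx w z j :: μ.vtx s t i :: L₄) =
        sgn K ((w.deg + z.deg - 1) * (s.deg + t.deg - 1)) • G (μ.vtx s t i :: μ.vtx w z j :: L₄) :=
      fun i j => hG.koszul [] L₄ _ _
    simp only [edgeSum, e, sum_ite_smul, smul_smul]
    rw [sum_ite_sum_comm, ← neg_smul]
    refine congrArg₂ (· • ·) ?_ rfl
    rw [← sgn_add, ← sgn_add, ← neg_one_mul, ← sgn_one, ← sgn_add]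
    exact sgn_congr ⟨-(w.deg + z.deg), by ring⟩
  rw [hpar, hseq, hdis, zero_add, add_zero, neg_add_cancel]

end LabMul

end ConCon

/-! ### Marked labels -/

/-- The identification of components of equal degrees. -/
def SMod.degCast (V : SMod.{u, v} K) (h : p = q) : V.obj n p →ₗ[K] V.obj n q :=
  h ▸ LinearMap.id

@[simp] lemma SMod.degCast_rfl (V : SMod.{u, v} K) {n : ℕ} {p : ℤ} (h : p = p) (x : V.obj n p) :
    V.degCast h x = x := rfl

/-- The graded `𝕊`-module `V ⊕ s⁻¹V`. A label in `V` is unmarked, and a label in `s⁻¹V` is marked. -/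
def marked (V : SMod.{u, v} K) : SMod.{u, v} K where
  obj n p := V.obj n p × V.obj n (p + 1)
  act σ := LinearMap.prodMap (V.act σ) (V.act σ)
  act_one x := Prod.ext (V.act_one x.1) (V.act_one x.2)
  act_mul σ τ x := Prod.ext (V.act_mul σ τ x.1) (V.act_mul σ τ x.2)

/-- The unmarked part of a label. -/
def markedFst : (marked V).obj n p →ₗ[K] V.obj n p := LinearMap.fst K _ _

/-- The marked part of a label. -/
def markedSnd : (marked V).obj n p →ₗ[K] V.obj n (p + 1) := LinearMap.snd K _ _

/-- The label with given unmarked and marked parts, as a linear function. -/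
def markedMk {M : Type*} [AddCommGroup M] [Module K M] (f : M →ₗ[K] V.obj n p) (g : M →ₗ[K] V.obj n
    (p + 1)) : M →ₗ[K] (marked V).obj n p := LinearMap.prod f g

@[simp] lemma markedFst_mk {M : Type*} [AddCommGroup M] [Module K M] {n : ℕ} {p : ℤ} (f : M →ₗ[K]
    V.obj n p) (g : M →ₗ[K] V.obj n (p + 1)) (x : M) : markedFst (markedMk f g x) = f x := rfl

@[simp] lemma markedSnd_mk {M : Type*} [AddCommGroup M] [Module K M] {n : ℕ} {p : ℤ} (f : M →ₗ[K]
    V.obj n p) (g : M →ₗ[K] V.obj n (p + 1)) (x : M) : markedSnd (markedMk f g x) = g x := rfl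

lemma marked_ext {x y : (marked V).obj n p} (h : markedFst x = markedFst y) (h' : markedSnd x =
    markedSnd y) : x = y := Prod.ext h h'

@[simp] lemma markedFst_act {n : ℕ} {p : ℤ} (σ : Perm (Fin n)) (x : (marked V).obj n p) : markedFst
    ((marked V).act σ x) = V.act σ (markedFst x) := rfl

@[simp] lemma markedSnd_act {n : ℕ} {p : ℤ} (σ : Perm (Fin n)) (x : (marked V).obj n p) : markedSnd
    ((marked V).act σ x) = V.act σ (markedSnd x) := rfl

/-- The operator that marks a label. -/
def markMap (V : SMod.{u, v} K) : LabMap (marked V) (marked V) 1 where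
  app h := markedMk 0 (V.degCast h.symm ∘ₗ markedFst)
  app_act h σ x := by subst h; exact marked_ext (by simp) (by simp)

/-- The operator that removes the mark of a label. -/
def unmarkMap (V : SMod.{u, v} K) : LabMap (marked V) (marked V) (-1) where
  app h := markedMk (V.degCast (by omega) ∘ₗ markedSnd) 0
  app_act {n p q} h σ x := by
    obtain rfl : q = p + 1 := by omega
    exact marked_ext (by simp) (by simp)

/-- The zero operator. -/
def LabMap.zero (V U : SMod.{u, v} K) (c : ℤ) : LabMap V U c where
  app _ := 0
  app_act _ _ _ := by simp

@[simp] lemma LabMap.zero_app {V U : SMod.{u, v} K} {c : ℤ} {n : ℕ} {p q : ℤ} (h : q + c = p) (x :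
    V.obj n p) : (LabMap.zero V U c).app h x = 0 := rfl

/-- The identity operator. -/
def LabMap.ident (V : SMod.{u, v} K) : LabMap V V 0 where
  app h := V.degCast (by omega)
  app_act {n p q} h σ x := by
    obtain rfl : q = p := by omega
    rfl

/-- The operator `f` on unmarked and `-f` on marked labels, plus the operator that marks a label. -/
def markedLin (f : LabMap V V 1) : LabMap (marked V) (marked V) 1 where
  app {n p q} h := markedMk (f.app h ∘ₗ markedFst)
    (V.degCast h.symm ∘ₗ markedFst - f.app (by omega) ∘ₗ markedSnd)
  app_act {n p q} h σ x := by
    subst h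
    exact marked_ext (by simp [f.app_act]) (by simp [f.app_act])

/-- The partial compositions on marked labels that are induced by partial compositions on labels: the
mark of the lower label is kept, and the composite is zero if the upper label is marked. -/
def markedMul {c : ℤ} (μ : LabMul V c) : LabMul (marked V) c where
  app {m n k} i e {p q r} h := LinearMap.mk₂ K
    (fun x y => markedMk (LinearMap.id.comp ((μ.app i e h).flip (markedFst y) ∘ₗ markedFst))
      (sgn K c • (μ.app i e (r := r + 1) (p := p + 1) (by omega)).flip (markedFst y) ∘ₗ markedSnd) x)
    (fun x x' y => map_add _ _ _)
    (fun a x y => map_smul _ _ _)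
    (fun x y y' => marked_ext (by simp) (by simp))
    (fun a x y => marked_ext (by simp) (by simp [smul_comm a]))
  app_act {m n k i} σ τ ρ e e' he {p q r} h x y := by
    refine marked_ext (μ.app_act σ τ ρ e e' he _ _ _) ?_
    refine Eq.trans ?_ (map_smul (V.act ρ) _ _).symm
    exact congrArg (sgn K c • ·) (μ.app_act σ τ ρ e e' he _ (markedSnd x) (markedFst y))

section

variable (x : (marked V).obj n p)

@[simp] lemma markedFst_mark (h : q + 1 = p) : markedFst ((markMap V).app h x) = 0 := rfl

@[simp] lemma markedSnd_mark (h : q + 1 = p) : markedSnd ((markMap V).app h x) = V.degCast h.symm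
    (markedFst x) := rfl

@[simp] lemma markedFst_unmark (h : q + -1 = p) : markedFst ((unmarkMap V).app h x) = V.degCast (by
    omega) (markedSnd x) := rfl

@[simp] lemma markedSnd_unmark (h : q + -1 = p) : markedSnd ((unmarkMap V).app h x) = 0 := rfl

@[simp] lemma markedFst_lin (f : LabMap V V 1) (h : q + 1 = p) : markedFst ((markedLin f).app h x) =
    f.app h (markedFst x) := rfl

@[simp] lemma markedSnd_lin (f : LabMap V V 1) (h : q + 1 = p) : markedSnd ((markedLin f).app h x) =
    V.degCast h.symm (markedFst x) - f.app (by omega) (markedSnd x) := rfl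

@[simp] lemma markedFst_mul {c : ℤ} (μ : LabMul V c) {m k : ℕ} (i : Fin n) (e : Wire i m k) {r : ℤ}
    (h : r + c = p + q) (y : (marked V).obj m q) : markedFst ((markedMul μ).app i e h x y) = μ.app i
    e h (markedFst x) (markedFst y) := rfl

@[simp] lemma markedSnd_mul {c : ℤ} (μ : LabMul V c) {m k : ℕ} (i : Fin n) (e : Wire i m k) {r : ℤ}
    (h : r + c = p + q) (y : (marked V).obj m q) : markedSnd ((markedMul μ).app i e h x y) = sgn K c
    • μ.app i e (by omega) (markedSnd x) (markedFst y) := rfl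

@[simp] lemma markedFst_ident (h : q + 0 = p) : markedFst ((LabMap.ident (marked V)).app h x) =
    V.degCast (by omega) (markedFst x) := by
  obtain rfl : q = p := by omega
  rfl

@[simp] lemma markedSnd_ident (h : q + 0 = p) : markedSnd ((LabMap.ident (marked V)).app h x) =
    V.degCast (by omega) (markedSnd x) := by
  obtain rfl : q = p := by omega
  rfl

end

/-- The zero operation. -/
def LabMul.zero (V : SMod.{u, v} K) (c : ℤ) : LabMul V c where
  app _ _ _ _ _ _ := 0
  app_act _ _ _ _ _ _ _ _ _ _ _ _ := by simp

@[simp] lemma LabMul.zero_app {c : ℤ} {m n k : ℕ} (i : Fin m) (e : Wire i n k) {p q r : ℤ} (h : r +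
    c = p + q) (x : V.obj m p) (y : V.obj n q) : (LabMul.zero V c).app i e h x y = 0 := rfl

lemma markedMul_isAssoc {μ : LabMul V 1} (hμ : μ.IsAssoc) : (markedMul μ).IsAssoc where
  seq {m n k l s t i j} e e₂ f f₂ he {p q r pq qr pqr} h h₂ g g₂ x y z := by
    refine marked_ext ?_ ?_
    · simpa using hμ.seq e e₂ f f₂ he _ _ _ _ _ _ _
    · simp only [markedSnd_mul, markedFst_mul, map_smul, map_neg, LinearMap.smul_apply,
        sgn_smul_smul]
      rw [hμ.seq e e₂ f f₂ he _ _ (qr := qr) (by omega) (by omega), sgn_add, smul_smul]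
  par {m n k l s t i j} hij e e₂ f f₂ he {p q r pq pr pqr} h h₂ g g₂ x y z := by
    refine marked_ext ?_ ?_
    · simpa using hμ.par hij e e₂ f f₂ he _ _ _ _ _ _ _
    · simp only [markedSnd_mul, markedFst_mul, map_smul, map_neg, LinearMap.smul_apply,
        sgn_smul_smul]
      rw [hμ.par hij e e₂ f f₂ he _ _ (pr := pr + 1) (by omega) (by omega)]

/-! ### The operators on the labels of the bar construction -/

lemma SMod.transport_refl (V : SMod.{u, v} K) (h : p = p) (x : V.obj n p) : V.transport (Equiv.refl
    _) h x = x := V.act_one x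

@[simp] lemma desuspPart_susp {n : ℕ} {p q : ℤ} (h h' : q + 1 = p) (x : P.obj n q) : desuspPart h
    (susp h' x) = x := by
  obtain rfl : q = p - 1 := by omega
  change P.transport _ _ (P.transport _ _ x) = x
  rw [SMod.transport_refl, SMod.transport_refl]

@[simp] lemma vCoeff_susp {n : ℕ} {p q : ℤ} (h : q + 1 = p) (x : P.obj n q) : vCoeff (susp h x) = 0
    := rfl

lemma barGen_ext (h : q + 1 = p) {x y : (barGen P).obj n p} (h₁ : desuspPart h x = desuspPart h y)
    (h₂ : vCoeff x = vCoeff y) : x = y := by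
  obtain rfl : q = p - 1 := by omega
  change P.transport _ _ x.1 = P.transport _ _ y.1 at h₁
  rw [SMod.transport_refl, SMod.transport_refl] at h₁
  exact Prod.ext h₁ (Subtype.ext h₂)

lemma vCoeff_eq_zero (h : ¬ (n = 1 ∧ p = 2)) (x : (barGen P).obj n p) : vCoeff x = 0 := by
  have := x.2.2
  simp only [vPart, if_neg h, Submodule.mem_bot] at this
  exact this

lemma GrOperad.unitAt_one (Q : GrOperad.{u, v} K) (c : K) : Q.unitAt 1 0 c = c • Q.one := by
  rw [GrOperad.unitAt, dif_pos ⟨rfl, rfl⟩]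
  exact Q.act_one _

lemma GrOperad.unitAt_eq_zero (Q : GrOperad.{u, v} K) (h : ¬ (1 = n ∧ 0 = p)) (c : K) : Q.unitAt n p
    c = 0 := by
  rw [GrOperad.unitAt, dif_neg h]
  rfl

lemma DerOperad.d_one (P : DerOperad.{u, v} K) (h : q + 1 = 0) : P.d h P.one = 0 := by
  obtain rfl : q = -1 := by omega
  let e : Wire (0 : Fin 1) 1 1 := ⟨fun _ => 0, fun _ => inr 0, fun x => by
    rcases x with ⟨x, hx⟩ | x
    · exact (hx (Subsingleton.elim _ _)).elim
    · exact congrArg inr (Subsingleton.elim _ _), fun x => Subsingleton.elim _ _⟩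
  have e1 := fun {p : ℤ} => P.one_comp e (fun b => Subsingleton.elim _ _) (p := p)
  have e2 := fun {p : ℤ} => P.comp_one 0 e (fun b => Subsingleton.elim _ _) rfl (p := p)
  have h1 := P.d_comp 0 e (add_zero 0) h h h (by omega) (by omega) P.one P.one
  rw [e1, e1, e2, sgn_zero, one_smul] at h1
  simpa using h1

lemma DerOperad.d_unitAt (P : DerOperad.{u, v} K) (h : q + 1 = p) (c : K) : P.d h (P.unitAt n p c) =
    0 := by
  by_cases h' : 1 = n ∧ 0 = p
  · obtain ⟨rfl, rfl⟩ := h'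
    rw [GrOperad.unitAt_one, map_smul, P.d_one, smul_zero]
  · rw [GrOperad.unitAt_eq_zero _ h', map_zero]

variable (P) in
/-- The operator `sx ↦ - s dx`, `v ↦ s 1` on labels. -/
def linMap : LabMap (barGen P) (barGen P) 1 where
  app {n p q} h := susp (q := p - 2) (by omega) ∘ₗ
    (- (P.d (p := p - 1) (by omega) ∘ₗ desuspPart (by omega)) + P.unitAt n (p - 2) ∘ₗ vCoeff)
  app_act {n p q} h σ x := by
    obtain rfl : q = p - 1 := by omega
    exact barLin_act σ x

lemma linMap_app {r : ℤ} (h : q + 1 = p) (h' : r + 1 = q) (x : (barGen P).obj n p) : (linMap P).app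
    h x = susp h' (- P.d h' (desuspPart h x) + P.unitAt n r (vCoeff x)) := by
  obtain rfl : q = p - 1 := by omega
  obtain rfl : r = p - 2 := by omega
  rfl

variable (P) in
/-- The operation `sx ⊗ sy ↦ (-1)^|x| s (x ∘ᵢ y)` on labels. -/
def mulMap : LabMul (barGen P) 1 where
  app {m n k} i e {p q r} h := sgn K (p - 1) •
    ((P.comp i e (show p - 1 + (q - 1) = p + q - 2 by omega)).compl₁₂ (desuspPart (by omega))
      (desuspPart (by omega))).compr₂ (susp (by omega))
  app_act {m n k i} σ τ ρ e e' he {p q r} h x y := by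
    obtain rfl : r = p + q - 1 := by omega
    exact barMul_act σ τ ρ e e' he x y

lemma mulMap_app (i : Fin m) (e : Wire i n k) {r p' q' r' : ℤ} (h : r + 1 = p + q) (hp : p' + 1 = p)
    (hq : q' + 1 = q) (hr : r' + 1 = r) (h' : p' + q' = r') (x : (barGen P).obj m p) (y : (barGen
    P).obj n q) : (mulMap P).app i e h x y = sgn K p' • susp hr (P.comp i e h' (desuspPart hp x)
    (desuspPart hq y)) := by
  obtain rfl : p' = p - 1 := by omega
  obtain rfl : q' = q - 1 := by omega
  obtain rfl : r' = p + q - 2 := by omega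
  rfl

variable (P) in
/-- The curvature of the operation on labels: `v` acts on the lower and the upper side as a unit, up
to sign. -/
def curvMap : LabMul (barGen P) 2 where
  app {m n k} i e {p q r} h :=
    ((P.comp i e (show p - 2 + (q - 1) = r - 1 by omega)).compl₁₂ (P.unitAt m (p - 2) ∘ₗ vCoeff)
      (desuspPart (by omega))).compr₂ (susp (by omega)) -
    ((P.comp i e (show p - 1 + (q - 2) = r - 1 by omega)).compl₁₂ (desuspPart (by omega))
      (P.unitAt n (q - 2) ∘ₗ vCoeff)).compr₂ (susp (by omega))
  app_act {m n k i} σ τ ρ e e' he {p q r} h x y := by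
    simp only [LinearMap.sub_apply, LinearMap.compr₂_apply, LinearMap.compl₁₂_apply,
      comp_apply, desuspPart_act, vCoeff_act, map_sub]
    rw [← P.act_unitAt σ (vCoeff x), P.equivariance σ τ ρ e e' he,
      ← P.act_unitAt τ (vCoeff y), P.equivariance σ τ ρ e e' he, susp_act, susp_act, P.act_unitAt,
      P.act_unitAt]

lemma curvMap_app (i : Fin m) (e : Wire i n k) {r p' q' p'' q'' r' : ℤ} (h : r + 2 = p + q) (hp : p'
    + 1 = p) (hq : q' + 1 = q) (hr : r' + 1 = r) (hp' : p'' + 1 = p') (hq' : q'' + 1 = q') (h₁ : p''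
    + q' = r') (h₂ : p' + q'' = r') (x : (barGen P).obj m p) (y : (barGen P).obj n q) : (curvMap
    P).app i e h x y = susp hr (P.comp i e h₁ (P.unitAt m p'' (vCoeff x)) (desuspPart hq y) - P.comp
    i e h₂ (desuspPart hp x) (P.unitAt n q'' (vCoeff y))) := by
  obtain rfl : p' = p - 1 := by omega
  obtain rfl : p'' = p - 2 := by omega
  obtain rfl : q' = q - 1 := by omega
  obtain rfl : q'' = q - 2 := by omega
  obtain rfl : r' = r - 1 := by omega
  rw [map_sub]
  rfl

lemma linMap_linMap (hP : P.SquareZero) {r : ℤ} (h : q + 1 = p) (h' : r + 1 = q) (x : (barGen P).obj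
    n p) : (linMap P).app h' ((linMap P).app h x) = 0 := by
  rw [linMap_app h h' x, linMap_app h' (sub_add_cancel r 1), desuspPart_susp, vCoeff_susp,
    (P.d _).map_add, (P.d _).map_neg, hP, P.d_unitAt]
  simp

lemma mulMap_isAssoc : (mulMap P).IsAssoc where
  seq {m n k l s t i j} e e₂ f f₂ he {p q r pq qr pqr} h h₂ g g₂ x y z := by
    rw [mulMap_app _ e h (sub_add_cancel p 1) (sub_add_cancel q 1) (sub_add_cancel pq 1) (by omega),
      mulMap_app _ e₂ h₂ (sub_add_cancel pq 1) (sub_add_cancel r 1) (sub_add_cancel pqr 1)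
        (by omega),
      mulMap_app _ f g (sub_add_cancel q 1) (sub_add_cancel r 1) (sub_add_cancel qr 1) (by omega),
      mulMap_app _ f₂ g₂ (sub_add_cancel p 1) (sub_add_cancel qr 1) (sub_add_cancel pqr 1)
        (by omega)]
    simp only [map_smul, desuspPart_susp, LinearMap.smul_apply]
    rw [P.seq e e₂ f f₂ he _ _ (qr := qr - 1) (by omega) (by omega)]
    simp only [smul_smul, ← neg_smul, ← sgn_add]
    congr 1
    rw [← neg_one_mul, ← sgn_one, ← sgn_add]
    exact sgn_congr (by rw [show pq = p + q - 1 by omega]; exact ⟨-1, by ring⟩)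
  par {m n k l s t i j} hij e e₂ f f₂ he {p q r pq pr pqr} h h₂ g g₂ x y z := by
    rw [mulMap_app _ e h (sub_add_cancel p 1) (sub_add_cancel q 1) (sub_add_cancel pq 1) (by omega),
      mulMap_app _ e₂ h₂ (sub_add_cancel pq 1) (sub_add_cancel r 1) (sub_add_cancel pqr 1)
        (by omega),
      mulMap_app _ f g (sub_add_cancel p 1) (sub_add_cancel r 1) (sub_add_cancel pr 1) (by omega),
      mulMap_app _ f₂ g₂ (sub_add_cancel pr 1) (sub_add_cancel q 1) (sub_add_cancel pqr 1)
        (by omega)]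
    simp only [map_smul, desuspPart_susp, LinearMap.smul_apply]
    rw [P.par hij e e₂ f f₂ he _ _ (pr := pr - 1) (by omega) (by omega)]
    simp only [map_smul, smul_smul, ← neg_smul, ← sgn_add]
    congr 1
    rw [← neg_one_mul, ← sgn_one, ← sgn_add]
    exact sgn_congr (by
      rw [show pq = p + q - 1 by omega, show pr = p + r - 1 by omega]; exact ⟨-r, by ring⟩)

/-- The failure of `linMap` to be a derivation of `mulMap` is the curvature. -/
lemma linMap_mulMap (i : Fin m) (e : Wire i n k) {r p' q' s : ℤ} (h : r + 1 = p + q) (hp : p' + 1 =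
    p) (hq : q' + 1 = q) (hr : s + 1 = r) (h₁ : s + 1 = p' + q) (h₂ : s + 1 = p + q') (h₃ : s + 2 =
    p + q) (x : (barGen P).obj m p) (y : (barGen P).obj n q) : (linMap P).app hr ((mulMap P).app i e
    h x y) = - ((mulMap P).app i e h₁ ((linMap P).app hp x) y + sgn K p • (mulMap P).app i e h₂ x
    ((linMap P).app hq y)) + (curvMap P).app i e h₃ x y := by
  rw [mulMap_app i e h hp hq hr (by omega), map_smul, linMap_app hr (sub_add_cancel s 1),
    linMap_app hp (sub_add_cancel p' 1), linMap_app hq (sub_add_cancel q' 1),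
    mulMap_app i e h₁ (sub_add_cancel p' 1) hq (sub_add_cancel s 1) (by omega),
    mulMap_app i e h₂ hp (sub_add_cancel q' 1) (sub_add_cancel s 1) (by omega),
    curvMap_app i e h₃ hp hq (sub_add_cancel s 1) (sub_add_cancel p' 1) (sub_add_cancel q' 1)
      (by omega) (by omega), desuspPart_susp, desuspPart_susp, desuspPart_susp, vCoeff_susp, map_zero,
    add_zero, P.d_comp i e _ (sub_add_cancel p' 1) (sub_add_cancel q' 1) _ (by omega) (by omega)]
  have e1 : sgn K p * sgn K p' = -1 := by
    rw [← sgn_add, ← sgn_one]; exact sgn_congr (by rw [← hp]; exact ⟨p', by ring⟩)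
  have e2 : sgn K (p' - 1) = - sgn K p' := by
    rw [← neg_one_mul, ← sgn_one, ← sgn_add]; exact sgn_congr ⟨-1, by ring⟩
  simp only [map_add, map_neg, LinearMap.add_apply, LinearMap.neg_apply, smul_add, smul_neg,
    smul_smul, map_smul, map_sub, e1, e2, sgn_mul_self, neg_smul, one_smul, neg_neg]
  have e3 : sgn K p' • susp (sub_add_cancel s 1) (P.comp i e (show p' - 1 + q' = s - 1 by omega)
      (P.unitAt m (p' - 1) (vCoeff x)) (desuspPart hq y)) =
      - susp (sub_add_cancel s 1) (P.comp i e (show p' - 1 + q' = s - 1 by omega)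
      (P.unitAt m (p' - 1) (vCoeff x)) (desuspPart hq y)) := by
    by_cases hm : 1 = m ∧ 0 = p' - 1
    · have h1 : sgn K p' = -1 := by rw [show p' = 1 by omega, sgn_one]
      rw [h1, neg_one_smul]
    · rw [P.unitAt_eq_zero hm]
      simp
  rw [e3]
  abel

lemma markedLin_markedLin {f : LabMap V V 1} (hf : ∀ {n : ℕ} {p q r : ℤ} (h : q + 1 = p) (h' : r + 1
    = q) (x : V.obj n p), f.app h' (f.app h x) = 0) {r : ℤ} (h : q + 1 = p) (h' : r + 1 = q) (x :
    (marked V).obj n p) : (markedLin f).app h' ((markedLin f).app h x) = 0 := by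
  subst h' h
  exact marked_ext (by simp [hf]) (by simp [hf])

lemma markMap_markedLin (f : LabMap V V 1) {r : ℤ} (h : q + 1 = p) (h' : r + 1 = q) (x : (marked
    V).obj n p) : (markMap V).app h' ((markedLin f).app h x) = - (markedLin f).app h' ((markMap
    V).app h x) := by
  subst h' h
  exact marked_ext (by simp) (by simp)

lemma unmarkMap_markedLin (f : LabMap V V 1) {q' r : ℤ} (h : q + 1 = p) (h' : r + -1 = q) (g : q' +
    -1 = p) (g' : r + 1 = q') (g'' : r + 0 = p) (x : (marked V).obj n p) : (unmarkMap V).app h'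
    ((markedLin f).app h x) = - (markedLin f).app g' ((unmarkMap V).app g x) + (LabMap.ident (marked
    V)).app g'' x := by
  obtain rfl : p = r := by omega
  subst g' h
  exact marked_ext (by simp; abel) (by simp)

lemma markedLin_markedMul {m n k : ℕ} (i : Fin m) (e : Wire i n k) {p q r p' q' s : ℤ} (h : r + 1 =
    p + q) (hp : p' + 1 = p) (hq : q' + 1 = q) (hr : s + 1 = r) (h₁ : s + 1 = p' + q) (h₂ : s + 1 =
    p + q') (h₃ : s + 2 = p + q) (x : (marked (barGen P)).obj m p) (y : (marked (barGen P)).obj n q)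
    : (markedLin (linMap P)).app hr ((markedMul (mulMap P)).app i e h x y) = sgn K (1 * 1) •
    ((markedMul (mulMap P)).app i e h₁ ((markedLin (linMap P)).app hp x) y + sgn K (1 * p) •
    (markedMul (mulMap P)).app i e h₂ x ((markedLin (linMap P)).app hq y)) + (markedMul (curvMap
    P)).app i e h₃ x y := by
  subst hp hq hr
  refine marked_ext ?_ ?_
  · simp [linMap_mulMap i e h rfl rfl rfl h₁ h₂ h₃]
    abel
  · have e2 : sgn K 2 = 1 := by
      rw [show (2 : ℤ) = 1 + 1 by rfl, sgn_add, sgn_mul_self]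
    have e3 : sgn K (p' + 1 + 1) = - sgn K (p' + 1) := by rw [sgn_add, sgn_one]; ring
    simp [e2, e3, linMap_mulMap (p' := p' + 1) (q' := q') i e _ rfl rfl (s := s + 1) rfl (by omega) (by omega) (by omega)]
    abel

lemma markMap_markedMul {V : SMod.{u, v} K} {c c'' : ℤ} (μ : LabMul V c) {m n k : ℕ} (i : Fin m) (e
    : Wire i n k) {p q r p' q' s : ℤ} (h : r + c = p + q) (hp : p' + 1 = p) (hq : q' + 1 = q) (hr :
    s + 1 = r) (h₁ : s + c = p' + q) (h₂ : s + c = p + q') (h₃ : s + c'' = p + q) (x : (marked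
    V).obj m p) (y : (marked V).obj n q) : (markMap V).app hr ((markedMul μ).app i e h x y) = sgn K
    (c * 1) • ((markedMul μ).app i e h₁ ((markMap V).app hp x) y + sgn K (1 * p) • (markedMul μ).app
    i e h₂ x ((LabMap.zero (marked V) (marked V) 1).app hq y)) + (LabMul.zero (marked V) c'').app i
    e h₃ x y := by
  subst hp hq hr
  refine marked_ext (by simp) ?_
  simp [sgn_smul_smul]

lemma zero_markedMul {V : SMod.{u, v} K} {c c'' : ℤ} (μ : LabMul V c) {m n k : ℕ} (i : Fin m) (e :
    Wire i n k) {p q r p' q' s : ℤ} (h : r + c = p + q) (hp : p' + 1 = p) (hq : q' + 1 = q) (hr : s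
    + 1 = r) (h₁ : s + c = p' + q) (h₂ : s + c = p + q') (h₃ : s + c'' = p + q) (x : (marked V).obj
    m p) (y : (marked V).obj n q) : (LabMap.zero (marked V) (marked V) 1).app hr ((markedMul μ).app
    i e h x y) = sgn K (c * 1) • ((markedMul μ).app i e h₁ ((LabMap.zero (marked V) (marked V)
    1).app hp x) y + sgn K (1 * p) • (markedMul μ).app i e h₂ x ((LabMap.zero (marked V) (marked V)
    1).app hq y)) + (LabMul.zero (marked V) c'').app i e h₃ x y := by
  simp

/-! ### The square of the differential on marked trees -/

lemma loc_zero {c : ℤ} (x : PTree V n p) : (loc (LabMap.zero V V c) (LabMap.zero V V c) x : PTree V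
    n q) = 0 := by
  induction x using ptree_induction with
  | zero => simp
  | add x x' hx hx' => rw [map_add, hx, hx', add_zero]
  | smul a x hx => rw [map_smul, hx, smul_zero]
  | tree L ρ l hL hp =>
  rw [loc_ptree _ _ hL hp]
  refine pick_eq_zero fun s L' _ => ?_
  have h : s.opAt (LabMap.zero V V c) (LabMap.zero V V c) ρ =
      ⟨s.out, s.ar, s.deg - c, 0, s.inp⟩ := by
    unfold Vtx.opAt; split_ifs <;> rfl
  rw [h]
  exact ((multi_ptree q ρ l).head s.out s.ar (s.deg - c) s.inp L').map_zero

lemma con_zero {c : ℤ} (x : PTree V n p) : ((LabMul.zero V c).con x : PTree V n q) = 0 := by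
  induction x using ptree_induction with
  | zero => simp
  | add x x' hx hx' => rw [map_add, hx, hx', add_zero]
  | smul a x hx => rw [map_smul, hx, smul_zero]
  | tree L ρ l hL hp =>
  rw [LabMul.con_ptree hL hp]
  refine pick_eq_zero fun s L' _ => pick_eq_zero fun t L'' _ =>
    sum_eq_zero fun i _ => ?_
  split_ifs
  · exact ((multi_ptree q ρ l).head s.out _ (s.deg + t.deg - c) _ L'').map_zero
  · rfl

/-- A local operator of degree `-1` whose square is zero on the labels has square zero. -/
lemma loc_loc_eq_zero [CharZero K] {g₁ g₀ : LabMap V V 1} (h₁ : ∀ {n : ℕ} {p q r : ℤ} (h : q + 1 =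
    p) (h' : r + 1 = q) (x : V.obj n p), g₁.app h' (g₁.app h x) = 0) (h₀ : ∀ {n : ℕ} {p q r : ℤ} (h
    : q + 1 = p) (h' : r + 1 = q) (x : V.obj n p), g₀.app h' (g₀.app h x) = 0) {r : ℤ} (hq : q + 1 =
    p) (x : PTree V n p) : (loc g₁ g₀ (loc g₁ g₀ x : PTree V n q) : PTree V n r) = 0 := by
  have h := loc_comm (g₁ := g₁) (g₀ := g₀) (g₁' := g₁) (g₀' := g₀) (k₁ := LabMap.zero V V 2)
    (k₀ := LabMap.zero V V 2) (r := r) (fun h h' g g' h'' x => by rw [h₁, h₁]; simp)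
    (fun h h' g g' h'' x => by rw [h₀, h₀]; simp) rfl hq hq x
  rw [loc_zero, mul_one, sgn_one, neg_one_smul, add_zero, eq_neg_iff_add_eq_zero, ← two_smul K] at h
  exact (smul_eq_zero.1 h).resolve_left two_ne_zero

variable (P) in
/-- The differential on trees with marked labels: the sum over the vertices of the trees obtained by
applying `markedLin` to the label, and over the inner edges of the trees obtained by contraction. -/
def markedDiff : PTree (marked (barGen P)) n p →ₗ[K] PTree (marked (barGen P)) n q :=
  loc (markedLin (linMap P)) (markedLin (linMap P)) + (markedMul (mulMap P)).con

lemma markedDiff_markedDiff [CharZero K] (hP : P.SquareZero) {r : ℤ} (hq : q + 1 = p) (x : PTree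
    (marked (barGen P)) n p) : (markedDiff P (markedDiff P x : PTree _ n q) : PTree _ n r) =
    (markedMul (curvMap P)).con x := by
  have h := loc_con (μ := markedMul (mulMap P)) (ν := markedMul (curvMap P))
    (g₁ := markedLin (linMap P)) (g₀ := markedLin (linMap P)) (r := r) (c'' := 2) rfl
    markedLin_markedMul markedLin_markedMul hq hq x
  simp only [markedDiff, LinearMap.add_apply, map_add]
  rw [loc_loc_eq_zero (markedLin_markedLin (linMap_linMap hP))
    (markedLin_markedLin (linMap_linMap hP)) hq, h,
    LabMul.con_con (markedMul_isAssoc mulMap_isAssoc) hq, mul_one, sgn_one, neg_one_smul]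
  abel

/-- The operator that marks the root vertex of a tree. -/
def markRoot : PTree (marked V) n p →ₗ[K] PTree (marked V) n q :=
  loc (markMap V) (LabMap.zero _ _ 1)

lemma markedDiff_markRoot {r : ℤ} (hq : q + 1 = p) (x : PTree (marked (barGen P)) n p) : (markedDiff
    P (markRoot x : PTree _ n q) : PTree _ n r) = - markRoot (markedDiff P x : PTree _ n q) := by
  have h1 := loc_comm (g₁ := markedLin (linMap P)) (g₀ := markedLin (linMap P))
    (g₁' := markMap _) (g₀' := LabMap.zero _ _ 1) (k₁ := LabMap.zero _ _ 2)
    (k₀ := LabMap.zero _ _ 2) (r := r)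
    (fun h h' g g' h'' x => by
      obtain rfl := h.trans g.symm |> (add_right_cancel)
      rw [markMap_markedLin]; simp)
    (fun h h' g g' h'' x => by simp) rfl hq hq x
  have h2 := loc_con (μ := markedMul (mulMap P)) (ν := LabMul.zero _ 2) (g₁ := markMap _)
    (g₀ := LabMap.zero _ _ 1) (r := r) rfl (markMap_markedMul _) (zero_markedMul _) hq hq x
  simp only [markedDiff, LinearMap.add_apply, map_add, markRoot]
  rw [h1, h2, loc_zero, con_zero, mul_one, sgn_one]
  simp only [neg_smul, one_smul, add_zero]
  abel

lemma curv_markRoot {q' r : ℤ} (hq : q + 2 = p) (hq' : q' + 1 = p) (x : PTree (marked (barGen P)) n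
    p) : ((markedMul (curvMap P)).con (markRoot x : PTree _ n q') : PTree _ n r) = markRoot
    ((markedMul (curvMap P)).con x : PTree _ n q) := by
  have h2 := loc_con (μ := markedMul (curvMap P)) (ν := LabMul.zero _ 3) (g₁ := markMap _)
    (g₀ := LabMap.zero _ _ 1) (r := r) rfl (markMap_markedMul _) (zero_markedMul _) hq hq' x
  rw [con_zero, add_zero, sgn_congr (b := 0) ⟨1, by ring⟩, sgn_zero, one_smul] at h2
  exact h2.symm

/-! ### Reduced trees as unmarked trees -/

/-- The linear map on the reduced tree module with given values on the trees. -/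
def TreeFun.treeLift {M : Type*} [AddCommGroup M] [Module K M] (p : ℤ) (f : TreeFun V n M) : TreeObj
    V n p →ₗ[K] M :=
  BarCobar.treeLift f.toFun f.linear f.swap (fun A B r l o k q σ x ι _ =>
    f.equivariant A B r l o k q σ x ι) (fun π L r l _ => f.rename π L r l)

lemma TreeFun.treeLift_eq {M : Type*} [AddCommGroup M] [Module K M] (f : TreeFun V n M) (h : IsTree
    L r l) (hp : deg L = p) : f.treeLift p (tree L r l) = f.toFun L r l := by
  exact (treeLift_tree _ _ _ _ (fun π L r l _ => f.rename π L r l) L r l).trans (if_pos ⟨h, hp⟩)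

lemma tree_induction {C : TreeObj V n p → Prop} (x : TreeObj V n p) (tree : ∀ L r l, IsTree L r l →
    deg L = p → C (tree L r l)) (zero : C 0) (add : ∀ x y, C x → C y → C (x + y)) (smul : ∀ (c : K)
    x, C x → C (c • x)) : C x := by
  obtain ⟨y, rfl⟩ := mk_surjective _ x
  induction y using Finsupp.induction_linear with
  | zero => exact zero
  | add y z hy hz => exact add _ _ hy hz
  | single m c =>
    have e : (Submodule.Quotient.mk (Finsupp.single m c) : TreeObj V n p) =
        c • BarCobar.tree m.1 m.2.1 m.2.2 := by
      rw [BarCobar.tree, ← mk_smul, monomial, Finsupp.smul_single, smul_eq_mul,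
        mul_one]
    rw [e]
    refine smul _ _ ?_
    by_cases hm : IsTree m.1 m.2.1 m.2.2 ∧ deg m.1 = p
    · exact tree _ _ _ hm.1 hm.2
    · rwa [tree_eq_zero hm]

/-- A vertex with its label `x`, unmarked. -/
def Vtx.unmarked (s : Vtx V) : Vtx (marked V) :=
  ⟨s.out, s.ar, s.deg, markedMk LinearMap.id 0 s.lab, s.inp⟩

/-- A vertex with the unmarked part of its label. -/
def Vtx.base (s : Vtx (marked V)) : Vtx V := ⟨s.out, s.ar, s.deg, markedFst s.lab, s.inp⟩

lemma Vtx.Comb.unmarked {c c' : K} {s s₁ s₂ : Vtx V} (h : Vtx.Comb c c' s s₁ s₂) : Vtx.Comb c c'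
    s.unmarked s₁.unmarked s₂.unmarked := by
  cases h with
  | linear o k q c c' x x' ι =>
    simp only [Vtx.unmarked, map_add, map_smul]
    exact .linear _ _ _ _ _ _ _ _
  | act o k q σ x ι =>
    have h : markedMk LinearMap.id 0 (V.act σ x) =
        (marked V).act σ (markedMk LinearMap.id 0 x) := marked_ext (by simp) (by simp)
    simp only [Vtx.unmarked, h]
    exact .act _ _ _ _ _ _

lemma Vtx.Comb.base {c c' : K} {s s₁ s₂ : Vtx (marked V)} (h : Vtx.Comb c c' s s₁ s₂) : Vtx.Comb c
    c' s.base s₁.base s₂.base := by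
  cases h with
  | linear o k q c c' x x' ι =>
    simp only [Vtx.base, map_add, map_smul]
    exact .linear _ _ _ _ _ _ _ _
  | act o k q σ x ι => exact .act _ _ _ _ _ _

lemma Multi.comp_map {U : SMod.{u, w} K} {M : Type*} [AddCommGroup M] [Module K M]
    {G : List (Vtx U) → M} (hG : Multi G) {f : Vtx V → Vtx U} (hdeg : ∀ s, (f s).deg = s.deg)
    (hf : ∀ {c c' : K} {s s₁ s₂ : Vtx V}, Vtx.Comb c c' s s₁ s₂ →
      Vtx.Comb c c' (f s) (f s₁) (f s₂)) : Multi fun L => G (L.map f) where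
  koszul A B s t := by
    simp only [map_append, map_cons, hG.koszul _ _ (f s) (f t), hdeg]
  comb A B c c' s s₁ s₂ h := by
    simp only [map_append, map_cons]
    exact hG.comb _ _ (hf h)

lemma deg_map {U : SMod.{u, w} K} {f : Vtx V → Vtx U} (hdeg : ∀ s, (f s).deg = s.deg) (L : List (Vtx
    V)) : deg (L.map f) = deg L := by
  simp only [deg, List.map_map]
  exact congrArg _ (map_congr_left fun s _ => hdeg s)

lemma isPTree_of_ends {U : SMod.{u, w} K} {L' : List (Vtx U)} (h : L.map Vtx.ends = L'.map Vtx.ends)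
    (hL : IsPTree L r l) : IsPTree L' r l := by
  by_cases h0 : L = []
  · subst h0
    obtain rfl : L' = [] := by simpa using h.symm
    exact ⟨hL.1, hL.2.1, 0, by simp⟩
  · have := isTree_iff.2 ⟨h0, hL⟩
    rw [IsTree, h] at this
    exact (isTree_iff.1 this).2

lemma outs_map {U : SMod.{u, w} K} {f : Vtx V → Vtx U} (h : ∀ s, (f s).out = s.out) (L : List (Vtx
    V)) : outs (L.map f) = outs L := by
  simp only [outs, List.map_map]
  exact congrArg _ (map_congr_left fun s _ => h s)

lemma ins_map {U : SMod.{u, w} K} {f : Vtx V → Vtx U} (h : ∀ s, (f s).ends = s.ends) (L : List (Vtx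
    V)) : ins (L.map f) = ins L := by
  simp only [ins, List.map_map]
  exact congrArg _ (map_congr_left fun s _ => congrArg Prod.snd (h s))

lemma isPTree_unmarked (h : IsPTree L r l) : IsPTree (L.map Vtx.unmarked) r l :=
  isPTree_of_ends (by rw [List.map_map]; rfl) h

/-- The inclusion of the reduced tree module in the tree module on the marked labels. -/
def embed : TreeObj V n p →ₗ[K] PTree (marked V) n p :=
  TreeFun.treeLift p <| Multi.treeFun (fun L r l => ptree (L.map Vtx.unmarked) r l)
    (fun r l => (multi_ptree p r l).comp_map (fun _ => rfl) Vtx.Comb.unmarked)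
    (fun π L r l => by
      refine Eq.trans ?_ (ptree_rename π (L.map Vtx.unmarked) r l)
      rw [List.map_map, List.map_map]
      rfl)

lemma embed_tree (h : IsTree L r l) (hp : deg L = p) : (embed (tree L r l) : PTree (marked V) n p) =
    ptree (L.map Vtx.unmarked) r l := TreeFun.treeLift_eq _ h hp

lemma embed_tree' (L : List (Vtx V)) (r : ℕ) (l : Fin n → ℕ) (h : L ≠ []) : (embed (tree L r l :
    TreeObj V n p) : PTree (marked V) n p) = ptree (L.map Vtx.unmarked) r l := by
  by_cases h' : IsTree L r l ∧ deg L = p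
  · exact embed_tree h'.1 h'.2
  · rw [tree_eq_zero h', map_zero, ptree_eq_zero]
    rintro ⟨h1, h2⟩
    rw [deg_map (f := Vtx.unmarked) fun _ => rfl] at h2
    refine h' ⟨isTree_iff.2 ⟨h, isPTree_of_ends ?_ h1⟩, h2⟩
    rw [List.map_map]
    rfl

lemma embed_treeAct (σ : Perm (Fin n)) (x : TreeObj V n p) : embed (treeAct σ x) = ptreeAct σ (embed
    x) := by
  induction x using tree_induction with
  | zero => simp
  | add x y hx hy => simp only [map_add, hx, hy]
  | smul c x hx => simp only [map_smul, hx]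
  | tree L r l hL hp =>
    rw [treeAct_tree, embed_tree hL hp, ptreeAct_ptree, embed_tree _ hp]
    rwa [isTree_relabel]

lemma loc_ptreeAct {c : ℤ} (g₁ g₀ : LabMap V V c) (σ : Perm (Fin n)) (x : PTree V n p) : (loc g₁ g₀
    (ptreeAct σ x) : PTree V n q) = ptreeAct σ (loc g₁ g₀ x) := by
  induction x using ptree_induction with
  | zero => simp
  | add x y hx hy => simp only [map_add, hx, hy]
  | smul c x hx => simp only [map_smul, hx]
  | tree L r l hL hp =>
    rw [ptreeAct_ptree, loc_ptree _ _ ((isPTree_relabel σ.symm L r l).2 hL) hp, loc_ptree _ _ hL hp,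
      pickSum_map]
    simp only [ptreeAct_ptree]

lemma con_ptreeAct {c : ℤ} (μ : LabMul V c) (σ : Perm (Fin n)) (x : PTree V n p) : (μ.con (ptreeAct
    σ x) : PTree V n q) = ptreeAct σ (μ.con x) := by
  induction x using ptree_induction with
  | zero => simp
  | add x y hx hy => simp only [map_add, hx, hy]
  | smul c x hx => simp only [map_smul, hx]
  | tree L r l hL hp =>
    rw [ptreeAct_ptree, LabMul.con_ptree ((isPTree_relabel σ.symm L r l).2 hL) hp,
      LabMul.con_ptree hL hp]
    simp only [LabMul.conSum, pickSum_map, LabMul.edgeSum_map, ptreeAct_ptree]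

/-- The image in the planted trees of the generators of the cobar construction: the root vertex of
the tree is marked. -/
def markEmbed : TreeObj V n (p + 1) →ₗ[K] PTree (marked V) n p :=
  markRoot ∘ₗ embed

lemma markEmbed_act (σ : Perm (Fin n)) (x : TreeObj V n (p + 1)) : markEmbed (treeAct σ x) =
    ptreeAct σ (markEmbed x : PTree (marked V) n p) := by
  simp only [markEmbed, comp_apply, embed_treeAct]
  exact loc_ptreeAct _ _ _ _

variable (V) in
/-- The comparison of the free operad on the desuspended reduced tree module with the operad of
planted trees: a nested tree becomes a tree with marks at the roots of the inner trees. -/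
def unnest : (CobarFree V).Hom (planted (marked V)) :=
  FreeOperad.lift (W := desusp (treeModule V)) (planted (marked V)) markEmbed markEmbed_act

/-- The sum over the vertices of the trees obtained by marking the vertex. -/
def markAny : PTree (marked V) n p →ₗ[K] PTree (marked V) n q :=
  loc (markMap V) (markMap V)

lemma unmarked_opAt_markedLin (s : Vtx (barGen P)) (r : ℕ) : Vtx.Comb (1 : K) 1 (s.unmarked.opAt
    (markedLin (linMap P)) (markedLin (linMap P)) r) s.barLin.unmarked (s.unmarked.opAt (markMap _)
    (markMap _) r) := by
  let y : (marked (barGen P)).obj s.ar (s.deg - 1) := markedMk LinearMap.id 0 (barLin s.lab)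
  let z : (marked (barGen P)).obj s.ar (s.deg - 1) :=
    (markMap _).app (sub_add_cancel _ _) (markedMk LinearMap.id 0 s.lab)
  have h : s.unmarked.opAt (markedLin (linMap P)) (markedLin (linMap P)) r =
      ⟨s.out, s.ar, s.deg - 1, (1 : K) • y + (1 : K) • z, s.inp⟩ := by
    have h' : s.unmarked.opAt (markedLin (linMap P)) (markedLin (linMap P)) r =
      s.unmarked.op (markedLin (linMap P)) := by rw [Vtx.opAt]; split_ifs <;> rfl
    rw [h']
    simp only [Vtx.op, Vtx.unmarked, one_smul]
    congr 1
    refine marked_ext ?_ ?_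
    · rw [map_add]
      exact (add_zero (barLin s.lab)).symm
    · rw [map_add]
      refine (markedSnd_lin _ (linMap P) _).trans ?_
      simp [y, z]
  have h'' : s.unmarked.opAt (markMap _) (markMap _) r = s.unmarked.op (markMap _) := by
    rw [Vtx.opAt]; split_ifs <;> rfl
  rw [h, h'']
  exact .linear _ _ _ 1 1 y z _

lemma unmarked_vtx (s t : Vtx (barGen P)) (i : Fin s.ar) : (markedMul (mulMap P)).vtx s.unmarked
    t.unmarked i = (s.contract t i).unmarked := by
  simp only [LabMul.vtx, LabMul.vtxVia, Vtx.unmarked, Vtx.contract, Vtx.contractVia]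
  congr 1
  refine marked_ext ?_ ?_
  · simp
    rfl
  · refine (markedSnd_mul _ (mulMap P) _ _ _ _).trans ?_
    simp
    rfl

/-- The differential of the marked trees on an unmarked tree. -/
lemma markedDiff_embed (hq : q + 1 = p) (x : TreeObj (barGen P) n p) : (markedDiff P (embed x) :
    PTree _ n q) = embed (barDiff P x) + markAny (embed x) := by
  induction x using tree_induction with
  | zero => simp
  | add x y hx hy => simp only [map_add, hx, hy]; abel
  | smul c x hx => simp only [map_smul, hx, smul_add]
  | tree L r l hL hp =>
    have hL' := isPTree_unmarked hL.ptree
    have hp' : deg (L.map (Vtx.unmarked (V := barGen P))) = p := (deg_map (f := Vtx.unmarked) (fun _ => rfl) L).trans hp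
    rw [embed_tree hL hp, markedDiff, LinearMap.add_apply, loc_ptree _ _ hL' hp',
      LabMul.con_ptree hL' hp', markAny, loc_ptree _ _ hL' hp', barDiff, treeLift_tree,
      if_pos ⟨hL, hp⟩, barDiffFun, map_add, pickSum_map, pickSum_map, LabMul.conSum,
      pickSum_mapVtx Vtx.unmarked (fun _ => rfl), pickSum_mapVtx Vtx.unmarked (fun _ => rfl),
      pickSum_mapVtx Vtx.unmarked (fun _ => rfl), add_right_comm]
    refine congrArg₂ (· + ·) ?_ ?_
    · rw [← pickSum_add]
      refine pick_congr fun s L' _ => ?_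
      refine ((multi_ptree (V := marked (barGen P)) q r l).comb_head (L'.map Vtx.unmarked)
        (unmarked_opAt_markedLin s r)).trans ?_
      rw [one_smul, one_smul, embed_tree' (s.barLin :: L') r l (by simp)]
      rfl
    · refine pick_congr fun s L' _ => ?_
      rw [pickSum_mapVtx Vtx.unmarked (fun _ => rfl), pickSum_map]
      refine pick_congr fun t L'' _ => ?_
      simp only [contractSum, LabMul.edgeSum, map_sum, apply_ite, map_zero]
      refine sum_congr rfl fun i _ => ?_
      refine if_congr Iff.rfl ?_ rfl
      rw [embed_tree' _ _ _ (by simp)]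
      exact congrArg (fun v => ptree (v :: _) r l) (unmarked_vtx s t i)

/-! ### Trees with a marked root vertex -/

section Grafts

lemma edges_perm {L' : List (Vtx V)} (h : L.Perm L') (r : ℕ) (l : Fin n → ℕ) : edges L r l = edges
    L' r l := by simp only [edges, outs_perm h, ins_perm h]

lemma Apart.mono {A A' B B' : List (Vtx V)} {b : ℕ} {f : Fin m → ℕ} {g : Fin n → ℕ} (h : Apart A r f
    B b g) (hA : ∀ x ∈ edges A' r f, x ∈ edges A r f) (hB : ∀ x ∈ edges B' b g, x ∈ edges B b g) :
    Apart A' r f B' b g :=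
  fun x hx hx' => h x (hA x hx) (hB x hx')

lemma mem_edges_vtx {c : ℤ} (μ : LabMul V c) {s t : Vtx V} (i : Fin s.ar) {x : ℕ} (hx : x ∈ edges
    (μ.vtx s t i :: L) r l) : x ∈ edges (s :: t :: L) r l := by
  have hl := (Wire.fits_wireLabel (equivFin _ : Wire i t.ar _) s.inp t.inp).lvs
  have hl' := congrArg (x ∈ ·) hl
  simp only [mem_add, mem_cons, eq_iff_iff] at hl'
  simp only [edges, outs_cons, ins_cons, mem_cons, mem_add, LabMul.vtx,
    LabMul.vtxVia] at hx ⊢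
  tauto

lemma Vtx.opAt_same {c : ℤ} (g : LabMap V V c) (r : ℕ) (s : Vtx V) : s.opAt g g r = s.op g := by
  rw [Vtx.opAt]; split_ifs <;> rfl

/-- The image of a tree with a vertex moved from the middle to the front. -/
lemma koszul_middle {M : Type*} [AddCommGroup M] [Module K M] {G : List (Vtx V) → M} (hG : Koszul G)
    (s : Vtx V) (A B : List (Vtx V)) : G (s :: (A ++ B)) = sgn K (s.deg * deg A) • G (A ++ s :: B)
    := by
  have := hG.swap_append [s] A B
  simpa [deg_cons, deg] using this

variable {i : Fin m} {e : Wire i n k} {A B : List (Vtx V)} {b : ℕ} {f : Fin m → ℕ}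
  {g : Fin n → ℕ} {l : Fin k → ℕ} {s : ℤ}

lemma graft_pickSum_left {U : SMod.{u, w} K} (h : p + q = s) (F : Vtx U → List (Vtx U) → PTree V m
    p) (y : PTree V n q) (L : List (Vtx U)) : graft i e h (pickSum F L) y = pickSum (fun t L' =>
    graft i e h (F t L') y) L :=
  pickSum_map ((graft i e h).flip y) F L

lemma graft_edgeSum_left {U : SMod.{u, w} K} {c : ℤ} (μ : LabMul U c) (h : p + q = s) (F : List (Vtx
    U) → PTree V m p) (y : PTree V n q) (u t : Vtx U) (L : List (Vtx U)) : graft i e h (μ.edgeSum F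
    u t L) y = μ.edgeSum (fun L' => graft i e h (F L') y) u t L :=
  LabMul.edgeSum_map ((graft i e h).flip y) F u t L

/-- An operator that acts in the same way at all vertices is a derivation. -/
lemma loc_graft_ptree {c : ℤ} (G : LabMap V V c) (hA : IsPTree A r f) (hB : IsPTree B b g) (hi : f i
    = b) (hap : Apart A r f B b g) (hl : e.Fits f g l) (hp : deg A = p) (hq : deg B = q) (h : p + q
    = s) {p' q' s' : ℤ} (hp' : p' + c = p) (hq' : q' + c = q) (h₁ : p' + q = s') (h₂ : p + q' = s')
    : (loc G G (ptree (A ++ B) r l : PTree V k s) : PTree V k s') = graft i e h₁ (loc G G (ptree A r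
    f : PTree V m p)) (ptree B b g) + sgn K (c * p) • graft i e h₂ (ptree A r f) (loc G G (ptree B b
    g : PTree V n q)) := by
  rw [loc_ptree _ _ (isPTree_append hA hB hi hap hl) (by rw [deg_append]; omega),
    loc_ptree _ _ hA hp, loc_ptree _ _ hB hq, pickSum_append, graft_pickSum_left,
    pickSum_map, ← pickSum_smul]
  refine congrArg₂ (· + ·) (pick_congr fun t A' ht => ?_) (pick_congr fun t B' ht => ?_)
  · have hd := deg_perm ht
    rw [deg_cons] at hd
    rw [Vtx.opAt_same, graft_ptree (A := t.op G :: A')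
      ((isPTree_replace [] A' (s := t.op G) (t := t) rfl rfl r f).2 ((IsPTree.perm ht).2 hA)) hB hi
      (hap.mono (fun x hx => by rwa [← edges_perm ht]) fun _ h => h) hl
      (by rw [deg_cons]; simp only [Vtx.op]; omega) hq]
    rfl
  · have hd := deg_perm ht
    rw [deg_cons] at hd
    rw [Vtx.opAt_same, Vtx.opAt_same, graft_ptree (B := t.op G :: B') hA
      ((isPTree_replace [] B' (s := t.op G) (t := t) rfl rfl b g).2 ((IsPTree.perm ht).2 hB)) hi
      (hap.mono (fun _ h => h) fun x hx => by rwa [← edges_perm ht]) hl hp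
      (by rw [deg_cons]; simp only [Vtx.op]; omega), koszul_middle (koszul_ptree r l), smul_smul,
      ← sgn_add]
    congr 1
    simp only [Vtx.op, hp]
    exact sgn_congr ⟨p * t.deg - c * p, by ring⟩

/-- The contraction of edges is a derivation, if the edge along which two trees are grafted does not
contribute. -/
lemma con_graft_ptree {c : ℤ} (μ : LabMul V c) (hA : IsPTree A r f) (hB : IsPTree B b g)
    (hi : f i = b) (hap : Apart A r f B b g) (hl : e.Fits f g l) (hp : deg A = p) (hq : deg B = q)
    (h : p + q = s) {p' q' s' : ℤ} (hp' : p' + c = p) (hq' : q' + c = q) (h₁ : p' + q = s')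
    (h₂ : p + q' = s')
    (hμ : ∀ t ∈ B, t.out = b → ∀ {m k : ℕ} (i : Fin m) (e : Wire i t.ar k) {p r : ℤ}
      (h : r + c = p + t.deg) (x : V.obj m p), μ.app i e h x t.lab = 0) :
    (μ.con (ptree (A ++ B) r l : PTree V k s) : PTree V k s') =
      graft i e h₁ (μ.con (ptree A r f : PTree V m p)) (ptree B b g) +
        sgn K (c * p) • graft i e h₂ (ptree A r f) (μ.con (ptree B b g : PTree V n q)) := by
  have hAB := isPTree_append hA hB hi hap hl
  -- an edge between the two trees starts at the root of the second one
  have hout : ∀ t ∈ B, ∀ x ∈ edges A r f, t.out = x → t.out = b := fun t ht x hx h =>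
    h ▸ hap x hx (by rw [← h]; simp only [edges, mem_cons, mem_add]
                     exact Or.inr (Or.inl (Or.inl (mem_outs.2 ⟨t, ht, rfl⟩))))
  have hAB0 : ∀ s₀ ∈ A, ∀ t ∈ B, ∀ L, μ.edgeSum (fun L => (ptree L r l : PTree V k s')) s₀ t L
      = 0 := by
    intro s₀ hs t ht L
    refine sum_eq_zero fun j _ => ?_
    split_ifs with hj
    · have hb := hout t ht (s₀.inp j) ((mem_edges hA).2 (Or.inr (mem_ins.2 ⟨s₀, hs, j, rfl⟩))) hj.symm
      have h0 : (μ.vtx s₀ t j).lab = 0 := hμ t ht hb _ _ _ _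
      have := (multi_ptree (V := V) s' r l).comb_head L (.linear (μ.vtx s₀ t j).out
        (μ.vtx s₀ t j).ar (μ.vtx s₀ t j).deg (0 : K) 0 0 0 (μ.vtx s₀ t j).inp)
      simp only [zero_smul, add_zero] at this
      rw [← h0] at this
      exact this
    · rfl
  have hBA0 : ∀ s₀ ∈ B, ∀ t ∈ A, ∀ L, μ.edgeSum (fun L => (ptree L r l : PTree V k s')) s₀ t L
      = 0 := by
    intro s₀ hs t ht L
    refine LabMul.edgeSum_eq_zero (fun j hj => ?_) L
    have h1 : s₀.inp j ∈ ins B := mem_ins.2 ⟨s₀, hs, j, rfl⟩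
    have h2 : t.out ∈ edges A r f := by
      simp only [edges, mem_cons, mem_add]
      exact Or.inr (Or.inl (Or.inl (mem_outs.2 ⟨t, ht, rfl⟩)))
    have h3 := hap _ h2 (hj ▸ (mem_edges hB).2 (Or.inr h1))
    rw [hj, h3] at h1
    exact (nodup_cons.1 hB.2.1).1 h1
  rw [LabMul.con_ptree hAB (by rw [deg_append]; omega),
    LabMul.con_ptree hA hp, LabMul.con_ptree hB hq, LabMul.conSum, pickSum_append,
    LabMul.conSum, LabMul.conSum, graft_pickSum_left, pickSum_map, ← pickSum_smul]
  refine congrArg₂ (· + ·) (pick_congr fun u A' hu => ?_) (pick_congr fun u B' hu => ?_)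
  · have hu' : u ∈ A := hu.subset (by simp)
    have h0 : pickSum (fun t B' => sgn K (deg A' * t.deg) • μ.edgeSum
        (fun L => (ptree L r l : PTree V k s')) u t (A' ++ B')) B = 0 :=
      pick_eq_zero fun t B' ht => by rw [hAB0 u hu' t (ht.subset (by simp)), smul_zero]
    rw [pickSum_append, h0, add_zero, graft_pickSum_left]
    refine pick_congr fun t A'' ht => ?_
    have hut : (u :: t :: A'').Perm A := (ht.cons u).trans hu
    rw [graft_edgeSum_left]
    refine sum_congr rfl fun j _ => ?_
    split_ifs with hj
    · have hd := deg_perm hut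
      beta_reduce
      rw [graft_ptree (A := μ.vtx u t j :: A'')
        (LabMul.isPTree_vtx hj ((IsPTree.perm hut).2 hA)) hB hi
        (hap.mono (fun x hx => by rw [← edges_perm hut]; exact mem_edges_vtx μ j hx) fun _ h => h) hl
        (by rw [LabMul.deg_vtx]; omega) hq]
      rfl
    · rfl
  · have hu' : u ∈ B := hu.subset (by simp)
    have h0 : pickSum (fun t A' => μ.edgeSum
        (fun L => (ptree L r l : PTree V k s')) u t (A' ++ B')) A = 0 :=
      pick_eq_zero fun t A' ht => hBA0 u hu' t (ht.subset (by simp)) _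
    rw [pickSum_append, h0, zero_add, pickSum_map, ← pickSum_smul, ← pickSum_smul]
    refine pick_congr fun t B'' ht => ?_
    have hut : (u :: t :: B'').Perm B := (ht.cons u).trans hu
    rw [LabMul.edgeSum_map]
    simp only [LabMul.edgeSum, smul_sum]
    refine sum_congr rfl fun j _ => ?_
    split_ifs with hj
    · have hd := deg_perm hut
      rw [graft_ptree (B := μ.vtx u t j :: B'') hA
        (LabMul.isPTree_vtx hj ((IsPTree.perm hut).2 hB)) hi
        (hap.mono (fun _ h => h) fun x hx => by rw [← edges_perm hut]; exact mem_edges_vtx μ j hx) hl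
        hp (by rw [LabMul.deg_vtx]; omega), koszul_middle (koszul_ptree r l)]
      simp only [smul_smul, ← sgn_add]
      congr 1
      simp only [LabMul.vtx, LabMul.vtxVia, hp]
      exact sgn_congr ⟨p * u.deg + p * t.deg - c * p, by ring⟩
    · simp

end Grafts

section MarkedTrees

lemma pickSum_mem {M : Type*} [AddCommGroup M] [Module K M] {S : Submodule K M} {F : Vtx V → List
    (Vtx V) → M} (h : ∀ s L', (s :: L').Perm L → F s L' ∈ S) : pickSum F L ∈ S := by
  rw [← mk_eq_zero, ← mkQ_apply, pickSum_map]
  exact pick_eq_zero fun s L' hs => (mk_eq_zero S).2 (h s L' hs)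

/-- Every vertex of `L` that starts at the edge `r` has a marked label. -/
def RootMarked (L : List (Vtx (marked V))) (r : ℕ) : Prop := ∀ s ∈ L, s.out = r → markedFst s.lab = 0

lemma RootMarked.ren {L : List (Vtx (marked V))} (h : RootMarked L r) (π : Perm ℕ) : RootMarked
    (L.map (Vtx.ren π)) (π r) := by
  intro s hs h'
  obtain ⟨t, ht, rfl⟩ := List.mem_map.1 hs
  exact h t ht (π.injective h')

variable (V) in
/-- The span of the trees with at most `k` vertices whose root vertex, if there is one, is marked. -/
def MTrees (k : ℕ∞) (n : ℕ) (p : ℤ) : Submodule K (PTree (marked V) n p) :=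
  Submodule.span K {x | ∃ (L : List (Vtx (marked V))) (r : ℕ) (l : Fin n → ℕ), IsPTree L r l ∧
    deg L = p ∧ RootMarked L r ∧ (L.length : ℕ∞) ≤ k ∧ ptree L r l = x}

variable {s : ℤ}

lemma ptree_mem_markedTrees {L : List (Vtx (marked V))} (hr : IsPTree L r l → RootMarked L r) {a :
    ℕ∞} (ha : (L.length : ℕ∞) ≤ a) : (ptree L r l : PTree (marked V) n p) ∈ MTrees V a n p := by
  by_cases h : IsPTree L r l ∧ deg L = p
  · exact Submodule.subset_span ⟨L, r, l, h.1, h.2, hr h.1, ha, rfl⟩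
  · rw [ptree_eq_zero h]
    exact zero_mem _

lemma MTrees_mono {a b : ℕ∞} (h : a ≤ b) : MTrees V a n p ≤ MTrees V b n p :=
  Submodule.span_mono fun _ ⟨L, r, l, h1, h2, h3, h4, h5⟩ => ⟨L, r, l, h1, h2, h3, h4.trans h, h5⟩

lemma MTrees_induction {a : ℕ∞} {C : ∀ x : PTree (marked V) n p, x ∈ MTrees V a n p → Prop} (tree :
    ∀ L r l (_ : IsPTree L r l) (_ : deg L = p) (hr : RootMarked L r) (ha : (L.length : ℕ∞) ≤ a), C
    (ptree L r l) (ptree_mem_markedTrees (fun _ => hr) ha)) (zero : C 0 (zero_mem _)) (add : ∀ x y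
    hx hy, C x hx → C y hy → C (x + y) (add_mem hx hy)) (smul : ∀ (c : K) x hx, C x hx → C (c • x)
    (smul_mem _ c hx)) {x : PTree (marked V) n p} (hx : x ∈ MTrees V a n p) : C x hx := by
  induction hx using Submodule.span_induction with
  | mem x hx =>
    obtain ⟨L, r, l, h1, h2, h3, h4, rfl⟩ := hx
    exact tree L r l h1 h2 h3 h4
  | zero => exact zero
  | add x y hx' hy' hx hy => exact add x y hx' hy' hx hy
  | smul c x hx' hx => exact smul c x hx' hx

lemma exists_mem_markedTrees {x : PTree (marked V) n p} (hx : x ∈ MTrees V ⊤ n p) : ∃ a : ℕ, x ∈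
    MTrees V a n p := by
  induction hx using MTrees_induction with
  | tree L r l hL hp hr ha => exact ⟨L.length, ptree_mem_markedTrees (fun _ => hr) le_rfl⟩
  | zero => exact ⟨0, zero_mem _⟩
  | add x y _ _ hx hy =>
    obtain ⟨a, ha⟩ := hx
    obtain ⟨b, hb⟩ := hy
    exact ⟨max a b, add_mem (MTrees_mono (by simp) ha) (MTrees_mono (by simp) hb)⟩
  | smul c x _ hx =>
    obtain ⟨a, ha⟩ := hx
    exact ⟨a, smul_mem _ _ ha⟩

lemma ptreeAct_mem_markedTrees (σ : Perm (Fin n)) {a : ℕ∞} {x : PTree (marked V) n p} (hx : x ∈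
    MTrees V a n p) : ptreeAct σ x ∈ MTrees V a n p := by
  induction hx using MTrees_induction with
  | tree L r l hL hp hr ha =>
    rw [ptreeAct_ptree]
    exact ptree_mem_markedTrees (fun _ => hr) ha
  | zero => rw [map_zero]; exact zero_mem _
  | add x y _ _ hx hy => rw [map_add]; exact add_mem hx hy
  | smul c x _ hx => rw [map_smul]; exact smul_mem _ _ hx

/-- A pair of a tree and a tree with marked root can be represented by trees that share only the edge
along which they are to be grafted. -/
lemma exists_apart_marked {U : SMod.{u, v} K} (A : List (Vtx U)) (r : ℕ) (f : Fin m → ℕ) (i : Fin m)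
    {B : List (Vtx U)} {b : ℕ} {g : Fin n → ℕ} (hB : IsPTree B b g) (p : ℤ) : ∃ (π : Perm ℕ), (ptree
    B b g : PTree U n p) = ptree (B.map (Vtx.ren π)) (f i) (π ∘ g) ∧ π b = f i ∧ IsPTree (B.map
    (Vtx.ren π)) (f i) (π ∘ g) ∧ deg (B.map (Vtx.ren π)) = deg B ∧ Apart A r f (B.map (Vtx.ren π))
    (f i) (π ∘ g) := by
  obtain ⟨π, hπ, h⟩ := exists_perm_apart B b g (edges A r f) (f i)
  exact ⟨π, by rw [← hπ, ptree_rename], hπ, hπ ▸ isPTree_ren π hB, deg_ren _ _, h⟩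

lemma graft_mem_markedTrees (i : Fin m) (e : Wire i n k) (h : p + q = s) {a b : ℕ∞}
    {x : PTree (marked V) m p} {y : PTree (marked V) n q} (hx : x ∈ MTrees V a m p)
    (hy : y ∈ MTrees V b n q) : graft i e h x y ∈ MTrees V (a + b) k s := by
  induction hx using MTrees_induction with
  | zero => simp
  | add x x' _ _ hx hx' => rw [map_add]; exact add_mem hx hx'
  | smul c x _ hx => rw [map_smul]; exact smul_mem _ _ hx
  | tree A r f hA hp hAr ha =>
  induction hy using MTrees_induction with
  | zero => simp
  | add x x' _ _ hx hx' => rw [map_add]; exact add_mem hx hx'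
  | smul c x _ hx => rw [map_smul]; exact smul_mem _ _ hx
  | tree B b g hB hq hBr hb =>
    obtain ⟨π, h1, h2, h3, h4, h5⟩ := exists_apart_marked A r f i hB q
    rw [h1, graft_ptree hA h3 rfl h5 (e.fits_wireLabel _ _) hp (h4.trans hq)]
    refine ptree_mem_markedTrees (fun _ t ht hr => ?_) ?_
    · rcases mem_append.1 ht with ht | ht
      · exact hAr t ht hr
      · refine (h2 ▸ hBr.ren π) t ht ?_
        -- the root of the first tree is not an inner edge of the second one
        rw [hr]
        refine h5 r (by simp [edges]) ?_
        rw [← hr]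
        simp only [edges, mem_cons, mem_add]
        exact Or.inr (Or.inl (Or.inl (mem_outs.2 ⟨t, ht, rfl⟩)))
    · rw [length_append, List.length_map, Nat.cast_add]
      exact add_le_add ha hb

lemma loc_graft {U : SMod.{u, v} K} {c : ℤ} (G : LabMap U U c) (i : Fin m) (e : Wire i n k) (h : p +
    q = s) {p' q' s' : ℤ} (hp' : p' + c = p) (hq' : q' + c = q) (h₁ : p' + q = s') (h₂ : p + q' =
    s') (x : PTree U m p) (y : PTree U n q) : (loc G G (graft i e h x y) : PTree U k s') = graft i e
    h₁ (loc G G x) y + sgn K (c * p) • graft i e h₂ x (loc G G y) := by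
  induction x using ptree_induction with
  | zero => simp
  | add x x' hx hx' => simp only [map_add, LinearMap.add_apply, hx, hx', smul_add]; abel
  | smul a x hx =>
    simp only [map_smul, LinearMap.smul_apply, hx, smul_add, smul_comm a]
  | tree A r f hA hp =>
  induction y using ptree_induction with
  | zero => simp
  | add x x' hx hx' => simp only [map_add, hx, hx', smul_add]; abel
  | smul a x hx => simp only [map_smul, hx, smul_add, smul_comm a]
  | tree B b g hB hq =>
    obtain ⟨π, h1, h2, h3, h4, h5⟩ := exists_apart_marked A r f i hB q
    rw [h1, graft_ptree hA h3 rfl h5 (e.fits_wireLabel _ _) hp (h4.trans hq)]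
    exact loc_graft_ptree G hA h3 rfl h5 (e.fits_wireLabel _ _) hp (h4.trans hq) h hp' hq' h₁ h₂

lemma con_graft {c : ℤ} (μ : LabMul V c) (i : Fin m) (e : Wire i n k) (h : p + q = s) {p' q' s' : ℤ}
    (hp' : p' + c = p) (hq' : q' + c = q) (h₁ : p' + q = s') (h₂ : p + q' = s') (x : PTree (marked
    V) m p) {y : PTree (marked V) n q} (hy : y ∈ MTrees V ⊤ n q) : ((markedMul μ).con (graft i e h x
    y) : PTree _ k s') = graft i e h₁ ((markedMul μ).con x) y + sgn K (c * p) • graft i e h₂ x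
    ((markedMul μ).con y) := by
  induction x using ptree_induction with
  | zero => simp
  | add x x' hx hx' => simp only [map_add, LinearMap.add_apply, hx, hx', smul_add]; abel
  | smul a x hx =>
    simp only [map_smul, LinearMap.smul_apply, hx, smul_add, smul_comm a]
  | tree A r f hA hp =>
  induction hy using MTrees_induction with
  | zero => simp
  | add x x' _ _ hx hx' => simp only [map_add, hx, hx', smul_add]; abel
  | smul a x _ hx => simp only [map_smul, hx, smul_add, smul_comm a]
  | tree B b g hB hq hBr _ =>
    obtain ⟨π, h1, h2, h3, h4, h5⟩ := exists_apart_marked A r f i hB q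
    rw [h1, graft_ptree hA h3 rfl h5 (e.fits_wireLabel _ _) hp (h4.trans hq)]
    refine con_graft_ptree (markedMul μ) hA h3 rfl h5 (e.fits_wireLabel _ _) hp (h4.trans hq) h hp'
      hq' h₁ h₂ fun t ht htb _ _ _ _ _ _ _ _ => ?_
    have h0 := (h2 ▸ hBr.ren π) t ht htb
    exact marked_ext (by simp [h0]) (by simp [h0])

lemma ptree_nil_mem_markedTrees (r : ℕ) (l : Fin n → ℕ) (a : ℕ∞) : (ptree [] r l : PTree (marked V)
    n p) ∈ MTrees V a n p :=
  ptree_mem_markedTrees (fun _ _ h => absurd h (by simp)) (by simp)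

lemma markRoot_ptree_mem {L : List (Vtx (marked V))}
    (hL : IsPTree L r l) (hp : deg L = p) : (markRoot (ptree L r l : PTree _ n p) :
      PTree (marked V) n q) ∈ MTrees V L.length n q := by
  rw [markRoot, loc_ptree _ _ hL hp]
  refine pickSum_mem fun s L' hs => ?_
  by_cases hsr : s.out = r
  · refine ptree_mem_markedTrees (fun _ t ht htr => ?_) ?_
    · rcases List.mem_cons.1 ht with rfl | ht
      · rw [Vtx.opAt, if_pos hsr]
        rfl
      · -- no other vertex starts at the root
        have h1 := ((IsPTree.perm hs).2 hL).1
        have h2 := ((IsPTree.perm hs).2 hL).2.1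
        rw [← h1, outs_cons, cons_add, nodup_cons] at h2
        exact absurd (mem_add.2 (Or.inl (mem_outs.2 ⟨t, ht, htr.trans hsr.symm⟩))) h2.1
    · rw [← hs.length_eq]
      simp
  · have h0 : s.opAt (markMap V) (LabMap.zero _ _ 1) r = ⟨s.out, s.ar, s.deg - 1, 0, s.inp⟩ := by
      rw [Vtx.opAt, if_neg hsr]
      rfl
    have := (multi_ptree (V := marked V) q r l).comb_head L' (.linear s.out s.ar (s.deg - 1) (0 : K)
      0 0 0 s.inp)
    simp only [zero_smul, add_zero] at this
    rw [h0, this]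
    exact zero_mem _

end MarkedTrees

/-! ### Cutting an edge of a tree -/

section Cuts

lemma exists_leaves (S : Multiset ℕ) : ∃ (k : ℕ) (l : Fin k → ℕ), lvs l = S := by
  induction S using Quot.inductionOn with
  | h L =>
    refine ⟨L.length, L.get, ?_⟩
    rw [lvs, Fin.univ_val_map, List.ofFn_get]
    rfl

lemma IsPTree.nodup_outs (h : IsPTree L r l) : (outs L + lvs l).Nodup := h.1 ▸ h.2.1

lemma IsPTree.out_mem (h : IsPTree L r l) {s : Vtx V} (hs : s ∈ L) : s.out = r ∨ s.out ∈ ins L := by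
  have := h.1 ▸ mem_add.2 (Or.inl (mem_outs.2 ⟨s, hs, rfl⟩))
  rwa [mem_cons] at this

lemma IsPTree.root_notMem_ins (h : IsPTree L r l) : r ∉ ins L := (nodup_cons.1 h.2.1).1

lemma IsPTree.root_mem_outs (h : IsPTree L r l) (h0 : L ≠ []) : r ∈ outs L := by
  obtain ⟨height, hh⟩ := h.2.2
  have : ∀ N, ∀ s ∈ L, height s.out < N → r ∈ outs L := by
    intro N
    induction N with
    | zero => intro s _ hs; omega
    | succ N ih =>
      intro s hs hN
      rcases h.out_mem hs with h' | h'
      · exact mem_outs.2 ⟨s, hs, h'⟩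
      · obtain ⟨v, hv, a, ha⟩ := mem_ins.1 h'
        have := hh v hv a
        rw [ha] at this
        exact ih v hv (by omega)
  obtain ⟨s, hs⟩ := List.exists_mem_of_ne_nil L h0
  exact this _ s hs (Nat.lt_succ_self _)

/-- The lists `A` and `B` of vertices are separated by the edge `f`: this edge goes from `B` to `A`,
and the other edges that start at `B` end at `B`, and those that start at `A` end at `A` or are the
root `r`. -/
def IsCut (A B : List (Vtx V)) (r f : ℕ) : Prop :=
  (∀ s ∈ A, s.out = r ∨ s.out ∈ ins A) ∧ (∀ t ∈ B, t.out = f ∨ t.out ∈ ins B) ∧ f ∈ ins A ∧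
    f ∈ outs B

/-- A presentation of the tree with vertices `A ++ B` as a graft of a tree with vertices `B` on a
tree with vertices `A`. -/
structure Glue (A B : List (Vtx V)) (r : ℕ) (l : Fin n → ℕ) where
  nA : ℕ
  nB : ℕ
  lA : Fin nA → ℕ
  lB : Fin nB → ℕ
  i : Fin nA
  e : Wire i nB n
  isTreeA : IsTree A r lA
  isTreeB : IsTree B (lA i) lB
  fits : e.Fits lA lB l

variable {A B : List (Vtx V)} {f : ℕ}

lemma IsCut.unique (hf : IsCut A B r f) {f' : ℕ} (hf' : IsCut A B r f') (h : IsPTree (A ++ B) r l) :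
    f' = f := by
  obtain ⟨t, ht, rfl⟩ := mem_outs.1 hf'.2.2.2
  rcases hf.2.1 t ht with h1 | h1
  · exact h1
  · have := h.2.1
    rw [ins_append, nodup_cons, nodup_add] at this
    exact (disjoint_left.1 this.2.2.2 hf'.2.2.1 h1).elim

lemma Glue.apart (g : Glue A B r l) (h : IsPTree (A ++ B) r l) : Apart A r g.lA B (g.lA g.i) g.lB :=
    by
  intro x hx hx'
  rw [mem_edges g.isTreeA.ptree] at hx
  rw [mem_edges g.isTreeB.ptree] at hx'
  have h2 := h.2.1
  rw [ins_append, nodup_cons, nodup_add, mem_add] at h2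
  rcases hx' with hx' | hx'
  · exact hx'
  · rcases hx with rfl | hx
    · exact absurd (Or.inr hx') h2.1
    · exact (disjoint_left.1 h2.2.2.2 hx hx').elim

lemma Glue.isCut (g : Glue A B r l) (h : IsPTree (A ++ B) r l) : IsCut A B r (g.lA g.i) := by
  obtain ⟨hA0, hA⟩ := isTree_iff.1 g.isTreeA
  obtain ⟨hB0, hB⟩ := isTree_iff.1 g.isTreeB
  have hf := hB.root_mem_outs hB0
  refine ⟨fun s hs => hA.out_mem hs, fun t ht => hB.out_mem ht, ?_, hf⟩
  have h1 : g.lA g.i ∈ r ::ₘ ins A := by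
    rw [← hA.1, mem_add]
    exact Or.inr (mem_lvs.2 ⟨_, rfl⟩)
  refine (mem_cons.1 h1).resolve_left fun h2 => ?_
  have h3 := h.nodup_outs
  rw [outs_append, nodup_add, nodup_add] at h3
  exact disjoint_left.1 h3.1.2.2 (hA.root_mem_outs hA0) (h2 ▸ hf)

lemma IsCut.exists_glue (hc : IsCut A B r f) (h : IsPTree (A ++ B) r l) : ∃ g : Glue A B r l, g.lA
    g.i = f := by
  obtain ⟨hA, hB, hfA, hfB⟩ := hc
  have h1 := h.1
  have h2 := h.nodup_outs
  have h3 := h.2.1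
  obtain ⟨height, hh⟩ := h.2.2
  rw [outs_append, ins_append] at h1
  rw [outs_append] at h2
  rw [ins_append] at h3
  have h2' := (nodup_add.1 h2).1
  have hle : outs A ≤ r ::ₘ ins A := by
    rw [Multiset.le_iff_subset (nodup_add.1 h2').1]
    intro x hx
    obtain ⟨s, hs, rfl⟩ := mem_outs.1 hx
    exact mem_cons.2 (hA s hs)
  have hle' : outs B ≤ f ::ₘ ins B := by
    rw [Multiset.le_iff_subset (nodup_add.1 h2').2.1]
    intro x hx
    obtain ⟨s, hs, rfl⟩ := mem_outs.1 hx
    exact mem_cons.2 (hB s hs)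
  obtain ⟨SA, hSA⟩ := Multiset.le_iff_exists_add.1 hle
  obtain ⟨SB, hSB⟩ := Multiset.le_iff_exists_add.1 hle'
  obtain ⟨nA, lA, rfl⟩ := exists_leaves SA
  obtain ⟨nB, lB, rfl⟩ := exists_leaves SB
  have hf : f ∈ lvs lA := by
    have : f ∈ outs A + lvs lA := hSA ▸ Multiset.mem_cons_of_mem hfA
    refine (mem_add.1 this).resolve_left fun h' => ?_
    exact disjoint_left.1 (nodup_add.1 h2').2.2 h' hfB
  obtain ⟨i, rfl⟩ := mem_lvs.1 hf
  have hfit : lvs lA + lvs lB = lA i ::ₘ lvs l := by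
    refine add_left_cancel (a := outs A + outs B) ?_
    rw [add_cons, h1, add_add_add_comm, ← hSA, ← hSB, cons_add, add_cons,
      cons_swap]
  obtain ⟨e, he⟩ := Wire.exists_fits h.leaf_injective hfit
  refine ⟨⟨nA, nB, lA, lB, i, e, isTree_iff.2 ⟨?_, hSA.symm, ?_, height, fun s hs =>
    hh s (by simp [hs])⟩, isTree_iff.2 ⟨?_, hSB.symm, ?_, height, fun s hs => hh s (by simp [hs])⟩,
    he⟩, rfl⟩
  · rintro rfl
    simp at hfA
  · rw [nodup_cons, nodup_add] at h3
    exact nodup_cons.2 ⟨fun h' => h3.1 (mem_add.2 (Or.inl h')), h3.2.1⟩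
  · rintro rfl
    simp at hfB
  · rw [nodup_cons, nodup_add] at h3
    exact nodup_cons.2 ⟨fun h' => disjoint_left.1 h3.2.2.2 hfA h', h3.2.2.1⟩

/-- The edges on the paths that lead to the edge `f`, including `f`. -/
inductive Above (L : List (Vtx V)) (f : ℕ) : ℕ → Prop
  | root : Above L f f
  | step (v : Vtx V) (hv : v ∈ L) (h : Above L f v.out) (a : Fin v.ar) : Above L f (v.inp a)

lemma Above.perm {L' : List (Vtx V)} (h : L.Perm L') {x : ℕ} (hx : Above L f x) : Above L' f x := by
  induction hx with
  | root => exact .root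
  | step v hv _ a ih => exact .step v (h.subset hv) ih a

/-- The partition of the vertices of a tree that is defined by the edge that starts at the vertex `t`:
one block consists of the vertices above this edge. -/
lemma isCut_iff {s t : Vtx V} (h : IsPTree (s :: A ++ t :: B) r l) (hs : s.out = r) : IsCut (s :: A)
    (t :: B) r t.out ↔ (∀ a ∈ A, ¬ Above (s :: A ++ t :: B) t.out a.out) ∧ ∀ b ∈ B, Above (s :: A ++
    t :: B) t.out b.out := by
  have h1 := h.nodup_outs
  have h2 := h.2.1
  obtain ⟨height, hh⟩ := h.2.2
  rw [outs_append] at h1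
  replace h1 : ∀ {x}, x ∈ outs (s :: A) → x ∉ outs (t :: B) :=
    disjoint_left.1 (nodup_add.1 (nodup_add.1 h1).1).2.2
  rw [ins_append] at h2
  have h4 := (nodup_cons.1 h2).1
  replace h2 : ∀ {x}, x ∈ ins (s :: A) → x ∉ ins (t :: B) :=
    disjoint_left.1 (nodup_add.1 (nodup_cons.1 h2).2).2.2
  have htr : t.out ≠ r := fun h' =>
    h1 (mem_outs.2 ⟨s, by simp, hs⟩) (h' ▸ mem_outs.2 ⟨t, by simp, rfl⟩)
  have hmem : ∀ v, v ∈ s :: A ++ t :: B ↔ v ∈ s :: A ∨ v ∈ t :: B := fun v => mem_append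
  generalize hL : s :: A ++ t :: B = L at *
  have hout : ∀ x ∈ outs (s :: A), x ≠ t.out ∧ ∀ y ∈ t :: B, y.out ≠ x := fun x hx =>
    ⟨fun h' => h1 hx (h' ▸ mem_outs.2 ⟨t, by simp, rfl⟩),
      fun y hy h' => h1 hx (h' ▸ mem_outs.2 ⟨y, hy, rfl⟩)⟩
  have hheight : ∀ {x}, Above L t.out x → height t.out ≤ height x := by
    intro x hx
    induction hx with
    | root => exact le_rfl
    | step v hv _ a ih => exact ih.trans (hh v hv a).le
  constructor
  · rintro ⟨hA, hB, hfA, hfB⟩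
    have key : ∀ {x}, Above L t.out x → x = t.out ∨ x ∈ ins (t :: B) := by
      intro x hx
      induction hx with
      | root => exact Or.inl rfl
      | step v hv _ a ih =>
        rcases (hmem v).1 hv with hv | hv
        · exfalso
          have hv' := hout v.out (mem_outs.2 ⟨v, hv, rfl⟩)
          have ih' := ih.resolve_left hv'.1
          rcases hA v hv with h' | h'
          · exact h4 (mem_add.2 (Or.inr (h' ▸ ih')))
          · exact h2 h' ih'
        · exact Or.inr (mem_ins.2 ⟨v, hv, a, rfl⟩)
    constructor
    · intro a ha hab
      have hv' := hout a.out (mem_outs.2 ⟨a, by simp [ha], rfl⟩)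
      have ih' := (key hab).resolve_left hv'.1
      rcases hA a (by simp [ha]) with h' | h'
      · exact h4 (mem_add.2 (Or.inr (h' ▸ ih')))
      · exact h2 h' ih'
    · have : ∀ N, ∀ b ∈ t :: B, height b.out < N → Above L t.out b.out := by
        intro N
        induction N with
        | zero => intro b _ hb; omega
        | succ N ih =>
          intro b hb hbN
          rcases hB b hb with h' | h'
          · rw [h']
            exact .root
          · obtain ⟨v, hv, a, hva⟩ := mem_ins.1 h'
            rw [← hva]
            have hvL := (hmem v).2 (Or.inr hv)
            have := hh v hvL a
            rw [hva] at this
            exact .step v hvL (ih v hv (by omega)) a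
      exact fun b hb => this _ b (by simp [hb]) (Nat.lt_succ_self _)
  · rintro ⟨hA, hB⟩
    have hB' : ∀ v ∈ t :: B, Above L t.out v.out := by
      intro v hv
      rcases List.mem_cons.1 hv with rfl | hv
      · exact .root
      · exact hB v hv
    have hins : ∀ x, x ∈ ins L ↔ x ∈ ins (s :: A) ∨ x ∈ ins (t :: B) := fun x => by
      rw [← hL, ins_append, mem_add]
    have hfA : t.out ∈ ins (s :: A) := by
      have := (h.out_mem ((hmem t).2 (Or.inr (by simp)))).resolve_left htr
      refine ((hins _).1 this).resolve_right fun h' => ?_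
      obtain ⟨v, hv, a, hva⟩ := mem_ins.1 h'
      have h5 := hheight (hB' v hv)
      have h6 := hh v ((hmem v).2 (Or.inr hv)) a
      rw [hva] at h6
      omega
    have hr : ∀ x, Above L t.out x → x ≠ r := by
      rintro _ (_ | ⟨v, hv, -, a⟩)
      · exact htr
      · exact fun h' => h.root_notMem_ins (h' ▸ mem_ins.2 ⟨v, hv, a, rfl⟩)
    have key : ∀ x, Above L t.out x → x = t.out ∨ x ∈ ins (t :: B) := by
      rintro _ (_ | ⟨v, hv, h', a⟩)
      · exact Or.inl rfl
      · rcases (hmem v).1 hv with hv | hv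
        · rcases List.mem_cons.1 hv with rfl | hv
          · exact (hr _ h' hs).elim
          · exact (hA v hv h').elim
        · exact Or.inr (mem_ins.2 ⟨v, hv, a, rfl⟩)
    refine ⟨?_, ?_, hfA, mem_outs.2 ⟨t, by simp, rfl⟩⟩
    · intro a ha
      rcases List.mem_cons.1 ha with rfl | ha
      · exact Or.inl hs
      · refine (h.out_mem ((hmem a).2 (Or.inl (by simp [ha])))).imp_right fun h' => ?_
        refine ((hins _).1 h').resolve_right fun h' => ?_
        obtain ⟨v, hv, j, hvj⟩ := mem_ins.1 h'
        exact hA a ha (hvj ▸ .step v ((hmem v).2 (Or.inr hv)) (hB' v hv) j)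
    · intro b hb
      rcases List.mem_cons.1 hb with rfl | hb
      · exact Or.inl rfl
      · exact key b.out (hB b hb)

end Cuts

section SplitSum

variable {M : Type w} [AddCommGroup M] [Module K M]

lemma split_congr {F G : List (Vtx V) → List (Vtx V) → M} (h : ∀ A B, (A ++ B).Perm L → F A B = G A
    B) : splitSum F L = splitSum G L := by
  induction L generalizing F G with
  | nil => exact h [] [] (.refl _)
  | cons s L ih =>
    rw [splitSum, splitSum]
    congr 1
    · exact ih fun A B hAB => h _ _ (hAB.cons s)
    · exact ih fun A B hAB => by rw [h _ _ (perm_middle.trans (hAB.cons s))]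

lemma split_eq_zero {F : List (Vtx V) → List (Vtx V) → M} (h : ∀ A B, (A ++ B).Perm L → F A B = 0) :
    splitSum F L = 0 := by
  rw [split_congr h]
  simpa using splitSum_smul (0 : K) (fun _ _ => (0 : M)) L

/-- Choosing a vertex of the first block of a partition. -/
lemma splitSum_pickSum_left (F : Vtx V → List (Vtx V) → List (Vtx V) → M) (L : List (Vtx V)) :
    splitSum (fun A B => pickSum (fun s A' => F s A' B) A) L = pickSum (fun s L' => splitSum (fun A'
    B => F s A' B) L') L := by
  induction L generalizing F with
  | nil => rfl
  | cons a L ih =>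
    have h : splitSum (fun A B => sgn K (a.deg * deg A) • pickSum (fun s A' => F s A' (a :: B)) A) L =
        splitSum (fun A B => pickSum (fun s A' =>
          sgn K (a.deg * s.deg) • sgn K (a.deg * deg A') • F s A' (a :: B)) A) L := by
      refine split_congr fun A B _ => ?_
      rw [← pickSum_smul]
      refine pick_congr fun s A' hs => ?_
      rw [← deg_perm hs, deg_cons, mul_add, sgn_add, mul_smul]
    rw [splitSum, h, ih]
    simp only [splitSum, pickSum, splitSum_add, ← splitSum_smul, smul_add, pickSum_add]
    rw [← ih, add_assoc, ih]

/-- Choosing a vertex of the second block of a partition. -/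
lemma splitSum_pickSum_right (F : Vtx V → List (Vtx V) → List (Vtx V) → M) (L : List (Vtx V)) :
    splitSum (fun A B => pickSum (fun t B' => F t A B') B) L = pickSum (fun t L' => splitSum (fun A
    B' => sgn K (deg A * t.deg) • F t A B') L') L := by
  induction L generalizing F with
  | nil => rfl
  | cons a L ih =>
    have h : splitSum (fun A B => sgn K (a.deg * deg A) • pickSum (fun t B' => F t A B') (a :: B)) L =
        splitSum (fun A B => sgn K (a.deg * deg A) • F a A B) L +
        splitSum (fun A B => pickSum (fun t B' =>
          sgn K (a.deg * t.deg) • sgn K (a.deg * deg A) • F t A (a :: B')) B) L := by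
      rw [← splitSum_add]
      refine split_congr fun A B _ => ?_
      rw [pickSum, smul_add, ← pickSum_smul]
      congr 1
      exact pick_congr fun t B' _ => smul_comm _ _ _
    rw [splitSum, h, ih, ih, pickSum]
    simp only [splitSum, splitSum_add, ← splitSum_smul, smul_add, pickSum_add]
    rw [add_left_comm]
    refine congrArg₂ (· + ·) (split_congr fun A B _ => by rw [mul_comm])
      (congrArg₂ (· + ·) (pick_congr fun t L' _ => split_congr fun A B _ => ?_)
        (pick_congr fun t L' _ => split_congr fun A B _ => ?_))
    · rw [smul_smul, ← sgn_add, deg_cons]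
      congr 1
      exact sgn_congr ⟨-(a.deg * t.deg), by ring⟩
    · simp only [smul_smul, ← sgn_add]
      congr 2
      ring

open Classical in
/-- Exactly one partition of a list has its first block outside of a given set and its second block
inside. -/
lemma splitSum_partition {G : List (Vtx V) → M} (hG : Koszul G) (P : Vtx V → Prop) (L : List (Vtx
    V)) : splitSum (fun A B => if (∀ a ∈ A, ¬ P a) ∧ ∀ b ∈ B, P b then G (A ++ B) else 0) L = G L :=
    by
  induction L generalizing G with
  | nil => simp [splitSum]
  | cons s L ih =>
    rw [splitSum]
    by_cases hs : P s
    · rw [split_eq_zero fun A B _ => if_neg fun h => h.1 s (by simp) hs, zero_add,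
        ← ih (hG.cons s)]
      refine split_congr fun A B _ => ?_
      simp only [List.mem_cons, forall_eq_or_imp, hs, true_and]
      rw [koszul_middle hG]
      split_ifs <;> simp
    · rw [split_eq_zero (F := fun A B => _ • _) fun A B _ => by
        rw [if_neg fun h => hs (h.2 s (by simp)), smul_zero], add_zero, ← ih (hG.cons s)]
      refine split_congr fun A B _ => ?_
      simp only [List.mem_cons, forall_eq_or_imp, hs, not_false_eq_true, true_and, cons_append]

lemma Multi.eq_zero {G : List (Vtx V) → M} (hG : Multi G) (A B : List (Vtx V)) {s : Vtx V} (hs :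
    s.lab = 0) : G (A ++ s :: B) = 0 := by
  have := hG.comb A B (.linear s.out s.ar s.deg (0 : K) 0 0 0 s.inp)
  simp only [zero_smul, add_zero] at this
  rw [← hs] at this
  exact this

end SplitSum

/-- The components of `unnest`, with values in planted trees. -/
def unnestLin (V : SMod.{u, v} K) : (CobarFree V).obj n p →ₗ[K] PTree (marked V) n p :=
  (unnest V).app

lemma unnestLin_gen (x : TreeObj V n (p + 1)) : unnestLin V (cobarGen x) = markEmbed x := rfl

lemma unnestLin_act (σ : Perm (Fin n)) (x : (CobarFree V).obj n p) : unnestLin V ((CobarFree V).act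
    σ x) = ptreeAct σ (unnestLin V x) := (unnest V).app_act σ x

lemma unnestLin_one : unnestLin V (CobarFree V).one = ptree [] 0 fun _ => 0 := (unnest V).app_one

lemma unnestLin_comp (i : Fin m) (e : Wire i n k) {s : ℤ} (h : p + q = s) (x : (CobarFree V).obj m
    p) (y : (CobarFree V).obj n q) : unnestLin V ((CobarFree V).comp i e h x y) = graft i e h
    (unnestLin V x) (unnestLin V y) :=
  (unnest V).app_comp i e h x y

/-- A vertex with its label, marked. -/
def Vtx.mark (s : Vtx V) : Vtx (marked V) := s.unmarked.op (markMap V)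

@[simp] lemma Vtx.mark_out (s : Vtx V) : s.mark.out = s.out := rfl
@[simp] lemma Vtx.mark_deg (s : Vtx V) : s.mark.deg = s.deg - 1 := rfl

lemma Vtx.mark_ends (s : Vtx V) : s.mark.ends = s.ends := rfl

lemma markedFst_mark_lab (s : Vtx V) : markedFst s.mark.lab = 0 := rfl

open Classical in
/-- Marking the root vertex of a tree. -/
lemma markRoot_unmarked (h : IsPTree L r l) (hp : deg L = p) : (markRoot (ptree (L.map Vtx.unmarked)
    r l : PTree _ n p) : PTree _ n q) = pickSum (fun s L' => if s.out = r then ptree (s.mark ::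
    L'.map Vtx.unmarked) r l else 0) L := by
  rw [markRoot, loc_ptree _ _ (isPTree_unmarked h) ((deg_map (f := Vtx.unmarked) (fun _ => rfl) L).trans hp),
    pickSum_mapVtx Vtx.unmarked (fun _ => rfl)]
  refine pick_congr fun s L' _ => ?_
  split_ifs with hs
  · have hs' : s.unmarked.out = r := hs
    rw [Vtx.opAt, if_pos hs']
    rfl
  · have hs' : ¬s.unmarked.out = r := hs
    rw [Vtx.opAt, if_neg hs']
    exact (multi_ptree q r l).eq_zero [] _ rfl

lemma isPTree_mark {s : Vtx V} (h : IsPTree (s :: L) r l) : IsPTree (s.mark :: L.map Vtx.unmarked) r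
    l :=
  isPTree_of_ends (by simp only [map_cons, List.map_map]; rfl) h

lemma deg_mark (s : Vtx V) (L : List (Vtx V)) : deg (s.mark :: L.map Vtx.unmarked) = deg (s :: L) -
    1 := by
  rw [deg_cons, deg_map (f := Vtx.unmarked) (fun _ => rfl), deg_cons, Vtx.mark_deg]
  omega

lemma edges_mark (s : Vtx V) (L : List (Vtx V)) (r : ℕ) (l : Fin n → ℕ) : edges (s.mark :: L.map
    Vtx.unmarked) r l = edges (s :: L) r l := by
  have h1 : outs (s.mark :: L.map Vtx.unmarked) = outs (s :: L) := by
    rw [outs_cons, outs_map (f := Vtx.unmarked) (fun _ => rfl)]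
    rfl
  have h2 : ins (s.mark :: L.map Vtx.unmarked) = ins (s :: L) := by
    rw [ins_cons, ins_map (f := Vtx.unmarked) (fun _ => rfl)]
    rfl
  rw [edges, h1, h2]
  rfl

/-- The cut given by a presentation as a graft. -/
def Glue.cut {A B : List (Vtx V)} (g : Glue A B r l)
    (h : IsPTree (A ++ B) r l) (hq : deg A + deg B = q + 2) : Cut A B r l q where
  nA := g.nA
  nB := g.nB
  pA := deg A - 1
  pB := deg B - 1
  lA := g.lA
  lB := g.lB
  i := g.i
  e := g.e
  isTreeA := g.isTreeA
  isTreeB := g.isTreeB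
  inj := h.leaf_injective
  inner b hb := by
    have h1 := h.nodup_outs
    rw [outs_append, nodup_add] at h1
    refine disjoint_left.1 h1.2.2 ?_ (mem_lvs.2 ⟨b, rfl⟩ : l b ∈ lvs l)
    rw [hb, mem_add]
    exact Or.inr (g.isTreeB.ptree.root_mem_outs g.isTreeB.ne_nil)
  labelA := g.fits.1
  labelB := g.fits.2
  degA := by omega
  degB := by omega
  deg_eq := by omega

/-- The presentation as a graft given by a cut. -/
def Cut.glue {A B : List (Vtx V)} (c : Cut A B r l q) : Glue A B r l :=
  ⟨c.nA, c.nB, c.lA, c.lB, c.i, c.e, c.isTreeA, c.isTreeB, c.labelA, c.labelB⟩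

open Classical in
lemma unnest_cutTerm {A B : List (Vtx V)} (h : IsPTree (A ++ B) r l) (hq : deg A + deg B = q + 2) :
    unnestLin V (cutTerm q A B r l) = (pickSum (fun s A' => pickSum (fun t B' => if s.out = r ∧
    IsCut A B r t.out then ptree (s.mark :: A'.map Vtx.unmarked ++ t.mark :: B'.map Vtx.unmarked) r
    l else 0) B) A : PTree (marked V) n q) := by
  by_cases hc : Nonempty (Cut A B r l q)
  · obtain ⟨c⟩ := hc
    have hcut := c.glue.isCut h
    have hap := c.glue.apart h
    obtain ⟨hA0, hA⟩ := isTree_iff.1 c.isTreeA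
    obtain ⟨hB0, hB⟩ := isTree_iff.1 c.isTreeB
    rw [cutTerm_eq c, Cut.value, unnestLin_comp, unnestLin_gen, unnestLin_gen, markEmbed,
      comp_apply, embed_tree c.isTreeA c.degA, markRoot_unmarked hA c.degA, markEmbed,
      comp_apply, embed_tree c.isTreeB c.degB, markRoot_unmarked hB c.degB]
    refine (graft_pickSum_left c.deg_eq _ _ _).trans (pick_congr fun s A' hs => ?_)
    rw [pickSum_map]
    refine pick_congr fun t B' ht => ?_
    have htc : t.out = c.lA c.i ↔ IsCut A B r t.out :=
      ⟨fun h' => h' ▸ hcut, fun h' => hcut.unique h' h⟩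
    by_cases hsr : s.out = r
    · by_cases htr : t.out = c.lA c.i
      · rw [if_pos hsr, if_pos htr, if_pos ⟨hsr, htc.1 htr⟩]
        have hdA := deg_perm hs
        have hdB := deg_perm ht
        have hdA' : deg (s.mark :: A'.map Vtx.unmarked) = c.pA := by
          rw [deg_mark, hdA, c.degA]
          ring
        have hdB' : deg (t.mark :: B'.map Vtx.unmarked) = c.pB := by
          rw [deg_mark, hdB, c.degB]
          ring
        have hap' : Apart (s.mark :: A'.map Vtx.unmarked) r c.lA (t.mark :: B'.map Vtx.unmarked)
            (c.lA c.i) c.lB := by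
          intro x hx hx'
          rw [edges_mark, edges_perm hs] at hx
          rw [edges_mark, edges_perm ht] at hx'
          exact hap x hx hx'
        exact graft_ptree (isPTree_mark ((IsPTree.perm hs).2 hA))
          (isPTree_mark ((IsPTree.perm ht).2 hB)) rfl hap'
          c.glue.fits hdA' hdB' _
      · rw [if_neg htr, map_zero, if_neg fun h' => htr (htc.2 h'.2)]
    · rw [if_neg hsr, map_zero, LinearMap.zero_apply, if_neg fun h' => hsr h'.1]
  · rw [cutTerm_eq_zero fun c => hc ⟨c⟩, map_zero]
    refine (pick_eq_zero fun s A' _ => pick_eq_zero fun t B' _ => if_neg ?_).symm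
    rintro ⟨-, h'⟩
    obtain ⟨g, -⟩ := h'.exists_glue h
    exact hc ⟨g.cut h hq⟩

lemma multi_unmarked {M : Type*} [AddCommGroup M] [Module K M] {G : List (Vtx (marked V)) → M} (hG :
    Multi G) : Multi fun L : List (Vtx V) => G (L.map Vtx.unmarked) :=
  hG.comp_map (fun _ => rfl) Vtx.Comb.unmarked

open Classical in
/-- Cutting an edge of a nested tree amounts to marking the vertex above the edge. -/
lemma unnest_cutMap (hq : q + 1 = p) (x : TreeObj V n (p + 1)) :
    unnestLin V (cutMap x : (CobarFree V).obj n q) =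
      (markRoot (markAny (embed x) : PTree (marked V) n p) : PTree (marked V) n q) := by
  induction x using tree_induction with
  | zero => simp
  | add x y hx hy => simp only [map_add, hx, hy]
  | smul c x hx => simp only [map_smul, hx]
  | tree L r l hL hp =>
  have hL' := hL.ptree
  -- the terms of both sides for a root vertex `s` and another vertex `t`
  let T : Vtx V → Vtx V → List (Vtx V) → PTree (marked V) n q := fun s t L'' =>
    if s.out = r then sgn K s.deg • ptree (s.mark :: t.mark :: L''.map Vtx.unmarked) r l else 0
  have h1 : unnestLin V (cutMap (tree L r l : TreeObj V n (p + 1)) : (CobarFree V).obj n q) =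
      pickSum (fun s L' => pickSum (fun t L'' => T s t L'') L') L := by
    rw [cutMap, treeLift_tree, if_pos ⟨hL, hp⟩, cutFun, splitSum_map]
    have e1 : ∀ A B, (A ++ B).Perm L → unnestLin V (sgn K (deg A) • cutTerm q A B r l) =
        pickSum (fun s A' => pickSum (fun t B' => if s.out = r ∧ IsCut (s :: A') (t :: B') r t.out then
          sgn K (s.deg + deg A') • ptree (s.mark :: A'.map Vtx.unmarked ++
            t.mark :: B'.map Vtx.unmarked) r l else 0) B) A := by
      intro A B hAB
      have hd := deg_perm hAB
      rw [deg_append] at hd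
      rw [map_smul, unnest_cutTerm ((IsPTree.perm hAB).2 hL') (by omega), ← pickSum_smul]
      refine pick_congr fun s A' hs => ?_
      rw [← pickSum_smul]
      refine pick_congr fun t B' ht => ?_
      have e : IsCut A B r t.out ↔ IsCut (s :: A') (t :: B') r t.out := by
        simp only [IsCut, ← hs.mem_iff, ← ht.mem_iff, ins_perm hs, ins_perm ht, outs_perm ht]
      rw [e, smul_ite, smul_zero, ← deg_perm hs, deg_cons]
    rw [split_congr e1, splitSum_pickSum_left (fun s A' B => pickSum (fun t B' => if s.out = r ∧
      IsCut (s :: A') (t :: B') r t.out then sgn K (s.deg + deg A') • ptree (s.mark ::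
        A'.map Vtx.unmarked ++ t.mark :: B'.map Vtx.unmarked) r l else 0) B)]
    refine pick_congr fun s L' hs => ?_
    rw [splitSum_pickSum_right (fun t A' B' => if s.out = r ∧
      IsCut (s :: A') (t :: B') r t.out then sgn K (s.deg + deg A') • ptree (s.mark ::
        A'.map Vtx.unmarked ++ t.mark :: B'.map Vtx.unmarked) r l else 0)]
    refine pick_congr fun t L'' ht => ?_
    have hst : (s :: t :: L'').Perm L := (ht.cons s).trans hs
    by_cases hsr : s.out = r
    · have hG : Koszul fun L'' : List (Vtx V) => sgn K s.deg •
          (ptree (s.mark :: t.mark :: L''.map Vtx.unmarked) r l : PTree (marked V) n q) :=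
        ((multi_unmarked (((multi_ptree q r l).cons s.mark).cons t.mark)).smul _).koszul
      simp only [T]
      rw [if_pos hsr, ← splitSum_partition hG (fun a => Above (s :: t :: L'') t.out a.out) L'']
      refine split_congr fun A B hAB => ?_
      have hperm : (s :: A ++ t :: B).Perm (s :: t :: L'') :=
        (perm_middle.trans (hAB.cons t)).cons s
      have e2 : ∀ x, Above (s :: A ++ t :: B) t.out x ↔ Above (s :: t :: L'') t.out x := fun x =>
        ⟨fun h => h.perm hperm, fun h => h.perm hperm.symm⟩
      simp only [hsr, true_and, isCut_iff ((IsPTree.perm (hperm.trans hst)).2 hL') hsr, e2, smul_ite,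
        smul_zero]
      refine if_congr Iff.rfl ?_ rfl
      have := koszul_middle ((multi_ptree (V := marked V) (K := K) q r l).cons s.mark).koszul t.mark
        (A.map Vtx.unmarked) (B.map Vtx.unmarked)
      rw [map_append, this, deg_map (f := Vtx.unmarked) (fun _ => rfl), smul_smul, smul_smul,
        ← sgn_add, ← sgn_add]
      congr 1
      simp only [Vtx.mark_deg]
      exact sgn_congr ⟨deg A, by ring⟩
    · simp only [T]
      rw [if_neg hsr]
      exact split_eq_zero fun A B _ => by rw [if_neg fun h => hsr h.1, smul_zero]
  rw [h1, embed_tree hL hp, markAny,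
    loc_ptree _ _ (isPTree_unmarked hL') ((deg_map (f := Vtx.unmarked) (fun _ => rfl) L).trans hp),
    pickSum_mapVtx Vtx.unmarked (fun _ => rfl), pickSum_map, pickSum_comm]
  refine pick_congr fun t L' ht => ?_
  have hd := deg_perm ht
  rw [deg_cons] at hd
  have hp' : deg (t.mark :: L'.map Vtx.unmarked) = p := by
    rw [deg_mark, deg_cons]
    omega
  have e3 : t.unmarked.opAt (markMap V) (markMap V) r = t.mark := Vtx.opAt_same _ _ _
  rw [e3, markRoot, loc_ptree _ _ (isPTree_mark ((IsPTree.perm ht).2 hL')) hp', pickSum]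
  have h0 : ptree (t.mark.opAt (markMap V) (LabMap.zero _ _ 1) r :: L'.map Vtx.unmarked) r l =
      (0 : PTree (marked V) n q) := by
    by_cases h : t.mark.out = r
    · rw [Vtx.opAt, if_pos h]
      exact (multi_ptree q r l).eq_zero [] _ (marked_ext rfl
        ((markedSnd_mark _ _).trans ((congrArg _ (markedFst_mark_lab t)).trans (map_zero _))))
    · rw [Vtx.opAt, if_neg h]
      exact (multi_ptree q r l).eq_zero [] _ rfl
  rw [h0, zero_add, pickSum_mapVtx Vtx.unmarked (fun _ => rfl)]
  refine pick_congr fun s L'' _ => ?_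
  simp only [T]
  by_cases hsr : s.out = r
  · have hs' : s.unmarked.out = r := hsr
    rw [if_pos hsr, Vtx.opAt, if_pos hs', smul_smul, ← sgn_add]
    refine congrArg₂ (· • ·) (sgn_congr ?_) rfl
    simp only [Vtx.mark_deg, Vtx.unmarked]
    exact ⟨s.deg, by ring⟩
  · have hs' : ¬s.unmarked.out = r := hsr
    rw [if_neg hsr, Vtx.opAt, if_neg hs', smul_zero]
    exact ((congrArg _ ((multi_ptree q r l).eq_zero [] _ rfl)).trans (smul_zero _)).symm

/-! ### The derivation of the cobar construction on nested trees -/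

lemma cobarFree_induction {C : ∀ {n : ℕ} {p : ℤ}, (CobarFree V).obj n p → Prop} (one : C (CobarFree
    V).one) (gen : ∀ {n : ℕ} {p : ℤ} (x : TreeObj V n (p + 1)), C (cobarGen x : (CobarFree V).obj n
    p)) (act : ∀ {n : ℕ} {p : ℤ} (σ : Perm (Fin n)) (x : (CobarFree V).obj n p), C x → C ((CobarFree
    V).act σ x)) (comp : ∀ {m n k : ℕ} (i : Fin m) (e : Wire i n k) {p q r : ℤ} (h : p + q = r) (x :
    (CobarFree V).obj m p) (y : (CobarFree V).obj n q), C x → C y → C ((CobarFree V).comp i e h x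
    y)) (zero : ∀ {n : ℕ} {p : ℤ}, C (0 : (CobarFree V).obj n p)) (add : ∀ {n : ℕ} {p : ℤ} (x y :
    (CobarFree V).obj n p), C x → C y → C (x + y)) (smul : ∀ {n : ℕ} {p : ℤ} (c : K) (x : (CobarFree
    V).obj n p), C x → C (c • x)) (x : (CobarFree V).obj n p) : C x := by
  have h : ∀ {n : ℕ} {p : ℤ} (x : Expr (desusp (treeModule V)) n p), C (FreeOperad.mk x) := by
    intro n p x
    induction x with
    | one => exact one
    | gen x => exact gen x
    | act σ x ih => exact act σ _ ih
    | comp i e h x y ihx ihy => exact comp i e h _ _ ihx ihy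
    | zero => exact zero
    | add x y ihx ihy => exact add _ _ ihx ihy
    | smul c x ih => exact smul c _ ih
  obtain ⟨x⟩ := x
  exact h x

lemma markEmbed_mem (x : TreeObj V n (p + 1)) : (markEmbed x : PTree (marked V) n p) ∈ MTrees V ⊤ n
    p := by
  induction x using tree_induction with
  | zero => rw [map_zero]; exact zero_mem _
  | add x y hx hy => rw [map_add]; exact add_mem hx hy
  | smul c x hx => rw [map_smul]; exact smul_mem _ c hx
  | tree L r l hL hp =>
    rw [markEmbed, comp_apply, embed_tree hL hp]
    exact MTrees_mono le_top (markRoot_ptree_mem (isPTree_unmarked hL.ptree)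
      ((deg_map (f := Vtx.unmarked) (fun _ => rfl) L).trans hp))

lemma unnestLin_mem (x : (CobarFree V).obj n p) : unnestLin V x ∈ MTrees V ⊤ n p := by
  induction x using cobarFree_induction with
  | one => rw [unnestLin_one]; exact ptree_nil_mem_markedTrees _ _ _
  | gen x => exact markEmbed_mem x
  | act σ x ih => rw [unnestLin_act]; exact ptreeAct_mem_markedTrees σ ih
  | comp i e h x y ihx ihy =>
    rw [unnestLin_comp]
    exact MTrees_mono le_top (graft_mem_markedTrees i e h ihx ihy)
  | zero => rw [map_zero]; exact zero_mem _
  | add x y hx hy => rw [map_add]; exact add_mem hx hy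
  | smul c x hx => rw [map_smul]; exact smul_mem _ c hx

variable (P) in
/-- The part of the derivation of the cobar construction, on generators, without the curvature. -/
def uncurvedDeriv (_ : q + 1 = p) : TreeObj (barGen P) n (p + 1) →ₗ[K] (CobarFree (barGen P)).obj n
    q :=
  - (cobarGen ∘ₗ barDiff P) - cutMap

variable (P) in
lemma uncurvedDeriv_act (h : q + 1 = p) (σ : Perm (Fin n)) (x : TreeObj (barGen P) n (p + 1)) :
    uncurvedDeriv P h (treeAct σ x) = (CobarFree (barGen P)).act σ (uncurvedDeriv P h x) := by
  simp only [uncurvedDeriv, LinearMap.sub_apply, LinearMap.neg_apply, comp_apply, map_sub,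
    map_neg]
  rw [barDiff_treeAct, cobarGen_act, cutMap_act]

variable (P) in
/-- The free operad on the bar construction, with the derivation that leaves out the curvature. -/
def uncurved : DerOperad.{u, max u v} K :=
  FreeOperad.withDeriv (W := desusp (treeModule (barGen P))) (uncurvedDeriv P) (uncurvedDeriv_act P)

variable (P) in
/-- The curvature of the bar construction, as a map to the units. -/
def curvDeriv (_ : q + 1 = p) : TreeObj (barGen P) n (p + 1) →ₗ[K] (CobarFree (barGen P)).obj n q :=
  (CobarFree (barGen P)).unitAt n q ∘ₗ vCoeff ∘ₗ proj (barGen P)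

variable (P) in
lemma curvDeriv_act (h : q + 1 = p) (σ : Perm (Fin n)) (x : TreeObj (barGen P) n (p + 1)) :
    curvDeriv P h (treeAct σ x) = (CobarFree (barGen P)).act σ (curvDeriv P h x) := by
  simp only [curvDeriv, comp_apply]
  rw [proj_treeAct, vCoeff_act, GrOperad.act_unitAt]

variable (P) in
/-- The free operad on the bar construction, with the derivation given by the curvature. -/
def curving : DerOperad.{u, max u v} K :=
  FreeOperad.withDeriv (W := desusp (treeModule (barGen P))) (curvDeriv P) (curvDeriv_act P)

/-- The derivation of the cobar construction without the curvature. -/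
def uncurvedD (P : DerOperad.{u, v} K) (h : q + 1 = p) : (CobarFree (barGen P)).obj n p →ₗ[K]
    (CobarFree (barGen P)).obj n q := (uncurved P).d h

/-- The derivation of the cobar construction given by the curvature. -/
def curvD (P : DerOperad.{u, v} K) (h : q + 1 = p) : (CobarFree (barGen P)).obj n p →ₗ[K] (CobarFree
    (barGen P)).obj n q := (curving P).d h

/-- The derivation of the cobar construction. -/
def cobarD (P : DerOperad.{u, v} K) (h : q + 1 = p) : (CobarFree (barGen P)).obj n p →ₗ[K]
    (CobarFree (barGen P)).obj n q := (cobarBar P).d h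

/-- A family of maps that is a derivation of degree `-1` of the free operad. -/
structure IsDeriv {V : SMod.{u, v} K} (D : ∀ {n : ℕ} {p q : ℤ} (_ : q + 1 = p),
    (CobarFree V).obj n p →ₗ[K] (CobarFree V).obj n q) : Prop where
  act : ∀ {n : ℕ} {p q : ℤ} (h : q + 1 = p) (σ : Perm (Fin n)) (x : (CobarFree V).obj n p),
    D h ((CobarFree V).act σ x) = (CobarFree V).act σ (D h x)
  comp : ∀ {m n k : ℕ} (i : Fin m) (e : Wire i n k) {p q r p' q' r' : ℤ} (h : p + q = r)
    (hp : p' + 1 = p) (hq : q' + 1 = q) (hr : r' + 1 = r) (h₁ : p' + q = r') (h₂ : p + q' = r')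
    (x : (CobarFree V).obj m p) (y : (CobarFree V).obj n q),
    D hr ((CobarFree V).comp i e h x y) =
      (CobarFree V).comp i e h₁ (D hp x) y + sgn K p • (CobarFree V).comp i e h₂ x (D hq y)
  one : ∀ {q : ℤ} (h : q + 1 = 0), D h (CobarFree V).one = 0

lemma isDeriv_uncurvedD : IsDeriv (uncurvedD P) :=
  ⟨(uncurved P).d_act, (uncurved P).d_comp, fun _ => rfl⟩

lemma isDeriv_curvD : IsDeriv (curvD P) := ⟨(curving P).d_act, (curving P).d_comp, fun _ => rfl⟩

lemma deriv_cobarD : IsDeriv (cobarD P) :=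
  ⟨(cobarBar P).d_act, (cobarBar P).d_comp, fun _ => rfl⟩

lemma uncurvedD_gen (h : q + 1 = p) (x : TreeObj (barGen P) n (p + 1)) : uncurvedD P h (cobarGen x)
    = - cobarGen (barDiff P x) - cutMap x := rfl

lemma curvD_gen (h : q + 1 = p) (x : TreeObj (barGen P) n (p + 1)) : curvD P h (cobarGen x) =
    (CobarFree (barGen P)).unitAt n q (vCoeff (proj _ x)) := rfl

lemma cobarD_eq (h : q + 1 = p) (x : (CobarFree (barGen P)).obj n p) : cobarD P h x = uncurvedD P h
    x + curvD P h x := by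
  induction x using cobarFree_induction generalizing q with
  | one => rw [deriv_cobarD.one, isDeriv_uncurvedD.one, isDeriv_curvD.one, add_zero]
  | gen x =>
    have : cobarD P h (cobarGen x) = (CobarFree (barGen P)).unitAt _ q (vCoeff (proj _ x)) -
      cobarGen (barDiff P x) - cutMap x := rfl
    rw [this, uncurvedD_gen, curvD_gen]
    abel
  | act σ x ih =>
    rw [deriv_cobarD.act, isDeriv_uncurvedD.act, isDeriv_curvD.act, ih, map_add]
  | @comp m n k i e p a s hr x y ihx ihy =>
    rw [deriv_cobarD.comp i e hr (p' := p - 1) (q' := a - 1) (by omega) (by omega) h (by omega)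
      (by omega),
      isDeriv_uncurvedD.comp i e hr (p' := p - 1) (q' := a - 1) (by omega) (by omega) h (by omega)
      (by omega),
      isDeriv_curvD.comp i e hr (p' := p - 1) (q' := a - 1) (by omega) (by omega) h (by omega)
      (by omega),
      ihx, ihy, map_add, map_add, LinearMap.add_apply, smul_add]
    abel
  | zero => simp only [map_zero, add_zero]
  | add x y hx hy =>
    simp only [map_add, hx, hy]
    abel
  | smul c x hx => simp only [map_smul, hx, smul_add]

lemma markedDiff_ptreeAct (σ : Perm (Fin n)) (x : PTree (marked (barGen P)) n p) : (markedDiff P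
    (ptreeAct σ x) : PTree _ n q) = ptreeAct σ (markedDiff P x) := by
  simp only [markedDiff, LinearMap.add_apply, loc_ptreeAct, con_ptreeAct, map_add]

lemma markedDiff_graft (i : Fin m) (e : Wire i n k) {s p' q' s' : ℤ} (h : p + q = s) (hp' : p' + 1 =
    p) (hq' : q' + 1 = q) (h₁ : p' + q = s') (h₂ : p + q' = s') (x : PTree (marked (barGen P)) m p)
    {y : PTree (marked (barGen P)) n q} (hy : y ∈ MTrees (barGen P) ⊤ n q) : (markedDiff P (graft i
    e h x y) : PTree _ k s') = graft i e h₁ (markedDiff P x) y + sgn K p • graft i e h₂ x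
    (markedDiff P y) := by
  simp only [markedDiff, LinearMap.add_apply, map_add,
    loc_graft _ i e h hp' hq' h₁ h₂, con_graft _ i e h hp' hq' h₁ h₂ x hy, one_mul, smul_add]
  abel

/-- On nested trees, the derivation of the cobar construction without the curvature is the sum over
the vertices of the differential of `P` and over the inner edges of its composition, together with
the passage from an unmarked vertex to the marked one. -/
lemma unnestLin_uncurvedD (h : q + 1 = p) (x : (CobarFree (barGen P)).obj n p) : unnestLin (barGen
    P) (uncurvedD P h x) = markedDiff P (unnestLin (barGen P) x) := by
  induction x using cobarFree_induction generalizing q with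
  | one =>
    rw [isDeriv_uncurvedD.one, map_zero, unnestLin_one, markedDiff, LinearMap.add_apply]
    refine ((congrArg₂ (· + ·) (loc_ptree _ _ (isPTree_nil 0) rfl)
      (LabMul.con_ptree (isPTree_nil 0) rfl)).trans (add_zero _)).symm
  | @gen n p x =>
    subst h
    rw [uncurvedD_gen, map_sub, map_neg, unnestLin_gen, unnestLin_gen, unnest_cutMap rfl, markEmbed,
      comp_apply, markEmbed, comp_apply,
      markedDiff_markRoot (q := q + 1) rfl, markedDiff_embed rfl, map_add, neg_add, sub_eq_add_neg]
  | act σ x ih => rw [isDeriv_uncurvedD.act, unnestLin_act, unnestLin_act, ih, markedDiff_ptreeAct]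
  | @comp m n k i e p a s hr x y ihx ihy =>
    rw [isDeriv_uncurvedD.comp i e hr (p' := p - 1) (q' := a - 1) (by omega) (by omega) h (by omega)
      (by omega),
      map_add, map_smul, unnestLin_comp, unnestLin_comp, ihx, ihy, unnestLin_comp,
      markedDiff_graft i e hr (p' := p - 1) (q' := a - 1) (by omega) (by omega)
        (by omega) (by omega) _ (unnestLin_mem y)]
  | zero => simp only [map_zero]
  | add x y hx hy => simp only [map_add, hx, hy]
  | smul c x hx => simp only [map_smul, hx]

/-! ### Convolution of maps from planted trees to an operad -/

section Convolution

variable {U : SMod.{u, v} K} {Q : GrOperad.{u, w} K}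

variable (U Q) in
/-- An equivariant map of degree `0` from planted trees to an operad. -/
structure TreeMap where
  app : ∀ {n : ℕ} {p : ℤ}, PTree U n p →ₗ[K] Q.obj n p
  app_act : ∀ {n : ℕ} {p : ℤ} (σ : Perm (Fin n)) (x : PTree U n p),
    app (ptreeAct σ x) = Q.act σ (app x)

namespace Glue

variable {A B : List (Vtx U)}

/-- The partial composite of the values of two maps at the two parts of a tree. -/
def value (g : Glue A B r l) (φ ψ : TreeMap U Q) (h : deg A + deg B = p) : Q.obj n p :=
  Q.comp g.i g.e h (φ.app (ptree A r g.lA)) (ψ.app (ptree B (g.lA g.i) g.lB))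

lemma value_deg (g : Glue A B r l) (φ ψ : TreeMap U Q) (h : deg A + deg B = p) {a b : ℤ} (ha : deg A
    = a) (hb : deg B = b) (h' : a + b = p) : g.value φ ψ h = Q.comp g.i g.e h' (φ.app (ptree A r
    g.lA)) (ψ.app (ptree B (g.lA g.i) g.lB)) := by
  subst ha hb
  rfl

lemma value_eq (hl : IsTree (A ++ B) r l) (g g' : Glue A B r l) (φ ψ : TreeMap U Q) (h : deg A + deg
    B = p) : g.value φ ψ h = g'.value φ ψ h := by
  have hl' := hl.ptree
  have hi' : g.lA g.i = g'.lA g'.i := (g'.isCut hl').unique (g.isCut hl') hl'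
  obtain ⟨σ, hσ⟩ := Cut.exists_equiv g.isTreeA.leaf_injective g'.isTreeA.leaf_injective
    (Cut.leaves_eq g.isTreeA g'.isTreeA)
  have hi : σ g.i = g'.i := g'.isTreeA.leaf_injective (by rw [hσ, hi'])
  have hinj := hl'.leaf_injective
  obtain ⟨nA, nB, lA, lB, i, e, hA, hB, lab⟩ := g
  obtain ⟨nA', nB', lA', lB', i', e', hA', hB', lab'⟩ := g'
  obtain ⟨σ₁, hσ₁, hi₁⟩ : ∃ σ : Fin nA ≃ Fin nA', (∀ a, lA' (σ a) = lA a) ∧ σ i = i' :=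
    ⟨σ, hσ, hi⟩
  clear hi hσ hi'
  clear σ
  rename' σ₁ => σ, hσ₁ => hσ, hi₁ => hi
  obtain rfl : nA = nA' := equiv_iff_eq.1 ⟨σ⟩
  subst hi
  have hr : lA' (σ i) = lA i := hσ i
  obtain ⟨τ, hτ⟩ := Cut.exists_equiv hB.leaf_injective hB'.leaf_injective
    (Cut.leaves_eq hB (by rwa [hr] at hB'))
  obtain rfl : nB = nB' := equiv_iff_eq.1 ⟨τ⟩
  have e1 : lA' = lA ∘ σ.symm := by
    ext a; simp [← hσ]
  have e2 : lB' = lB ∘ τ.symm := by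
    ext a; simp [← hτ]
  simp only [value]
  have := Q.equivariance σ τ 1 e e'
    ⟨fun a => hinj (by
      rw [lab'.1, hσ]
      exact (lab.1 a).symm), fun b => hinj (by
      rw [lab'.2, hτ]
      exact (lab.2 b).symm)⟩ h (φ.app (ptree A r lA)) (ψ.app (ptree B (lA i) lB))
  rw [Q.act_one, ← φ.app_act, ← ψ.app_act, ptreeAct_ptree, ptreeAct_ptree] at this
  rw [← this, ← e1, ← e2, ← hr]

/-- The same presentation, for lists of vertices with the same ends. -/
def congr (g : Glue A B r l) {A' B' : List (Vtx U)} (hA : (A.map Vtx.ends).Perm (A'.map Vtx.ends))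
    (hB : (B.map Vtx.ends).Perm (B'.map Vtx.ends)) : Glue A' B' r l where
  __ := g
  isTreeA := (isTree_congr hA).1 g.isTreeA
  isTreeB := (isTree_congr hB).1 g.isTreeB

/-- Rename the edges. -/
def ren (g : Glue A B r l) (π : Perm ℕ) :
    Glue (A.map (Vtx.ren π)) (B.map (Vtx.ren π)) (π r) (π ∘ l) where
  __ := g
  lA := π ∘ g.lA
  lB := π ∘ g.lB
  isTreeA := isTree_iff.2 ⟨by simpa using g.isTreeA.ne_nil,
    isPTree_ren π g.isTreeA.ptree⟩
  isTreeB := isTree_iff.2 ⟨by simpa using g.isTreeB.ne_nil,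
    isPTree_ren π g.isTreeB.ptree⟩
  fits := ⟨fun a => congrArg π (g.fits.1 a), fun b => congrArg π (g.fits.2 b)⟩

/-- Rename the leaves. -/
def relabel (g : Glue A B r l) (σ : Perm (Fin n)) : Glue A B r (l ∘ σ.symm) where
  __ := g
  e := g.e.trans σ
  fits := ⟨fun a => by simpa using g.fits.1 a, fun b => by simpa using g.fits.2 b⟩

end Glue

open Classical in
/-- The partial composite of the values of two maps at two trees of which the tree with vertices
`A ++ B` is a graft, or zero. -/
def glueTerm (φ ψ : TreeMap U Q) (p : ℤ) (A B : List (Vtx U)) (r : ℕ) (l : Fin n → ℕ) : Q.obj n p :=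
  if h : IsTree (A ++ B) r l ∧ Nonempty (Glue A B r l) ∧ deg A + deg B = p then
    h.2.1.some.value φ ψ h.2.2 else 0

variable {A B : List (Vtx U)} {φ ψ : TreeMap U Q}

lemma glueTerm_eq (g : Glue A B r l) (hl : IsTree (A ++ B) r l) (h : deg A + deg B = p) : glueTerm φ
    ψ p A B r l = g.value φ ψ h := by
  rw [glueTerm, dif_pos ⟨hl, ⟨g⟩, h⟩]
  exact Glue.value_eq hl _ _ φ ψ h

lemma glueTerm_eq_zero (h : IsEmpty (Glue A B r l)) : glueTerm φ ψ p A B r l = 0 :=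
  dif_neg fun h' => h.elim h'.2.1.some

lemma glueTerm_eq_zero_of_left (h : ∀ m q lA, (φ.app (ptree A r lA : PTree U m q)) = 0) : glueTerm φ
    ψ p A B r l = 0 := by
  rw [glueTerm]
  split_ifs
  · rw [Glue.value, h, map_zero, LinearMap.zero_apply]
  · rfl

lemma glueTerm_eq_zero_of_right (h : ∀ m q f lB, (ψ.app (ptree B f lB : PTree U m q)) = 0) :
    glueTerm φ ψ p A B r l = 0 := by
  rw [glueTerm]
  split_ifs
  · rw [Glue.value, h, map_zero]
  · rfl

lemma ends_append (hA : ((A : List (Vtx U)).map Vtx.ends).Perm (B.map Vtx.ends)) (C : List (Vtx U))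
    : ((A ++ C).map Vtx.ends).Perm ((B ++ C).map Vtx.ends) := by
  rw [map_append, map_append]
  exact hA.append_right _

lemma glueTerm_left {A₁ A₂ : List (Vtx U)} {c c' : K} (h₁ : (A.map Vtx.ends).Perm (A₁.map Vtx.ends))
    (h₂ : (A.map Vtx.ends).Perm (A₂.map Vtx.ends)) (d₁ : deg A₁ = deg A) (d₂ : deg A₂ = deg A) (h :
    ∀ m (f : Fin m → ℕ) q, (ptree A r f : PTree U m q) = c • ptree A₁ r f + c' • ptree A₂ r f) :
    glueTerm φ ψ p A B r l = c • glueTerm φ ψ p A₁ B r l + c' • glueTerm φ ψ p A₂ B r l := by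
  by_cases hg : IsTree (A ++ B) r l ∧ Nonempty (Glue A B r l) ∧ deg A + deg B = p
  · obtain ⟨hl, ⟨g⟩, hd⟩ := hg
    rw [glueTerm_eq g hl hd, glueTerm_eq (g.congr h₁ (.refl _)) ((isTree_congr (ends_append h₁ B)).1 hl)
      (by rw [d₁, hd]), glueTerm_eq (g.congr h₂ (.refl _)) ((isTree_congr (ends_append h₂ B)).1 hl)
      (by rw [d₂, hd]), Glue.value, h, map_add, map_smul, map_smul, map_add, map_smul, map_smul,
      LinearMap.add_apply, LinearMap.smul_apply, LinearMap.smul_apply, Glue.value_deg _ _ _ _ d₁ rfl hd,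
      Glue.value_deg _ _ _ _ d₂ rfl hd]
    rfl
  · have e : ∀ A', (A.map Vtx.ends).Perm (A'.map Vtx.ends) → deg A' = deg A →
        glueTerm φ ψ p A' B r l = 0 := fun A' h' d' => dif_neg fun hg' => hg
      ⟨(isTree_congr (ends_append h' B)).2 hg'.1, ⟨hg'.2.1.some.congr h'.symm (.refl _)⟩,
        d' ▸ hg'.2.2⟩
    rw [e A (.refl _) rfl, e A₁ h₁ d₁, e A₂ h₂ d₂, smul_zero, smul_zero, add_zero]

lemma glueTerm_right {B₁ B₂ : List (Vtx U)} {c c' : K} (h₁ : (B.map Vtx.ends).Perm (B₁.map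
    Vtx.ends)) (h₂ : (B.map Vtx.ends).Perm (B₂.map Vtx.ends)) (d₁ : deg B₁ = deg B) (d₂ : deg B₂ =
    deg B) (h : ∀ m f (g : Fin m → ℕ) q, (ptree B f g : PTree U m q) = c • ptree B₁ f g + c' • ptree
    B₂ f g) : glueTerm φ ψ p A B r l = c • glueTerm φ ψ p A B₁ r l + c' • glueTerm φ ψ p A B₂ r l :=
    by
  have e' : ∀ B', (B.map Vtx.ends).Perm (B'.map Vtx.ends) →
      ((A ++ B).map Vtx.ends).Perm ((A ++ B').map Vtx.ends) := fun B' h' => by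
    rw [map_append, map_append]
    exact h'.append_left _
  by_cases hg : IsTree (A ++ B) r l ∧ Nonempty (Glue A B r l) ∧ deg A + deg B = p
  · obtain ⟨hl, ⟨g⟩, hd⟩ := hg
    rw [glueTerm_eq g hl hd, glueTerm_eq (g.congr (.refl _) h₁) ((isTree_congr (e' _ h₁)).1 hl)
      (by rw [d₁, hd]), glueTerm_eq (g.congr (.refl _) h₂) ((isTree_congr (e' _ h₂)).1 hl)
      (by rw [d₂, hd]), Glue.value, h, map_add, map_smul, map_smul, map_add, map_smul, map_smul,
      Glue.value_deg _ _ _ _ rfl d₁ hd, Glue.value_deg _ _ _ _ rfl d₂ hd]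
    rfl
  · have e : ∀ B', (B.map Vtx.ends).Perm (B'.map Vtx.ends) → deg B' = deg B →
        glueTerm φ ψ p A B' r l = 0 := fun B' h' d' => dif_neg fun hg' => hg
      ⟨(isTree_congr (e' B' h')).2 hg'.1, ⟨hg'.2.1.some.congr (.refl _) h'.symm⟩,
        d' ▸ hg'.2.2⟩
    rw [e B (.refl _) rfl, e B₁ h₁ d₁, e B₂ h₂ d₂, smul_zero, smul_zero, add_zero]

lemma Vtx.Comb.ends {c c' : K} {s s₁ s₂ : Vtx U} (h : Vtx.Comb c c' s s₁ s₂) : s.ends = s₁.ends ∧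
    s.ends = s₂.ends := by
  cases h with
  | linear => exact ⟨rfl, rfl⟩
  | act o k q σ x ι =>
    have : (univ.val.map ι) = univ.val.map (ι ∘ σ) := (lvs_comp_perm σ ι).symm
    exact ⟨Prod.ext rfl this, Prod.ext rfl this⟩

lemma multi_glueTerm_left (B : List (Vtx U)) :
    Multi fun A => glueTerm φ ψ p A B r l where
  koszul A C s t := by
    have hp : (A ++ s :: t :: C).Perm (A ++ t :: s :: C) := .append_left A (.swap t s C)
    have := glueTerm_left (φ := φ) (ψ := ψ) (p := p) (B := B) (r := r) (l := l)
      (c := sgn K (s.deg * t.deg)) (c' := 0) (hp.map Vtx.ends) (hp.map Vtx.ends) (deg_perm hp).symm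
      (deg_perm hp).symm fun m f q => by
        rw [zero_smul, add_zero]
        exact ptree_swap A C s t r f
    rwa [zero_smul, add_zero] at this
  comb A C c c' s s₁ s₂ h := by
    refine glueTerm_left ?_ ?_ ?_ ?_ fun m f q => (multi_ptree q r f).comb A C h
    · simp [h.ends.1]
    · simp [h.ends.2]
    · simp [deg_append, deg_cons, h.deg_left]
    · simp [deg_append, deg_cons, h.deg_right]

lemma multi_glueTerm_right (A : List (Vtx U)) :
    Multi fun B => glueTerm φ ψ p A B r l where
  koszul B C s t := by
    have hp : (B ++ s :: t :: C).Perm (B ++ t :: s :: C) := .append_left B (.swap t s C)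
    have := glueTerm_right (φ := φ) (ψ := ψ) (p := p) (A := A) (r := r) (l := l)
      (c := sgn K (s.deg * t.deg)) (c' := 0) (hp.map Vtx.ends) (hp.map Vtx.ends) (deg_perm hp).symm
      (deg_perm hp).symm fun m f g q => by
        rw [zero_smul, add_zero]
        exact ptree_swap B C s t f g
    rwa [zero_smul, add_zero] at this
  comb B C c c' s s₁ s₂ h := by
    refine glueTerm_right ?_ ?_ ?_ ?_ fun m f g q => (multi_ptree q f g).comb B C h
    · simp [h.ends.1]
    · simp [h.ends.2]
    · simp [deg_append, deg_cons, h.deg_left]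
    · simp [deg_append, deg_cons, h.deg_right]

lemma map_ren_symm (π : Perm ℕ) (L : List (Vtx U)) : (L.map (Vtx.ren π)).map (Vtx.ren π.symm) = L :=
    by
  rw [List.map_map]
  refine (map_congr_left fun s _ => ?_).trans (List.map_id L)
  simp [Vtx.ren, ← comp_assoc]

lemma glueTerm_ren (π : Perm ℕ) : glueTerm φ ψ p (A.map (Vtx.ren π)) (B.map (Vtx.ren π)) (π r) (π ∘
    l) = glueTerm φ ψ p A B r l := by
  have hd : deg (A.map (Vtx.ren π)) + deg (B.map (Vtx.ren π)) = deg A + deg B := by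
    rw [deg_ren, deg_ren]
  by_cases hg : IsTree (A ++ B) r l ∧ Nonempty (Glue A B r l) ∧ deg A + deg B = p
  · obtain ⟨hl, ⟨g⟩, h⟩ := hg
    obtain ⟨hl0, hl'⟩ := isTree_iff.1 hl
    rw [glueTerm_eq g hl h, glueTerm_eq (g.ren π) (isTree_iff.2 ⟨by simpa using hl0, by
      rw [← map_append]
      exact isPTree_ren π hl'⟩) (hd.trans h), Glue.value_deg _ _ _ _ (deg_ren _ _) (deg_ren _ _) h]
    have e1 : ∀ q, (ptree (A.map (Vtx.ren π)) (π r) (g.ren π).lA : PTree U _ q) = ptree A r g.lA :=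
      fun q => ptree_rename π A r g.lA
    have e2 : ∀ q, (ptree (B.map (Vtx.ren π)) ((g.ren π).lA (g.ren π).i) (g.ren π).lB :
        PTree U _ q) = ptree B (g.lA g.i) g.lB := fun q => ptree_rename π B (g.lA g.i) g.lB
    rw [e1, e2]
    rfl
  · rw [glueTerm, glueTerm, dif_neg hg, dif_neg]
    rintro ⟨hl, ⟨g⟩, h⟩
    obtain ⟨hl0, hl'⟩ := isTree_iff.1 hl
    have e1 : π.symm (π r) = r := π.symm_apply_apply r
    have e2 : π.symm ∘ (π ∘ l) = l := by
      rw [← comp_assoc]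
      simp
    have g' := g.ren π.symm
    have hl'' := isPTree_ren π.symm hl'
    rw [map_append, map_ren_symm, map_ren_symm, e1, e2] at hl''
    rw [map_ren_symm, map_ren_symm, e1, e2] at g'
    exact hg ⟨isTree_iff.2 ⟨by simpa using hl0, hl''⟩, ⟨g'⟩, hd ▸ h⟩

lemma glueTerm_relabel (σ : Perm (Fin n)) : glueTerm φ ψ p A B r (l ∘ σ.symm) = Q.act σ (glueTerm φ
    ψ p A B r l) := by
  by_cases hg : IsTree (A ++ B) r l ∧ Nonempty (Glue A B r l) ∧ deg A + deg B = p
  · obtain ⟨hl, ⟨g⟩, h⟩ := hg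
    obtain ⟨hl0, hl'⟩ := isTree_iff.1 hl
    rw [glueTerm_eq g hl h, glueTerm_eq (g.relabel σ) (isTree_iff.2 ⟨hl0,
      (isPTree_relabel σ.symm _ _ _).2 hl'⟩) h, Glue.value, Glue.value]
    have := Q.equivariance 1 1 σ g.e (g.relabel σ).e ⟨fun a => rfl, fun b => rfl⟩ h
      (φ.app (ptree A r g.lA)) (ψ.app (ptree B (g.lA g.i) g.lB))
    rw [Q.act_one, Q.act_one] at this
    exact this
  · rw [glueTerm, glueTerm, dif_neg hg, dif_neg, map_zero]
    rintro ⟨hl, ⟨g⟩, h⟩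
    have e2 : (l ∘ σ.symm) ∘ σ.symm.symm = l := by
      rw [comp_assoc]
      simp
    have g' := g.relabel σ.symm
    rw [e2] at g'
    exact hg ⟨isTree_iff.2 ⟨hl.ne_nil, (isPTree_relabel σ.symm _ _ _).1 hl.ptree⟩,
      ⟨g'⟩, h⟩

/-- The convolution of two maps from planted trees to an operad: the sum, over the inner edges of a
tree, of the partial composites of the values at the two trees obtained by cutting the edge. -/
def TreeMap.conv (φ ψ : TreeMap U Q) : TreeMap U Q where
  app {n p} := TreeFun.lift p <| Multi.treeFun
    (fun L r l => splitSum (fun A B => glueTerm φ ψ p A B r l) L)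
    (fun _ _ => multi_splitSum multi_glueTerm_left multi_glueTerm_right)
    (fun π L r l => by
      refine (splitSum_rename π _ L).trans (split_congr fun A B _ => ?_)
      exact glueTerm_ren π)
  app_act {n p} σ x := by
    induction x using ptree_induction with
    | zero => simp
    | add x y hx hy => simp only [map_add, hx, hy]
    | smul c x hx => simp only [map_smul, hx]
    | tree L r l hL hp =>
      rw [ptreeAct_ptree, TreeFun.lift_eq _ ((isPTree_relabel σ.symm _ _ _).2 hL) hp,
        TreeFun.lift_eq _ hL hp]
      change splitSum _ L = Q.act σ (splitSum _ L)
      rw [splitSum_map]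
      exact split_congr fun A B _ => glueTerm_relabel σ

lemma TreeMap.conv_ptree {L : List (Vtx U)} (hL : IsPTree L r l) (hp : deg L = p) : (φ.conv ψ).app
    (ptree L r l) = splitSum (fun A B => glueTerm φ ψ p A B r l) L :=
  TreeFun.lift_eq _ hL hp

end Convolution

section Grafted

variable {U : SMod.{u, v} K} {M : Type w} [AddCommGroup M] [Module K M]

lemma splitSum_append (F : List (Vtx U) → List (Vtx U) → M) (A B : List (Vtx U)) : splitSum F (A ++
    B) = splitSum (fun A₁ A₂ => splitSum (fun B₁ B₂ => sgn K (deg A₂ * deg B₁) • F (A₁ ++ B₁) (A₂ ++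
    B₂)) B) A := by
  induction A generalizing F with
  | nil =>
    rw [splitSum]
    refine split_congr fun B₁ B₂ _ => ?_
    rw [show deg ([] : List (Vtx U)) = 0 from rfl, zero_mul, sgn_zero, one_smul]
    rfl
  | cons a A ih =>
    rw [cons_append, splitSum, splitSum, ih, ih]
    refine congrArg₂ (· + ·) rfl (split_congr fun A₁ A₂ _ => ?_)
    rw [← splitSum_smul]
    refine split_congr fun B₁ B₂ _ => ?_
    rw [smul_smul, smul_smul, ← sgn_add, ← sgn_add, deg_append, deg_cons, cons_append]
    congr 2
    ring

lemma splitSum_left_nil [DecidableEq (List (Vtx U))] (G : List (Vtx U) → M) (L : List (Vtx U)) :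
    splitSum (fun A B => if A = [] then G B else 0) L = G L := by
  induction L generalizing G with
  | nil => simp [splitSum]
  | cons s L ih =>
    rw [splitSum, split_eq_zero fun A B _ => if_neg (List.cons_ne_nil s A), zero_add, ← ih fun B => G (s :: B)]
    refine split_congr fun A B _ => ?_
    split_ifs with h
    · rw [h, show deg ([] : List (Vtx U)) = 0 from rfl, mul_zero, sgn_zero, one_smul]
    · rw [smul_zero]

lemma splitSum_right_nil [DecidableEq (List (Vtx U))] (G : List (Vtx U) → M) (L : List (Vtx U)) :
    splitSum (fun A B => if B = [] then G A else 0) L = G L := by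
  induction L generalizing G with
  | nil => simp [splitSum]
  | cons s L ih =>
    rw [splitSum, split_eq_zero (F := fun A B => _ • _) fun A B _ => by
      rw [if_neg (List.cons_ne_nil s B), smul_zero], add_zero]
    exact ih fun A => G (s :: A)

lemma IsPTree.exists_lowest {L S : List (Vtx U)} (h : IsPTree L r l) (hS : S ≠ []) (hSL : ∀ s ∈ S, s
    ∈ L) : ∃ s ∈ S, s.out ∉ ins S := by
  classical
  obtain ⟨height, hh⟩ := h.2.2
  have hex : ∃ k, ∃ s ∈ S, height s.out = k :=
    ⟨_, S.head hS, List.head_mem hS, rfl⟩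
  obtain ⟨s, hs, hk⟩ := Nat.find_spec hex
  refine ⟨s, hs, fun h' => ?_⟩
  obtain ⟨t, ht, a, ha⟩ := mem_ins.1 h'
  have h1 := hh t (hSL t ht) a
  have h2 := Nat.find_min' hex ⟨t, ht, rfl⟩
  rw [ha] at h1
  omega

lemma Wire.seq_of_fits {l s t : ℕ} {i : Fin m} {j : Fin n} {e : Wire i n k} {e₂ : Wire (e (inr j)) l
    t} {f : Wire j l s} {f₂ : Wire i s t} {x : Fin m → ℕ} {y : Fin n → ℕ} {z : Fin l → ℕ} {xy : Fin
    k → ℕ} {yz : Fin s → ℕ} {xyz : Fin t → ℕ} (hinj : Injective xyz) (h1 : e.Fits x y xy) (h2 :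
    e₂.Fits xy z xyz) (h3 : f.Fits y z yz) (h4 : f₂.Fits x yz xyz) : e.Seq e₂ f f₂ := by
  refine ⟨fun a => hinj ?_, fun b => hinj ?_, fun c => hinj ?_⟩
  · rw [h2.1, h4.1, h1.1]
  · rw [h2.1, h4.2, h1.2, h3.1]
  · rw [h2.2, h4.2, h3.2]

lemma Wire.par_of_fits {l s t : ℕ} {i j : Fin m} {hij : i ≠ j} {e : Wire i n k} {e₂ : Wire (e (inl
    ⟨j, hij.symm⟩)) l t} {f : Wire j l s} {f₂ : Wire (f (inl ⟨i, hij⟩)) n t} {x : Fin m → ℕ} {y :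
    Fin n → ℕ} {z : Fin l → ℕ} {xy : Fin k → ℕ} {xz : Fin s → ℕ} {xyz : Fin t → ℕ} (hinj : Injective
    xyz) (h1 : e.Fits x y xy) (h2 : e₂.Fits xy z xyz) (h3 : f.Fits x z xz) (h4 : f₂.Fits xz y xyz) :
    e.Par hij e₂ f f₂ := by
  refine ⟨fun a hi hj => hinj ?_, fun b => hinj ?_, fun c => hinj ?_⟩
  · rw [h2.1, h4.1, h1.1, h3.1]
  · rw [h2.1, h4.2, h1.2]
  · rw [h2.2, h4.1, h3.2]

lemma Wire.exists_wire (i : Fin m) (n : ℕ) : ∃ k, Nonempty (Wire i n k) :=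
  ⟨_, ⟨equivFin _⟩⟩

/-- The tree with vertices `A ++ B`, root `r` and leaves `l` is obtained by grafting the tree with
vertices `B` on the leaf `i` of the tree with vertices `A`. -/
structure Grafted {m n k : ℕ} (A : List (Vtx U)) (r : ℕ) (f : Fin m → ℕ) (B : List (Vtx U)) (b : ℕ)
    (g : Fin n → ℕ) (i : Fin m) (e : Wire i n k) (l : Fin k → ℕ) : Prop where
  left : IsPTree A r f
  right : IsPTree B b g
  root : f i = b
  apart : Apart A r f B b g
  fits : e.Fits f g l

namespace Grafted

variable {A B A₁ A₂ B₁ B₂ : List (Vtx U)} {b : ℕ} {f : Fin m → ℕ} {g : Fin n → ℕ}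
  {i : Fin m} {e : Wire i n k} {l : Fin k → ℕ}

lemma isPTree (G : Grafted A r f B b g i e l) : IsPTree (A ++ B) r l :=
  isPTree_append G.left G.right G.root G.apart G.fits

lemma perm (G : Grafted A r f B b g i e l) {A' B' : List (Vtx U)} (hA : A'.Perm A) (hB : B'.Perm B)
    : Grafted A' r f B' b g i e l :=
  ⟨(IsPTree.perm hA).2 G.left, (IsPTree.perm hB).2 G.right, G.root,
    G.apart.mono (fun x hx => by rwa [edges_perm hA] at hx) fun x hx => by rwa [edges_perm hB] at hx,
    G.fits⟩

/-- The presentation as a graft. -/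
def glue (G : Grafted A r f B b g i e l) (hA : A ≠ []) (hB : B ≠ []) : Glue A B r l :=
  ⟨m, n, f, g, i, e, isTree_iff.2 ⟨hA, G.left⟩, isTree_iff.2 ⟨hB, by rw [G.root]; exact G.right⟩,
    G.fits⟩

lemma root_mem_ins (G : Grafted A r f B b g i e l) (hA : A ≠ []) : b ∈ ins A := by
  have h1 : b ∈ r ::ₘ ins A := by
    rw [← G.left.1, mem_add]
    exact Or.inr (mem_lvs.2 ⟨i, G.root⟩)
  refine (mem_cons.1 h1).resolve_left fun h2 => ?_
  have h3 := G.left.2.1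
  rw [← G.left.1, nodup_add] at h3
  exact disjoint_left.1 h3.2.2 (G.left.root_mem_outs hA) (h2 ▸ mem_lvs.2 ⟨i, G.root⟩)

lemma root_notMem_outs (G : Grafted A r f B b g i e l) : b ∉ outs A := by
  have h3 := G.left.2.1
  rw [← G.left.1, nodup_add] at h3
  exact fun h => disjoint_left.1 h3.2.2 h (mem_lvs.2 ⟨i, G.root⟩)

lemma eq_of_mem (G : Grafted A r f B b g i e l) {x : ℕ} (h : x = r ∨ x ∈ ins A) (h' : x = b ∨ x ∈
    ins B) : x = b :=
  G.apart x ((mem_edges G.left).2 h) ((mem_edges G.right).2 h')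

/-- The inner edges of a graft are the edge of the graft and the inner edges of both trees. -/
lemma isCut_cases (G : Grafted A r f B b g i e l) (hA0 : A ≠ []) (hA : (A₁ ++ A₂).Perm A)
    (hB : (B₁ ++ B₂).Perm B) {x : ℕ} (hx : IsCut (A₁ ++ B₁) (A₂ ++ B₂) r x) :
    (A₂ = [] ∧ B₁ = []) ∨ (A₂ = [] ∧ IsCut B₁ B₂ b x) ∨
      (IsCut A₁ A₂ r x ∧ b ∈ ins A₂ ∧ B₁ = []) ∨ (IsCut A₁ A₂ r x ∧ b ∈ ins A₁ ∧ B₂ = []) := by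
  obtain ⟨h1, h2, h3, h4⟩ := hx
  have hbA := G.root_mem_ins hA0
  have hrb : b ≠ r := fun h => G.left.root_notMem_ins (h ▸ hbA)
  have hbA' := G.root_notMem_outs
  have hbB : b ∉ ins B := G.right.root_notMem_ins
  have hdis := (nodup_cons.1 G.left.2.1).2
  have memA₁ : ∀ s ∈ A₁, s ∈ A := fun s hs => hA.mem_iff.1 (mem_append_left _ hs)
  have memA₂ : ∀ s ∈ A₂, s ∈ A := fun s hs => hA.mem_iff.1 (mem_append_right _ hs)
  have memB₁ : ∀ s ∈ B₁, s ∈ B := fun s hs => hB.mem_iff.1 (mem_append_left _ hs)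
  have memB₂ : ∀ s ∈ B₂, s ∈ B := fun s hs => hB.mem_iff.1 (mem_append_right _ hs)
  have outA : ∀ s ∈ A, s.out = r ∨ s.out ∈ ins A := fun s hs => G.left.out_mem hs
  have outB : ∀ s ∈ B, s.out = b ∨ s.out ∈ ins B := fun s hs => G.right.out_mem hs
  rw [← ins_perm hA, ins_append] at hbA hdis
  have insA : ∀ y, (y ∈ ins A₁ ∨ y ∈ ins A₂) → y ∈ ins A := fun y hy => by
    rwa [← ins_perm hA, ins_append, mem_add]
  have insB : ∀ y, (y ∈ ins B₁ ∨ y ∈ ins B₂) → y ∈ ins B := fun y hy => by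
    rwa [← ins_perm hB, ins_append, mem_add]
  have hdis' : ∀ y, y ∈ ins A₁ → y ∈ ins A₂ → False := fun y =>
    disjoint_left.1 (nodup_add.1 hdis).2.2
  -- a vertex of `A` does not start at an input of `B`, nor one of `B` at the root of `A`
  have nA : ∀ s ∈ A, s.out ∉ ins B := fun s hs h => by
    have := G.eq_of_mem (outA s hs) (Or.inr h)
    exact hbA' (this ▸ mem_outs.2 ⟨s, hs, rfl⟩)
  have nB : ∀ s ∈ B, s.out ≠ r := fun s hs h =>
    hrb ((G.eq_of_mem (Or.inl h) (outB s hs)).symm.trans h)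
  have bB : ∀ s ∈ B, s.out ∈ ins A → s.out = b := fun s hs h => G.eq_of_mem (Or.inr h) (outB s hs)
  have hA₂ : x = b ∨ x ∈ outs B₂ → A₂ = [] := fun hxB => by
    by_contra h0
    obtain ⟨t, ht, hlow⟩ := G.left.exists_lowest h0 memA₂
    rcases h2 t (mem_append_left _ ht) with h | h
    · have hxb : x = b := by
        rcases hxB with hxB | hxB
        · exact hxB
        · obtain ⟨s, hs, rfl⟩ := mem_outs.1 hxB
          exact G.eq_of_mem (h ▸ outA t (memA₂ t ht)) (outB s (memB₂ s hs))
      exact hbA' (mem_outs.2 ⟨t, memA₂ t ht, h.trans hxb⟩)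
    · rw [ins_append, mem_add] at h
      exact h.elim hlow fun h => nA t (memA₂ t ht) (insB _ (Or.inr h))
  rw [outs_append, mem_add] at h4
  rw [ins_append, mem_add] at h3
  rcases h4 with h4 | h4
  · obtain ⟨t, ht, rfl⟩ := mem_outs.1 h4
    have hxb : t.out ≠ b := fun h => hbA' (mem_outs.2 ⟨t, memA₂ t ht, h⟩)
    have h3' : t.out ∈ ins A₁ := h3.resolve_right fun h => nA t (memA₂ t ht) (insB _ (Or.inl h))
    rcases mem_add.1 hbA with hb | hb
    · refine Or.inr (Or.inr (Or.inr ⟨⟨fun s hs => ?_, fun s hs => ?_, h3', h4⟩, hb, ?_⟩))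
      · refine (h1 s (mem_append_left _ hs)).imp_right fun h => ?_
        rw [ins_append, mem_add] at h
        exact h.resolve_right fun h => nA s (memA₁ s hs) (insB _ (Or.inl h))
      · refine (h2 s (mem_append_left _ hs)).imp_right fun h => ?_
        rw [ins_append, mem_add] at h
        exact h.resolve_right fun h => nA s (memA₂ s hs) (insB _ (Or.inr h))
      · by_contra h0
        obtain ⟨s, hs, hlow⟩ := G.right.exists_lowest h0 memB₂
        rcases h2 s (mem_append_right _ hs) with h | h
        · exact hxb (h ▸ bB s (memB₂ s hs) (h ▸ insA _ (Or.inl h3')))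
        · rw [ins_append, mem_add] at h
          refine h.elim (fun h => ?_) hlow
          have := bB s (memB₂ s hs) (insA _ (Or.inr h))
          exact hdis' b hb (this ▸ h)
    · refine Or.inr (Or.inr (Or.inl ⟨⟨fun s hs => ?_, fun s hs => ?_, h3', h4⟩, hb, ?_⟩))
      · refine (h1 s (mem_append_left _ hs)).imp_right fun h => ?_
        rw [ins_append, mem_add] at h
        exact h.resolve_right fun h => nA s (memA₁ s hs) (insB _ (Or.inl h))
      · refine (h2 s (mem_append_left _ hs)).imp_right fun h => ?_
        rw [ins_append, mem_add] at h
        exact h.resolve_right fun h => nA s (memA₂ s hs) (insB _ (Or.inr h))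
      · by_contra h0
        obtain ⟨s, hs, hlow⟩ := G.right.exists_lowest h0 memB₁
        rcases h1 s (mem_append_right _ hs) with h | h
        · exact nB s (memB₁ s hs) h
        · rw [ins_append, mem_add] at h
          refine h.elim (fun h => ?_) hlow
          have := bB s (memB₁ s hs) (insA _ (Or.inl h))
          exact hdis' b (this ▸ h) hb
  · have hA₂' := hA₂ (Or.inr h4)
    subst hA₂'
    obtain ⟨t, ht, rfl⟩ := mem_outs.1 h4
    by_cases hxb : t.out = b
    · refine Or.inl ⟨rfl, ?_⟩
      by_contra h0
      obtain ⟨s, hs, hlow⟩ := G.right.exists_lowest h0 memB₁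
      rcases h1 s (mem_append_right _ hs) with h | h
      · exact nB s (memB₁ s hs) h
      · rw [ins_append, mem_add] at h
        refine h.elim (fun h => ?_) hlow
        have h5 := bB s (memB₁ s hs) (insA _ (Or.inl h))
        have h6 := G.right.nodup_outs
        rw [← outs_perm hB, outs_append, nodup_add, nodup_add] at h6
        exact disjoint_left.1 h6.1.2.2 (mem_outs.2 ⟨s, hs, h5⟩) (hxb ▸ h4)
    · refine Or.inr (Or.inl ⟨rfl, fun s hs => ?_, fun s hs => ?_, ?_, h4⟩)
      · rcases h1 s (mem_append_right _ hs) with h | h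
        · exact (nB s (memB₁ s hs) h).elim
        · rw [ins_append, mem_add] at h
          exact h.imp_left fun h => bB s (memB₁ s hs) (insA _ (Or.inl h))
      · simpa using h2 s (mem_append_right _ hs)
      · refine h3.resolve_left fun h => hxb (bB t (memB₂ t ht) (insA _ (Or.inl h)))

/-- Cutting an inner edge of the upper tree of a graft. -/
lemma exists_upper (G : Grafted A r f B b g i e l) (hB : (B₁ ++ B₂).Perm B) (c : Glue B₁ B₂ b g) : ∃
    (k' : ℕ) (l' : Fin k' → ℕ) (e' : Wire i c.nA k') (e₂ : Wire (e' (inr c.i)) c.nB k), Grafted A r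
    f B₁ b c.lA i e' l' ∧ e₂.Fits l' c.lB l ∧ e'.Seq e₂ c.e e ∧ l' (e' (inr c.i)) = c.lA c.i := by
  obtain ⟨k', ⟨e'⟩⟩ := Wire.exists_wire i c.nA
  have h1 := e'.fits_wireLabel f c.lA
  have hinj := G.isPTree.leaf_injective
  have hl : lvs (wLabel e' f c.lA) + lvs c.lB =
      wLabel e' f c.lA (e' (inr c.i)) ::ₘ lvs l := by
    have e1 := h1.lvs
    have e2 := c.fits.lvs
    have e3 := G.fits.lvs
    rw [h1.2]
    refine (cons_inj_right (f i)).1 ?_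
    rw [← cons_add, ← e1, add_assoc, e2, add_cons, e3, cons_swap]
  obtain ⟨e₂, h2⟩ := Wire.exists_fits hinj hl
  have G' : Grafted A r f B₁ b c.lA i e' (wLabel e' f c.lA) := by
    refine ⟨G.left, c.isTreeA.ptree, G.root, fun x hx hx' => ?_, h1⟩
    rw [mem_edges c.isTreeA.ptree] at hx'
    refine G.eq_of_mem ((mem_edges G.left).1 hx) (hx'.imp_right fun h => ?_)
    rw [← ins_perm hB, ins_append, mem_add]
    exact Or.inl h
  exact ⟨k', _, e', e₂, G', h2, Wire.seq_of_fits hinj h1 h2 c.fits G.fits, h1.2 _⟩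

/-- Cutting an inner edge of the lower tree of a graft, below the edge of the graft. -/
lemma exists_lower (c : Glue A₁ A₂ r f) {j : Fin c.nB} {e : Wire (c.e (inr j)) n k} (hA : (A₁ ++
    A₂).Perm A) (G : Grafted A r f B b g (c.e (inr j)) e l) : ∃ (k' : ℕ) (l' : Fin k' → ℕ) (e' :
    Wire j n k') (e₂ : Wire c.i k' k), Grafted A₂ (c.lA c.i) c.lB B b g j e' l' ∧ e₂.Fits c.lA l' l
    ∧ c.e.Seq e e' e₂ := by
  obtain ⟨k', ⟨e'⟩⟩ := Wire.exists_wire j n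
  have h1 := e'.fits_wireLabel c.lB g
  have hinj := G.isPTree.leaf_injective
  have hroot : c.lB j = b := by rw [← c.fits.2, G.root]
  have hl : lvs c.lA + lvs (wLabel e' c.lB g) = c.lA c.i ::ₘ lvs l := by
    have e1 := h1.lvs
    have e2 := c.fits.lvs
    have e3 := G.fits.lvs
    rw [G.root] at e3
    rw [hroot] at e1
    refine (cons_inj_right b).1 ?_
    rw [← add_cons, ← e1, ← add_assoc, e2, cons_add, e3, cons_swap]
  obtain ⟨e₂, h2⟩ := Wire.exists_fits hinj hl
  have hA₂ := c.isTreeB.ptree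
  have hcut := c.isCut ((IsPTree.perm hA).2 G.left)
  have G' : Grafted A₂ (c.lA c.i) c.lB B b g j e' (wLabel e' c.lB g) := by
    refine ⟨hA₂, G.right, hroot, fun x hx hx' => ?_, h1⟩
    rw [mem_edges hA₂] at hx
    refine G.eq_of_mem (Or.inr ?_) ((mem_edges G.right).1 hx')
    rw [← ins_perm hA, ins_append, mem_add]
    exact hx.imp_left fun h => by rw [h]; exact hcut.2.2.1
  exact ⟨k', _, e', e₂, G', h2, Wire.seq_of_fits hinj c.fits G.fits h1 h2⟩

/-- Cutting an inner edge of the lower tree of a graft that is not below the edge of the graft. -/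
lemma exists_beside (c : Glue A₁ A₂ r f) {j : Fin c.nA} (hj : j ≠ c.i) {e : Wire (c.e (inl ⟨j, hj⟩))
    n k} (hA : (A₁ ++ A₂).Perm A) (G : Grafted A r f B b g (c.e (inl ⟨j, hj⟩)) e l) : ∃ (k' : ℕ) (l'
    : Fin k' → ℕ) (e' : Wire j n k') (e₂ : Wire (e' (inl ⟨c.i, hj.symm⟩)) c.nB k), Grafted A₁ r c.lA
    B b g j e' l' ∧ e₂.Fits l' c.lB l ∧ c.e.Par hj.symm e e' e₂ ∧ l' (e' (inl ⟨c.i, hj.symm⟩)) =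
    c.lA c.i := by
  obtain ⟨k', ⟨e'⟩⟩ := Wire.exists_wire j n
  have h1 := e'.fits_wireLabel c.lA g
  have hinj := G.isPTree.leaf_injective
  have hroot : c.lA j = b := (c.fits.1 ⟨j, hj⟩).symm.trans G.root
  have hl : lvs (wLabel e' c.lA g) + lvs c.lB =
      wLabel e' c.lA g (e' (inl ⟨c.i, hj.symm⟩)) ::ₘ lvs l := by
    have e1 := h1.lvs
    have e2 := c.fits.lvs
    have e3 := G.fits.lvs
    rw [G.root] at e3
    rw [hroot] at e1
    have e4 := h1.1 ⟨c.i, hj.symm⟩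
    rw [e4]
    refine (cons_inj_right b).1 ?_
    rw [← cons_add, ← e1, add_right_comm, e2, cons_add, e3, cons_swap]
  obtain ⟨e₂, h2⟩ := Wire.exists_fits hinj hl
  have hA₁ := c.isTreeA.ptree
  have G' : Grafted A₁ r c.lA B b g j e' (wLabel e' c.lA g) := by
    refine ⟨hA₁, G.right, hroot, fun x hx hx' => ?_, h1⟩
    rw [mem_edges hA₁] at hx
    refine G.eq_of_mem (hx.imp_right fun h => ?_) ((mem_edges G.right).1 hx')
    rw [← ins_perm hA, ins_append, mem_add]
    exact Or.inl h
  exact ⟨k', _, e', e₂, G', h2, Wire.par_of_fits hinj c.fits G.fits h1 h2, h1.1 _⟩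

end Grafted

end Grafted

section Multiplicative

open Finset.HasAntidiagonal (antidiagonal)

lemma sum_antidiagonal_assoc {M : Type*} [AddCommMonoid M] (F : ℕ → ℕ → ℕ → M) (c : ℕ) : ∑ x ∈
    antidiagonal c, ∑ y ∈ antidiagonal x.1, F y.1 y.2 x.2 = ∑ x ∈ antidiagonal c, ∑ y ∈ antidiagonal
    x.2, F x.1 y.1 y.2 := by
  rw [Finset.sum_sigma', Finset.sum_sigma']
  refine Finset.sum_nbij' (fun x => ⟨(x.2.1, x.2.2 + x.1.2), (x.2.2, x.1.2)⟩)
    (fun x => ⟨(x.1.1 + x.2.1, x.2.2), (x.1.1, x.2.1)⟩) ?_ ?_ ?_ ?_ ?_ <;>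
  · rintro ⟨⟨a, b⟩, ⟨a', b'⟩⟩
    simp only [Finset.mem_sigma, Finset.HasAntidiagonal.mem_antidiagonal]
    rintro ⟨rfl, rfl⟩
    simp [add_assoc]

lemma sum_antidiagonal_comm {M : Type*} [AddCommMonoid M] (F : ℕ → ℕ → ℕ → M) (c : ℕ) : ∑ x ∈
    antidiagonal c, ∑ y ∈ antidiagonal x.1, F y.1 y.2 x.2 = ∑ x ∈ antidiagonal c, ∑ y ∈ antidiagonal
    x.1, F y.1 x.2 y.2 := by
  rw [sum_antidiagonal_assoc, sum_antidiagonal_assoc fun a b c => F a c b]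
  refine sum_congr rfl fun x _ => ?_
  exact (Finset.Nat.sum_antidiagonal_swap (f := fun y => F x.1 y.1 y.2)).symm

variable {U : SMod.{u, v} K} {Q : GrOperad.{u, w} K}

lemma splitSum_sum {M ι : Type*} [AddCommGroup M] [Module K M] (S : Finset ι) (F : ι → List (Vtx U)
    → List (Vtx U) → M) (L : List (Vtx U)) : splitSum (fun A B => ∑ x ∈ S, F x A B) L = ∑ x ∈ S,
    splitSum (F x) L := by
  classical
  induction S using Finset.induction_on with
  | empty => exact split_eq_zero fun _ _ _ => Finset.sum_empty
  | insert x S hx ih => simp only [Finset.sum_insert hx, splitSum_add, ih]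

/-- The sum of the convolution terms of total weight `c` of a sequence of maps. -/
def glueSum (ψ : ℕ → TreeMap U Q) (c : ℕ) (p : ℤ) (A B : List (Vtx U)) (r : ℕ) (l : Fin n → ℕ) :
    Q.obj n p := ∑ x ∈ antidiagonal c, glueTerm (ψ x.1) (ψ x.2) p A B r l

/-- A sequence of maps from planted trees to an operad is multiplicative, in the sense of
generating series, on the grafts of a tree with vertices `B` on a tree with vertices `A`. -/
def IsMult (ψ : ℕ → TreeMap U Q) (A B : List (Vtx U)) : Prop :=
  ∀ {m n k : ℕ} {r b : ℕ} {f : Fin m → ℕ} {g : Fin n → ℕ} {i : Fin m} {e : Wire i n k}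
    {l : Fin k → ℕ} {p q s : ℤ}, Grafted A r f B b g i e l → deg A = p → deg B = q →
    ∀ (h : p + q = s) (c : ℕ), (ψ c).app (ptree (A ++ B) r l : PTree U k s) =
      ∑ x ∈ antidiagonal c, Q.comp i e h ((ψ x.1).app (ptree A r f)) ((ψ x.2).app (ptree B b g))

variable {ψ : ℕ → TreeMap U Q} {A B A₁ A₂ B₁ B₂ : List (Vtx U)} {b : ℕ}
  {f : Fin m → ℕ} {g : Fin n → ℕ} {i : Fin m} {e : Wire i n k} {l : Fin k → ℕ} {s : ℤ}

lemma glueSum_upper (G : Grafted A r f B b g i e l) (hA0 : A ≠ []) (hp : deg A = p) (hq : deg B = q)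
    (h : p + q = s) (hB : (B₁ ++ B₂).Perm B) (c : Glue B₁ B₂ b g) (hm : IsMult ψ A B₁) (N : ℕ) :
    glueSum ψ N s (A ++ B₁) B₂ r l = ∑ x ∈ antidiagonal N, Q.comp i e h ((ψ x.1).app (ptree A r f))
    (glueSum ψ x.2 q B₁ B₂ b g) := by
  obtain ⟨k', l', e', e₂, G', h2, hseq, hr⟩ := G.exists_upper hB c
  have hBt : IsTree (B₁ ++ B₂) b g := isTree_iff.2
    ⟨by simp [c.isTreeA.ne_nil], (IsPTree.perm hB).2 G.right⟩
  have hd : deg B₁ + deg B₂ = q := by rw [← deg_append, deg_perm hB, hq]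
  have hdA : deg (A ++ B₁) = p + deg B₁ := by rw [deg_append, hp]
  have hT : IsTree ((A ++ B₁) ++ B₂) r l := isTree_iff.2 ⟨by simp [hA0], by
    rw [append_assoc]
    exact (G.perm (.refl _) hB).isPTree⟩
  let c' : Glue (A ++ B₁) B₂ r l := ⟨k', c.nB, l', c.lB, e' (inr c.i), e₂,
    isTree_iff.2 ⟨by simp [hA0], G'.isPTree⟩, by rw [hr]; exact c.isTreeB, h2⟩
  have e1 : ∀ x : ℕ × ℕ, glueTerm (ψ x.1) (ψ x.2) s (A ++ B₁) B₂ r l =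
      ∑ y ∈ antidiagonal x.1, Q.comp i e h ((ψ y.1).app (ptree A r f))
        (Q.comp c.i c.e hd ((ψ y.2).app (ptree B₁ b c.lA))
          ((ψ x.2).app (ptree B₂ (c.lA c.i) c.lB))) := by
    intro x
    rw [glueTerm_eq c' hT (by rw [hdA, add_assoc, hd, h]), Glue.value_deg _ _ _ _ hdA rfl
      (by rw [add_assoc, hd, h])]
    change Q.comp (e' (inr c.i)) e₂ _ ((ψ x.1).app (ptree (A ++ B₁) r l'))
      ((ψ x.2).app (ptree B₂ (l' (e' (inr c.i))) c.lB)) = _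
    rw [hm G' hp rfl rfl, map_sum, LinearMap.sum_apply, hr]
    exact sum_congr rfl fun y _ => Q.seq e' e₂ c.e e hseq rfl _ hd h _ _ _
  simp only [glueSum, e1, map_sum]
  rw [sum_antidiagonal_assoc fun a a' d => Q.comp i e h ((ψ a).app (ptree A r f))
        (Q.comp c.i c.e hd ((ψ a').app (ptree B₁ b c.lA))
          ((ψ d).app (ptree B₂ (c.lA c.i) c.lB)))]
  refine sum_congr rfl fun x _ => sum_congr rfl fun y _ => ?_
  rw [glueTerm_eq c hBt hd]
  rfl

lemma glueSum_lower (c : Glue A₁ A₂ r f) {j : Fin c.nB} {e : Wire (c.e (inr j)) n k} (hA : (A₁ ++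
    A₂).Perm A) (G : Grafted A r f B b g (c.e (inr j)) e l) (hp : deg A = p) (hq : deg B = q) (h : p
    + q = s) (hm : IsMult ψ A₂ B) (N : ℕ) : glueSum ψ N s A₁ (A₂ ++ B) r l = ∑ x ∈ antidiagonal N,
    Q.comp _ e h (glueSum ψ x.1 p A₁ A₂ r f) ((ψ x.2).app (ptree B b g)) := by
  obtain ⟨k', l', e', e₂, G', h2, hseq⟩ := Grafted.exists_lower c hA G
  have hA₁ := c.isTreeA.ne_nil
  have hAt : IsTree (A₁ ++ A₂) r f := isTree_iff.2 ⟨by simp [hA₁], (IsPTree.perm hA).2 G.left⟩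
  have hd : deg A₁ + deg A₂ = p := by rw [← deg_append, deg_perm hA, hp]
  have hdB : deg (A₂ ++ B) = deg A₂ + q := by rw [deg_append, hq]
  have hT : IsTree (A₁ ++ (A₂ ++ B)) r l := isTree_iff.2 ⟨by simp [hA₁], by
    rw [← append_assoc]
    exact (G.perm hA (.refl _)).isPTree⟩
  let c' : Glue A₁ (A₂ ++ B) r l := ⟨c.nA, k', c.lA, l', c.i, e₂, c.isTreeA,
    isTree_iff.2 ⟨by simp [c.isTreeB.ne_nil], G'.isPTree⟩, h2⟩
  have e1 : ∀ x : ℕ × ℕ, glueTerm (ψ x.1) (ψ x.2) s A₁ (A₂ ++ B) r l =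
      ∑ y ∈ antidiagonal x.2, Q.comp _ e h (Q.comp c.i c.e hd ((ψ x.1).app (ptree A₁ r c.lA))
        ((ψ y.1).app (ptree A₂ (c.lA c.i) c.lB))) ((ψ y.2).app (ptree B b g)) := by
    intro x
    rw [glueTerm_eq c' hT (by rw [hdB, ← add_assoc, hd, h]), Glue.value_deg _ _ _ _ rfl hdB
      (by rw [← add_assoc, hd, h])]
    change Q.comp c.i e₂ _ ((ψ x.1).app (ptree A₁ r c.lA))
      ((ψ x.2).app (ptree (A₂ ++ B) (c.lA c.i) l')) = _
    rw [hm G' rfl hq rfl, map_sum]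
    exact sum_congr rfl fun y _ => (Q.seq c.e e e' e₂ hseq hd h rfl _ _ _ _).symm
  simp only [glueSum, e1, map_sum, LinearMap.sum_apply]
  rw [← sum_antidiagonal_assoc fun a a' d => Q.comp _ e h (Q.comp c.i c.e hd
    ((ψ a).app (ptree A₁ r c.lA)) ((ψ a').app (ptree A₂ (c.lA c.i) c.lB))) ((ψ d).app (ptree B b g))]
  refine sum_congr rfl fun x _ => sum_congr rfl fun y _ => ?_
  rw [glueTerm_eq c hAt hd]
  rfl

lemma glueSum_beside (c : Glue A₁ A₂ r f) {j : Fin c.nA} (hj : j ≠ c.i) {e : Wire (c.e (inl ⟨j,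
    hj⟩)) n k} (hA : (A₁ ++ A₂).Perm A) (G : Grafted A r f B b g (c.e (inl ⟨j, hj⟩)) e l) (hp : deg
    A = p) (hq : deg B = q) (h : p + q = s) (hm : IsMult ψ A₁ B) (N : ℕ) : sgn K (deg A₂ * q) •
    glueSum ψ N s (A₁ ++ B) A₂ r l = ∑ x ∈ antidiagonal N, Q.comp _ e h (glueSum ψ x.1 p A₁ A₂ r f)
    ((ψ x.2).app (ptree B b g)) := by
  obtain ⟨k', l', e', e₂, G', h2, hpar, hr⟩ := Grafted.exists_beside c hj hA G
  have hA₁ := c.isTreeA.ne_nil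
  have hAt : IsTree (A₁ ++ A₂) r f := isTree_iff.2 ⟨by simp [hA₁], (IsPTree.perm hA).2 G.left⟩
  have hd : deg A₁ + deg A₂ = p := by rw [← deg_append, deg_perm hA, hp]
  have hdA : deg (A₁ ++ B) = deg A₁ + q := by rw [deg_append, hq]
  have hd' : deg A₁ + q + deg A₂ = s := by rw [add_right_comm, hd, h]
  have hT : IsTree ((A₁ ++ B) ++ A₂) r l := by
    refine isTree_iff.2 ⟨by simp [hA₁], ?_⟩
    have hperm : (A₁ ++ B ++ A₂).Perm (A₁ ++ A₂ ++ B) := by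
      rw [append_assoc, append_assoc]
      exact List.perm_append_comm.append_left _
    exact (IsPTree.perm hperm).2 (G.perm hA (.refl _)).isPTree
  let c' : Glue (A₁ ++ B) A₂ r l := ⟨k', c.nB, l', c.lB, e' (inl ⟨c.i, hj.symm⟩), e₂,
    isTree_iff.2 ⟨by simp [hA₁], G'.isPTree⟩, by rw [hr]; exact c.isTreeB, h2⟩
  have e1 : ∀ x : ℕ × ℕ, sgn K (deg A₂ * q) • glueTerm (ψ x.1) (ψ x.2) s (A₁ ++ B) A₂ r l =
      ∑ y ∈ antidiagonal x.1, Q.comp _ e h (Q.comp c.i c.e hd ((ψ y.1).app (ptree A₁ r c.lA))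
        ((ψ x.2).app (ptree A₂ (c.lA c.i) c.lB))) ((ψ y.2).app (ptree B b g)) := by
    intro x
    rw [glueTerm_eq c' hT (by rw [hdA, hd']), Glue.value_deg _ _ _ _ hdA rfl hd']
    change sgn K (deg A₂ * q) • Q.comp (e' (inl ⟨c.i, hj.symm⟩)) e₂ _
      ((ψ x.1).app (ptree (A₁ ++ B) r l'))
      ((ψ x.2).app (ptree A₂ (l' (e' (inl ⟨c.i, hj.symm⟩))) c.lB)) = _
    rw [hm G' rfl hq rfl, map_sum, LinearMap.sum_apply, hr, smul_sum]
    exact sum_congr rfl fun y _ => (Q.par hj.symm c.e e e' e₂ hpar hd h rfl hd' _ _ _).symm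
  simp only [glueSum, smul_sum, e1, map_sum, LinearMap.sum_apply]
  rw [sum_antidiagonal_comm fun a d a' => Q.comp _ e h (Q.comp c.i c.e hd
    ((ψ a).app (ptree A₁ r c.lA)) ((ψ a').app (ptree A₂ (c.lA c.i) c.lB))) ((ψ d).app (ptree B b g))]
  refine sum_congr rfl fun x _ => sum_congr rfl fun y _ => ?_
  rw [glueTerm_eq c hAt hd]
  rfl

lemma glueSum_eq_zero (h : IsEmpty (Glue A B r l)) (N : ℕ) : glueSum ψ N p A B r l = 0 :=
  sum_eq_zero fun _ _ => glueTerm_eq_zero h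

lemma glueSum_grafted (G : Grafted A r f B b g i e l) (hA0 : A ≠ []) (hB0 : B ≠ []) (hp : deg A = p)
    (hq : deg B = q) (h : p + q = s) (N : ℕ) : glueSum ψ N s A B r l = ∑ x ∈ antidiagonal N, Q.comp
    i e h ((ψ x.1).app (ptree A r f)) ((ψ x.2).app (ptree B b g)) := by
  refine sum_congr rfl fun x _ => ?_
  rw [glueTerm_eq (G.glue hA0 hB0) (isTree_iff.2 ⟨by simp [hA0], G.isPTree⟩) (by rw [hp, hq, h]),
    Glue.value_deg _ _ _ _ hp hq h]
  change Q.comp i e h _ ((ψ x.2).app (ptree B (f i) g)) = _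
  rw [G.root]
  rfl

/-- The cuts of a graft whose edge is not in the lower tree. -/
lemma splitSum_glueSum_upper (G : Grafted A r f B b g i e l) (hA0 : A ≠ []) (hB0 : B ≠ []) (hp : deg
    A = p) (hq : deg B = q) (h : p + q = s) (hm : ∀ B₁ B₂, (B₁ ++ B₂).Perm B → Nonempty (Glue B₁ B₂
    b g) → IsMult ψ A B₁) (N : ℕ) : splitSum (fun B₁ B₂ => glueSum ψ N s (A ++ B₁) B₂ r l) B = ∑ x ∈
    antidiagonal N, Q.comp i e h ((ψ x.1).app (ptree A r f)) ((ψ x.2).app (ptree B b g)) + ∑ x ∈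
    antidiagonal N, Q.comp i e h ((ψ x.1).app (ptree A r f)) (splitSum (fun B₁ B₂ => glueSum ψ x.2 q
    B₁ B₂ b g) B) := by
  classical
  have e1 : ∀ B₁ B₂, (B₁ ++ B₂).Perm B → glueSum ψ N s (A ++ B₁) B₂ r l =
      (if B₁ = [] then glueSum ψ N s A B₂ r l else 0) + ∑ x ∈ antidiagonal N,
        Q.comp i e h ((ψ x.1).app (ptree A r f)) (glueSum ψ x.2 q B₁ B₂ b g) := by
    intro B₁ B₂ hB
    by_cases hc : Nonempty (Glue B₁ B₂ b g)
    · obtain ⟨c⟩ := hc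
      rw [if_neg c.isTreeA.ne_nil, zero_add]
      exact glueSum_upper G hA0 hp hq h hB c (hm B₁ B₂ hB ⟨c⟩) N
    · rw [sum_eq_zero (s := antidiagonal N) fun x _ => by
        rw [glueSum_eq_zero (not_nonempty_iff.1 hc), map_zero], add_zero]
      split_ifs with h0
      · rw [h0, append_nil]
      · refine glueSum_eq_zero ⟨fun c' => ?_⟩ N
        have hT : IsPTree ((A ++ B₁) ++ B₂) r l := by
          rw [append_assoc]
          exact (G.perm (.refl _) hB).isPTree
        rcases G.isCut_cases hA0 (A₂ := []) (by simp) hB (c'.isCut hT) with h' | h' | h' | h'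
        · exact h0 h'.2
        · obtain ⟨c, -⟩ := h'.2.exists_glue ((IsPTree.perm hB).2 G.right)
          exact hc ⟨c⟩
        · simpa using h'.2.1
        · simpa [IsCut] using h'.1
  rw [split_congr e1, splitSum_add, splitSum_left_nil, glueSum_grafted G hA0 hB0 hp hq h]
  refine congrArg₂ (· + ·) rfl ?_
  rw [splitSum_sum]
  exact sum_congr rfl fun x _ => (splitSum_map _ _ _).symm

/-- The cuts of a graft whose edge is in the lower tree. -/
lemma splitSum_glueSum_lower (G : Grafted A r f B b g i e l) (hA : (A₁ ++ A₂).Perm A) (hA0 : A₂ ≠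
    []) (hp : deg A = p) (hq : deg B = q) (h : p + q = s) (hm : ∀ A₁ A₂, (A₁ ++ A₂).Perm A → A₁ ≠ []
    → A₂ ≠ [] → IsMult ψ A₁ B ∧ IsMult ψ A₂ B) (N : ℕ) : splitSum (fun B₁ B₂ => sgn K (deg A₂ * deg
    B₁) • glueSum ψ N s (A₁ ++ B₁) (A₂ ++ B₂) r l) B = ∑ x ∈ antidiagonal N, Q.comp i e h (glueSum ψ
    x.1 p A₁ A₂ r f) ((ψ x.2).app (ptree B b g)) := by
  classical
  have hA0' : A ≠ [] := by
    rintro rfl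
    exact hA0 (List.append_eq_nil_iff.1 hA.eq_nil).2
  have hA' := (IsPTree.perm hA).2 G.left
  have hdis := (nodup_cons.1 hA'.2.1).2
  rw [ins_append] at hdis
  have hdis' : ∀ y, y ∈ ins A₁ → y ∈ ins A₂ → False := fun y =>
    disjoint_left.1 (nodup_add.1 hdis).2.2
  have hT : ∀ B₁ B₂, (B₁ ++ B₂).Perm B → IsPTree ((A₁ ++ B₁) ++ (A₂ ++ B₂)) r l := by
    intro B₁ B₂ hB
    have hperm : (A₁ ++ B₁ ++ (A₂ ++ B₂)).Perm (A₁ ++ A₂ ++ (B₁ ++ B₂)) := by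
      rw [append_assoc, append_assoc]
      refine List.Perm.append_left _ ?_
      rw [← append_assoc, ← append_assoc]
      exact List.perm_append_comm.append_right _
    exact (IsPTree.perm hperm).2 (G.perm hA hB).isPTree
  by_cases hc : Nonempty (Glue A₁ A₂ r f)
  · obtain ⟨c⟩ := hc
    have hA₁ := c.isTreeA.ne_nil
    obtain ⟨hm₁, hm₂⟩ := hm A₁ A₂ hA hA₁ hA0
    have hcut := c.isCut hA'
    obtain ⟨j | j, rfl⟩ := c.e.surjective i
    · obtain ⟨j, hj⟩ := j
      rw [← glueSum_beside c hj hA G hp hq h hm₁,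
        ← splitSum_right_nil (fun B₁ => sgn K (deg A₂ * q) • glueSum ψ N s (A₁ ++ B₁) A₂ r l) B]
      refine split_congr fun B₁ B₂ hB => ?_
      split_ifs with h0
      · rw [h0, append_nil] at hB ⊢
        rw [deg_perm hB, hq]
      · rw [glueSum_eq_zero ⟨fun c' => ?_⟩, smul_zero]
        have hb : b ∈ ins A₁ := by
          have hb : b ∈ r ::ₘ ins A₁ := by
            rw [← c.isTreeA.ptree.1, mem_add]
            exact Or.inr (mem_lvs.2 ⟨j, by rw [← G.root, c.fits.1]⟩)
          refine (mem_cons.1 hb).resolve_left fun h' => ?_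
          exact G.left.root_notMem_ins (h' ▸ G.root_mem_ins hA0')
        rcases G.isCut_cases hA0' hA hB (c'.isCut (hT B₁ B₂ hB)) with h' | h' | h' | h'
        · exact hA0 h'.1
        · exact hA0 h'.1
        · exact hdis' b hb h'.2.1
        · exact h0 h'.2.2
    · rw [← glueSum_lower c hA G hp hq h hm₂,
        ← splitSum_left_nil (fun B₂ => glueSum ψ N s A₁ (A₂ ++ B₂) r l) B]
      refine split_congr fun B₁ B₂ hB => ?_
      split_ifs with h0
      · rw [h0, append_nil, show deg ([] : List (Vtx U)) = 0 from rfl, mul_zero, sgn_zero,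
          one_smul]
      · rw [glueSum_eq_zero ⟨fun c' => ?_⟩, smul_zero]
        have hb : b ∈ ins A₂ := by
          have hb : b ∈ c.lA c.i ::ₘ ins A₂ := by
            rw [← c.isTreeB.ptree.1, mem_add]
            exact Or.inr (mem_lvs.2 ⟨j, by rw [← G.root, c.fits.2]⟩)
          refine (mem_cons.1 hb).resolve_left fun h' => ?_
          refine G.root_notMem_outs ?_
          rw [← outs_perm hA, outs_append, mem_add, h']
          exact Or.inr hcut.2.2.2
        rcases G.isCut_cases hA0' hA hB (c'.isCut (hT B₁ B₂ hB)) with h' | h' | h' | h'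
        · exact hA0 h'.1
        · exact hA0 h'.1
        · exact h0 h'.2.2
        · exact hdis' b h'.2.1 hb
  · rw [sum_eq_zero (s := antidiagonal N) fun x _ => by
      rw [glueSum_eq_zero (not_nonempty_iff.1 hc), map_zero, LinearMap.zero_apply]]
    refine split_eq_zero fun B₁ B₂ hB => ?_
    rw [glueSum_eq_zero ⟨fun c' => ?_⟩, smul_zero]
    have : ∀ {x}, IsCut A₁ A₂ r x → False := fun hx =>
      hc ⟨(hx.exists_glue hA').choose⟩
    rcases G.isCut_cases hA0' hA hB (c'.isCut (hT B₁ B₂ hB)) with h' | h' | h' | h'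
    · exact hA0 h'.1
    · exact hA0 h'.1
    · exact this h'.1
    · exact this h'.1

end Multiplicative

section Multiplicativity

open Finset.HasAntidiagonal (antidiagonal)

variable {Q : GrOperad.{u, w} K}

/-- The vertices of `B` that do not start at an inner edge are marked. -/
def RootsMarked (B : List (Vtx (marked V))) : Prop := ∀ t ∈ B, t.out ∉ ins B → markedFst t.lab = 0

/-- A sequence of maps is multiplicative as soon as it satisfies the recursion for a grouplike
generating series: its Euler derivative minus itself is its convolution square. -/
lemma isMult_of_conv [CharZero K] {ψ : ℕ → TreeMap (marked V) Q} (h0 : ∀ {n : ℕ} {p : ℤ} {L : List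
    (Vtx (marked V))} {r : ℕ} {l : Fin n → ℕ}, L ≠ [] → (ψ 0).app (ptree L r l : PTree _ n p) = 0)
    (h1 : ∀ {m n k : ℕ} {p : ℤ} {A B : List (Vtx (marked V))} {r b : ℕ} {f : Fin m → ℕ} {g : Fin n →
    ℕ} {i : Fin m} {e : Wire i n k} {l : Fin k → ℕ}, Grafted A r f B b g i e l → A ≠ [] → B ≠ [] →
    RootsMarked B → (ψ 1).app (ptree (A ++ B) r l : PTree _ k p) = 0) (hψ : ∀ {n : ℕ} {p : ℤ} {L :
    List (Vtx (marked V))} {r : ℕ} {l : Fin n → ℕ}, IsPTree L r l → deg L = p → L ≠ [] → ∀ c : ℕ,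
    ((c : K) - 1) • (ψ c).app (ptree L r l : PTree _ n p) = splitSum (fun A B => glueSum ψ c p A B r
    l) L) {A B : List (Vtx (marked V))} (hA0 : A ≠ []) (hB0 : B ≠ []) (hB : RootsMarked B) : IsMult
    ψ A B := by
  classical
  induction hN : A.length + B.length using Nat.strong_induction_on generalizing A B with
  | _ N ih =>
  subst hN
  intro m n k r b f g i e l p q s G hp hq h c
  have hT : IsPTree (A ++ B) r l := G.isPTree
  have hd : deg (A ++ B) = s := by rw [deg_append, hp, hq, h]
  have hAB : A ++ B ≠ [] := by simp [hA0]
  by_cases hc : c ≤ 1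
  · have hl : (ψ c).app (ptree (A ++ B) r l : PTree _ k s) = 0 := by
      interval_cases c
      · exact h0 hAB
      · exact h1 G hA0 hB0 hB
    rw [hl]
    refine (sum_eq_zero fun x hx => ?_).symm
    rw [Finset.HasAntidiagonal.mem_antidiagonal] at hx
    have : x.1 = 0 ∨ x.2 = 0 := by omega
    rcases this with h' | h'
    · rw [h', h0 hA0, map_zero, LinearMap.zero_apply]
    · rw [h', h0 hB0, map_zero]
  have hc' : (c : K) - 1 ≠ 0 := by
    rw [sub_ne_zero]
    exact_mod_cast fun h : c = 1 => hc h.le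
  refine (smul_right_injective _ hc') ?_
  change ((c : K) - 1) • _ = ((c : K) - 1) • _
  rw [hψ hT hd hAB, splitSum_append]
  have e1 : ∀ A₁ A₂, (A₁ ++ A₂).Perm A → splitSum (fun B₁ B₂ => sgn K (deg A₂ * deg B₁) •
      glueSum ψ c s (A₁ ++ B₁) (A₂ ++ B₂) r l) B =
      (if A₂ = [] then ∑ x ∈ antidiagonal c, (x.2 : K) • Q.comp i e h ((ψ x.1).app (ptree A₁ r f))
        ((ψ x.2).app (ptree B b g)) else 0) + ∑ x ∈ antidiagonal c, Q.comp i e h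
          (glueSum ψ x.1 p A₁ A₂ r f) ((ψ x.2).app (ptree B b g)) := by
    intro A₁ A₂ hA
    have hlen := hA.length_eq
    rw [length_append] at hlen
    by_cases hA₂ : A₂ = []
    · subst hA₂
      rw [append_nil] at hA
      have hz : ∑ x ∈ antidiagonal c, Q.comp i e h (glueSum ψ x.1 p A₁ [] r f)
          ((ψ x.2).app (ptree B b g)) = 0 := sum_eq_zero fun x _ => by
        rw [glueSum_eq_zero ⟨fun c => c.isTreeB.ne_nil rfl⟩, map_zero,
          LinearMap.zero_apply]
      rw [if_pos rfl, hz, add_zero]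
      have hA₁ : A₁ ≠ [] := fun h' => hA0 (List.Perm.nil_eq (h' ▸ hA)).symm
      have := splitSum_glueSum_upper (ψ := ψ) (G.perm hA (.refl _)) hA₁ hB0 ((deg_perm hA).trans hp) hq h
        (fun B₁ B₂ hB' hc => by
          obtain ⟨c⟩ := hc
          have hl := hB'.length_eq
          have hB₂ := List.length_pos_iff.2 c.isTreeB.ne_nil
          rw [length_append] at hl
          refine @ih _ ?_ A₁ B₁ hA₁ c.isTreeA.ne_nil (fun t ht ht' => ?_) rfl
          · rw [hA.length_eq]
            omega
          · have htb := (c.isTreeA.ptree.out_mem ht).resolve_right ht'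
            exact hB t (hB'.mem_iff.1 (mem_append_left _ ht))
              (htb ▸ G.right.root_notMem_ins)) c
      rw [← sum_add_distrib] at this
      refine Eq.trans (split_congr fun B₁ B₂ _ => ?_) (this.trans
        (sum_congr rfl fun x _ => ?_))
      · rw [show deg ([] : List (Vtx (marked V))) = 0 from rfl, zero_mul, sgn_zero, one_smul]
        rfl
      · rw [← hψ G.right hq hB0, map_smul, sub_smul, one_smul, add_sub_cancel]
    · rw [if_neg hA₂, zero_add]
      refine splitSum_glueSum_lower G hA hA₂ hp hq h (fun A₁ A₂ hA' h₁ h₂ => ?_) c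
      have hlen := hA'.length_eq
      rw [length_append] at hlen
      have l₁ := List.length_pos_iff.2 h₁
      have l₂ := List.length_pos_iff.2 h₂
      exact ⟨ih _ (by omega) h₁ hB0 hB rfl, ih _ (by omega) h₂ hB0 hB rfl⟩
  rw [split_congr e1, splitSum_add, splitSum_right_nil (fun A₁ => ∑ x ∈ antidiagonal c,
    (x.2 : K) • Q.comp i e h ((ψ x.1).app (ptree A₁ r f)) ((ψ x.2).app (ptree B b g))), splitSum_sum,
    ← sum_add_distrib, smul_sum]
  refine sum_congr rfl fun x hx => ?_
  have e2 := splitSum_map ((Q.comp i e h).flip ((ψ x.2).app (ptree B b g)))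
    (fun A₁ A₂ => glueSum ψ x.1 p A₁ A₂ r f) A
  rw [← hψ G.left hp hA0, map_smul] at e2
  refine (congrArg₂ (· + ·) rfl e2.symm).trans ?_
  rw [LinearMap.flip_apply, ← add_smul]
  rw [Finset.HasAntidiagonal.mem_antidiagonal] at hx
  rw [← hx]
  congr 1
  push_cast
  ring

lemma exists_wire_eq_left {i : Fin 1} (e : Wire i n k) : n = k := by
  obtain rfl : i = 0 := Subsingleton.elim _ _
  have := Fintype.card_congr e
  simpa using this

lemma exists_wire_eq_right {i : Fin m} (e : Wire i 1 k) : m = k := by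
  have := Fintype.card_congr e
  have hm := i.pos
  simp only [Fintype.card_sum, Fintype.card_fin, ne_eq, Fintype.card_subtype_compl,
    Fintype.card_subtype_eq] at this
  omega

lemma GrOperad.one_comp_wire (Q : GrOperad.{u, w} K) [IsEmpty {a : Fin 1 // a ≠ 0}] (e : Wire (0 :
    Fin 1) n n) (h : 0 + p = p) (y : Q.obj n p) : Q.comp 0 e h Q.one y = Q.act ((emptySum _
    _).symm.trans e) y := by
  let e₀ : Wire (0 : Fin 1) n n := emptySum _ _
  have he : e₀.Renames 1 1 (e₀.symm.trans e) e := ⟨fun a => isEmptyElim a, fun b => rfl⟩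
  have h1 := Q.equivariance 1 1 (e₀.symm.trans e) e₀ e he h Q.one y
  rwa [Q.act_one, Q.act_one, Q.one_comp e₀ fun b => rfl] at h1

lemma TreeMap.comp_unit_left {U : SMod.{u, v} K} (φ : TreeMap U Q) (i : Fin 1) (e : Wire i n k) (h :
    0 + p = p) (y : PTree U n p) : Q.comp i e h Q.one (φ.app y) = φ.app (graft i e h (ptree [] 0 fun
    _ => 0) y) := by
  obtain rfl := exists_wire_eq_left e
  obtain rfl : i = 0 := Subsingleton.elim _ _
  haveI : IsEmpty {a : Fin 1 // a ≠ 0} := ⟨fun a => a.2 (Subsingleton.elim _ _)⟩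
  rw [Q.one_comp_wire e h]
  exact (φ.app_act _ y).symm.trans (congrArg φ.app ((planted U).one_comp_wire e h y).symm)

/-- The wiring of a corolla with one leaf to the leaf `i` that keeps all leaves in place. -/
def unitWire (i : Fin m) : Wire i 1 m :=
  Equiv.ofBijective (Sum.elim (fun a => a.1) fun _ => i) ⟨by
    rintro (⟨a, ha⟩ | a) (⟨b, hb⟩ | b) hab
    · simpa using hab
    · exact (ha hab).elim
    · exact (hb hab.symm).elim
    · exact congrArg inr (Subsingleton.elim _ _), fun a => by
    by_cases ha : a = i
    · exact ⟨inr 0, ha.symm⟩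
    · exact ⟨inl ⟨a, ha⟩, rfl⟩⟩

lemma GrOperad.comp_one_wire (Q : GrOperad.{u, w} K) (i : Fin m) (e : Wire i 1 m) (h : p + 0 = p) (x
    : Q.obj m p) : Q.comp i e h x Q.one = Q.act ((unitWire i).symm.trans e) x := by
  have he : (unitWire i).Renames 1 1 ((unitWire i).symm.trans e) e :=
    ⟨fun a => by simp; rfl, fun b => by simp; rfl⟩
  have h1 := Q.equivariance 1 1 ((unitWire i).symm.trans e) (unitWire i) e he h x Q.one
  rwa [Q.act_one, Q.act_one, Q.comp_one i (unitWire i) (fun a => rfl) rfl] at h1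

lemma TreeMap.comp_unit_right {U : SMod.{u, v} K} (φ : TreeMap U Q) (i : Fin m) (e : Wire i 1 k) (h
    : p + 0 = p) (x : PTree U m p) : Q.comp i e h (φ.app x) Q.one = φ.app (graft i e h x (ptree [] 0
    fun _ => 0)) := by
  obtain rfl := exists_wire_eq_right e
  rw [Q.comp_one_wire i e h]
  exact (φ.app_act _ x).symm.trans (congrArg φ.app ((planted U).comp_one_wire i e h x).symm)

end Multiplicativity

/-! ### The inverse of the comparison with marked trees -/

section Inverse

open Finset.HasAntidiagonal (antidiagonal)

lemma vtx_degCast (o k : ℕ) (h : p = q) (x : V.obj k p) (ι : Fin k → ℕ) : (⟨o, k, q, V.degCast h x,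
    ι⟩ : Vtx V) = ⟨o, k, p, x, ι⟩ := by
  subst h
  rfl

lemma IsPTree.out_ne {s t : Vtx V} (h : IsPTree (s :: L) r l) (hs : s.out = r) (ht : t ∈ L) : t.out
    ≠ r := by
  intro htr
  have h1 := h.nodup_outs
  rw [outs_cons, cons_add, nodup_cons] at h1
  exact h1.1 (mem_add.2 (Or.inl (mem_outs.2 ⟨t, ht, htr.trans hs.symm⟩)))

lemma IsPTree.exists_root (h : IsPTree L r l) (h0 : L ≠ []) : ∃ s L', (s :: L').Perm L ∧ s.out = r
    := by
  obtain ⟨s, hs, hsr⟩ := mem_outs.1 (h.root_mem_outs h0)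
  obtain ⟨A, B, rfl⟩ := List.append_of_mem hs
  exact ⟨s, A ++ B, perm_middle.symm, hsr⟩

lemma IsPTree.countP_root (h : IsPTree L r l) (h0 : L ≠ []) : L.countP (fun s => s.out = r) = 1 :=
    by
  obtain ⟨s, L', hs, hsr⟩ := h.exists_root h0
  rw [← hs.countP_eq, List.countP_cons_of_pos (by simpa using hsr), List.countP_eq_zero.2]
  intro t ht
  simpa using ((IsPTree.perm hs).2 h).out_ne hsr ht

/-- A linear combination of maps from planted trees to an operad. -/
def TreeMap.smulSum {U : SMod.{u, v} K} {Q : GrOperad.{u, w} K} {ι : Type*} (c : K)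
    (S : Finset ι) (F : ι → TreeMap U Q) : TreeMap U Q where
  app := c • ∑ x ∈ S, (F x).app
  app_act σ x := by simp [LinearMap.sum_apply, (F _).app_act]

variable (V) in
/-- The projection to the trivial tree. -/
def trivialPart : TreeMap (marked V) (CobarFree V) where
  app {n p} := TreeFun.lift p <| Multi.treeFun
    (fun L _ _ => if L = [] then (CobarFree V).unitAt n p 1 else 0)
    (fun _ _ => ⟨fun A B s t => by simp, fun A B c c' s s₁ s₂ _ => by simp⟩)
    (fun π L r l => by simp)
  app_act {n p} σ x := by
    induction x using ptree_induction with
    | zero => simp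
    | add x y hx hy => simp only [map_add, hx, hy]
    | smul c x hx => simp only [map_smul, hx]
    | tree L r l hL hp =>
      rw [ptreeAct_ptree, TreeFun.lift_eq _ hL hp,
        TreeFun.lift_eq _ ((isPTree_relabel σ.symm L r l).2 hL) hp]
      change (if L = [] then _ else _) = (CobarFree V).act σ (if L = [] then _ else _)
      split_ifs
      · rw [GrOperad.act_unitAt]
      · rw [map_zero]

lemma trivialPart_ptree {L : List (Vtx (marked V))} (hL : L ≠ []) (r : ℕ) (l : Fin n → ℕ) :
    (trivialPart V).app (ptree L r l : PTree _ n p) = 0 := by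
  by_cases h : IsPTree L r l ∧ deg L = p
  · exact (TreeFun.lift_eq _ h.1 h.2).trans (if_neg hL)
  · rw [ptree_eq_zero h, map_zero]

/-- The projection to the trees without marks. -/
def unmarkedPart : PTree (marked V) n p →ₗ[K] TreeObj V n p :=
  TreeFun.lift p <| Multi.treeFun (fun L r l => tree (L.map Vtx.base) r l)
    (fun r l => (multi_tree p r l).comp_map (fun _ => rfl) Vtx.Comb.base)
    (fun π L r l => by
      refine Eq.trans ?_ (tree_rename π (L.map Vtx.base) r l)
      rw [List.map_map, List.map_map]
      rfl)

lemma unmarkedPart_ptree (L : List (Vtx (marked V))) (r : ℕ) (l : Fin n → ℕ) : unmarkedPart (ptree L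
    r l : PTree _ n p) = tree (L.map Vtx.base) r l := by
  by_cases h : IsPTree L r l ∧ deg L = p
  · exact TreeFun.lift_eq _ h.1 h.2
  · rw [ptree_eq_zero h, map_zero, tree_eq_zero fun h' => h ⟨?_, ?_⟩]
    · exact isPTree_of_ends (by rw [List.map_map]; rfl) h'.1.ptree
    · exact (deg_map (f := Vtx.base) (fun _ => rfl) L).symm.trans h'.2

lemma unmarkedPart_eq_zero {L : List (Vtx (marked V))} {t : Vtx (marked V)} (ht : t ∈ L) (h :
    markedFst t.lab = 0) (r : ℕ) (l : Fin n → ℕ) : unmarkedPart (ptree L r l : PTree _ n p) = 0 :=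
    by
  obtain ⟨A, B, rfl⟩ := List.append_of_mem ht
  rw [unmarkedPart_ptree, map_append, map_cons]
  exact (multi_tree p r l).eq_zero _ _ h

lemma unmarkedPart_act (σ : Perm (Fin n)) (x : PTree (marked V) n p) : unmarkedPart (ptreeAct σ x) =
    treeAct σ (unmarkedPart x) := by
  induction x using ptree_induction with
  | zero => simp
  | add x y hx hy => simp only [map_add, hx, hy]
  | smul c x hx => simp only [map_smul, hx]
  | tree L r l hL hp => rw [ptreeAct_ptree, unmarkedPart_ptree, unmarkedPart_ptree, treeAct_tree]

/-- The projection to the trees with a mark at the root vertex only. -/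
def rootUnmark : PTree (marked V) n p →ₗ[K] TreeObj V n (p + 1) :=
  unmarkedPart ∘ₗ loc (unmarkMap V) (LabMap.zero _ _ (-1))

lemma rootUnmark_act (σ : Perm (Fin n)) (x : PTree (marked V) n p) : rootUnmark (ptreeAct σ x) =
    treeAct σ (rootUnmark x) :=
  (congrArg unmarkedPart (loc_ptreeAct _ _ σ x)).trans (unmarkedPart_act _ _)

variable (V) in
/-- The projection to the trees with a mark at the root vertex only, as generators. -/
def singlePart : TreeMap (marked V) (CobarFree V) where
  app := cobarGen ∘ₗ rootUnmark
  app_act σ x := (congrArg (fun y => cobarGen y) (rootUnmark_act σ x)).trans (cobarGen_act σ _)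

lemma singlePart_app (x : PTree (marked V) n p) : (singlePart V).app x = cobarGen (rootUnmark x) := rfl

lemma rootUnmark_ptree {L : List (Vtx (marked V))} (h : IsPTree L r l) (hp : deg L = p) : rootUnmark
    (ptree L r l : PTree _ n p) = pickSum (fun s L' => unmarkedPart (ptree (s.opAt (unmarkMap V)
    (LabMap.zero _ _ (-1)) r :: L') r l)) L := by
  rw [rootUnmark, comp_apply, loc_ptree _ _ h hp, pickSum_map]

lemma unmarkedPart_opAt_of_ne {s : Vtx (marked V)} {L : List (Vtx (marked V))} (h : s.out ≠ r) :
    unmarkedPart (ptree (s.opAt (unmarkMap V) (LabMap.zero _ _ (-1)) r :: L) r l : PTree _ n p) = 0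
    := by
  refine unmarkedPart_eq_zero (mem_cons_self ..) ?_ r l
  rw [Vtx.opAt, if_neg h]
  rfl

lemma singlePart_of_marked {L : List (Vtx (marked V))} {t : Vtx (marked V)} (ht : t ∈ L) (htr :
    t.out ≠ r) (h : markedFst t.lab = 0) (l : Fin n → ℕ) : (singlePart V).app (ptree L r l : PTree _
    n p) = 0 := by
  by_cases hL : IsPTree L r l ∧ deg L = p
  · rw [singlePart_app, rootUnmark_ptree hL.1 hL.2, pick_eq_zero fun s L' hs => ?_, map_zero]
    by_cases hsr : s.out = r
    · refine unmarkedPart_eq_zero (mem_cons_of_mem _ ?_) h r l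
      exact (List.mem_cons.1 (hs.mem_iff.2 ht)).resolve_left fun h => htr (h ▸ hsr)
    · exact unmarkedPart_opAt_of_ne hsr
  · rw [ptree_eq_zero hL, map_zero]

lemma singlePart_of_unmarked {L : List (Vtx (marked V))} (h : ∀ t ∈ L, markedSnd t.lab = 0) (l : Fin
    n → ℕ) : (singlePart V).app (ptree L r l : PTree _ n p) = 0 := by
  by_cases hL : IsPTree L r l ∧ deg L = p
  · rw [singlePart_app, rootUnmark_ptree hL.1 hL.2, pick_eq_zero fun s L' hs => ?_, map_zero]
    by_cases hsr : s.out = r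
    · refine unmarkedPart_eq_zero (mem_cons_self ..) ?_ r l
      rw [Vtx.opAt, if_pos hsr]
      change V.degCast (show s.deg + 1 = s.deg - -1 by omega) (markedSnd s.lab) = 0
      rw [h s (hs.subset (mem_cons_self ..)), map_zero]
    · exact unmarkedPart_opAt_of_ne hsr
  · rw [ptree_eq_zero hL, map_zero]

lemma singlePart_markEmbed (x : TreeObj V n (p + 1)) : (singlePart V).app (markEmbed x : PTree
    (marked V) n p) = cobarGen x := by
  classical
  induction x using tree_induction with
  | zero => simp
  | add x y hx hy => simp only [map_add, hx, hy]
  | smul c x hx => simp only [map_smul, hx]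
  | tree L r l hL hp =>
  have hL' := hL.ptree
  rw [markEmbed, comp_apply, embed_tree hL hp, markRoot_unmarked hL' hp, pickSum_map]
  have key : ∀ s L', (s :: L').Perm L → (singlePart V).app (if s.out = r then
      ptree (s.mark :: L'.map Vtx.unmarked) r l else 0 : PTree (marked V) n p) =
        if s.out = r then cobarGen (tree (s :: L') r l) else 0 := by
    intro s L' hs
    split_ifs with hsr
    · have h1 := (IsPTree.perm hs).2 hL'
      have hd : deg (s.mark :: L'.map Vtx.unmarked) = p := by
        rw [deg_mark, deg_perm hs, hp]
        omega
      rw [singlePart_app, rootUnmark_ptree (isPTree_mark h1) hd, pickSum, pickSum_mapVtx Vtx.unmarked (fun _ => rfl),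
        pick_eq_zero fun t L'' ht => ?_, add_zero]
      · congr 1
        rw [unmarkedPart_ptree, map_cons, List.map_map]
        have hL'' : L'.map (Vtx.base ∘ Vtx.unmarked) = L' := by
          conv_rhs => rw [← List.map_id L']
          rfl
        rw [hL'']
        congr 2
        have hsr' : s.mark.out = r := hsr
        rw [Vtx.opAt, if_pos hsr']
        obtain ⟨o, k, d, x, ι⟩ := s
        exact (vtx_degCast o k _ _ ι).trans rfl
      · rw [unmarkedPart_opAt_of_ne, smul_zero]
        exact h1.out_ne hsr (ht.subset (mem_cons_self ..))
    · rw [map_zero]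
  rw [pick_congr key, pickSum_cons (G := fun L => cobarGen (tree L r l)) (fun A B s t =>
    (congrArg (fun y => cobarGen y) (koszul_tree r l A B s t)).trans (map_smul _ _ _)), hL'.countP_root hL.ne_nil, Nat.cast_one,
    one_smul]

variable (V) in
/-- The components of the left inverse of the comparison with marked trees: the component `c` is
supported on the trees with `c` marks, all of whose cuts into generators give the same value. -/
def unnestInv : ℕ → TreeMap (marked V) (CobarFree V)
  | 0 => trivialPart V
  | 1 => singlePart V
  | c + 2 => TreeMap.smulSum ((c + 1 : K)⁻¹) univ fun a : Fin (c + 1) =>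
    (unnestInv (a + 1)).conv (unnestInv (c + 1 - a))

lemma unnestInv_add_two {L : List (Vtx (marked V))} (h : IsPTree L r l) (hp : deg L = p) (c : ℕ) :
    (unnestInv V (c + 2)).app (ptree L r l : PTree _ n p) = (c + 1 : K)⁻¹ • ∑ a : Fin (c + 1),
    splitSum (fun A B => glueTerm (unnestInv V (a + 1)) (unnestInv V (c + 1 - a)) p A B r l) L := by
  rw [unnestInv]
  change ((c + 1 : K)⁻¹ • ∑ a : Fin (c + 1), ((unnestInv V (a + 1)).conv
    (unnestInv V (c + 1 - a))).app) (ptree L r l) = _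
  rw [LinearMap.smul_apply, LinearMap.sum_apply]
  simp only [TreeMap.conv_ptree h hp]

lemma glueTerm_zero_left (φ : TreeMap (marked V) (CobarFree V)) (A B : List (Vtx (marked V))) (r :
    ℕ) (l : Fin n → ℕ) : glueTerm (unnestInv V 0) φ p A B r l = 0 := by
  by_cases hA : A = []
  · exact glueTerm_eq_zero ⟨fun g => g.isTreeA.ne_nil hA⟩
  · refine glueTerm_eq_zero_of_left fun m q lA => ?_
    rw [unnestInv, trivialPart_ptree hA]

lemma glueTerm_zero_right (φ : TreeMap (marked V) (CobarFree V)) (A B : List (Vtx (marked V))) (r :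
    ℕ) (l : Fin n → ℕ) : glueTerm φ (unnestInv V 0) p A B r l = 0 := by
  by_cases hB : B = []
  · exact glueTerm_eq_zero ⟨fun g => g.isTreeB.ne_nil hB⟩
  · refine glueTerm_eq_zero_of_right fun m q f lB => ?_
    rw [unnestInv, trivialPart_ptree hB]

lemma unnestInv_conv [CharZero K] {L : List (Vtx (marked V))} (h : IsPTree L r l) (hp : deg L = p)
    (h0 : L ≠ []) (c : ℕ) : ((c : K) - 1) • (unnestInv V c).app (ptree L r l : PTree _ n p) =
    splitSum (fun A B => glueSum (unnestInv V) c p A B r l) L := by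
  match c with
  | 0 =>
    rw [unnestInv, trivialPart_ptree h0, smul_zero, split_eq_zero]
    intro A B _
    simp [glueSum, glueTerm_zero_left]
  | 1 =>
    rw [Nat.cast_one, sub_self, zero_smul, split_eq_zero]
    intro A B _
    simp [glueSum, Finset.Nat.antidiagonal_succ, glueTerm_zero_left, glueTerm_zero_right]
  | c + 2 =>
    have hc : ((c + 2 : ℕ) : K) - 1 = c + 1 := by push_cast; ring
    rw [unnestInv_add_two h hp, hc, smul_inv_smul₀ (by exact_mod_cast c.succ_ne_zero),
      ← splitSum_sum]
    refine split_congr fun A B _ => ?_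
    rw [glueSum, Finset.Nat.sum_antidiagonal_eq_sum_range_succ_mk, Finset.sum_range_succ,
      Finset.sum_range_succ', Nat.sub_self, glueTerm_zero_left, glueTerm_zero_right, add_zero,
      add_zero, Finset.sum_range]
    refine sum_congr rfl fun a _ => ?_
    rw [show c + 2 - (a + 1) = c + 1 - (a : ℕ) by omega]

lemma unnestInv_of_unmarked [CharZero K] {L : List (Vtx (marked V))} (h0 : L ≠ []) (h : ∀ t ∈ L,
    markedSnd t.lab = 0) (c : ℕ) (r : ℕ) (l : Fin n → ℕ) : (unnestInv V c).app (ptree L r l : PTree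
    _ n p) = 0 := by
  induction c using Nat.strong_induction_on generalizing n p L r with
  | _ c ih =>
  by_cases hL : IsPTree L r l ∧ deg L = p
  swap
  · rw [ptree_eq_zero hL, map_zero]
  match c with
  | 0 => rw [unnestInv, trivialPart_ptree h0]
  | 1 => rw [unnestInv, singlePart_of_unmarked h]
  | c + 2 =>
    rw [unnestInv_add_two hL.1 hL.2, sum_eq_zero, smul_zero]
    refine fun a _ => split_eq_zero fun A B hAB => ?_
    by_cases hA : A = []
    · exact glueTerm_eq_zero ⟨fun g => g.isTreeA.ne_nil hA⟩
    · exact glueTerm_eq_zero_of_left fun m q lA => ih _ (by omega) hA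
        (fun t ht => h t (hAB.subset (mem_append_left _ ht))) _ _

/-- The left inverse is the identity on generators. -/
lemma unnestInv_markEmbed [CharZero K] (x : TreeObj V n (p + 1)) (c : ℕ) :
    (unnestInv V c).app (markEmbed x : PTree (marked V) n p) =
      if c = 1 then cobarGen x else 0 := by
  classical
  split_ifs with hc
  · rw [hc, unnestInv, singlePart_markEmbed]
  induction x using tree_induction with
  | zero => simp
  | add x y hx hy => simp only [map_add, hx, hy, add_zero]
  | smul c x hx => simp only [map_smul, hx, smul_zero]
  | tree L r l hL hp =>
  have hL' := hL.ptree
  rw [markEmbed, comp_apply, embed_tree hL hp, markRoot_unmarked hL' hp, pickSum_map]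
  refine pick_eq_zero fun s L' hs => ?_
  split_ifs with hsr
  swap
  · rw [map_zero]
  have h1 := isPTree_mark ((IsPTree.perm hs).2 hL')
  have hd : deg (s.mark :: L'.map Vtx.unmarked) = p := by
    rw [deg_mark, deg_perm hs, hp]
    omega
  match c with
  | 0 => rw [unnestInv, trivialPart_ptree (by simp)]
  | 1 => exact absurd rfl hc
  | c + 2 =>
    rw [unnestInv_add_two h1 hd, sum_eq_zero, smul_zero]
    have hu : ∀ t ∈ L'.map Vtx.unmarked, markedSnd t.lab = 0 := fun t ht => by
      obtain ⟨t, _, rfl⟩ := List.mem_map.1 ht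
      rfl
    intro a _
    -- one of the two parts of a cut has no marks
    refine split_eq_zero fun A B hAB => ?_
    have hn := (IsPTree.perm hAB).2 h1
    by_cases hA : A = []
    · exact glueTerm_eq_zero ⟨fun g => g.isTreeA.ne_nil hA⟩
    by_cases hB : B = []
    · exact glueTerm_eq_zero ⟨fun g => g.isTreeB.ne_nil hB⟩
    have hr : ∀ t ∈ A ++ B, t.out = r ∨ markedSnd t.lab = 0 := fun t ht =>
      (List.mem_cons.1 (hAB.subset ht)).imp (fun h => (congrArg Vtx.out h).trans hsr) (hu t)
    by_cases hAr : ∀ t ∈ A, markedSnd t.lab = 0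
    · exact glueTerm_eq_zero_of_left fun m q lA => unnestInv_of_unmarked hA hAr _ _ _
    · refine glueTerm_eq_zero_of_right fun m q f lB => unnestInv_of_unmarked hB (fun t ht => ?_) _ _ _
      push Not at hAr
      obtain ⟨u, hu, hu'⟩ := hAr
      refine (hr t (mem_append_right _ ht)).resolve_left fun htr => ?_
      have hur := (hr u (mem_append_left _ hu)).resolve_right hu'
      obtain ⟨A₁, A₂, rfl⟩ := List.append_of_mem hu
      exact IsPTree.out_ne ((IsPTree.perm (by
        rw [append_assoc]
        exact perm_middle)).1 hn) hur (mem_append.2 (Or.inr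
          (mem_append_right A₂ ht))) htr

lemma unnestInv_nil [CharZero K] (c : ℕ) : (unnestInv V c).app (ptree [] 0 (fun _ : Fin 1 => 0) :
    PTree (marked V) 1 0) = if c = 0 then (CobarFree V).one else 0 := by
  have h : IsPTree ([] : List (Vtx (marked V))) 0 (fun _ : Fin 1 => 0) := isPTree_nil 0
  have hd : deg ([] : List (Vtx (marked V))) = 0 := rfl
  match c with
  | 0 =>
    rw [unnestInv]
    refine (TreeFun.lift_eq _ h hd).trans ?_
    rw [if_pos rfl]
    change (if ([] : List (Vtx (marked V))) = [] then _ else 0) = _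
    exact (if_pos rfl).trans (((CobarFree V).unitAt_one 1).trans (one_smul K (CobarFree V).one))
  | 1 =>
    rw [unnestInv, singlePart_app, rootUnmark_ptree h hd]
    exact map_zero _
  | c + 2 =>
    rw [unnestInv_add_two h hd, sum_eq_zero, smul_zero, if_neg (by omega)]
    refine fun a _ => split_eq_zero fun A B hAB => glueTerm_eq_zero
      ⟨fun g => g.isTreeA.ne_nil (List.append_eq_nil_iff.1 (List.perm_nil.1 hAB)).1⟩

/-- The left inverse is multiplicative, in the sense of generating series. -/
lemma unnestInv_graft [CharZero K] (i : Fin m) (e : Wire i n k) {s : ℤ} (h : p + q = s) (x : PTree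
    (marked V) m p) {y : PTree (marked V) n q} (hy : y ∈ MTrees V ⊤ n q) (c : ℕ) : (unnestInv V
    c).app (graft i e h x y) = ∑ a ∈ antidiagonal c, (CobarFree V).comp i e h ((unnestInv V a.1).app
    x) ((unnestInv V a.2).app y) := by
  induction x using ptree_induction with
  | zero => simp
  | add x x' hx hx' => simp only [map_add, LinearMap.add_apply, hx, hx', sum_add_distrib]
  | smul a x hx => simp only [map_smul, LinearMap.smul_apply, hx, smul_sum]
  | tree A r f hA hp =>
  by_cases hA0 : A = []
  · subst hA0
    obtain ⟨rfl, hf⟩ := hA.nil_eq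
    obtain rfl : f = fun _ => r := funext hf
    obtain rfl : (0 : ℤ) = p := hp
    obtain rfl : q = s := by omega
    have hz := TreeMap.comp_unit_left (unnestInv V c) i e h y
    rw [ptree_nil_eq 0 r 0, ← hz, Finset.sum_eq_single (0, c)]
    · rw [unnestInv_nil, if_pos rfl]
    · rintro ⟨a, b⟩ hab hne
      rw [Finset.HasAntidiagonal.mem_antidiagonal] at hab
      rw [unnestInv_nil, if_neg, map_zero, LinearMap.zero_apply]
      rintro rfl
      exact hne (by simp at hab; rw [hab])
    · simp
  induction hy using MTrees_induction with
  | zero => simp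
  | add x x' _ _ hx hx' => simp only [map_add, hx, hx', sum_add_distrib]
  | smul a x _ hx => simp only [map_smul, hx, smul_sum]
  | tree B b g hB hq hBr _ =>
    by_cases hB0 : B = []
    · subst hB0
      obtain ⟨rfl, hg⟩ := hB.nil_eq
      obtain rfl : g = fun _ => b := funext hg
      obtain rfl : (0 : ℤ) = q := hq
      obtain rfl : p = s := by omega
      have hz := TreeMap.comp_unit_right (unnestInv V c) i e h (ptree A r f)
      rw [ptree_nil_eq 0 b 0, ← hz, Finset.sum_eq_single (c, 0)]
      · rw [unnestInv_nil, if_pos rfl]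
      · rintro ⟨a, b⟩ hab hne
        rw [Finset.HasAntidiagonal.mem_antidiagonal] at hab
        rw [unnestInv_nil, if_neg, map_zero]
        rintro rfl
        exact hne (by simp at hab; rw [hab])
      · simp
    obtain ⟨π, h1, h2, h3, h4, h5⟩ := exists_apart_marked A r f i hB q
    rw [h1, graft_ptree hA h3 rfl h5 (e.fits_wireLabel _ _) hp (h4.trans hq)]
    refine isMult_of_conv (ψ := unnestInv V) (fun h0 => by rw [unnestInv, trivialPart_ptree h0])
      (fun {m n k p A B r b f g i e l} G hA0 hB0 hB => ?_)
      (fun h hp h0 c => unnestInv_conv h hp h0 c) hA0 (by simpa using hB0) (fun t ht ht' => ?_)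
      ⟨hA, h3, rfl, h5, e.fits_wireLabel _ _⟩ hp (h4.trans hq) h c
    · rw [unnestInv]
      obtain ⟨t, ht, rfl⟩ := mem_outs.1 (G.right.root_mem_outs hB0)
      refine singlePart_of_marked (mem_append_right _ ht) (fun htr => ?_)
        (hB t ht G.right.root_notMem_ins) _
      exact G.left.root_notMem_ins (htr ▸ G.root_mem_ins hA0)
    · exact (h2 ▸ hBr.ren π) t ht ((h3.out_mem ht).resolve_right ht')

lemma sum_range_antidiagonal {M : Type*} [AddCommMonoid M] (F : ℕ → ℕ → M) {a b : ℕ} (hF : ∀ i j, a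
    ≤ i ∨ b ≤ j → F i j = 0) : ∑ c ∈ range (a + b), ∑ x ∈ antidiagonal c, F x.1 x.2 = ∑ i ∈ range a,
    ∑ j ∈ range b, F i j := by
  rw [← Finset.sum_product', ← Finset.sum_fiberwise_of_maps_to
    (s := range a ×ˢ range b) (t := range (a + b)) (g := fun x => x.1 + x.2)]
  · refine sum_congr rfl fun c _ => (Finset.sum_subset (fun x hx => ?_) fun x hx hx' => ?_).symm
    · simpa using (Finset.mem_filter.1 hx).2
    · refine hF _ _ ?_
      by_contra! hlt
      exact hx' (by simpa [hlt] using hx)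
  · intro x hx
    simp only [Finset.mem_product, Finset.mem_range] at hx ⊢
    omega

lemma sum_unnestInv_unnest [CharZero K] (x : (CobarFree V).obj n p) : ∃ N : ℕ, ∀ c ≥ N, (unnestInv V
    c).app (unnestLin V x) = 0 ∧ ∑ a ∈ range c, (unnestInv V a).app (unnestLin V x) = x := by
  classical
  have of_N : ∀ {n : ℕ} {p : ℤ} (x : (CobarFree V).obj n p) (N : ℕ),
      (∀ c ≥ N, (unnestInv V c).app (unnestLin V x) = 0) →
      ∑ a ∈ range N, (unnestInv V a).app (unnestLin V x) = x → ∃ N : ℕ, ∀ c ≥ N,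
        (unnestInv V c).app (unnestLin V x) = 0 ∧
          ∑ a ∈ range c, (unnestInv V a).app (unnestLin V x) = x := fun x N h1 h2 =>
    ⟨N, fun c hc => ⟨h1 c hc, (Finset.eventually_constant_sum h1 hc).trans h2⟩⟩
  induction x using cobarFree_induction with
  | one =>
    refine of_N _ 1 (fun c hc => ?_) ?_
    · rw [unnestLin_one, unnestInv_nil, if_neg (by omega)]
    · rw [Finset.sum_range_one, unnestLin_one, unnestInv_nil, if_pos rfl]
  | gen x =>
    refine of_N _ 2 (fun c hc => ?_) ?_
    · rw [unnestLin_gen, unnestInv_markEmbed, if_neg (by omega)]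
    · simp [unnestLin_gen, unnestInv_markEmbed]
  | act σ x ih =>
    obtain ⟨N, h⟩ := ih
    refine ⟨N, fun c hc => ⟨?_, ?_⟩⟩
    · rw [unnestLin_act, (unnestInv V c).app_act, (h c hc).1, map_zero]
    · simp only [unnestLin_act, (unnestInv V _).app_act]
      rw [← map_sum, (h c hc).2]
  | comp i e h x y ihx ihy =>
    obtain ⟨N, hN⟩ := ihx
    obtain ⟨M, hM⟩ := ihy
    have hz : ∀ a b, N ≤ a ∨ M ≤ b → (CobarFree V).comp i e h ((unnestInv V a).app (unnestLin V x))
        ((unnestInv V b).app (unnestLin V y)) = 0 := by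
      rintro a b (h' | h')
      · rw [(hN a h').1, map_zero, LinearMap.zero_apply]
      · rw [(hM b h').1, map_zero]
    refine of_N _ (N + M) (fun c hc => ?_) ?_
    · rw [unnestLin_comp, unnestInv_graft i e h _ (unnestLin_mem y)]
      refine sum_eq_zero fun a ha => hz _ _ ?_
      rw [Finset.HasAntidiagonal.mem_antidiagonal] at ha
      omega
    · simp only [unnestLin_comp, unnestInv_graft i e h _ (unnestLin_mem y)]
      rw [sum_range_antidiagonal _ hz]
      refine (sum_congr rfl fun a _ => (map_sum _ _ _).symm.trans
        (congrArg _ (hM M le_rfl).2)).trans ?_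
      rw [← LinearMap.sum_apply, ← map_sum, (hN N le_rfl).2]
  | zero => exact ⟨0, fun c _ => by simp⟩
  | add x y ihx ihy =>
    obtain ⟨N, hN⟩ := ihx
    obtain ⟨M, hM⟩ := ihy
    refine ⟨max N M, fun c hc => ?_⟩
    have h1 := hN c ((le_max_left _ _).trans hc)
    have h2 := hM c ((le_max_right _ _).trans hc)
    simp only [map_add, sum_add_distrib, h1.1, h1.2, h2.1, h2.2, add_zero, and_self]
  | smul a x ih =>
    obtain ⟨N, hN⟩ := ih
    refine ⟨N, fun c hc => ?_⟩
    simp only [map_smul, ← smul_sum, (hN c hc).1, (hN c hc).2, smul_zero, and_self]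

lemma unnestLin_injective [CharZero K] : Injective (unnestLin V (n := n) (p := p)) := by
  refine (injective_iff_map_eq_zero _).2 fun x hx => ?_
  obtain ⟨N, h⟩ := sum_unnestInv_unnest x
  rw [← (h N le_rfl).2, hx]
  simp

end Inverse

/-! ### Generation of the marked trees -/

lemma unnestLin_unitAt (n : ℕ) (p : ℤ) (c : K) (a : ℕ∞) : unnestLin V ((CobarFree V).unitAt n p c) ∈
    MTrees V a n p := by
  by_cases h : 1 = n ∧ 0 = p
  · obtain ⟨rfl, rfl⟩ := h
    rw [GrOperad.unitAt_one, map_smul, unnestLin_one]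
    exact smul_mem _ _ (ptree_nil_mem_markedTrees _ _ _)
  · rw [GrOperad.unitAt_eq_zero _ h, map_zero]
    exact zero_mem _

lemma markEmbed_tree_cons {s : Vtx V} (h : IsPTree (s :: L) r l) (hs : s.out = r) (hp : deg (s :: L)
    = p + 1) : (markEmbed (tree (s :: L) r l) : PTree (marked V) n p) = ptree (s.mark :: L.map
    Vtx.unmarked) r l := by
  classical
  rw [markEmbed, comp_apply, embed_tree (isTree_iff.2 ⟨by simp, h⟩) hp,
    markRoot_unmarked h hp, pickSum, if_pos hs, pick_eq_zero, add_zero]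
  intro t L' ht
  rw [if_neg (h.out_ne hs (ht.subset (mem_cons_self ..))), smul_zero]

variable (P) in
/-- The images of elements of the cobar construction on which the curvature lowers the number of
vertices. -/
def generated (a : ℕ) (n : ℕ) (p : ℤ) : Submodule K (PTree (marked (barGen P)) n p) where
  carrier := {x | ∃ z, unnestLin (barGen P) z = x ∧ ∀ {q : ℤ} (h : q + 1 = p),
    unnestLin (barGen P) (curvD P h z) ∈ MTrees (barGen P) (a - 1 : ℕ) n q}
  zero_mem' := ⟨0, map_zero _, fun h => by simp⟩
  add_mem' := by
    rintro _ _ ⟨z, rfl, hz⟩ ⟨w, rfl, hw⟩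
    exact ⟨z + w, map_add _ _ _, fun h => by rw [map_add, map_add]; exact add_mem (hz h) (hw h)⟩
  smul_mem' := by
    rintro c _ ⟨z, rfl, hz⟩
    exact ⟨c • z, map_smul _ _ _, fun h => by
      rw [map_smul, map_smul]; exact smul_mem _ c (hz h)⟩

lemma graft_mem_generated (i : Fin m) (e : Wire i n k) {s : ℤ} (h : p + q = s) {a b c : ℕ} (ha : a ≠
    0) (hb : b ≠ 0) (hc : a + b = c) {x : PTree (marked (barGen P)) m p} {y : PTree (marked (barGen
    P)) n q} (hx : x ∈ generated P a m p) (hx' : x ∈ MTrees (barGen P) a m p) (hy : y ∈ generated P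
    b n q) (hy' : y ∈ MTrees (barGen P) b n q) : graft i e h x y ∈ generated P c k s := by
  obtain ⟨z, rfl, hz⟩ := hx
  obtain ⟨w, rfl, hw⟩ := hy
  refine ⟨(CobarFree (barGen P)).comp i e h z w, unnestLin_comp .., fun {s'} h' => ?_⟩
  rw [isDeriv_curvD.comp i e h (p' := p - 1) (q' := q - 1) (by omega) (by omega) h' (by omega)
    (by omega), map_add, map_smul, unnestLin_comp, unnestLin_comp]
  refine add_mem ?_ (smul_mem _ _ ?_)
  · refine MTrees_mono ?_ (graft_mem_markedTrees i e _ (hz _) hy')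
    exact_mod_cast (by omega : a - 1 + b ≤ c - 1)
  · refine MTrees_mono ?_ (graft_mem_markedTrees i e _ hx' (hw _))
    exact_mod_cast (by omega : a + (b - 1) ≤ c - 1)

/-- The label of `t` has a marked or an unmarked part only. -/
def IsPure (t : Vtx (marked V)) : Prop :=
  markedFst t.lab = 0 ∨ markedSnd t.lab = 0

lemma exists_mark_eq {s : Vtx (marked V)} (hs : markedFst s.lab = 0) : ∃ s' : Vtx V, s'.mark = s :=
    by
  have key : ∀ (d : ℤ) (hd : d + 1 = s.deg + 1), (⟨s.out, s.ar, d, (markMap _).app hd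
      (markedMk LinearMap.id 0 (markedSnd s.lab)), s.inp⟩ : Vtx (marked V)) = s := by
    intro d hd
    obtain rfl : d = s.deg := by omega
    exact congrArg (fun y => (⟨s.out, s.ar, s.deg, y, s.inp⟩ : Vtx (marked V)))
      (marked_ext hs.symm rfl)
  exact ⟨⟨s.out, s.ar, s.deg + 1, markedSnd s.lab, s.inp⟩, key _ _⟩

/-- A tree whose only mark is at the root is the image of a generator; other trees are cut at a
marked vertex. -/
lemma ptree_mem_generated_of_pure {s : Vtx (marked (barGen P))} {L : List (Vtx (marked (barGen P)))}
    (h : IsPTree (s :: L) s.out l) (hp : deg (s :: L) = p) (hs : markedFst s.lab = 0) (hL : ∀ t ∈ L,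
    IsPure t) : ptree (s :: L) s.out l ∈ generated P (s :: L).length n p := by
  classical
  induction hN : L.length using Nat.strong_induction_on generalizing s L n p with
  | _ N ih =>
  by_cases hm : ∀ t ∈ L, markedSnd t.lab = 0
  · obtain ⟨s, rfl⟩ := exists_mark_eq hs
    have hL' : (L.map Vtx.base).map Vtx.unmarked = L := by
      rw [List.map_map]
      conv_rhs => rw [← List.map_id L]
      refine map_congr_left fun t ht => ?_
      obtain ⟨o, k, d, x, ι⟩ := t
      exact congrArg (fun y => (⟨o, k, d, y, ι⟩ : Vtx (marked (barGen P))))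
        (marked_ext rfl (hm _ ht).symm)
    have h1 : IsPTree (s :: L.map Vtx.base) s.out l :=
      isPTree_of_ends (by simp only [map_cons, List.map_map]; rfl) h
    have hd : deg (s :: L.map Vtx.base) = p + 1 := by
      rw [deg_cons, deg_map (f := Vtx.base) fun _ => rfl, ← hp, deg_cons, show s.mark.deg = s.deg - 1
        from rfl]
      omega
    have h2 := markEmbed_tree_cons h1 rfl hd
    rw [hL'] at h2
    refine ⟨cobarGen (tree (s :: L.map Vtx.base) s.out l), h2, fun h => ?_⟩
    rw [curvD_gen]
    exact unnestLin_unitAt _ _ _ _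
  · push Not at hm
    obtain ⟨t, ht, htm⟩ := hm
    have htm' := (hL t ht).resolve_right htm
    obtain ⟨X, Y, rfl⟩ := List.append_of_mem ht
    let A := (X ++ Y).filter fun v => ¬ Above (s :: (X ++ t :: Y)) t.out v.out
    let B := (X ++ Y).filter fun v => Above (s :: (X ++ t :: Y)) t.out v.out
    have hperm : (s :: A ++ t :: B).Perm (s :: (X ++ t :: Y)) := by
      refine List.Perm.cons s (perm_middle.trans (List.Perm.trans ?_ perm_middle.symm))
      refine List.Perm.cons t (List.perm_append_comm.trans ?_)
      simpa [A, B] using List.filter_append_perm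
        (fun v : Vtx (marked (barGen P)) => Above (s :: (X ++ t :: Y)) t.out v.out) (X ++ Y)
    have h' := (IsPTree.perm hperm).2 h
    obtain ⟨g, hg⟩ := ((isCut_iff h' rfl).2 ⟨fun a ha ha' => by
      simpa [ha'.perm hperm] using (mem_filter.1 ha).2, fun b hb =>
        Above.perm hperm.symm (by simpa using (mem_filter.1 hb).2)⟩).exists_glue h'
    have hA := g.isTreeA.ptree
    have hB := g.isTreeB.ptree
    have hap := g.apart h'
    rw [hg] at hB hap
    have hlen := hperm.length_eq
    have hlen' : (s :: A).length + (t :: B).length = (s :: (X ++ t :: Y)).length := by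
      rw [← hlen, length_append]
    simp only [length_append, length_cons] at hlen hN
    have hsub : ∀ v ∈ X ++ Y, IsPure v := fun v hv => hL v (by
      rcases mem_append.1 hv with hv | hv
      · exact mem_append_left _ hv
      · exact mem_append_right _ (mem_cons_of_mem _ hv))
    obtain ⟨ε, hε⟩ := Koszul.exists_perm hperm.symm
    rw [hε _ (koszul_ptree s.out l), ← graft_ptree hA hB hg hap g.fits rfl rfl
      (by rw [← deg_append, deg_perm hperm, hp])]
    have hr : ∀ {m : ℕ} {v : Vtx (marked (barGen P))} {L : List (Vtx (marked (barGen P)))}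
        {f : Fin m → ℕ}, markedFst v.lab = 0 → IsPTree (v :: L) v.out f →
          RootMarked (v :: L) v.out := fun hv h u hu hu' =>
      (List.mem_cons.1 hu).elim (fun h => h ▸ hv) fun hu => (h.out_ne rfl hu hu').elim
    refine smul_mem _ _ (graft_mem_generated g.i g.e _ (a := (s :: A).length)
      (b := (t :: B).length) (by simp) (by simp) hlen'
      (ih _ (by omega) hA rfl hs (fun v hv => hsub v (mem_filter.1 hv).1) rfl)
      (ptree_mem_markedTrees (fun _ => hr hs hA) le_rfl)
      (ih _ (by omega) hB rfl htm' (fun v hv => hsub v (mem_filter.1 hv).1) rfl)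
      (ptree_mem_markedTrees (fun _ => hr htm' hB) le_rfl))

lemma ptree_mem_generated {s : Vtx (marked (barGen P))} {L M : List (Vtx (marked (barGen P)))} (h :
    IsPTree (s :: L ++ M) s.out l) (hp : deg (s :: L ++ M) = p) (hs : markedFst s.lab = 0) (hL : ∀ t
    ∈ L, IsPure t) : ptree (s :: L ++ M) s.out l ∈ generated P (s :: L ++ M).length n p := by
  induction M generalizing L with
  | nil =>
    rw [append_nil] at h hp ⊢
    exact ptree_mem_generated_of_pure h hp hs hL
  | cons t M ih =>
    obtain ⟨o, k, d, x, ι⟩ := t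
    let y : (marked (barGen P)).obj k d := (markedFst x, 0)
    let z : (marked (barGen P)).obj k d := (0, markedSnd x)
    have hx : x = (1 : K) • y + (1 : K) • z := by
      rw [one_smul, one_smul]
      exact marked_ext (add_zero _).symm (zero_add _).symm
    have key : ∀ y : (marked (barGen P)).obj k d, IsPure ⟨o, k, d, y, ι⟩ →
        ptree (s :: L ++ ⟨o, k, d, y, ι⟩ :: M) s.out l ∈
          generated P (s :: L ++ ⟨o, k, d, x, ι⟩ :: M).length n p := by
      intro y hy
      have hend : (s :: L ++ ⟨o, k, d, x, ι⟩ :: M).map Vtx.ends =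
        ((s :: (L ++ [⟨o, k, d, y, ι⟩])) ++ M).map Vtx.ends := by simp [Vtx.ends]
      have := ih (L := L ++ [⟨o, k, d, y, ι⟩]) (isPTree_of_ends hend h) (by
          rw [← hp]
          simp [deg])
        (fun t ht => (mem_append.1 ht).elim (hL t) fun ht => mem_singleton.1 ht ▸ hy)
      simpa using this
    rw [(multi_ptree (V := marked (barGen P)) p s.out l).comb (s :: L) M
      (by rw [hx]; exact .linear o k d 1 1 y z ι), one_smul, one_smul]
    exact add_mem (key y (Or.inr rfl)) (key z (Or.inl rfl))

lemma markedTrees_le_generated (a : ℕ) : MTrees (barGen P) a n p ≤ generated P a n p := by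
  intro x hx
  have mono : ∀ {b : ℕ}, b ≤ a → generated P b n p ≤ generated P a n p := fun hb x ⟨z, hz, hz'⟩ =>
    ⟨z, hz, fun h => MTrees_mono (by exact_mod_cast Nat.sub_le_sub_right hb 1) (hz' h)⟩
  induction hx using MTrees_induction with
  | zero => exact zero_mem _
  | add x y _ _ hx hy => exact add_mem hx hy
  | smul c x _ hx => exact smul_mem _ c hx
  | tree L r l hL hp hr ha =>
    by_cases h0 : L = []
    · subst h0
      obtain ⟨rfl, hl⟩ := hL.nil_eq
      obtain rfl : l = fun _ => r := funext hl
      obtain rfl : (0 : ℤ) = p := hp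
      refine ⟨(CobarFree (barGen P)).one, ?_, fun h => ?_⟩
      · rw [unnestLin_one, ptree_nil_eq 0 r 0]
      · rw [isDeriv_curvD.one, map_zero]
        exact zero_mem _
    · obtain ⟨s, L', hs, rfl⟩ := hL.exists_root h0
      obtain ⟨ε, hε⟩ := Koszul.exists_perm hs.symm
      rw [hε _ (koszul_ptree s.out l)]
      refine smul_mem _ _ (mono (b := L.length) (by exact_mod_cast ha) ?_)
      have := ptree_mem_generated (P := P) (s := s) (L := []) (M := L')
        ((IsPTree.perm hs).2 hL) ((deg_perm hs).trans hp)
        (hr s (hs.subset (mem_cons_self ..)) rfl) (by simp)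
      rw [← hs.length_eq]
      exact this

/-- The curvature lowers the number of vertices. -/
lemma unnestLin_curvD_mem [CharZero K] (h : q + 1 = p) {a : ℕ} {z : (CobarFree (barGen P)).obj n p}
    (hz : unnestLin (barGen P) z ∈ MTrees (barGen P) a n p) : unnestLin (barGen P) (curvD P h z) ∈
    MTrees (barGen P) (a - 1 : ℕ) n q := by
  obtain ⟨w, hw, hw'⟩ := markedTrees_le_generated a hz
  exact unnestLin_injective hw ▸ hw' h

lemma exists_unnestLin_eq {a : ℕ} {x : PTree (marked (barGen P)) n p} (hx : x ∈ MTrees (barGen P) a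
    n p) : ∃ z, unnestLin (barGen P) z = x :=
  (markedTrees_le_generated a hx).imp fun _ h => h.1

/-! ### Curvature -/

section Curvature

variable {M : Type w} [AddCommGroup M] [Module K M]

/-- The first input of a vertex, and `0` if there is none. -/
def Vtx.child (s : Vtx V) : ℕ := if h : 0 < s.ar then s.inp ⟨0, h⟩ else 0

/-- The contraction of an edge by the curvature: a vertex of curvature is removed. -/
lemma curv_vtx {G : List (Vtx (barGen P)) → M} (hG : Multi G) (s t : Vtx (barGen P)) (i : Fin s.ar)
    (hi : s.inp i = t.out) (hinj : Injective s.inp) (L : List (Vtx (barGen P))) : G ((curvMap P).vtx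
    s t i :: L) = vCoeff s.lab • G (⟨s.out, t.ar, t.deg, t.lab, t.inp⟩ :: L) - vCoeff t.lab • G
    (⟨s.out, s.ar, s.deg, s.lab, update id t.out t.child ∘ s.inp⟩ :: L) := by
  have h : ∀ {k : ℕ} (e : Wire i t.ar k), G ((curvMap P).vtx s t i :: L) =
      G ((curvMap P).vtxVia s t i e :: L) := fun e => LabMul.vtxVia_congr _ hG s t i _ e L
  obtain ⟨o, k, d, x, ι⟩ := s
  obtain ⟨o', k', d', y, ι'⟩ := t
  dsimp only at h hi hinj ⊢
  have hlab : ∀ {k₀ : ℕ} (e : Wire i k' k₀) {r : ℤ} (hr : r + 2 = d + d'), (curvMap P).app i e hr x y =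
      susp (q := r - 1) (by omega) (P.comp i e (show d - 1 - 1 + (d' - 1) = r - 1 by omega)
        (P.unitAt k (d - 1 - 1) (vCoeff x)) (desuspPart (by omega) y) - P.comp i e
        (show d - 1 + (d' - 1 - 1) = r - 1 by omega) (desuspPart (by omega) x)
        (P.unitAt k' (d' - 1 - 1) (vCoeff y))) := fun e r hr => curvMap_app i e hr _ _ _ (by omega) (by omega) _ _ x y
  by_cases hx : k = 1 ∧ d = 2
  · obtain ⟨rfl, rfl⟩ := hx
    obtain rfl : i = 0 := Subsingleton.elim _ _
    haveI : IsEmpty {a : Fin 1 // a ≠ 0} := ⟨fun a => a.2 (Subsingleton.elim _ _)⟩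
    have hf : Wire.Fits (emptySum _ _ : Wire (0 : Fin 1) k' k') ι ι' ι' :=
      ⟨fun a => isEmptyElim a, fun b => rfl⟩
    rw [h (emptySum _ _), (curvMap P).vtxVia_eq _ _ _ _ (show d' + 2 = 2 + d' by omega) hf,
      hlab]
    have h1 : P.comp 0 (emptySum {a : Fin 1 // a ≠ 0} (Fin k'))
        (show (2 : ℤ) - 1 - 1 + (d' - 1) = d' - 1 by omega) (P.unitAt 1 (2 - 1 - 1) (vCoeff x))
        (desuspPart (by omega) y) = vCoeff x • desuspPart (by omega) y := by
      refine (congrArg (fun z => P.comp 0 (emptySum {a : Fin 1 // a ≠ 0} (Fin k')) _ z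
        (desuspPart (by omega) y)) (P.unitAt_one (vCoeff x))).trans ?_
      rw [map_smul, LinearMap.smul_apply]
      exact congrArg _ (P.one_comp _ (fun b => rfl) _ _)
    rw [h1]
    by_cases hy : k' = 1 ∧ d' = 2
    · obtain ⟨rfl, rfl⟩ := hy
      have h2 : P.comp 0 (emptySum {a : Fin 1 // a ≠ 0} (Fin 1))
          (show (2 : ℤ) - 1 + (2 - 1 - 1) = 2 - 1 by omega) (desuspPart (by omega) x)
          (P.unitAt 1 (2 - 1 - 1) (vCoeff y)) = vCoeff y • desuspPart (by omega) x := by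
        refine (congrArg (fun z => P.comp 0 (emptySum {a : Fin 1 // a ≠ 0} (Fin 1)) _
          (desuspPart (by omega) x) z) (P.unitAt_one (vCoeff y))).trans ?_
        rw [map_smul]
        exact congrArg _ (P.comp_one 0 _ (fun a => isEmptyElim a) rfl _ _)
      have e : susp (show (2 : ℤ) - 1 + 1 = 2 by omega) (vCoeff x • desuspPart (P := P)
          (show (2 : ℤ) - 1 + 1 = 2 by omega) y - vCoeff y • desuspPart (by omega) x) =
            vCoeff x • y + -vCoeff y • x := by
        refine barGen_ext (show (2 : ℤ) - 1 + 1 = 2 by omega) ?_ ?_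
        · simp [sub_eq_add_neg]
        · simp [mul_comm]
      have e2 : update id o' (Vtx.child ⟨o', 1, 2, y, ι'⟩) ∘ ι = ι' := by
        funext a
        obtain rfl : a = 0 := Subsingleton.elim _ _
        simp [hi, Vtx.child]
      rw [h2, e, e2, sub_eq_add_neg, ← neg_smul]
      exact hG.comb [] L (.linear o 1 2 _ _ y x ι')
    · have hy0 := vCoeff_eq_zero hy y
      have e : susp (show d' - 1 + 1 = d' by omega) (vCoeff x • desuspPart (P := P)
          (show d' - 1 + 1 = d' by omega) y) = vCoeff x • y + (0 : K) • 0 := by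
        refine barGen_ext (show d' - 1 + 1 = d' by omega) ?_ ?_
        · simp
        · simp [hy0]
      rw [hy0, map_zero, map_zero, sub_zero, e]
      refine (hG.comb [] L (.linear o k' d' (vCoeff x) 0 y 0 ι')).trans ?_
      rw [zero_smul, zero_smul, add_zero, sub_zero]
      rfl
  · have hx0 := vCoeff_eq_zero hx x
    by_cases hy : k' = 1 ∧ d' = 2
    · obtain ⟨rfl, rfl⟩ := hy
      have hf : (unitWire i).Fits ι ι'
          (update id o' (Vtx.child ⟨o', 1, 2, y, ι'⟩) ∘ ι) := by
        refine ⟨fun a => ?_, fun b => ?_⟩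
        · change update id o' _ (ι a.1) = ι a.1
          rw [update_of_ne, id]
          exact fun h => a.2 (hinj (h.trans hi.symm))
        · obtain rfl : b = 0 := Subsingleton.elim _ _
          change update id o' _ (ι i) = _
          rw [hi, update_self]
          rfl
      have h2 : P.comp i (unitWire i) (show d - 1 + (2 - 1 - 1) = d - 1 by omega)
          (desuspPart (by omega) x) (P.unitAt 1 (2 - 1 - 1) (vCoeff y)) =
            vCoeff y • desuspPart (by omega) x := by
        refine (congrArg (fun z => P.comp i (unitWire i) _ (desuspPart (by omega) x) z)
          (P.unitAt_one (vCoeff y))).trans ?_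
        rw [map_smul]
        exact congrArg _ (P.comp_one i _ (fun a => rfl) rfl _ _)
      have e : susp (show d - 1 + 1 = d by omega) (-(vCoeff y • desuspPart (P := P)
          (show d - 1 + 1 = d by omega) x)) = -vCoeff y • x + (0 : K) • 0 := by
        refine barGen_ext (show d - 1 + 1 = d by omega) ?_ ?_
        · simp
        · simp [hx0]
      rw [h (unitWire i), (curvMap P).vtxVia_eq _ _ _ _ (show d + 2 = d + 2 from rfl) hf, hlab, h2,
        hx0, map_zero, map_zero, LinearMap.zero_apply, zero_sub, e]
      refine (hG.comb [] L (.linear o k d (-vCoeff y) 0 x 0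
        (update id o' (Vtx.child ⟨o', 1, 2, y, ι'⟩) ∘ ι))).trans ?_
      rw [zero_smul, zero_smul, add_zero, zero_sub, neg_smul]
      rfl
    · have hy0 := vCoeff_eq_zero hy y
      rw [hx0, hy0, zero_smul, zero_smul, sub_zero]
      refine hG.eq_zero [] L ?_
      refine (hlab _ _).trans ?_
      rw [hx0, hy0]
      simp only [map_zero, LinearMap.zero_apply, sub_zero]
      rfl

lemma Vtx.ren_eq {f : ℕ → ℕ} {s : Vtx V} (h : f s.out = s.out) (h' : ∀ a, f (s.inp a) = s.inp a) :
    s.ren f = s := by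
  obtain ⟨o, k, d, x, ι⟩ := s
  simp only [Vtx.ren] at h h' ⊢
  rw [h, show f ∘ ι = ι from funext h']

lemma map_ren_eq {f : ℕ → ℕ} (h : ∀ x, x ∈ outs L ∨ x ∈ ins L → f x = x) : L.map (Vtx.ren f) = L :=
    by
  conv_rhs => rw [← List.map_id L]
  exact map_congr_left fun s hs => Vtx.ren_eq (h _ (Or.inl (mem_outs.2 ⟨s, hs, rfl⟩)))
    fun a => h _ (Or.inr (mem_ins.2 ⟨s, hs, a, rfl⟩))

/-- The edges of a tree with a distinguished vertex of arity one. -/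
lemma IsPTree.unary {u : Vtx V} (h : IsPTree (u :: L) r l) (hu : u.ar = 1) : u.out ≠ u.child ∧ r ≠
    u.child ∧ u.out ∉ outs L ∧ u.child ∉ ins L ∧ (u.child ∈ outs L ↔ u.child ∉ lvs l) ∧ (u.out ∈ ins
    L ↔ u.out ≠ r) ∧ u.out ∉ lvs l ∧ outs L + lvs l + {u.out} = r ::ₘ u.child ::ₘ ins L := by
  obtain ⟨o, k, d, x, ι⟩ := u
  dsimp only at hu
  subst hu
  have hc : Vtx.child (⟨o, 1, d, x, ι⟩ : Vtx V) = ι 0 := rfl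
  have hins : ins (⟨o, 1, d, x, ι⟩ :: L) = ι 0 ::ₘ ins L := by
    rw [ins_cons]
    simp [lvs]
  obtain ⟨h1, h2, height, hh⟩ := h
  have hne := (hh _ (mem_cons_self ..) 0).ne
  simp only at hne
  rw [hins] at h1 h2
  have h3 := h1 ▸ h2
  rw [outs_cons] at h1 h3
  simp only [cons_add, nodup_cons, mem_cons, mem_add,
    not_or, nodup_add] at h2 h3
  have m : ∀ y, (y = o ∨ y ∈ outs L ∨ y ∈ lvs l) ↔ (y = r ∨ y = ι 0 ∨ y ∈ ins L) := fun y => by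
    have := congrArg (y ∈ ·) h1
    simpa using this
  have hoc : o ≠ ι 0 := fun h => hne (congrArg height h)
  rw [hc]
  refine ⟨hoc, h2.1.1, h3.1.1, h2.2.1, ⟨fun h h' => ?_, fun h => ?_⟩, ⟨?_, ?_⟩, h3.1.2, ?_⟩
  · exact disjoint_left.1 h3.2.2.2 h h'
  · exact (((m (ι 0)).2 (Or.inr (Or.inl rfl))).resolve_left hoc.symm).resolve_right h
  · rintro h rfl
    exact h2.1.2 h
  · exact fun h => (((m o).1 (Or.inl rfl)).resolve_left h).resolve_left hoc
  · rw [← h1, Multiset.add_comm, singleton_add, cons_add]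

lemma countP_out (h : (outs L).Nodup) (x : ℕ) : L.countP (fun s => s.out = x) = if x ∈ outs L then 1
    else 0 := by
  rw [← Multiset.count_eq_of_nodup h, outs, Multiset.coe_count, List.count, List.countP_map]
  refine List.countP_congr fun s _ => ?_
  simp

lemma countP_inp (h : (ins L).Nodup) (x : ℕ) : L.countP (fun s => x ∈ lvs s.inp) = if x ∈ ins L then
    1 else 0 := by
  induction L with
  | nil => simp
  | cons s L ih =>
    rw [ins_cons, nodup_add] at h
    rw [List.countP_cons, ih h.2.1, ins_cons]
    have := fun hx : x ∈ lvs s.inp => disjoint_left.1 h.2.2 hx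
    by_cases h1 : x ∈ lvs s.inp <;> by_cases h2 : x ∈ ins L <;> simp_all

/-- The contraction of all edges by the curvature amounts to the removal of a vertex of curvature:
the contributions of the two ends of the vertex cancel unless it is the root vertex, or next to a
leaf. -/
lemma conSum_curv {L : List (Vtx (barGen P))} (hL : IsPTree L r l)
    (G : List (Vtx (barGen P)) → ℕ → (Fin n → ℕ) → M) (hG : ∀ r l, Multi fun L => G L r l)
    (hren : ∀ (π : Perm ℕ) L r l, G (L.map (Vtx.ren π)) (π r) (π ∘ l) = G L r l) :
    (curvMap P).conSum (fun L => G L r l) L = pickSum (fun u L' => vCoeff u.lab •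
      ((if u.out = r then G L' u.child l else 0) - if u.child ∈ lvs l then
        G L' r (update id u.child u.out ∘ l) else 0)) L := by
  classical
  -- the two summands of the contraction of an edge
  let S : Vtx (barGen P) → Vtx (barGen P) → List (Vtx (barGen P)) → M := fun s t L =>
    vCoeff s.lab • if t.out = s.child then
      G ((t :: L).map (Vtx.ren (update id s.child s.out))) r l else 0
  let T : Vtx (barGen P) → Vtx (barGen P) → List (Vtx (barGen P)) → M := fun t s L =>
    vCoeff t.lab • if t.out ∈ lvs s.inp then
      G ((s :: L).map (Vtx.ren (update id t.out t.child))) r l else 0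
  have e1 : (curvMap P).conSum (fun L => G L r l) L =
      pickSum (fun s L' => pickSum (fun t L'' => S s t L'') L') L -
        pickSum (fun s L' => pickSum (fun t L'' => T t s L'') L') L := by
    rw [LabMul.conSum, sub_eq_add_neg, ← pickSum_neg, ← pickSum_add]
    refine pick_congr fun s L' hs => ?_
    rw [← pickSum_neg, ← pickSum_add]
    refine pick_congr fun t L'' ht => ?_
    have hst := (IsPTree.perm ((ht.cons s).trans hs)).2 hL
    have hts := (IsPTree.perm (.swap t s L'')).1 hst
    have ho := hst.nodup_outs
    have hi := (nodup_cons.1 hst.2.1).2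
    simp only [outs_cons, ins_cons, cons_add, nodup_cons, nodup_add,
      mem_cons, mem_add, not_or] at ho hi
    by_cases hc : t.out ∈ lvs s.inp
    · obtain ⟨i, hi'⟩ := mem_lvs.1 hc
      have hinj : Injective s.inp := fun a b hab =>
        inj_on_of_nodup_map hi.1 a (by simp) b (by simp) hab
      rw [LabMul.edgeSum, Finset.sum_eq_single i (fun j _ hj => if_neg fun h =>
        hj (hinj (h.trans hi'.symm))) (by simp), if_pos hi',
        curv_vtx (hG r l) s t i hi' hinj, sub_eq_add_neg]
      refine congrArg₂ (· + ·) ?_ (congrArg Neg.neg ?_)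
      · by_cases hs : s.ar = 1 ∧ s.deg = 2
        · have hch : s.child = t.out := by
            rw [← hi', Vtx.child, dif_pos i.pos]
            exact congrArg _ (Fin.ext (by have := i.isLt; simp only; omega))
          have hun := hst.unary hs.1
          simp only [S]
          rw [if_pos hch.symm, map_cons, hch, map_ren_eq]
          · simp only [Vtx.ren, update_self]
            have : update id t.out s.out ∘ t.inp = t.inp := by
              funext a
              refine update_of_ne (fun h => ?_) _ _
              refine hun.2.2.2.1 ?_
              rw [hch, ← h]
              exact mem_ins.2 ⟨t, mem_cons_self .., a, rfl⟩
            rw [this]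
          · rintro x (hx | hx)
            · exact update_of_ne (fun h : x = t.out => ho.2.1.1 (by rwa [← h])) _ _
            · refine update_of_ne (fun h : x = t.out => hun.2.2.2.1 ?_) _ _
              rw [hch, ← h]
              exact mem_add.2 (Or.inr hx)
        · simp only [S]
          rw [vCoeff_eq_zero hs, zero_smul, zero_smul]
      · by_cases ht' : t.ar = 1 ∧ t.deg = 2
        · simp only [T]
          rw [if_pos hc, map_cons, map_ren_eq]
          · simp only [Vtx.ren]
            rw [update_of_ne ho.1.1, id]
          · rintro x (hx | hx)
            · exact update_of_ne (fun h : x = t.out => ho.2.1.1 (by rwa [← h])) _ _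
            · exact update_of_ne (fun h : x = t.out => disjoint_left.1 hi.2.2 hc
                (mem_add.2 (Or.inr (by rwa [← h])))) _ _
        · simp only [T]
          rw [vCoeff_eq_zero ht', zero_smul, zero_smul]
    · rw [LabMul.edgeSum, sum_eq_zero fun i _ => if_neg fun h => hc (mem_lvs.2 ⟨i, h⟩)]
      have hS : S s t L'' = 0 := by
        by_cases hs : s.ar = 1 ∧ s.deg = 2
        · simp only [S]
          have hcs : s.child ∈ lvs s.inp := by
            rw [Vtx.child, dif_pos (by omega)]
            exact mem_lvs.2 ⟨_, rfl⟩
          rw [if_neg fun h : t.out = s.child => hc (by rwa [h]), smul_zero]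
        · simp only [S]
          rw [vCoeff_eq_zero hs, zero_smul]
      have hT : T t s L'' = 0 := by
        simp only [T]
        rw [if_neg hc, smul_zero]
      rw [hS, hT, neg_zero, add_zero]
  have hK : ∀ f : ℕ → ℕ, Koszul fun L => G (L.map (Vtx.ren f)) r l := fun f A B s t => by
    simpa [Vtx.ren] using (hG r l).koszul (A.map (Vtx.ren f)) (B.map (Vtx.ren f)) (s.ren f) (t.ren f)
  rw [e1, pickSum_comm (fun s t L => T t s L), sub_eq_add_neg, ← pickSum_neg, ← pickSum_add]
  refine pick_congr fun u L' hu => ?_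
  have hu' := (IsPTree.perm hu).2 hL
  by_cases hu0 : u.ar = 1 ∧ u.deg = 2
  swap
  · rw [vCoeff_eq_zero hu0, zero_smul, pick_eq_zero, pick_eq_zero, neg_zero, add_zero]
    · intro s L'' _
      simp only [T]
      rw [vCoeff_eq_zero hu0, zero_smul, smul_zero]
    · intro s L'' _
      simp only [S]
      rw [vCoeff_eq_zero hu0, zero_smul]
  obtain ⟨hoc, hrc, hoo, hci, hcl, hor, hol, -⟩ := hu'.unary hu0.1
  have ho := (nodup_add.1 hu'.nodup_outs).1
  have hi := (nodup_cons.1 hu'.2.1).2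
  rw [outs_cons, nodup_cons] at ho
  rw [ins_cons, nodup_add] at hi
  have e2 : pickSum (fun t L'' => S u t L'') L' = vCoeff u.lab • if u.child ∈ outs L' then
      G (L'.map (Vtx.ren (update id u.child u.out))) r l else 0 := by
    simp only [S]
    rw [pickSum_smul, pickSum_cons (hK _) (fun t => t.out = u.child), countP_out ho.2]
    split_ifs <;> simp
  have e3 : pickSum (fun s L'' => sgn K (u.deg * s.deg) • T u s L'') L' = vCoeff u.lab •
      if u.out ∈ ins L' then G (L'.map (Vtx.ren (update id u.out u.child))) r l else 0 := by
    have h2 : ∀ s : Vtx (barGen P), sgn K (u.deg * s.deg) = 1 := fun s => by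
      rw [hu0.2, ← sgn_zero]
      exact sgn_congr ⟨s.deg, by ring⟩
    simp only [T, h2, one_smul]
    rw [pickSum_smul, pickSum_cons (hK _) (fun s => u.out ∈ lvs s.inp), countP_inp hi.2.1]
    split_ifs <;> simp
  rw [e2, e3, ← smul_neg, ← smul_add, ← sub_eq_add_neg]
  congr 1
  set f := update (id : ℕ → ℕ) u.child u.out with hf
  set C := G (L'.map (Vtx.ren f)) r (f ∘ l) with hC
  have hfπ : ∀ x, x ≠ u.out → Equiv.swap u.out u.child x = f x := fun x hx => by
    by_cases h : x = u.child
    · rw [h, Equiv.swap_apply_right, hf, update_self]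
    · rw [Equiv.swap_apply_of_ne_of_ne hx h, hf, update_of_ne h, id]
  have hl : Equiv.swap u.out u.child ∘ l = f ∘ l := funext fun a => hfπ _ fun h =>
    hol (mem_lvs.2 ⟨a, h⟩)
  have f1 : u.out = r → G L' u.child l = C := fun h => by
    rw [← hren (Equiv.swap u.out u.child), Equiv.swap_apply_right, hl, hC, ← h]
    refine congrArg (fun A => G A _ _) (map_congr_left fun s hs => ?_)
    simp only [Vtx.ren]
    rw [hfπ _ fun h' => hoo (mem_outs.2 ⟨s, hs, h'⟩)]
    congr 1
    funext a
    exact hfπ _ fun h' => hor.not.2 (not_not.2 h) (mem_ins.2 ⟨s, hs, a, h'⟩)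
  have f2 : u.child ∈ lvs l → G L' r (f ∘ l) = C := fun h => by
    rw [hC, map_ren_eq]
    rintro x (hx | hx)
    · exact update_of_ne (fun h' : x = u.child => hcl.1 (by rwa [← h']) h) _ _
    · exact update_of_ne (fun h' : x = u.child => hci (by rwa [← h'])) _ _
  have f3 : u.child ∉ lvs l → G (L'.map (Vtx.ren f)) r l = C := fun h => by
    rw [hC, show f ∘ l = l from funext fun a =>
      update_of_ne (fun h' => h (mem_lvs.2 ⟨a, h'⟩)) _ _]
  have f4 : u.out ≠ r → G (L'.map (Vtx.ren (update id u.out u.child))) r l = C := fun h => by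
    rw [← hren (Equiv.swap u.out u.child), hl, Equiv.swap_apply_of_ne_of_ne h.symm hrc, hC,
      List.map_map]
    congr 1
    refine congrArg₂ List.map (funext fun s => ?_) rfl
    have : ∀ x, Equiv.swap u.out u.child (update id u.out u.child x) = f x := fun x => by
      by_cases hx : x = u.out
      · rw [hx, update_self, Equiv.swap_apply_right, hf, update_of_ne hoc, id]
      · rw [update_of_ne hx, id, hfπ x hx]
    simp only [Function.comp_apply, Vtx.ren, this]
    congr 1
    exact funext fun a => this _
  simp only [hcl, hor]
  by_cases h1 : u.out = r <;> by_cases h2 : u.child ∈ lvs l <;>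
    simp only [h1, h2, if_true, if_false, not_true_eq_false, not_false_eq_true, ne_eq]
  · rw [f1 h1, f2 h2, sub_self, sub_self]
  · rw [f1 h1, f3 h2]
  · rw [f2 h2, f4 h1]
  · rw [f3 h2, f4 h1, sub_self, sub_zero]

end Curvature

lemma unmarked_vtx_mul {c : ℤ} (μ : LabMul (barGen P) c) (s t : Vtx (barGen P)) (i : Fin s.ar) :
    (markedMul μ).vtx s.unmarked t.unmarked i = (μ.vtx s t i).unmarked := by
  simp only [LabMul.vtx, LabMul.vtxVia, Vtx.unmarked]
  congr 1
  refine marked_ext ?_ ?_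
  · simp
    rfl
  · refine (markedSnd_mul _ μ _ _ _ _).trans ?_
    simp
    rfl

/-- The contraction of the edges of a generator by the curvature, as a nested tree. -/
lemma con_curv_markEmbed (hq : q + 2 = p) {L : List (Vtx (barGen P))} (h : IsTree L r l) (hp : deg L
    = p + 1) : ((markedMul (curvMap P)).con (markEmbed (tree L r l) : PTree _ n p) : PTree _ n q) =
    pickSum (fun u L' => vCoeff u.lab • ((if u.out = r then markEmbed (tree L' u.child l) else 0) -
    if u.child ∈ lvs l then markEmbed (tree L' r (update id u.child u.out ∘ l)) else 0)) L := by
  rw [← conSum_curv h.ptree (fun L r l => (markEmbed (tree L r l : TreeObj _ n (q + 1))))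
    (fun r l => (multi_tree (q + 1) r l).map _) fun π L r l => by
      rw [← tree_rename π L r l]
      rfl]
  have hL := isPTree_unmarked h.ptree
  rw [markEmbed, comp_apply, curv_markRoot (q := q + 1) (by omega) rfl, embed_tree h hp,
    LabMul.con_ptree hL ((deg_map (f := Vtx.unmarked) (fun _ => rfl) L).trans hp), LabMul.conSum,
    LabMul.conSum, pickSum_mapVtx Vtx.unmarked (fun _ => rfl), pickSum_map]
  refine pick_congr fun s L' _ => ?_
  rw [pickSum_mapVtx Vtx.unmarked (fun _ => rfl), pickSum_map]
  refine pick_congr fun t L'' _ => ?_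
  simp only [LabMul.edgeSum, map_sum, apply_ite, map_zero]
  refine sum_congr rfl fun i _ => if_congr Iff.rfl ?_ rfl
  rw [markEmbed, comp_apply, embed_tree' _ _ _ (by simp)]
  exact congrArg (fun v => markRoot (ptree (v :: _) r l)) (unmarked_vtx_mul _ s t i)

lemma IsTree.corolla {u : Vtx V} (h : IsTree [u] r l) : u.out = r ∧ ∃ σ : Fin u.ar ≃ Fin n, ∀ a, l
    (σ a) = u.inp a := by
  have h' := h.ptree
  have ho : u.out = r := by
    obtain ⟨s, hs, hr⟩ := mem_outs.1 (h'.root_mem_outs (by simp))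
    rwa [← mem_singleton.1 hs]
  have h1 := h'.1
  have h2 := (nodup_cons.1 h'.2.1).2
  have e1 : outs [u] = {u.out} := rfl
  have e2 : ins [u] = lvs u.inp := by rw [ins_cons]; exact add_zero _
  rw [e1, e2, ho, singleton_add, cons_inj_right] at h1
  rw [e2] at h2
  exact ⟨ho, Cut.exists_equiv (fun a b hab =>
    inj_on_of_nodup_map h2 a (by simp) b (by simp) hab) h.leaf_injective h1.symm⟩

lemma vCoeff_proj_corolla {u : Vtx (barGen P)} (h : IsTree [u] r l) (hp : u.deg = p) : vCoeff (proj
    (barGen P) (tree [u] r l : TreeObj _ n p)) = vCoeff u.lab := by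
  obtain ⟨-, σ, hσ⟩ := h.corolla
  have hd : deg [u] = p := by rw [deg_cons, hp]; exact add_zero p
  rw [proj, treeLift_tree, if_pos ⟨h, hd⟩, projFun_eq h.leaf_injective σ hσ hp]
  obtain ⟨o, k, d, x, ι⟩ := u
  obtain rfl : k = n := equiv_iff_eq.1 ⟨σ⟩
  obtain rfl : d = p := hp
  exact vCoeff_act _ _

lemma proj_eq_zero (h : L.length ≠ 1) : proj V (tree L r l : TreeObj _ n p) = 0 := by
  rw [proj, treeLift_tree]
  match L with
  | [] => simp [projFun]
  | [_] => exact (h rfl).elim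
  | _ :: _ :: _ => simp [projFun]

lemma vCoeff_proj_eq_zero {C : List (Vtx (barGen P))} (hC : ∀ u, C = [u] → vCoeff u.lab = 0) (r : ℕ)
    (l : Fin n → ℕ) : vCoeff (proj _ (tree C r l : TreeObj _ n p)) = 0 := by
  by_cases h : IsTree C r l ∧ deg C = p
  swap
  · rw [tree_eq_zero h, map_zero, map_zero]
  by_cases h1 : C.length = 1
  · obtain ⟨u, rfl⟩ := List.length_eq_one_iff.1 h1
    rw [vCoeff_proj_corolla h.1 (by rw [← h.2, deg_cons]; exact (add_zero _).symm), hC u rfl]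
  · rw [proj_eq_zero h1, map_zero]

section OnCorolla

variable {M : Type w} [AddCommGroup M] [Module K M]

/-- The extension by zero of a function on vertices to a function on lists of vertices. -/
def onCorolla (F : Vtx V → M) : List (Vtx V) → M
  | [u] => F u
  | _ => 0

lemma onCorolla_cons (F : Vtx V → M) (s : Vtx V) (L : List (Vtx V)) [Decidable (L = [])] : onCorolla
    F (s :: L) = if L = [] then F s else 0 := by
  cases L <;> simp [onCorolla]

lemma splitSum_onCorolla_left (F : Vtx V → List (Vtx V) → M) (L : List (Vtx V)) : splitSum (fun A B
    => onCorolla (fun u => F u B) A) L = pickSum F L := by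
  classical
  induction L generalizing F with
  | nil => rfl
  | cons s L ih =>
    rw [splitSum, pickSum, ← ih]
    simp only [onCorolla_cons]
    rw [splitSum_left_nil]
    refine congrArg₂ (· + ·) rfl (split_congr fun A B _ => ?_)
    match A with
    | [] => simp [onCorolla]
    | [u] => simp [onCorolla, deg_cons, show deg ([] : List (Vtx V)) = 0 from rfl]
    | _ :: _ :: _ => simp [onCorolla]

lemma splitSum_onCorolla_right (F : Vtx V → List (Vtx V) → M) (L : List (Vtx V)) (hF : ∀ (c : ℤ) u
    B, sgn K (u.deg * c) • F u B = F u B) : splitSum (fun A B => onCorolla (fun u => F u A) B) L =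
    pickSum F L := by
  classical
  induction L generalizing F with
  | nil => rfl
  | cons s L ih =>
    rw [splitSum, pickSum]
    simp only [onCorolla_cons, smul_ite, hF, smul_zero]
    rw [splitSum_right_nil, add_comm, ih (fun u L => F u (s :: L)) fun c u B => hF c u _]
    refine congrArg₂ (· + ·) rfl (pick_congr fun u B _ => ?_)
    rw [mul_comm, hF]

end OnCorolla

lemma unitAt_comp_cobarGen (i : Fin m) (e : Wire i n k) {a : ℤ} (h : a + p = q) (hm : m = 1) (ha : a
    = 0) (c : K) {B : List (Vtx V)} {l' : Fin k → ℕ} (hl : ∀ b, l' (e (inr b)) = l b) : (CobarFree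
    V).comp i e h ((CobarFree V).unitAt m a c) (cobarGen (tree B r l)) = c • cobarGen (tree B r l')
    := by
  subst hm ha
  obtain rfl : p = q := by omega
  obtain rfl := exists_wire_eq_left e
  obtain rfl : i = 0 := Subsingleton.elim _ _
  have : IsEmpty {a : Fin 1 // a ≠ 0} := ⟨fun a => a.2 (Subsingleton.elim _ _)⟩
  rw [GrOperad.unitAt_one, map_smul, LinearMap.smul_apply, (CobarFree V).one_comp_wire e h,
    ← cobarGen_act, treeAct_tree]
  refine congrArg (fun f => c • cobarGen (tree B r f)) (funext fun b => ?_)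
  rw [Function.comp_apply, ← hl]
  exact congrArg l' (apply_symm_apply ((emptySum _ _).symm.trans e) b)

lemma cobarGen_comp_unitAt (i : Fin m) (e : Wire i n k) {a : ℤ} (h : p + a = q) (hn : n = 1) (ha : a
    = 0) (c : K) {A : List (Vtx V)} {l : Fin m → ℕ} {l' : Fin k → ℕ} (hl : ∀ a : {a // a ≠ i}, l' (e
    (inl a)) = l a.1) (hl' : ∀ b, l' (e (inr b)) = l i) : (CobarFree V).comp i e h (cobarGen (tree A
    r l)) ((CobarFree V).unitAt n a c) = c • cobarGen (tree A r l') := by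
  subst hn ha
  obtain rfl : p = q := by omega
  obtain rfl := exists_wire_eq_right e
  rw [GrOperad.unitAt_one, map_smul, (CobarFree V).comp_one_wire i e h, ← cobarGen_act, treeAct_tree]
  refine congrArg (fun f => c • cobarGen (tree A r f)) ?_
  have key : ∀ b, l' (e b) = l (unitWire i b) := by
    rintro (b | b)
    · exact hl b
    · exact hl' b
  funext b
  rw [Function.comp_apply, Equiv.symm_trans_apply, Equiv.symm_symm, ← key, apply_symm_apply]

lemma mem_lvs_unary {u : Vtx V} (hu : u.ar = 1) {x : ℕ} : x ∈ lvs u.inp ↔ x = u.child := by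
  have h0 : 0 < u.ar := by omega
  rw [mem_lvs, Vtx.child, dif_pos h0]
  constructor
  · rintro ⟨a, rfl⟩
    congr 1
    exact Fin.ext (by have := a.isLt; simp only; omega)
  · rintro rfl
    exact ⟨_, rfl⟩

lemma IsPTree.child_mem_outs {u : Vtx V} (h : IsPTree (u :: L) r l) (hu : u.ar = 1) (hr : u.out = r)
    (h0 : L ≠ []) : u.child ∈ outs L := by
  obtain ⟨-, -, -, h1, -, -, -, h2⟩ := h.unary hu
  rw [hr, Multiset.add_comm, singleton_add, cons_inj_right] at h2
  obtain ⟨height, hh⟩ := h.2.2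
  have h3 := (nodup_cons.1 h.2.1).2
  rw [ins_cons, nodup_add] at h3
  have h4 : IsPTree L u.child l := ⟨h2, nodup_cons.2 ⟨h1, h3.2.1⟩, height,
    fun s hs => hh s (mem_cons_of_mem _ hs)⟩
  exact h4.root_mem_outs h0

/-- The curvature of the two pieces of a cut: a piece with a single vertex of curvature is
removed. -/
lemma curvD_cutTerm (h : q + 1 = p) {A B : List (Vtx (barGen P))} (hL : IsPTree (A ++ B) r l) (hq :
    deg A + deg B = p + 2) : sgn K (deg A) • curvD P h (cutTerm p A B r l) = onCorolla (fun u =>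
    vCoeff u.lab • if u.out = r then cobarGen (tree B u.child l) else 0) A - onCorolla (fun u =>
    vCoeff u.lab • if u.child ∈ lvs l then cobarGen (tree A r (update id u.child u.out ∘ l)) else 0)
    B := by
  classical
  have hdu : ∀ {u : Vtx (barGen P)}, vCoeff u.lab ≠ 0 → u.ar = 1 ∧ u.deg = 2 := fun hu => by
    by_contra hc
    exact hu (vCoeff_eq_zero hc _)
  have hsg : ∀ c : Cut A B r l p, sgn K (deg A + c.pA) = -1 := fun c => by
    rw [← sgn_one, c.degA]
    exact sgn_congr ⟨c.pA, by ring⟩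
  by_cases hc : Nonempty (Cut A B r l p)
  · obtain ⟨c⟩ := hc
    rw [cutTerm_eq c, Cut.value, isDeriv_curvD.comp c.i c.e c.deg_eq (p' := c.pA - 1)
      (q' := c.pB - 1) (by omega) (by omega) h (by have := c.deg_eq; omega)
      (by have := c.deg_eq; omega), smul_add, curvD_gen, curvD_gen, smul_smul, ← sgn_add, hsg c,
      neg_one_smul K]
    have hdA := c.degA
    have hdB := c.degB
    refine Eq.trans (congrArg₂ (· + ·) ?_ (congrArg Neg.neg ?_)) (sub_eq_add_neg _ _).symm
    · by_cases hA : ∃ u, A = [u] ∧ vCoeff u.lab ≠ 0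
      · obtain ⟨u, rfl, hu⟩ := hA
        obtain ⟨hu1, hu2⟩ := hdu hu
        obtain ⟨hr, σ, hσ⟩ := c.isTreeA.corolla
        have hd : deg [u] = 2 := by rw [deg_cons, hu2]; rfl
        have hnA : c.nA = 1 := (equiv_iff_eq.1 ⟨σ⟩).symm.trans hu1
        have hch : c.lA c.i = u.child := by
          rw [Vtx.child, dif_pos (by omega), ← hσ]
          congr 1
          exact Fin.ext (by have := (σ ⟨0, by omega⟩).isLt; have := c.i.isLt; omega)
        rw [vCoeff_proj_corolla c.isTreeA (by omega), hd, sgn_congr (b := 0) ⟨1, by ring⟩, sgn_zero,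
          one_smul, unitAt_comp_cobarGen _ _ _ hnA (by omega) _ c.labelB, onCorolla, if_pos hr, hch]
      · push Not at hA
        rw [vCoeff_proj_eq_zero hA, map_zero, map_zero,
          LinearMap.zero_apply, smul_zero]
        symm
        match A with
        | [] => rfl
        | [u] => exact (congrArg (· • _) (hA u rfl)).trans (zero_smul _ _)
        | _ :: _ :: _ => rfl
    · by_cases hB : ∃ u, B = [u] ∧ vCoeff u.lab ≠ 0
      · obtain ⟨u, rfl, hu⟩ := hB
        obtain ⟨hu1, hu2⟩ := hdu hu
        obtain ⟨hr, σ, hσ⟩ := c.isTreeB.corolla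
        have hd : deg [u] = 2 := by rw [deg_cons, hu2]; rfl
        have hnB : c.nB = 1 := (equiv_iff_eq.1 ⟨σ⟩).symm.trans hu1
        have hch : ∀ b, c.lB b = u.child := fun b => by
          rw [Vtx.child, dif_pos (by omega), ← hσ]
          congr 1
          exact Fin.ext (by have := (σ ⟨0, by omega⟩).isLt; have := b.isLt; omega)
        have hb : u.child ∈ lvs l := by
          have b : Fin c.nB := ⟨0, by omega⟩
          exact mem_lvs.2 ⟨_, (c.labelB b).trans (hch b)⟩
        rw [vCoeff_proj_corolla c.isTreeB (by omega), cobarGen_comp_unitAt _ _ _ hnB (by omega) _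
          (l' := update id u.child u.out ∘ l), onCorolla, if_pos hb]
        · intro a
          rw [Function.comp_apply, update_of_ne, id, c.labelA]
          intro ha
          have b : Fin c.nB := ⟨0, by omega⟩
          have := c.inj (ha.trans ((c.labelB b).trans (hch b)).symm)
          exact Sum.inl_ne_inr (c.e.injective this)
        · intro b
          rw [Function.comp_apply, c.labelB, hch, update_self, hr]
      · push Not at hB
        rw [vCoeff_proj_eq_zero hB, map_zero, map_zero]
        symm
        match B with
        | [] => rfl
        | [u] => exact (congrArg (· • _) (hB u rfl)).trans (zero_smul _ _)
        | _ :: _ :: _ => rfl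
  · rw [cutTerm_eq_zero fun c => hc ⟨c⟩, map_zero, smul_zero]
    have hcut : ∀ f, ¬ IsCut A B r f := fun f hf => by
      obtain ⟨g, -⟩ := hf.exists_glue hL
      exact hc ⟨g.cut hL hq⟩
    have e1 : onCorolla (fun u => vCoeff u.lab • if u.out = r then
        (cobarGen (tree B u.child l) : (CobarFree _).obj n q) else 0) A = 0 := by
      match A with
      | [] => rfl
      | _ :: _ :: _ => rfl
      | [u] =>
        rw [onCorolla]
        by_cases hu : vCoeff u.lab = 0
        · rw [hu, zero_smul]
        split_ifs with hr
        · rcases eq_or_ne B [] with rfl | hB0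
          · rw [tree_eq_zero fun h => h.1.ne_nil rfl, map_zero, smul_zero]
          refine (hcut u.child ⟨fun s hs => Or.inl ?_, fun t ht => ?_, ?_,
            IsPTree.child_mem_outs hL (hdu hu).1 hr hB0⟩).elim
          · rw [mem_singleton.1 hs, hr]
          · have := (hL.out_mem (mem_cons_of_mem _ ht)).resolve_left (IsPTree.out_ne hL hr ht)
            rwa [List.singleton_append, ins_cons, mem_add, mem_lvs_unary (hdu hu).1] at this
          · rw [ins_cons, mem_add, mem_lvs_unary (hdu hu).1]
            exact Or.inl rfl
        · rw [smul_zero]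
    have e2 : onCorolla (fun u => vCoeff u.lab • if u.child ∈ lvs l then
        (cobarGen (tree A r (update id u.child u.out ∘ l)) : (CobarFree _).obj n q)
          else 0) B = 0 := by
      match B with
      | [] => rfl
      | _ :: _ :: _ => rfl
      | [u] =>
        rw [onCorolla]
        by_cases hu : vCoeff u.lab = 0
        · rw [hu, zero_smul]
        split_ifs with hr
        · rcases eq_or_ne A [] with rfl | hA0
          · rw [tree_eq_zero fun h => h.1.ne_nil rfl, map_zero, smul_zero]
          have hL' := (IsPTree.perm (List.perm_append_singleton u A)).1 hL
          obtain ⟨-, -, -, -, h1, h2, -⟩ := hL'.unary (hdu hu).1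
          have h3 : u.child ∉ outs A := fun h => h1.1 h hr
          refine (hcut u.out ⟨fun s hs => ?_, fun t ht => Or.inl ?_, h2.2 fun hr' =>
            h3 (hL'.child_mem_outs (hdu hu).1 hr' hA0), mem_outs.2 ⟨u, by simp, rfl⟩⟩).elim
          · refine (hL'.out_mem (mem_cons_of_mem _ hs)).imp_right fun h => ?_
            rw [ins_cons, mem_add, mem_lvs_unary (hdu hu).1] at h
            exact h.resolve_left fun h => h3 (mem_outs.2 ⟨s, hs, h⟩)
          · rw [mem_singleton.1 ht]
        · rw [smul_zero]
    rw [e1, e2, sub_zero]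

/-- The curvature of the sum over the inner edges is the contraction of the edges by the
curvature. -/
lemma unnestLin_curvD_cutMap {q' : ℤ} (h : q' + 1 = q) (hq : q + 1 = p) (x : TreeObj (barGen P) n (p
    + 1)) : unnestLin (barGen P) (curvD P h (cutMap x)) = (markedMul (curvMap P)).con (markEmbed x :
    PTree _ n p) := by
  induction x using tree_induction with
  | zero => simp only [map_zero]
  | add x y hx hy => simp only [map_add, hx, hy]
  | smul c x hx => simp only [map_smul, hx]
  | tree L r l hL hp =>
    rw [con_curv_markEmbed (by omega) hL hp, cutMap, treeLift_tree, if_pos ⟨hL, by omega⟩, cutFun,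
      splitSum_map (curvD P h)]
    simp only [map_smul]
    rw [split_congr fun A B hAB => curvD_cutTerm h ((IsPTree.perm hAB).2 hL.ptree)
      (by rw [← deg_append, deg_perm hAB]; omega)]
    have h2 : ∀ (c : ℤ) (u : Vtx (barGen P)) {M : Type (max u v)} [AddCommGroup M] [Module K M] (x : M),
        sgn K (u.deg * c) • vCoeff u.lab • x = vCoeff u.lab • x := fun c u {M} _ _ x => by
      by_cases hu : u.ar = 1 ∧ u.deg = 2
      · rw [sgn_congr (b := 0) ⟨c, by rw [hu.2]; ring⟩, sgn_zero, one_smul]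
      · rw [vCoeff_eq_zero hu, zero_smul, smul_zero]
    simp only [sub_eq_add_neg]
    simp only [← neg_one_smul K (onCorolla _ _)]
    rw [splitSum_add, splitSum_smul, splitSum_onCorolla_left fun u B => vCoeff u.lab •
      if u.out = r then (cobarGen (tree B u.child l) : (CobarFree _).obj n q') else 0,
      splitSum_onCorolla_right (fun u A => vCoeff u.lab • if u.child ∈ lvs l then
        (cobarGen (tree A r (update id u.child u.out ∘ l)) : (CobarFree _).obj n q') else 0)
        L fun c u B => h2 c u _, ← pickSum_smul, ← pickSum_add, pickSum_map]
    refine pick_congr fun u L' _ => ?_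
    rw [map_add, map_smul, map_smul, map_smul, neg_one_smul, ← smul_neg, ← smul_add, apply_ite
      (unnestLin (barGen P)), apply_ite (unnestLin (barGen P)), map_zero, unnestLin_gen, unnestLin_gen]

/-! ### The square of the differential -/

section Square

variable {r : ℤ}

/-- The curvature vanishes on the boundaries of the bar construction. -/
lemma vCoeff_proj_barDiff (x : TreeObj (barGen P) n p) : vCoeff (proj _ (barDiff P x : TreeObj _ n
    q)) = 0 := by
  induction x using tree_induction with
  | zero => simp only [map_zero]
  | add x y hx hy => simp only [map_add, hx, hy, add_zero]
  | smul c x hx => simp only [map_smul, hx, smul_zero]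
  | tree L r l hL hp =>
    have h1 : ∀ (s : Vtx (barGen P)) (L : List (Vtx (barGen P))), vCoeff s.lab = 0 →
        (vCoeff ∘ₗ proj (barGen P)) (tree (s :: L) r l : TreeObj _ n q) = 0 := fun s L hs =>
      vCoeff_proj_eq_zero (fun u hu => by rw [← (List.cons.inj hu).1, hs]) r l
    rw [barDiff, treeLift_tree, if_pos ⟨hL, hp⟩, barDiffFun, ← comp_apply, map_add,
      pickSum_map, pickSum_map, pick_eq_zero fun s L' _ => h1 s.barLin L'
        (vCoeff_susp (P := P) (q := s.deg - 2) (by simp only [Vtx.barLin]; omega) _),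
      pick_eq_zero, add_zero]
    intro s L' _
    rw [pickSum_map, pick_eq_zero]
    intro t L'' _
    rw [contractSum, map_sum]
    refine sum_eq_zero fun i _ => ?_
    split_ifs
    · refine h1 _ _ ?_
      simp only [Vtx.contract, Vtx.contractVia, barMul, LinearMap.smul_apply, LinearMap.compr₂_apply]
      exact ((vCoeff (P := P)).map_smul _ _).trans ((congrArg _ (vCoeff_susp ..)).trans (smul_zero _))
    · exact map_zero _

lemma IsDeriv.unitAt {D : ∀ {n : ℕ} {p q : ℤ} (_ : q + 1 = p), (CobarFree V).obj n p →ₗ[K]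
    (CobarFree V).obj n q} (hD : IsDeriv D) (h : q + 1 = p) (c : K) : D h ((CobarFree V).unitAt n p
    c) = 0 := by
  by_cases hn : 1 = n ∧ 0 = p
  · obtain ⟨rfl, rfl⟩ := hn
    rw [GrOperad.unitAt_one, map_smul, hD.one, smul_zero]
  · rw [GrOperad.unitAt_eq_zero _ hn, map_zero]

lemma cobarD_cobarD [CharZero K] (hP : P.SquareZero) (h : q + 1 = p) (h' : r + 1 = q) (x :
    (CobarFree (barGen P)).obj n p) : cobarD P h' (cobarD P h x) = 0 := by
  induction x using cobarFree_induction generalizing q r with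
  | one => rw [deriv_cobarD.one, map_zero]
  | @gen n p x =>
    rw [cobarD_eq h, curvD_gen, map_add, deriv_cobarD.unitAt, add_zero, cobarD_eq]
    refine unnestLin_injective ?_
    subst h
    rw [map_add, unnestLin_uncurvedD, unnestLin_uncurvedD, markedDiff_markedDiff hP rfl, unnestLin_gen,
      uncurvedD_gen, map_sub, map_neg, curvD_gen, vCoeff_proj_barDiff, map_zero, neg_zero, zero_sub,
      map_neg, unnestLin_curvD_cutMap h' rfl, add_neg_cancel, map_zero]
  | act σ x ih => rw [deriv_cobarD.act, deriv_cobarD.act, ih, map_zero]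
  | @comp m n k i e p a s hs x y ihx ihy =>
    rw [deriv_cobarD.comp i e hs (p' := p - 1) (q' := a - 1) (by omega) (by omega) h (by omega)
      (by omega), map_add, map_smul,
      deriv_cobarD.comp i e (p := p - 1) (p' := p - 2) (q' := a - 1) _ (by omega) (by omega) h'
        (by omega) (by omega),
      deriv_cobarD.comp i e (q := a - 1) (p' := p - 1) (q' := a - 2) _ (by omega) (by omega) h'
        (by omega) (by omega), ihx, ihy, map_zero, map_zero, LinearMap.zero_apply, smul_zero, zero_add,
      add_zero, ← add_smul]
    have : sgn K (p - 1) = - sgn K p := by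
      rw [← neg_one_mul, ← sgn_one, ← sgn_add]
      exact sgn_congr ⟨-1, by ring⟩
    rw [this, neg_add_cancel, zero_smul]
  | zero => simp only [map_zero]
  | add x y hx hy => simp only [map_add, hx, hy, add_zero]
  | smul c x hx => simp only [map_smul, hx, smul_zero]

lemma cobarBar_squareZero [CharZero K] (hP : P.SquareZero) : (cobarBar P).SquareZero :=
  fun h h' x => cobarD_cobarD hP h h' x

end Square

/-! ### Contraction onto trees with one vertex -/

section Contraction

variable {a : ℕ} {r : ℤ}
  {x : PTree (marked V) n p}

lemma con_mem_markedTrees {c : ℤ} (μ : LabMul V c) (hx : x ∈ MTrees V (a + 1 : ℕ) n p) : ((markedMul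
    μ).con x : PTree _ n q) ∈ MTrees V a n q := by
  induction hx using MTrees_induction with
  | zero => simp
  | add x y _ _ hx hy => rw [map_add]; exact add_mem hx hy
  | smul c x _ hx => rw [map_smul]; exact smul_mem _ _ hx
  | tree L r l hL hp hr ha =>
    rw [LabMul.con_ptree hL hp]
    refine pickSum_mem fun s L' hs => pickSum_mem fun t L'' ht => Submodule.sum_mem _ fun i _ => ?_
    split_ifs
    · have hst := (ht.cons s).trans hs
      refine ptree_mem_markedTrees (fun _ u hu hur => ?_) ?_
      · rcases List.mem_cons.1 hu with rfl | hu
        · have := hr s (hst.subset (by simp)) hur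
          exact (congrArg (fun y => μ.app _ _ _ y _) this).trans (LinearMap.map_zero₂ _ _)
        · exact hr u (hst.subset (by simp [hu])) hur
      · rw [← hst.length_eq] at ha
        simp only [length_cons, Nat.cast_le] at ha ⊢
        omega
    · exact zero_mem _

lemma ptree_cons_zero {U : SMod.{u, v} K} {s : Vtx U} (hs : s.lab = 0) (L : List (Vtx U)) (r : ℕ) (l
    : Fin n → ℕ) : (ptree (s :: L) r l : PTree U n p) = 0 :=
  (multi_ptree p r l).eq_zero [] L hs

variable (V) in
/-- The removal of one mark outside of the root vertex, as a contracting homotopy. -/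
def unmarkAny : PTree (marked V) n p →ₗ[K] PTree (marked V) n q :=
  loc (LabMap.zero _ _ (-1)) (unmarkMap V)

lemma unmarkAny_mem (hx : x ∈ MTrees V a n p) : (unmarkAny V x : PTree _ n q) ∈ MTrees V a n q := by
  induction hx using MTrees_induction with
  | zero => simp
  | add x y _ _ hx hy => rw [map_add]; exact add_mem hx hy
  | smul c x _ hx => rw [map_smul]; exact smul_mem _ _ hx
  | tree L r l hL hp hr ha =>
    rw [unmarkAny, loc_ptree _ _ hL hp]
    refine pickSum_mem fun s L' hs => ?_
    by_cases hsr : s.out = r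
    · rw [Vtx.opAt, if_pos hsr, ptree_cons_zero rfl]
      exact zero_mem _
    · refine ptree_mem_markedTrees (fun _ u hu hur => ?_) (by simpa [← hs.length_eq] using ha)
      rcases List.mem_cons.1 hu with rfl | hu
      · exact (hsr ((Vtx.opAt_out ..).symm.trans hur)).elim
      · exact hr u (hs.subset (by simp [hu])) hur

/-- The vertices other than the root vertex are counted up to trees with fewer vertices. -/
lemma loc_ident_sub_mem (hx : x ∈ MTrees V (a + 1 : ℕ) n p) : loc (LabMap.zero _ _ 0) (LabMap.ident
    (marked V)) x - (a : K) • x ∈ MTrees V a n p := by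
  classical
  induction hx using MTrees_induction with
  | zero => simp
  | add x y _ _ hx hy => rw [map_add, smul_add, add_sub_add_comm]; exact add_mem hx hy
  | smul c x _ hx => rw [map_smul, smul_comm, ← smul_sub]; exact smul_mem _ _ hx
  | tree L r l hL hp hr ha =>
    have h1 : (loc (LabMap.zero _ _ 0) (LabMap.ident (marked V)) (ptree L r l : PTree _ n p) :
        PTree _ n p) = (L.countP (fun s => s.out ≠ r) : K) • ptree L r l := by
      rw [loc_ptree _ _ hL hp, ← pickSum_cons (multi_ptree p r l).koszul]
      refine pick_congr fun s L' _ => ?_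
      by_cases hs : s.out = r
      · rw [Vtx.opAt, if_pos hs, ptree_cons_zero rfl, if_neg (not_not.2 hs)]
      · rw [Vtx.opAt, if_neg hs, if_pos hs]
        exact congrArg (fun v => ptree (v :: L') r l) (vtx_degCast ..)
    have h2 : (L.length : ℕ∞) ≤ a → ptree L r l ∈ MTrees V a n p :=
      ptree_mem_markedTrees fun _ => hr
    rw [h1, ← sub_smul]
    rw [Nat.cast_le] at ha
    rcases Nat.le_succ_iff.1 ha with h | h
    · exact smul_mem _ _ (h2 (by exact_mod_cast h))
    · have h0 : L ≠ [] := by rintro rfl; simp at h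
      have h3 := List.length_eq_countP_add_countP (fun s : Vtx (marked V) => s.out = r) (l := L)
      simp only [hL.countP_root h0, decide_eq_true_eq] at h3
      rw [show L.countP (fun s => s.out ≠ r) = a by simp only [ne_eq]; omega, sub_self, zero_smul]
      exact zero_mem _

end Contraction

section Reduction

variable [CharZero K] {a : ℕ} {r : ℤ}

/-- Up to trees with fewer vertices, the differential acts on each vertex. -/
lemma unnestLin_cobarD_sub_mem (h : q + 1 = p) {z : (CobarFree (barGen P)).obj n p} (hz : unnestLin
    (barGen P) z ∈ MTrees (barGen P) (a + 1 : ℕ) n p) : unnestLin (barGen P) (cobarD P h z) - (loc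
    (markedLin (linMap P)) (markedLin (linMap P)) (unnestLin (barGen P) z) : PTree _ n q) ∈ MTrees
    (barGen P) a n q := by
  rw [cobarD_eq, map_add, unnestLin_uncurvedD, markedDiff, LinearMap.add_apply, add_assoc,
    add_sub_cancel_left]
  have h1 := unnestLin_curvD_mem h hz
  rw [Nat.add_sub_cancel] at h1
  exact add_mem (con_mem_markedTrees _ hz) h1

/-- Removing a mark is a homotopy from the differential of the vertices to their number. -/
lemma unmarkAny_lin (h : q + 1 = p) (h' : p + 1 = r) (x : PTree (marked (barGen P)) n p) : unmarkAny
    _ (loc (markedLin (linMap P)) (markedLin (linMap P)) x : PTree _ n q) = - loc (markedLin (linMap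
    P)) (markedLin (linMap P)) (unmarkAny _ x : PTree _ n r) + (loc (LabMap.zero _ _ 0)
    (LabMap.ident _) x : PTree _ n p) := by
  have h4 := loc_comm (g₁ := markedLin (linMap P)) (g₀ := markedLin (linMap P))
    (g₁' := LabMap.zero _ _ (-1)) (g₀' := unmarkMap _) (k₁ := LabMap.zero _ _ 0)
    (k₀ := LabMap.ident _) (q := q) (q' := r) (r := p)
    (fun h h' g g' h'' x => by simp only [LabMap.zero_app, map_zero, smul_zero, add_zero])
    (fun h h' g g' h'' x => by
      rw [unmarkMap_markedLin _ h h' g g' h'', mul_neg_one, sgn_congr (b := 1) ⟨-1, by ring⟩, sgn_one,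
        neg_one_smul K])
    (by norm_num) h (by omega) x
  rwa [mul_neg_one, sgn_congr (b := 1) ⟨-1, by ring⟩, sgn_one, neg_one_smul K] at h4

/-- A cycle with at most `a + 1` vertices, where `a` is positive, is homologous to one with at most
`a` vertices. -/
lemma exists_sub_cobarD_mem (ha : a ≠ 0) (h : q + 1 = p) (h' : p + 1 = r) {z : (CobarFree (barGen
    P)).obj n p} (hz : cobarD P h z = 0) (hz' : unnestLin (barGen P) z ∈ MTrees (barGen P) (a + 1 :
    ℕ) n p) : ∃ w : (CobarFree (barGen P)).obj n r, unnestLin (barGen P) (z - cobarD P h' w) ∈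
    MTrees (barGen P) a n p := by
  obtain ⟨w, hw⟩ := exists_unnestLin_eq (unmarkAny_mem (q := r) hz')
  refine ⟨(a : K)⁻¹ • w, ?_⟩
  have h1 := unnestLin_cobarD_sub_mem h' (hw ▸ unmarkAny_mem hz' :
    unnestLin (barGen P) w ∈ MTrees (barGen P) (a + 1 : ℕ) n r)
  have h2 := unmarkAny_mem (q := p) (neg_mem (unnestLin_cobarD_sub_mem h hz'))
  have h3 := loc_ident_sub_mem hz'
  rw [hz, map_zero, zero_sub, neg_neg, unmarkAny_lin h h'] at h2
  rw [hw] at h1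
  have h4 := smul_mem _ (a : K)⁻¹ (sub_mem (sub_mem h2 h3) h1)
  have ha' : (a : K) ≠ 0 := Nat.cast_ne_zero.2 ha
  convert h4 using 1
  rw [map_sub, map_smul, map_smul, show ∀ A B C D : PTree (marked (barGen P)) n p,
    -A + B - (B - C) - (D - A) = C - D from fun A B C D => by abel, smul_sub, inv_smul_smul₀ ha']

end Reduction

/-! ### Corollas and homology -/

lemma isTree_corolla (p : ℤ) (x : V.obj n p) : IsTree [⟨0, n, p, x, fun a => a + 1⟩] 0 fun a : Fin n
    => (a : ℕ) + 1 := by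
  refine isTree_iff.2 ⟨by simp, by simp [outs, ins_cons], nodup_cons.2 ⟨?_, ?_⟩, id, by simp⟩
  · simp [ins_cons, mem_lvs]
  · rw [ins_cons, ins_nil, add_zero]
    exact Multiset.Nodup.map (fun a b h => Fin.ext (by simpa using h)) univ.nodup

/-- The tree with one vertex, in standard position. -/
def corolla : V.obj n p →ₗ[K] TreeObj V n p where
  toFun x := tree [⟨0, n, p, x, fun a => a + 1⟩] 0 fun a => a + 1
  map_add' x y := by simpa using tree_linear [] [] 0 _ 0 n p (1 : K) 1 x y _
  map_smul' c x := by simpa using tree_linear [] [] 0 _ 0 n p c 0 x 0 _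

lemma deg_corolla (x : V.obj n p) : deg [(⟨0, n, p, x, fun a => a + 1⟩ : Vtx V)] = p := add_zero p

lemma proj_corolla (x : V.obj n p) : proj V (corolla x) = x := by
  refine (treeLift_tree ..).trans ((if_pos ⟨isTree_corolla p x, deg_corolla x⟩).trans ?_)
  rw [projFun_eq (s := ⟨0, n, p, x, fun a => a + 1⟩) (isTree_corolla p x).leaf_injective (Equiv.refl _) (fun _ => rfl) rfl]
  exact V.act_one x

lemma exists_corolla_eq {s : Vtx V} (h : IsTree [s] r l) (hp : s.deg = p) : ∃ x : V.obj n p, tree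
    [s] r l = corolla x := by
  have h' := h.ptree
  obtain ⟨hr, σ, hσ⟩ := h.corolla
  obtain ⟨o, k, d, x, ι⟩ := s
  obtain rfl : k = n := equiv_iff_eq.1 ⟨σ⟩
  obtain rfl : d = p := hp
  obtain rfl : o = r := hr
  have hl : Injective (Fin.cons o l : Fin (k + 1) → ℕ) :=
    Fin.cons_injective_iff.2 ⟨fun ⟨b, hb⟩ => h'.root_notMem_ins <|
      mem_ins.2 ⟨_, mem_cons_self .., σ.symm b, by simpa [hb] using (hσ (σ.symm b)).symm⟩, h.leaf_injective⟩
  obtain ⟨π, hπ⟩ := (Perm.isMultiplyPretransitive ℕ (k + 1)).exists_smul_eq ⟨_, hl⟩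
    ⟨fun a => (a : ℕ), Fin.val_injective⟩
  have h1 : ∀ a, π ((Fin.cons o l : Fin (k + 1) → ℕ) a) = a := fun a => DFunLike.congr_fun hπ a
  have h2 : π ∘ l = fun a : Fin k => (a : ℕ) + 1 := funext fun a => by simpa using h1 a.succ
  have h3 := (multi_tree (V := V) d o l).comb [] [] (.act o k d σ x l)
  rw [one_smul, zero_smul, add_zero, show l ∘ σ = ι from funext hσ] at h3
  refine ⟨V.act σ x, h3.symm.trans ((tree_rename π ..).symm.trans ?_)⟩
  rw [h2, show π o = 0 from h1 0, corolla]
  simp only [nil_append, map_cons, List.map_nil, Vtx.rename, h2, show π o = 0 from h1 0]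
  rfl

section Section

variable {r : ℤ}

lemma barDiff_corolla (h : q + 1 = p) (x : (barGen P).obj n p) : barDiff P (corolla x) = corolla
    ((linMap P).app h x) := by
  obtain rfl : q = p - 1 := by omega
  refine (treeLift_tree ..).trans ((if_pos ⟨isTree_corolla p x, deg_corolla x⟩).trans ?_)
  simp [barDiffFun, pickSum]
  rfl

lemma cutMap_corolla (x : (barGen P).obj n p) : (cutMap (corolla x) : (CobarFree (barGen P)).obj n
    q) = 0 := by
  refine (treeLift_tree ..).trans ((if_pos ⟨isTree_corolla p x, deg_corolla x⟩).trans ?_)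
  simp [cutFun, splitSum, cutTerm_eq_zero fun c : Cut _ [] _ _ _ => c.isTreeB.ne_nil rfl,
    cutTerm_eq_zero fun c : Cut [] _ _ _ _ => c.isTreeA.ne_nil rfl]

lemma cobarD_gen (h : q + 1 = p) (x : TreeObj (barGen P) n (p + 1)) : cobarD P h (cobarGen x) =
    (CobarFree (barGen P)).unitAt n q (vCoeff (proj _ x)) - cobarGen (barDiff P x) - cutMap x := rfl

/-- The section `x ↦ s⁻¹sx` of the counit. -/
def counitSection : P.obj n p →ₗ[K] (CobarFree (barGen P)).obj n p :=
  cobarGen ∘ₗ corolla ∘ₗ susp rfl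

lemma cobarD_corolla (h : q + 1 = p) (x : (barGen P).obj n (p + 1)) : cobarD P h (cobarGen (corolla
    x)) = (CobarFree (barGen P)).unitAt n q (vCoeff x) - counitSection (- P.d h (desuspPart rfl x) +
    P.unitAt n q (vCoeff x)) := by
  subst h
  rw [cobarD_gen, proj_corolla, cutMap_corolla, sub_zero, barDiff_corolla (by omega), linMap_app _ rfl]
  rfl

lemma cobarD_counitSection (h : q + 1 = p) (x : P.obj n p) : cobarD P h (counitSection x) =
    counitSection (P.d h x) := by
  refine (cobarD_corolla h (susp rfl x)).trans ?_
  rw [vCoeff_susp, desuspPart_susp]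
  simp

lemma counit_counitSection (x : P.obj n p) : (counit P).app (counitSection x) = x := by
  refine (congrArg (desuspPart rfl) (proj_corolla (susp rfl x))).trans ?_
  exact desuspPart_susp ..

variable [CharZero K]

lemma exists_of_mem_markedTrees_one {z : (CobarFree (barGen P)).obj n p} (hz : unnestLin (barGen P)
    z ∈ MTrees (barGen P) (1 : ℕ) n p) : ∃ c x, z = (CobarFree (barGen P)).unitAt n p c + cobarGen
    (corolla x) := by
  suffices h : unnestLin (barGen P) z ∈ LinearMap.range (unnestLin (barGen P) ∘ₗ LinearMap.coprod
      ((CobarFree (barGen P)).unitAt n p) (cobarGen ∘ₗ corolla)) by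
    obtain ⟨⟨c, x⟩, h⟩ := h
    exact ⟨c, x, (unnestLin_injective h).symm⟩
  generalize unnestLin (barGen P) z = y at hz
  induction hz using MTrees_induction with
  | zero => exact zero_mem _
  | add x y _ _ hx hy => exact add_mem hx hy
  | smul c x _ hx => exact smul_mem _ c hx
  | tree L r l hL hp hr ha =>
    match L with
    | [] =>
      obtain ⟨rfl, hl⟩ := hL.nil_eq
      obtain rfl : (0 : ℤ) = p := hp
      refine ⟨(1, 0), ?_⟩
      rw [comp_apply, LinearMap.coprod_apply, map_zero, add_zero, GrOperad.unitAt_one,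
        one_smul, unnestLin_one, ptree_nil_eq 0 0 r, show l = fun _ => r from funext hl]
    | [s] =>
      have hs : s.out = r := by
        obtain ⟨t, ht, h⟩ := mem_outs.1 (hL.root_mem_outs (by simp))
        rwa [← mem_singleton.1 ht]
      obtain ⟨s, rfl⟩ := exists_mark_eq (hr s (by simp) hs)
      have h1 : IsPTree [s] r l := isPTree_of_ends (by simp only [map_cons, List.map_nil]; rfl) hL
      have hd : deg [s] = p + 1 := by
        rw [deg_cons, show s.mark.deg = s.deg - 1 from rfl] at hp
        rw [deg_cons, ← hp]
        have : deg ([] : List (Vtx (marked (barGen P)))) = deg ([] : List (Vtx (barGen P))) := rfl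
        omega
      obtain ⟨x, hx⟩ := exists_corolla_eq (p := p + 1) (isTree_iff.2 ⟨by simp, h1⟩)
        (by rw [← hd, deg_cons]; exact (add_zero _).symm)
      refine ⟨(0, x), ?_⟩
      rw [comp_apply, LinearMap.coprod_apply, map_zero, zero_add, comp_apply, ← hx]
      exact markEmbed_tree_cons h1 hs hd
    | _ :: _ :: _ =>
      rw [Nat.cast_le] at ha
      simp at ha

lemma exists_cobarD_add_counitSection (h : q + 1 = p) (h' : p + 1 = r)
    {z : (CobarFree (barGen P)).obj n p} (hz : cobarD P h z = 0) (hP : P.SquareZero) :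
    ∃ w x, z = cobarD P h' w + counitSection x := by
  obtain ⟨N, hN⟩ : ∃ N : ℕ, unnestLin (barGen P) z ∈ MTrees (barGen P) (N + 1 : ℕ) n p := by
    obtain ⟨N, hN⟩ := exists_mem_markedTrees (unnestLin_mem z)
    exact ⟨N, MTrees_mono (by exact_mod_cast N.le_succ) hN⟩
  induction N generalizing z with
  | succ N ih =>
    obtain ⟨w, hw⟩ := exists_sub_cobarD_mem N.succ_ne_zero h h' hz hN
    obtain ⟨w', x, hw'⟩ := ih (by rw [map_sub, hz, cobarD_cobarD hP, sub_zero]) hw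
    exact ⟨w + w', x, by rw [map_add, add_assoc, ← hw', add_sub_cancel]⟩
  | zero =>
    obtain ⟨c, x, rfl⟩ := exists_of_mem_markedTrees_one hN
    by_cases hx : vCoeff x = 0
    · have hx' : x = susp rfl (desuspPart rfl x) :=
        barGen_ext rfl (desuspPart_susp ..).symm (hx.trans (vCoeff_susp ..).symm)
      by_cases hn : 1 = n ∧ 0 = p
      · obtain ⟨rfl, rfl⟩ := hn
        subst h'
        let v : (barGen P).obj 1 (0 + 1 + 1) := (0, ⟨c, by simp [vPart]⟩)
        have hv := cobarD_corolla (P := P) rfl v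
        rw [show desuspPart rfl v = 0 from (P.transport _ _).map_zero, map_zero, neg_zero,
          zero_add (P.unitAt 1 0 _), show vCoeff v = c from rfl] at hv
        refine ⟨cobarGen (corolla v), P.unitAt 1 0 c + desuspPart rfl x, ?_⟩
        rw [hv, map_add, ← add_assoc, sub_add_cancel]
        exact congrArg (fun y => _ + cobarGen (corolla y)) hx'
      · refine ⟨0, desuspPart rfl x, ?_⟩
        rw [map_zero, GrOperad.unitAt_eq_zero _ hn]
        exact congrArg (fun y => 0 + cobarGen (corolla y)) hx'
    · -- the unit of the cobar construction would vanish
      obtain ⟨rfl, hp⟩ := not_not.1 fun h => hx (vCoeff_eq_zero h x)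
      obtain rfl : q = 0 := by omega
      rw [map_add, deriv_cobarD.unitAt, zero_add, cobarD_corolla, GrOperad.unitAt_one, sub_eq_zero]
        at hz
      have h1 := congrArg (fun y => (unnestInv _ 0).app (unnestLin (barGen P) y)) hz
      simp only [map_smul, unnestLin_one, unnestInv_nil, if_true, counitSection, comp_apply,
        unnestLin_gen, unnestInv_markEmbed, zero_ne_one, if_false] at h1
      have h2 : ∀ y : (CobarFree (barGen P)).obj 1 p, y = 0 := fun y => by
        have : IsEmpty {a : Fin 1 // a ≠ 0} := ⟨fun a => a.2 (Subsingleton.elim _ _)⟩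
        rw [← (CobarFree (barGen P)).one_comp (emptySum _ _) (fun _ => rfl) (zero_add p) y,
          (smul_eq_zero.1 h1).resolve_left hx, map_zero, LinearMap.zero_apply]
      exact ⟨0, 0, (h2 _).trans (h2 _).symm⟩

end Section

/-! ### The counit -/

section Closed

/-- A family of subspaces of the cobar construction that is closed under the operations. -/
structure IsSuboperad (S : ∀ n p, Submodule K ((CobarFree V).obj n p)) : Prop where
  one : (CobarFree V).one ∈ S 1 0
  act : ∀ {n : ℕ} {p : ℤ} (σ : Perm (Fin n)) (x : (CobarFree V).obj n p), x ∈ S n p →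
    (CobarFree V).act σ x ∈ S n p
  comp : ∀ {m n k : ℕ} (i : Fin m) (e : Wire i n k) {p q r : ℤ} (h : p + q = r)
    (x : (CobarFree V).obj m p) (y : (CobarFree V).obj n q), x ∈ S m p → y ∈ S n q →
    (CobarFree V).comp i e h x y ∈ S k r

variable {S : ∀ n p, Submodule K ((CobarFree V).obj n p)}

lemma IsSuboperad.mem (hS : IsSuboperad S) (hg : ∀ n p (x : TreeObj V n (p + 1)), (cobarGen x :
    (CobarFree V).obj n p) ∈ S n p) (x : (CobarFree V).obj n p) : x ∈ S n p := by
  induction x using cobarFree_induction with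
  | one => exact hS.one
  | gen x => exact hg _ _ x
  | act σ x hx => exact hS.act σ x hx
  | comp i e h x y hx hy => exact hS.comp i e h x y hx hy
  | zero => exact zero_mem _
  | add x y hx hy => exact add_mem hx hy
  | smul c x hx => exact smul_mem _ c hx

lemma IsSuboperad.unitAt (hS : IsSuboperad S) (n : ℕ) (p : ℤ) (c : K) : (CobarFree V).unitAt n p c ∈
    S n p := by
  by_cases h : 1 = n ∧ 0 = p
  · obtain ⟨rfl, rfl⟩ := h
    rw [GrOperad.unitAt_one]
    exact smul_mem _ _ hS.one
  · rw [GrOperad.unitAt_eq_zero _ h]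
    exact zero_mem _

lemma isSuboperad_eqLocus {Q : GrOperad.{u, w} K} (f g : (CobarFree V).Hom Q) :
    IsSuboperad fun _ _ => eqLocus f.app g.app where
  one := f.app_one.trans g.app_one.symm
  act σ x (hx : f.app x = g.app x) := by
    rw [mem_eqLocus, f.app_act, g.app_act, hx]
  comp i e _ _ _ h x y (hx : f.app x = g.app x) (hy : f.app y = g.app y) := by
    rw [mem_eqLocus, f.app_comp, g.app_comp, hx, hy]

lemma GrOperad.Hom.app_unitAt {P : GrOperad.{u, v} K} {Q : GrOperad.{u, w} K} (f : P.Hom Q) (n : ℕ)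
    (p : ℤ) (c : K) : f.app (P.unitAt n p c) = Q.unitAt n p c := by
  by_cases h : 1 = n ∧ 0 = p
  · obtain ⟨rfl, rfl⟩ := h
    rw [GrOperad.unitAt_one, GrOperad.unitAt_one, map_smul, f.app_one]
  · rw [GrOperad.unitAt_eq_zero _ h, GrOperad.unitAt_eq_zero _ h, map_zero]

variable {X : DerOperad.{u, w} K}

/-- The elements on which a morphism of operads commutes with the differentials. -/
def commuting (f : (CobarFree (barGen P)).Hom X.toGrOperad) (n : ℕ) (p : ℤ) : Submodule K
    ((CobarFree (barGen P)).obj n p) :=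
  eqLocus (f.app ∘ₗ cobarD P (sub_add_cancel p 1)) (X.d (sub_add_cancel p 1) ∘ₗ f.app)

lemma mem_commuting {f : (CobarFree (barGen P)).Hom X.toGrOperad} (h : q + 1 = p) {x : (CobarFree
    (barGen P)).obj n p} : x ∈ commuting f n p ↔ f.app (cobarD P h x) = X.d h (f.app x) := by
  obtain rfl : q = p - 1 := by omega
  exact mem_eqLocus

lemma isSuboperad_commuting (f : (CobarFree (barGen P)).Hom X.toGrOperad) :
    IsSuboperad (commuting f) where
  one := by
    rw [mem_commuting (sub_add_cancel 0 1), deriv_cobarD.one, map_zero, f.app_one, X.d_one]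
  act σ x hx := by
    rw [mem_commuting (sub_add_cancel _ 1)] at hx ⊢
    rw [deriv_cobarD.act, f.app_act, hx, f.app_act, X.d_act]
  comp {m n k} i e {p q r} h x y hx hy := by
    rw [mem_commuting (sub_add_cancel _ 1)] at hx hy ⊢
    rw [deriv_cobarD.comp i e h (sub_add_cancel p 1) (sub_add_cancel q 1) (sub_add_cancel r 1)
      (by omega) (by omega), map_add, map_smul, f.app_comp, f.app_comp, f.app_comp, hx, hy,
      X.d_comp i e h (sub_add_cancel p 1) (sub_add_cancel q 1) (sub_add_cancel r 1)
      (by omega) (by omega)]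

end Closed

section Counit

lemma proj_tree {x : V.obj n p} (h : IsTree [⟨r, n, p, x, l⟩] r l) : proj V (tree [⟨r, n, p, x, l⟩]
    r l) = x := by
  refine (treeLift_tree ..).trans ((if_pos ⟨h, add_zero p⟩).trans ?_)
  rw [projFun_eq (s := ⟨r, n, p, x, l⟩) h.leaf_injective (Equiv.refl _) (fun _ => rfl) rfl]
  exact V.act_one x

/-- A tree with two vertices is the graft of two corollas along a wire of their own inputs. -/
lemma IsTree.exists_wire {s t : Vtx V} (hs : s.out = r) (h : IsTree [s, t] r l) : ∃ (i : Fin s.ar)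
    (e : Wire i t.ar n), s.inp i = t.out ∧ e.Fits s.inp t.inp l ∧ IsTree [s] r s.inp ∧ IsTree [t]
    (s.inp i) t.inp := by
  have h' := h.ptree
  have ht : t.out ∈ ins [s] := by
    have h1 := (h'.out_mem (mem_cons_of_mem s (List.mem_singleton_self t))).resolve_left
      (h'.out_ne hs (List.mem_singleton_self t))
    obtain ⟨height, hh⟩ := h'.2.2
    obtain ⟨u, hu, a, ha⟩ := mem_ins.1 h1
    rcases List.mem_cons.1 hu with rfl | hu
    · exact mem_ins.2 ⟨u, by simp, a, ha⟩
    · obtain rfl := mem_singleton.1 hu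
      exact absurd (hh u (by simp) a) (by rw [ha]; exact lt_irrefl _)
  obtain ⟨⟨nA, nB, lA, lB, i, e, hA, hB, he⟩, hf⟩ := IsCut.exists_glue (A := [s]) (B := [t]) (f := t.out)
    ⟨by simp [hs], by simp, ht, by simp [outs]⟩ h'
  obtain ⟨o, k, a, x, ι⟩ := s
  obtain ⟨o', k', b, y, κ⟩ := t
  obtain ⟨-, σ, hσ⟩ := hA.corolla
  obtain ⟨-, τ, hτ⟩ := hB.corolla
  obtain rfl : k = nA := equiv_iff_eq.1 ⟨σ⟩
  obtain rfl : k' = nB := equiv_iff_eq.1 ⟨τ⟩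
  dsimp only at hσ hτ hf ⊢
  have hi : ι (σ.symm i) = lA i := by rw [← hσ, apply_symm_apply]
  refine ⟨σ.symm i, ((σ.subtypeEquiv fun j => ?_).sumCongr τ).trans e, hi.trans hf,
    ⟨fun j => (he.1 _).trans (hσ j), fun b => (he.2 _).trans (hτ b)⟩, ?_, ?_⟩
  · rw [Ne, Ne, Equiv.eq_symm_apply]
  · rw [← show lA ∘ σ = ι from funext hσ] at hA ⊢
    exact (isTree_relabel ..).2 hA
  · rw [hi]
    rw [← show lB ∘ τ = κ from funext hτ] at hB ⊢
    exact (isTree_relabel ..).2 hB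

variable (P : DerOperad.{u, v} K)

/-- The counit, as a morphism from the free operad. -/
def counitHom : (CobarFree (barGen P)).Hom P.toGrOperad := counit P

variable {P}

lemma counit_gen (x : TreeObj (barGen P) n (p + 1)) : (counitHom P).app (cobarGen x) = desuspPart
    rfl (proj _ x) := rfl

lemma counit_cutTerm_eq_zero {A B : List (Vtx (barGen P))} (h : ¬ (A.length = 1 ∧ B.length = 1)) (r
    : ℕ) (l : Fin n → ℕ) : (counitHom P).app (cutTerm q A B r l) = 0 := by
  by_cases hc : Nonempty (Cut A B r l q)
  · obtain ⟨c⟩ := hc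
    rw [cutTerm_eq c, Cut.value, (counitHom P).app_comp, counit_gen, counit_gen]
    by_cases hA : A.length = 1
    · rw [proj_eq_zero (L := B) fun hB => h ⟨hA, hB⟩, map_zero, map_zero]
    · rw [proj_eq_zero hA, map_zero, map_zero, LinearMap.zero_apply]
  · rw [cutTerm_eq_zero fun c => hc ⟨c⟩, map_zero]

lemma counit_cutTerm {s t : Vtx (barGen P)} (hs : s.out = r) {a b : ℤ} (ha : a + 1 = s.deg) (hb : b
    + 1 = t.deg) (hab : a + b = q) (hl : Injective l) (i : Fin s.ar) (e : Wire i t.ar n) (hi : s.inp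
    i = t.out) (he : e.Fits s.inp t.inp l) (hA : IsTree [s] r s.inp) (hB : IsTree [t] (s.inp i)
    t.inp) (hn : ∀ b, l b ≠ s.inp i) : (counitHom P).app (cutTerm q [s] [t] r l) = P.comp i e hab
    (desuspPart ha s.lab) (desuspPart hb t.lab) := by
  obtain ⟨_, k, d, x, ι⟩ := s
  obtain ⟨_, k', d', y, κ⟩ := t
  obtain rfl : d = a + 1 := ha.symm
  obtain rfl : d' = b + 1 := hb.symm
  subst hs hi
  let c : Cut [(⟨_, k, a + 1, x, ι⟩ : Vtx (barGen P))] [⟨ι i, k', b + 1, y, κ⟩] _ l q :=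
    ⟨k, k', a, b, ι, κ, i, e, hA, hB, hl, hn, he.1, he.2, add_zero _, add_zero _, hab⟩
  rw [cutTerm_eq c, Cut.value, (counitHom P).app_comp, counit_gen, counit_gen]
  exact congrArg₂ (fun x y => P.comp i e _ (desuspPart rfl x) (desuspPart rfl y)) (proj_tree hA)
    (proj_tree hB)

lemma proj_contractSum {s t : Vtx (barGen P)} (hs : s.out = r) {a b : ℤ} (ha : a + 1 = s.deg) (hb :
    b + 1 = t.deg) (hab : a + b = q) (h : IsTree [s, t] r l) (i : Fin s.ar) (e : Wire i t.ar n) (hi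
    : s.inp i = t.out) (he : e.Fits s.inp t.inp l) : desuspPart rfl (proj _ (contractSum s t [] r l
    : TreeObj (barGen P) n (q + 1))) = sgn K a • P.comp i e hab (desuspPart ha s.lab) (desuspPart hb
    t.lab) := by
  have h' := h.ptree
  have hr : r ∉ lvs l := fun hr => by
    have h1 := h'.nodup_outs
    rw [outs_cons, hs, cons_add, nodup_cons] at h1
    exact h1.1 (mem_add.2 (Or.inr hr))
  have hl : Sum.elim (fun a : {j // j ≠ i} => s.inp a.1) t.inp ∘ e.symm = l := funext fun c => by
    obtain ⟨c, rfl⟩ := e.surjective c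
    rw [Function.comp_apply, Equiv.symm_apply_apply]
    rcases c with c | c
    · exact (he.1 c).symm
    · exact (he.2 c).symm
  have h1 : contractSum (p := q + 1) s t [] r l = tree [s.contractVia t i e] r l := by
    rw [contractSum, Finset.sum_eq_single_of_mem i (Finset.mem_univ _) fun j _ hj => if_neg fun h2 => ?_,
      if_pos hi]
    · exact tree_contractVia ..
    · refine hj ?_
      have h3 := (nodup_cons.1 h'.2.1).2
      rw [ins_cons, nodup_add] at h3
      exact inj_on_of_nodup_map h3.1 _ (by simp) _ (by simp) (h2.trans hi.symm)
  have h2 : ∀ x : (barGen P).obj n (s.deg + t.deg - 1), IsTree [⟨r, n, _, x, l⟩] r l := fun x =>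
    isTree_iff.2 ⟨by simp, by simp [outs, ins_cons, ins_nil, lvs], by
      rw [ins_cons, ins_nil, add_zero, nodup_cons]
      exact ⟨hr, univ.nodup.map h.leaf_injective⟩, fun c => if c = r then 0 else 1, by
      simpa [Nat.pos_iff_ne_zero] using fun b hb => hr (mem_lvs.2 ⟨b, hb⟩)⟩
  obtain rfl : a = s.deg - 1 := by omega
  obtain rfl : b = t.deg - 1 := by omega
  have h3 : s.deg + t.deg - 1 = q + 1 := by omega
  have h4 : ∀ {p p' : ℤ} (hp : p = p') (h : q + 1 = p') (x : (barGen P).obj n p),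
      IsTree [⟨r, n, _, x, l⟩] r l → desuspPart h (proj _ (tree [⟨r, n, p, x, l⟩] r l)) =
        desuspPart (h.trans hp.symm) x := by
    rintro p _ rfl h x hx
    rw [proj_tree hx]
  rw [h1, Vtx.contractVia, hl, hs, h4 h3 rfl _ (h2 _)]
  obtain rfl : q = s.deg + t.deg - 2 := by omega
  rw [barMul, LinearMap.smul_apply, LinearMap.smul_apply, map_smul]
  exact congrArg (sgn K (s.deg - 1) • ·) (desuspPart_susp (q := s.deg + t.deg - 2) (by omega) (by omega) _)

lemma counit_cobarD_tree {L : List (Vtx (barGen P))} (h : IsTree L r l) (hp : deg L = p + 1) (hL :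
    L.length ≠ 1) (hq : q + 1 = p) : (counitHom P).app (cobarD P hq (cobarGen (tree L r l))) =
    -(desuspPart rfl (proj _ (barDiffFun L r l : TreeObj _ n (q + 1))) + (counitHom P).app (cutFun q
    L r l)) := by
  rw [cobarD_gen, proj_eq_zero hL, map_sub, map_sub, map_zero, map_zero, map_zero, zero_sub, ← neg_add',
    counit_gen, barDiff, treeLift_tree, if_pos ⟨h, hp⟩, cutMap, treeLift_tree, if_pos ⟨h, hp⟩]

lemma counit_cobarD_two {s t : Vtx (barGen P)} (hs : s.out = r) (h : IsTree [s, t] r l) (hp : deg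
    [s, t] = p + 1) (hq : q + 1 = p) : (counitHom P).app (cobarD P hq (cobarGen (tree [s, t] r l)))
    = 0 := by
  have h' := h.ptree
  have hp' : s.deg + t.deg = q + 2 := by
    rw [deg_cons, show deg [t] = t.deg from add_zero _] at hp
    omega
  have hts : contractSum (p := q + 1) t s [] r l = 0 := sum_eq_zero fun i _ => if_neg fun hi =>
    h'.root_notMem_ins (mem_ins.2 ⟨t, by simp, i, hi.trans hs⟩)
  have hc : cutTerm q [t] [s] r l = 0 := cutTerm_eq_zero fun c =>
    h'.out_ne hs (List.mem_singleton_self t) c.isTreeA.corolla.1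
  obtain ⟨i, e, hi, he, hA, hB⟩ := h.exists_wire hs
  have hn : ∀ b, l b ≠ s.inp i := fun b hb => by
    have h1 := h'.nodup_outs
    rw [outs_cons, cons_add, nodup_cons, nodup_add] at h1
    exact disjoint_left.1 h1.2.2.2 (mem_outs.2 ⟨t, by simp, hi.symm⟩) (mem_lvs.2 ⟨b, hb⟩)
  rw [counit_cobarD_tree h hp (by simp) hq, neg_eq_zero, barDiffFun, cutFun]
  have h1 := proj_contractSum (q := q) hs (sub_add_cancel s.deg 1) (sub_add_cancel t.deg 1)
    (by omega) h i e hi he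
  have h2 := counit_cutTerm hs (sub_add_cancel s.deg 1) (sub_add_cancel t.deg 1) (q := q)
    (by omega) h.leaf_injective i e hi he hA hB hn
  have h3 : sgn K s.deg = - sgn K (s.deg - 1) := by
    rw [show s.deg = s.deg - 1 + 1 by omega, sgn_add, sgn_one, mul_neg_one, add_sub_cancel_right]
  simp [pickSum, splitSum, hts, hc, proj_eq_zero, counit_cutTerm_eq_zero, deg, h1, h2, h3]

lemma counit_commutes : GrOperad.Hom.Commutes (P := cobarBar P) (Q := P) (counit P) := by
  refine fun h x => (mem_commuting (f := counitHom P) h).1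
    ((isSuboperad_commuting (counitHom P)).mem (fun n p x => ?_) x)
  have hq := sub_add_cancel p 1
  rw [mem_commuting hq]
  generalize p - 1 = q at hq
  induction x using tree_induction with
  | zero => simp only [map_zero]
  | add x y hx hy => simp only [map_add, hx, hy]
  | smul c x hx => simp only [map_smul, hx]
  | tree L r l h hp =>
    by_cases hL : L.length = 1
    · obtain ⟨s, rfl⟩ := List.length_eq_one_iff.1 hL
      obtain ⟨x, hx⟩ := exists_corolla_eq h ((add_zero _).symm.trans hp)
      rw [hx, cobarD_corolla, map_sub, (counitHom P).app_unitAt, counit_gen, proj_corolla]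
      refine (congrArg (_ - ·) (counit_counitSection _)).trans ?_
      abel
    · rw [counit_gen, proj_eq_zero hL, map_zero, map_zero]
      obtain ⟨s, L', hs, hsr⟩ := h.ptree.exists_root h.ne_nil
      obtain ⟨ε, hε⟩ := Koszul.exists_perm (K := K) hs.symm
      rw [hε (fun L => tree L r l) (koszul_tree r l), map_smul, map_smul, map_smul]
      have h' := (isTree_congr (hs.map Vtx.ends)).2 h
      have hp' : deg (s :: L') = p + 1 := by rw [← hp]; exact (hs.map Vtx.deg).sum_eq
      rw [← hs.length_eq] at hL
      refine (congrArg _ ?_).trans (smul_zero _)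
      match L' with
      | [] => exact absurd rfl hL
      | [t] => exact counit_cobarD_two hsr h' hp' hq
      | t :: u :: L =>
        rw [counit_cobarD_tree h' hp' hL, neg_eq_zero, barDiffFun, cutFun, map_add, map_add, pickSum_map,
          pickSum_map, pickSum_map, pickSum_map, splitSum_map, pick_eq_zero, pick_eq_zero,
          split_eq_zero, add_zero, add_zero]
        · intro A B hAB
          rw [map_smul, counit_cutTerm_eq_zero, smul_zero]
          rintro ⟨h1, h2⟩
          have := hAB.length_eq
          simp at this
          omega
        · intro s L' hL'
          rw [pickSum_map, pickSum_map]
          refine pick_eq_zero fun t L'' hL'' => ?_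
          rw [contractSum, map_sum, map_sum]
          refine sum_eq_zero fun i _ => ?_
          split_ifs
          · rw [proj_eq_zero, map_zero]
            have := hL'.length_eq
            have := hL''.length_eq
            simp only [length_cons] at *
            omega
          · rw [map_zero, map_zero]
        · intro s L' hL'
          rw [proj_eq_zero, map_zero]
          have := hL'.length_eq
          simp only [length_cons] at *
          omega

end Counit

/-! ### Equivariant homotopies -/

section Average

/-- By averaging, a linear relation that is stable under the symmetric groups and admits solutions
admits an equivariant solution. -/
lemma exists_equivariant {K : Type*} [Field K] [CharZero K] {V : SMod.{_, v} K} {W : SMod.{_, w} K}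
    {M : Type*} [AddCommGroup M] [Module K M] {p' : ℤ} (S : Submodule K (V.obj n p)) (hS : ∀ σ, ∀ x
    ∈ S, V.act σ x ∈ S) (L : W.obj n p' →ₗ[K] M) (g : V.obj n p →ₗ[K] M) (ρ : Perm (Fin n) → M → M)
    (hL : ∀ σ y, L (W.act σ y) = ρ σ (L y)) (hg : ∀ σ x, g (V.act σ x) = ρ σ (g x)) (h : ∀ x ∈ S, ∃
    y, L y = g x) : ∃ T : V.obj n p →ₗ[K] W.obj n p', (∀ σ x, T (V.act σ x) = W.act σ (T x)) ∧ ∀ x ∈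
    S, L (T x) = g x := by
  obtain ⟨i, hi⟩ := L.rangeRestrict.exists_rightInverse_of_surjective L.range_rangeRestrict
  obtain ⟨T, hT⟩ := (i ∘ₗ (g ∘ₗ S.subtype).codRestrict (LinearMap.range L) fun x => h x x.2).exists_extend
  have hT' : ∀ x ∈ S, L (T x) = g x := fun x hx =>
    (congrArg L (LinearMap.congr_fun hT ⟨x, hx⟩)).trans
      (congrArg Subtype.val (LinearMap.congr_fun hi ⟨g x, h x hx⟩))
  have hn : ((n.factorial : ℕ) : K) ≠ 0 := Nat.cast_ne_zero.2 n.factorial_ne_zero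
  refine ⟨(n.factorial : K)⁻¹ • ∑ σ : Perm (Fin n), W.act σ ∘ₗ T ∘ₗ V.act σ⁻¹, fun σ x => ?_,
    fun x hx => ?_⟩
  · simp only [LinearMap.smul_apply, LinearMap.sum_apply, comp_apply, map_smul, map_sum]
    refine congrArg _ (Fintype.sum_equiv (Equiv.mulLeft σ⁻¹) _ _ fun τ => ?_)
    rw [← W.act_mul, ← V.act_mul, Equiv.coe_mulLeft, mul_inv_cancel_left, mul_inv_rev, inv_inv]
  · have : ∀ σ, L (W.act σ (T (V.act σ⁻¹ x))) = g x := fun σ => by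
      rw [hL, hT' _ (hS _ x hx), ← hg, ← V.act_mul, mul_inv_cancel, V.act_one]
    simp only [LinearMap.smul_apply, LinearMap.sum_apply, comp_apply, map_smul, map_sum, this]
    rw [Finset.sum_const, Finset.card_univ, Fintype.card_perm, Fintype.card_fin, ← Nat.cast_smul_eq_nsmul K,
      inv_smul_smul₀ hn]

variable {X Y : DGOperad.{u, w} K} (q : X.Hom Y)

lemma DGOperad.Hom.exists_of_d_eq_zero (hq : q.IsFibration) (hq' : q.IsWeakEquivalence) {p' : ℤ} (h
    : p + 1 = p') (u : X.obj n p) (hu : X.d (sub_add_cancel p 1) u = 0) (hu' : q.app u = 0) : ∃ y :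
    X.obj n p', q.app y = 0 ∧ X.d h y = u := by
  subst h
  obtain ⟨x, hx⟩ : u ∈ X.boundaries n p := by
    have h1 := (injective_iff_map_eq_zero _).1 (hq' n p).1 (Submodule.Quotient.mk ⟨u, hu⟩)
      ((mk_eq_zero _).2 (by
        change q.app u ∈ Y.boundaries n p
        rw [hu']
        exact zero_mem _))
    exact (mk_eq_zero ((X.boundaries n p).submoduleOf (X.cycles n p))).1 h1
  have h2 : ∀ r (h : r + 1 = p + 1), Y.d h (q.app x) = 0 := fun r h => by
    obtain rfl : r = p := by omega
    rw [← q.app_d, hx, hu']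
  obtain ⟨⟨z, hz'⟩, hz⟩ := (hq' n (p + 1)).2 (Submodule.Quotient.mk ⟨q.app x, h2 _ _⟩)
  obtain ⟨b, hb⟩ := (Submodule.Quotient.eq _).1 hz
  obtain ⟨b, rfl⟩ := hq n _ b
  have hb : Y.d rfl (q.app b) = q.app z - q.app x := hb
  have hz'' : ∀ r (h : r + 1 = p + 1), X.d h z = 0 := fun r h => by
    obtain rfl : r = p + 1 - 1 := by omega
    exact hz'
  refine ⟨x - z + X.d rfl b, ?_, ?_⟩
  · rw [map_add, map_sub, q.app_d, hb]
    abel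
  · rw [map_add, map_sub, X.d_d, hz'' _ rfl, hx, sub_zero, add_zero]

/-- An acyclic fibration has an equivariant linear section, and its kernel has an equivariant
contracting homotopy. -/
lemma DGOperad.Hom.exists_section [CharZero K] (hq : q.IsFibration) (n : ℕ) (p : ℤ) : ∃ j : Y.obj n
    p →ₗ[K] X.obj n p, (∀ σ x, j (Y.act σ x) = X.act σ (j x)) ∧ ∀ y, q.app (j y) = y := by
  obtain ⟨j, hj, hj'⟩ := exists_equivariant (V := Y.toSMod) (W := X.toSMod) (n := n) (p := p) (p' := p) ⊤
    (fun _ _ _ => trivial) q.app LinearMap.id (fun σ => Y.act σ) q.app_act (fun _ _ => rfl)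
    fun x _ => hq n p x
  exact ⟨j, hj, fun y => hj' y trivial⟩

lemma DGOperad.Hom.exists_homotopy [CharZero K] (hq : q.IsFibration) (hq' : q.IsWeakEquivalence) : ∃
    s : ∀ {n : ℕ} {p p' : ℤ}, p + 1 = p' → X.obj n p →ₗ[K] X.obj n p', (∀ {n p p'} (h : p + 1 = p')
    (σ : Perm (Fin n)) (x : X.obj n p), s h (X.act σ x) = X.act σ (s h x)) ∧ ∀ {n p p' r} (h : p + 1
    = p') (h' : r + 1 = p) (x : X.obj n p), q.app x = 0 → q.app (s h x) = 0 ∧ X.d h (s h x) + s h'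
    (X.d h' x) = x := by
  have H : ∀ n p, ∃ t : X.obj n p →ₗ[K] X.obj n (p + 1), (∀ σ x, t (X.act σ x) = X.act σ (t x)) ∧
      ∀ x, q.app x = 0 → X.d (sub_add_cancel p 1) x = 0 → q.app (t x) = 0 ∧ X.d rfl (t x) = x := by
    intro n p
    obtain ⟨t, ht, ht'⟩ := exists_equivariant (V := X.toSMod) (W := X.toSMod) (n := n) (p := p)
      (p' := p + 1) (ker q.app ⊓ ker (X.d (sub_add_cancel p 1)))
      (fun σ x hx => by
        rw [Submodule.mem_inf, mem_ker, mem_ker] at hx ⊢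
        rw [q.app_act, X.d_act, hx.1, hx.2, map_zero, map_zero]
        exact ⟨rfl, rfl⟩)
      (q.app.prod (X.d rfl)) (LinearMap.prod 0 LinearMap.id)
      (fun σ => Prod.map (Y.act σ) (X.act σ))
      (fun σ y => Prod.ext (q.app_act σ y) (X.d_act rfl σ y))
      (fun σ x => Prod.ext (map_zero _).symm rfl)
      fun x hx => by
        obtain ⟨y, h1, h2⟩ := q.exists_of_d_eq_zero hq hq' rfl x hx.2 hx.1
        exact ⟨y, Prod.ext h1 h2⟩
    exact ⟨t, ht, fun x hx hx' => Prod.ext_iff.1 (ht' x ⟨hx, hx'⟩)⟩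
  choose t ht ht' using H
  let τ : ∀ {n : ℕ} {p p' : ℤ}, p + 1 = p' → X.obj n p →ₗ[K] X.obj n p' := fun {n p p'} h => h ▸ t n p
  have hτ : ∀ {n p p'} (h : p + 1 = p') (σ : Perm (Fin n)) (x : X.obj n p),
      τ h (X.act σ x) = X.act σ (τ h x) := by
    rintro n p _ rfl σ x
    exact ht n p σ x
  have hτ' : ∀ {n : ℕ} {p p' r : ℤ} (h : p + 1 = p') (h' : r + 1 = p) (x : X.obj n p), q.app x = 0 →
      X.d h' x = 0 → q.app (τ h x) = 0 ∧ X.d h (τ h x) = x := by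
    rintro n p _ r rfl h' x hx hx'
    obtain rfl : r = p - 1 := by omega
    exact ht' n p x hx hx'
  refine ⟨fun {n p p'} h => τ h ∘ₗ (LinearMap.id - τ (sub_add_cancel p 1) ∘ₗ X.d (sub_add_cancel p 1)),
    fun h σ x => ?_, fun {n p p' r} h h' x hx => ?_⟩
  · simp only [comp_apply, LinearMap.sub_apply, id_apply, X.d_act, hτ, ← map_sub]
  · obtain rfl : r = p - 1 := by omega
    have hd := q.app_d h' x
    rw [hx, map_zero] at hd
    have h0 : X.d (sub_add_cancel _ 1) (X.d h' x) = 0 := X.d_d _ _ x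
    obtain ⟨h1, h2⟩ := hτ' h' (sub_add_cancel _ 1) _ hd h0
    obtain ⟨h3, h4⟩ := hτ' h h' (x - τ h' (X.d h' x)) (by rw [map_sub, hx, h1, sub_zero])
      (by rw [map_sub, h2, sub_self])
    simp only [comp_apply, LinearMap.sub_apply, id_apply, h0, map_zero, sub_zero]
    exact ⟨h3, by rw [h4]; exact sub_add_cancel x _⟩

end Average

/-! ### The internal differential of the generators -/

section Linear

variable (P : DerOperad.{u, v} K) {r : ℤ}

/-- The part of the bar differential that preserves the shape of a tree. -/
def treeDiff : TreeObj (barGen P) n p →ₗ[K] TreeObj (barGen P) n q :=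
  TreeFun.treeLift p <| Multi.treeFun
    (fun L r l => pickSum (fun s L' => tree (s.op (linMap P) :: L') r l) L)
    (fun r l => multi_pickSum (fun s => (multi_tree q r l).cons _)
      fun L _ _ _ _ _ h => (multi_tree q r l).comb_head L (h.op _))
    (fun π L r l => by
      rw [← Vtx.rename_eq_ren]
      exact (pickSum_rename π _ L).trans (pick_congr fun s L' _ =>
        tree_rename π (s.op (linMap P) :: L') r l))

variable {P} {L : List (Vtx (barGen P))} {ρ : ℕ}

lemma treeDiff_tree (h : IsTree L ρ l) (hp : deg L = p) : (treeDiff P (tree L ρ l : TreeObj _ n p) :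
    TreeObj _ n q) = pickSum (fun s L' => tree (s.op (linMap P) :: L') ρ l) L := TreeFun.treeLift_eq _ h hp

lemma treeDiff_act (σ : Perm (Fin n)) (x : TreeObj (barGen P) n p) : (treeDiff P (treeAct σ x) :
    TreeObj _ n q) = treeAct σ (treeDiff P x) := by
  induction x using tree_induction with
  | zero => simp only [map_zero]
  | add x y hx hy => simp only [map_add, hx, hy]
  | smul c x hx => simp only [map_smul, hx]
  | tree L r l h hp =>
    rw [treeAct_tree, treeDiff_tree ((isTree_relabel ..).2 h) hp, treeDiff_tree h hp, pickSum_map]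
    simp only [treeAct_tree]

lemma treeDiff_treeDiff [CharZero K] (hP : P.SquareZero) (h : q + 1 = p) (x : TreeObj (barGen P) n
    p) : (treeDiff P (treeDiff P x : TreeObj _ n q) : TreeObj _ n r) = 0 := by
  induction x using tree_induction with
  | zero => simp only [map_zero]
  | add x y hx hy => simp only [map_add, hx, hy, add_zero]
  | smul c x hx => simp only [map_smul, hx, smul_zero]
  | tree L r' l hL hp =>
    have h1 : pickSum (fun s L' => (treeDiff P (tree (s.op (linMap P) :: L') r' l : TreeObj _ n q) :
        TreeObj _ n r)) L = pickSum (fun s L' => pickSum (fun t L'' => sgn K ((s.deg - 1) * t.deg) •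
          tree (t.op (linMap P) :: s.op (linMap P) :: L'') r' l) L') L := by
      refine pick_congr fun s L' hs => ?_
      rw [treeDiff_tree, pickSum]
      · rw [show (s.op (linMap P)).op (linMap P) = ⟨s.out, s.ar, _, 0, s.inp⟩ from
          congrArg (fun x => (⟨s.out, s.ar, _, x, s.inp⟩ : Vtx (barGen P))) (linMap_linMap hP _ _ s.lab)]
        have := (multi_tree r r' l).comb_head L' (.linear s.out s.ar (s.deg - 1 - 1) (0 : K) 0
          (0 : (barGen P).obj _ _) 0 s.inp)
        simp only [zero_smul, add_zero] at this
        exact (congrArg (· + _) this).trans (zero_add _)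
      · exact (isTree_congr (hs.map Vtx.ends)).2 hL
      · have := (hs.map Vtx.deg).sum_eq
        rw [deg_cons, show (s.op (linMap P)).deg = s.deg - 1 from rfl]
        have : s.deg + deg L' = p := by rw [← hp, ← deg_cons]; exact this
        omega
    rw [treeDiff_tree hL hp, pickSum_map, h1]
    refine pickSum_pickSum_eq_zero _ L fun s t L' _ => ?_
    have h2 := koszul_tree (p := r) r' l [] L' (t.op (linMap P)) (s.op (linMap P))
    dsimp only [nil_append] at h2
    rw [h2, smul_smul, smul_smul, ← neg_smul]
    congr 1
    rw [← sgn_add, ← sgn_add, ← neg_one_mul, ← sgn_one, ← sgn_add]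
    exact sgn_congr ⟨- t.deg, by change _ + (t.deg - 1) * (s.deg - 1) - _ = _; ring⟩

end Linear

section Filtration

variable {S : ∀ n p, Submodule K ((CobarFree (barGen P)).obj n p)}

/-- The cobar construction is quasi-free, with respect to the filtration by the number of vertices:
up to the internal differential, the differential of a tree lies in the suboperad generated by the
smaller trees. -/
lemma IsSuboperad.cobarD_add_mem (hS : IsSuboperad S) (hk : ∀ {n p} {L : List (Vtx (barGen P))} {r}
    {l : Fin n → ℕ}, L.length ≤ k → cobarGen (tree L r l) ∈ S n p) (h : q + 1 = p) {L : List (Vtx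
    (barGen P))} (hL : L.length ≤ k + 1) : cobarD P h (cobarGen (tree L r l)) + cobarGen (treeDiff P
    (tree L r l : TreeObj _ n (p + 1))) ∈ S n q := by
  by_cases hT : IsTree L r l ∧ deg L = p + 1
  swap
  · rw [tree_eq_zero hT]
    simp only [map_zero, add_zero, zero_mem]
  have h1 : (barDiff P (tree L r l : TreeObj _ n (p + 1)) : TreeObj _ n (q + 1)) =
      treeDiff P (tree L r l : TreeObj _ n (p + 1)) +
        pickSum (fun s L' => pickSum (fun t L'' => contractSum s t L'' r l) L') L := by
    rw [treeDiff_tree hT.1 hT.2, barDiff, treeLift_tree, if_pos hT]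
    rfl
  have h2 : ∀ a b c d : (CobarFree (barGen P)).obj n q, a - (b + c) - d + b = a - (c + d) := fun a b c d => by
    abel
  rw [cobarD_gen, h1, map_add, h2]
  refine sub_mem (hS.unitAt n q _) (add_mem ?_ ?_)
  · rw [pickSum_map, ← mk_eq_zero, ← mkQ_apply, pickSum_map]
    refine pick_eq_zero fun s L' hs => (mk_eq_zero _).2 ?_
    rw [pickSum_map, ← mk_eq_zero, ← mkQ_apply, pickSum_map]
    refine pick_eq_zero fun t L'' ht => (mk_eq_zero _).2 ?_
    rw [contractSum, map_sum]
    refine sum_mem fun i _ => ?_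
    split_ifs
    · refine hk ?_
      have := hs.length_eq
      have := ht.length_eq
      simp only [length_cons] at *
      omega
    · rw [map_zero]
      exact zero_mem _
  · rw [cutMap, treeLift_tree, if_pos hT, cutFun, ← mk_eq_zero,
      ← mkQ_apply, splitSum_map]
    refine split_eq_zero fun A B hAB => (mk_eq_zero _).2
      (smul_mem _ _ ?_)
    by_cases hc : Nonempty (Cut A B r l q)
    · obtain ⟨c⟩ := hc
      have hA := List.length_pos_of_ne_nil c.isTreeA.ne_nil
      have hB := List.length_pos_of_ne_nil c.isTreeB.ne_nil
      have := hAB.length_eq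
      rw [length_append] at this
      rw [cutTerm_eq c]
      exact hS.comp _ _ _ _ _ (hk (by omega)) (hk (by omega))
    · rw [cutTerm_eq_zero fun c => hc ⟨c⟩]
      exact zero_mem _

lemma IsSuboperad.cobarGen_treeDiff_mem (hS : IsSuboperad S) (hk : ∀ {n p} {L : List (Vtx (barGen
    P))} {r} {l : Fin n → ℕ}, L.length ≤ k → cobarGen (tree L r l) ∈ S n p) {L : List (Vtx (barGen
    P))} (hL : L.length ≤ k) : cobarGen (treeDiff P (tree L r l : TreeObj _ n p)) ∈ S n q := by
  by_cases hT : IsTree L r l ∧ deg L = p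
  · rw [treeDiff_tree hT.1 hT.2, pickSum_map, ← mk_eq_zero, ← mkQ_apply,
      pickSum_map]
    refine pick_eq_zero fun s L' hs => (mk_eq_zero _).2 (hk ?_)
    exact hs.length_eq.trans_le hL
  · rw [tree_eq_zero hT]
    simp only [map_zero, zero_mem]

end Filtration

/-! ### Lifting along acyclic fibrations -/

section Lifting

variable {X : DerOperad.{u, w} K}

variable (V X) in
/-- A morphism from the free operad on the desuspension of the trees, given on the generators. -/
structure GenMap where
  app : ∀ {n : ℕ} {p : ℤ}, TreeObj V n (p + 1) →ₗ[K] X.obj n p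
  app_act : ∀ {n : ℕ} {p : ℤ} (σ : Perm (Fin n)) (x : TreeObj V n (p + 1)),
    app (treeAct σ x : TreeObj V n (p + 1)) = X.act σ (app x : X.obj n p)

def GenMap.hom (γ : GenMap V X) : (CobarFree V).Hom X.toGrOperad :=
  FreeOperad.lift (W := desusp (treeModule V)) X.toGrOperad γ.app γ.app_act

lemma GenMap.hom_gen (γ : GenMap V X) (x : TreeObj V n (p + 1)) : γ.hom.app (cobarGen x : (CobarFree
    V).obj n p) = γ.app x := rfl

variable (γ₀ γ : GenMap (barGen P) X)

/-- The failure of `γ₀` to commute with the differentials, when the decomposable part of the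
differential of the cobar construction is evaluated by `γ`. -/
def GenMap.defect (h : q + 1 = p) : TreeObj (barGen P) n (p + 1) →ₗ[K] X.obj n q :=
  X.d h ∘ₗ γ₀.app + γ₀.app ∘ₗ treeDiff P -
    γ.hom.app ∘ₗ (cobarD P h ∘ₗ cobarGen + cobarGen ∘ₗ treeDiff P)

lemma GenMap.defect_act (h : q + 1 = p) (σ : Perm (Fin n)) (x : TreeObj (barGen P) n (p + 1)) :
    γ₀.defect γ h (treeAct σ x) = X.act σ (γ₀.defect γ h x) := by
  simp only [defect, LinearMap.sub_apply, LinearMap.add_apply, comp_apply, γ₀.app_act,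
    treeDiff_act, cobarGen_act, deriv_cobarD.act, X.d_act, ← map_add, γ.hom.app_act, map_sub]

variable (s : ∀ {n : ℕ} {p p' : ℤ}, p + 1 = p' → X.obj n p →ₗ[K] X.obj n p')
  (hs : ∀ {n : ℕ} {p p' : ℤ} (h : p + 1 = p') (σ : Perm (Fin n)) (x : X.obj n p),
    s h (X.act σ x) = X.act σ (s h x))

/-- The correction of `γ₀` by the image of its defect under a homotopy. -/
def GenMap.correct : GenMap (barGen P) X where
  app {n p} := γ₀.app - s (sub_add_cancel p 1) ∘ₗ γ₀.defect γ (sub_add_cancel p 1)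
  app_act σ x := by
    simp only [LinearMap.sub_apply, comp_apply, γ₀.app_act, defect_act, hs, map_sub]

lemma GenMap.correct_app (h : q + 1 = p) (x : TreeObj (barGen P) n (p + 1)) : (γ₀.correct γ s
    hs).app x = γ₀.app x - s h (γ₀.defect γ h x) := by
  obtain rfl : q = p - 1 := by omega
  rfl

/-- The successive corrections of `γ₀`. -/
def GenMap.seq : ℕ → GenMap (barGen P) X
  | 0 => γ₀
  | k + 1 => γ₀.correct (GenMap.seq k) s hs

lemma GenMap.seq_succ_eq (k : ℕ) {L : List (Vtx (barGen P))} (hL : L.length ≤ k) : (γ₀.seq s hs (k +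
    1)).app (tree L r l : TreeObj _ n (p + 1)) = (γ₀.seq s hs k).app (tree L r l) := by
  induction k generalizing n p L r l with
  | zero =>
    obtain rfl := List.length_eq_zero_iff.1 (Nat.le_zero.1 hL)
    rw [tree_eq_zero fun h => h.1.ne_nil rfl, map_zero, map_zero]
  | succ k ih =>
    have h := (isSuboperad_eqLocus (γ₀.seq s hs (k + 1)).hom (γ₀.seq s hs k).hom).cobarD_add_mem
      (fun hL => ih hL) (sub_add_cancel p 1) (r := r) (l := l) hL
    rw [seq, correct_app _ _ _ _ (sub_add_cancel p 1), seq, correct_app _ _ _ _ (sub_add_cancel p 1)]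
    congr 2
    exact congrArg (_ - ·) h

lemma GenMap.seq_eq {j : ℕ} (hjk : j ≤ k) {L : List (Vtx (barGen P))} (hL : L.length ≤ j) : (γ₀.seq
    s hs k).app (tree L r l : TreeObj _ n (p + 1)) = (γ₀.seq s hs j).app (tree L r l) := by
  induction k, hjk using Nat.le_induction with
  | base => rfl
  | succ k hk ih => rw [seq_succ_eq _ _ _ k (hL.trans hk), ih]

/-- The limit of the successive corrections: on the trees with `k` vertices it is the `k`-th one. -/
def GenMap.lim : GenMap (barGen P) X where
  app {n p} := TreeFun.treeLift (p + 1) <| Multi.treeFun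
    (fun L r l => (γ₀.seq s hs L.length).app (tree L r l : TreeObj _ n (p + 1)))
    (fun r l => ⟨fun A B v t => by
      simpa using ((multi_tree (p + 1) r l).map (γ₀.seq s hs (A ++ v :: t :: B).length).app).koszul A B v t,
      fun A B _ _ v _ _ h => by
      simpa using ((multi_tree (p + 1) r l).map (γ₀.seq s hs (A ++ v :: B).length).app).comb A B h⟩)
    (fun π L r l => by
      rw [← Vtx.rename_eq_ren, List.length_map, tree_rename])
  app_act σ x := by
    induction x using tree_induction with
    | zero => simp only [map_zero]
    | add x y hx hy => simp only [map_add, hx, hy]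
    | smul c x hx => simp only [map_smul, hx]
    | tree L r l h hp =>
      rw [treeAct_tree, TreeFun.treeLift_eq _ ((isTree_relabel ..).2 h) hp,
        TreeFun.treeLift_eq _ h hp]
      refine Eq.trans ?_ (GenMap.app_act _ σ _)
      rw [treeAct_tree]
      rfl

lemma GenMap.lim_tree {L : List (Vtx (barGen P))} (hL : L.length ≤ k) : (γ₀.lim s hs).app (tree L r
    l : TreeObj _ n (p + 1)) = (γ₀.seq s hs k).app (tree L r l) := by
  rw [γ₀.seq_eq s hs hL le_rfl]
  by_cases hT : IsTree L r l ∧ deg L = p + 1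
  · exact TreeFun.treeLift_eq _ hT.1 hT.2
  · rw [tree_eq_zero hT, map_zero, map_zero]

end Lifting

section Acyclic

variable {X : DGOperad.{u, w} K}
  {Y : GrOperad.{u, w} K} {s : ∀ {n : ℕ} {p p' : ℤ}, p + 1 = p' → X.obj n p →ₗ[K] X.obj n p'}
  {hs : ∀ {n : ℕ} {p p' : ℤ} (h : p + 1 = p') (σ : Perm (Fin n)) (x : X.obj n p),
    s h (X.act σ x) = X.act σ (s h x)} {γ₀ γ : GenMap (barGen P) X.toDerOperad}

def GrOperad.Hom.comp {P : GrOperad.{u, v} K} {Q : GrOperad.{u, w} K}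
    (g : Q.Hom Y) (f : P.Hom Q) : P.Hom Y where
  app := g.app ∘ₗ f.app
  app_act σ x := by simp only [comp_apply, f.app_act, g.app_act]
  app_one := by simp only [comp_apply, f.app_one, g.app_one]
  app_comp i e _ _ _ h x y := by simp only [comp_apply, f.app_comp, g.app_comp]

lemma GenMap.app_hom_eq {q : X.toGrOperad.Hom Y} {f : (CobarFree (barGen P)).Hom Y} (h : ∀ {n p} (x
    : TreeObj (barGen P) n (p + 1)), q.app (γ.app x) = f.app (cobarGen x)) (x : (CobarFree (barGen
    P)).obj n p) : q.app (γ.hom.app x) = f.app x :=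
  (isSuboperad_eqLocus (q.comp γ.hom) f).mem (fun _ _ x => h x) x

variable {Y : DGOperad.{u, w} K} {q : X.Hom Y} {f : (CobarFree (barGen P)).Hom Y.toGrOperad}

lemma GenMap.app_defect (hf : ∀ {n p r} (h : r + 1 = p) (x : (CobarFree (barGen P)).obj n p), f.app
    (cobarD P h x) = Y.d h (f.app x)) (h₀ : ∀ {n p} (x : TreeObj (barGen P) n (p + 1)), q.app
    (γ₀.app x) = f.app (cobarGen x)) (h : ∀ {n p} (x : TreeObj (barGen P) n (p + 1)), q.app (γ.app
    x) = f.app (cobarGen x)) {r : ℤ} (hr : r + 1 = p) (x : TreeObj (barGen P) n (p + 1)) : q.app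
    (γ₀.defect γ hr x) = 0 := by
  simp only [defect, LinearMap.sub_apply, LinearMap.add_apply, comp_apply, map_sub, map_add,
    q.app_d, h₀, app_hom_eq h, hf, sub_self]

variable (hf : ∀ {n p r} (h : r + 1 = p) (x : (CobarFree (barGen P)).obj n p),
      f.app (cobarD P h x) = Y.d h (f.app x))
  (h₀ : ∀ {n p} (x : TreeObj (barGen P) n (p + 1)), q.app (γ₀.app x) = f.app (cobarGen x))
  (hsq : ∀ {n p p' r} (h : p + 1 = p') (h' : r + 1 = p) (x : X.obj n p), q.app x = 0 →
    q.app (s h x) = 0 ∧ X.d h (s h x) + s h' (X.d h' x) = x)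
include hf h₀ hsq

lemma GenMap.app_seq (k : ℕ) (x : TreeObj (barGen P) n (p + 1)) : q.app ((γ₀.seq s hs k).app x) =
    f.app (cobarGen x) := by
  induction k generalizing n p with
  | zero => exact h₀ x
  | succ k ih =>
    rw [seq, correct_app _ _ _ _ (sub_add_cancel p 1), map_sub, h₀,
      (hsq _ (sub_add_cancel _ 1) _ (app_defect hf h₀ ih _ x)).1, sub_zero]

lemma GenMap.seq_mem_commuting [CharZero K] (hP : P.SquareZero) (k : ℕ) {L : List (Vtx (barGen P))}
    (hL : L.length ≤ k) : cobarGen (tree L r l) ∈ commuting (γ₀.seq s hs k).hom n p := by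
  induction k generalizing n p L r l with
  | zero =>
    obtain rfl := List.length_eq_zero_iff.1 (Nat.le_zero.1 hL)
    rw [tree_eq_zero fun h => h.1.ne_nil rfl, map_zero]
    exact zero_mem _
  | succ k ih =>
    have hp := sub_add_cancel p 1
    have hp' := sub_add_cancel (p - 1) 1
    rw [mem_commuting hp]
    generalize p - 1 = a at hp hp'
    generalize a - 1 = b at hp'
    have h1 := (isSuboperad_commuting (γ₀.seq s hs k).hom).cobarD_add_mem (fun hL => ih hL) hp
      (r := r) (l := l) hL
    have h2 := (isSuboperad_eqLocus (γ₀.seq s hs (k + 1)).hom (γ₀.seq s hs k).hom).cobarD_add_mem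
      (fun hL => γ₀.seq_succ_eq s hs k hL) hp (r := r) (l := l) hL
    generalize (tree L r l : TreeObj (barGen P) n (p + 1)) = w at h1 h2
    rw [mem_commuting hp', map_add, cobarD_cobarD hP, zero_add] at h1
    have h3 : X.d hp' (γ₀.defect (γ₀.seq s hs k) hp w) =
        γ₀.defect (γ₀.seq s hs k) hp' (treeDiff P w) := by
      simp only [defect, LinearMap.sub_apply, LinearMap.add_apply, comp_apply]
      rw [map_sub, map_add, X.d_d, zero_add, treeDiff_treeDiff hP (by omega), map_zero, map_zero, add_zero,
        add_zero, h1]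
    have h4 := (hsq hp hp' _ (app_defect hf h₀ (app_seq (hs := hs) hf h₀ hsq k) hp w)).2
    rw [h3] at h4
    have h5 := ((γ₀.seq s hs (k + 1)).hom.app.map_add _ _).symm.trans h2
    rw [hom_gen] at h5 ⊢
    rw [seq, correct_app _ _ _ _ hp', ← seq] at h5
    rw [seq, correct_app _ _ _ _ hp, ← seq, map_sub]
    nth_rw 3 [defect] at h4
    simp only [LinearMap.sub_apply, LinearMap.add_apply, comp_apply] at h4
    rw [← sub_eq_zero] at h4 h5 ⊢
    refine Eq.trans ?_ ((congrArg₂ (· + ·) h5 h4).trans (add_zero 0))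
    abel

end Acyclic

/-- A quasi-free operad that is filtered by the number of vertices is cofibrant. -/
lemma isCofibrant_cobarBar [Field K] [CharZero K] (P : DGOperad.{u, v} K) (hd : (cobarBar
    P.toDerOperad).SquareZero) : DGOperad.IsCofibrant.{u, max u v, w} ⟨cobarBar P.toDerOperad, hd⟩
    := by
  intro X Y q hq hq' f
  obtain ⟨s, hs, hsq⟩ := q.exists_homotopy hq hq'
  choose j hj hj' using fun n p => q.exists_section hq n p
  let f' : (CobarFree (barGen P.toDerOperad)).Hom Y.toGrOperad := f.toHom
  have hf : ∀ {n p r} (h : r + 1 = p) (x : (CobarFree (barGen P.toDerOperad)).obj n p),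
      f'.app (cobarD P.toDerOperad h x) = Y.d h (f'.app x) := fun h x => f.app_d h x
  let γ₀ : GenMap (barGen P.toDerOperad) X.toDerOperad :=
    { app := fun {n p} => j n p ∘ₗ f'.app ∘ₗ cobarGen
      app_act := fun σ x => by
        simp only [comp_apply, cobarGen_act, f'.app_act, hj] }
  have h₀ : ∀ {n p} (x : TreeObj (barGen P.toDerOperad) n (p + 1)),
      q.app (γ₀.app x) = f'.app (cobarGen x) := fun x => hj' _ _ _
  let g := (γ₀.lim s hs).hom
  have hg : ∀ k {n p} {L : List (Vtx (barGen P.toDerOperad))} {r} {l : Fin n → ℕ}, L.length ≤ k →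
      g.app (cobarGen (tree L r l) : (CobarFree _).obj n p) =
        (γ₀.seq s hs k).hom.app (cobarGen (tree L r l)) := fun k {n p L r l} hL => γ₀.lim_tree s hs hL
  have hgd : ∀ n p x, x ∈ commuting g n p := fun n p x => (isSuboperad_commuting g).mem (fun n p x => by
    induction x using tree_induction with
    | zero => rw [map_zero]; exact zero_mem _
    | add x y hx hy => rw [map_add]; exact add_mem hx hy
    | smul c x hx => rw [map_smul]; exact smul_mem _ c hx
    | tree L r l h hp =>
      have h1 := GenMap.seq_mem_commuting (s := s) (hs := hs) hf h₀ hsq P.d_d L.length (r := r) (l := l)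
        (p := p) le_rfl
      have h2 := isSuboperad_eqLocus g (γ₀.seq s hs L.length).hom
      have h3 := h2.cobarD_add_mem (fun hL => hg _ hL) (sub_add_cancel p 1) (r := r) (l := l)
        L.length.le_succ
      have h4 := h2.cobarGen_treeDiff_mem (fun hL => hg _ hL) (p := p + 1) (q := p - 1) (r := r) (l := l)
        (le_refl L.length)
      have h5 := sub_mem h3 h4
      rw [add_sub_cancel_right] at h5
      rw [mem_commuting (sub_add_cancel p 1)] at h1 ⊢
      rw [hg _ le_rfl, ← h1]
      exact h5) x
  refine ⟨⟨g, fun h x => (mem_commuting h).1 (hgd _ _ x)⟩, fun n p x => ?_⟩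
  refine GenMap.app_hom_eq (f := f') (fun x => ?_) x
  induction x using tree_induction with
  | zero => simp only [map_zero]
  | add x y hx hy => simp only [map_add, hx, hy]
  | smul c x hx => simp only [map_smul, hx]
  | tree L r l h hp =>
    rw [← GenMap.app_seq (s := s) (hs := hs) hf h₀ hsq L.length]
    exact congrArg q.app (γ₀.lim_tree s hs le_rfl)

/-- The section of the counit is a chain map, and each cycle of the cobar construction is homologous to
a cycle in its image. -/
lemma counit_isWeakEquivalence [Field K] [CharZero K] (P : DGOperad.{u, v} K) (hd : (cobarBar
    P.toDerOperad).SquareZero) (hp : GrOperad.Hom.Commutes (P := cobarBar P.toDerOperad) (Q :=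
    P.toDerOperad) (counit P.toDerOperad)) : DGOperad.Hom.IsWeakEquivalence (P := ⟨cobarBar
    P.toDerOperad, hd⟩) (Q := P) ⟨counit P.toDerOperad, hp⟩ := by
  refine fun n p => ⟨(injective_iff_map_eq_zero _).2 ?_, ?_⟩
  · rintro ⟨z, hz⟩ hz'
    obtain ⟨b, hb⟩ : (counit P.toDerOperad).app z ∈ P.boundaries n p :=
      (mk_eq_zero ((P.boundaries n p).submoduleOf (P.cycles n p))).1 hz'
    obtain ⟨y, x, rfl⟩ := exists_cobarD_add_counitSection (sub_add_cancel p 1) rfl hz P.d_d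
    refine (mk_eq_zero _).2
      ⟨y + counitSection (b - (counit P.toDerOperad).app y), ?_⟩
    have h1 : P.d rfl b - P.d rfl ((counit P.toDerOperad).app y) = x := sub_eq_of_eq_add' <|
      hb.trans <| ((counit P.toDerOperad).app.map_add _ _).trans <|
        congrArg₂ (· + ·) (hp rfl y) (counit_counitSection x)
    refine ((cobarD P.toDerOperad rfl).map_add _ _).trans (congrArg (_ + ·) ?_)
    rw [cobarD_counitSection, map_sub, h1]
  · rintro ⟨x, hx⟩
    refine ⟨Submodule.Quotient.mk ⟨counitSection x, (cobarD_counitSection _ x).trans ?_⟩, ?_⟩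
    · rw [show P.d (sub_add_cancel p 1) x = 0 from hx, map_zero]
      rfl
    · exact congrArg Submodule.Quotient.mk (Subtype.ext (counit_counitSection x))

end

end BarCobar

theorem mainTheorem6 {K : Type u} [Field K] [CharZero K] (P : BarCobar.DGOperad.{u, v} K) :
    ∃ (hd : (BarCobar.cobarBar P.toDerOperad).SquareZero)
      (hp : BarCobar.GrOperad.Hom.Commutes (P := BarCobar.cobarBar P.toDerOperad)
        (Q := P.toDerOperad) (BarCobar.counit P.toDerOperad)),
      let ΩBP : BarCobar.DGOperad.{u, max u v} K := ⟨BarCobar.cobarBar P.toDerOperad, hd⟩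
      let counit : ΩBP.Hom P := ⟨BarCobar.counit P.toDerOperad, hp⟩
      counit.IsWeakEquivalence ∧ counit.IsFibration ∧
        BarCobar.DGOperad.IsCofibrant.{u, max u v, w} ΩBP := by
  have hd : (BarCobar.cobarBar P.toDerOperad).SquareZero := BarCobar.cobarBar_squareZero P.d_d
  refine ⟨hd, BarCobar.counit_commutes, BarCobar.counit_isWeakEquivalence P hd _, fun n p x => ?_,
    BarCobar.isCofibrant_cobarBar P hd⟩
  exact ⟨BarCobar.counitSection x, BarCobar.counit_counitSection x⟩
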